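/- Let $n\ge 2$ be even and $0<r<\tfrac14$. Let $\Delta^n=\{x\in\mathbb R^{n+1}: x_j\ge 0,\ \sum_{j=0}^n x_j=1\}$ with facets $\Delta_j=\{x\in\Delta^n: x_j=0\}$, and put $$\Delta^n_Q=\{x\in\Delta^n:\ x_{n/2}+\dots+x_n\ge r,\ \ x_0+\dots+x_{n/2}\ge r,\ \ x_{n/2}\le 1-r\},$$ with facets $P_1,P_2,P_3$ of $\Delta^n_Q$ on which the first, second, respectively third of these inequalities is an equality. Let $\alpha_1,\dots,\alpha_{n-1}$ be the standard basis of $\mathbb Z^{n-1}$ and put $\eta(\Delta_{n-j})=\eta_j$ for $0\le j\le n$, where $\eta_j=\alpha_{j+1}$ for $0\le j<\frac n2-1$, $\eta_{n/2-1}=\alpha_1+\dots+\alpha_{n/2}$, $\eta_j=\alpha_j$ for $\frac n2\le j<n$, and $\eta_n=\alpha_{n/2}+\dots+\alpha_{n-1}$. For $p\in\Delta^n$ let $\mathbb T_p\subset\mathbb T^{n-1}$ be the subtorus determined by the vectors $\eta(\Delta_l)$ with $p_l=0$ (trivial if there are none). Let $$W=W(\Delta^n_Q,\eta)=(\mathbb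 T^{n-1}\times\Delta^n_Q)/\!\sim_\eta,\qquad (s,p)\sim_\eta(t,q)\iff p=q\ \text{and}\ ts^{-1}\in\mathbb T_p,$$ and let $\partial W$ be the image of $\mathbb T^{n-1}\times(P_1\cup P_2\cup P_3)$ in $W$. Let $\zeta$ be a linear functional that takes distinct values at the vertices of $\Delta^n_Q$; direct each edge of $\Delta^n_Q$ so that $\zeta$ increases along it, and let $\operatorname{ind}(v)$ be the number of edges of $\Delta^n_Q$ pointing towards the vertex $v$. For $1\le j\le n$ let $I_j$ be the set of pairs $(v,e_v)$ where $v$ is a vertex of $\Delta^n_Q$ with $\operatorname{ind}(v)=j$ and $e_v$ is an edge of $\Delta^n_Q$ that points towards $v$ and is of the form $e_v=e\cap\Delta^n_Q$ for an edge $e$ of $\Delta^n$. **Theorem.** For every such $\zeta$, the sets $I_j$ are finite, $|I_n|=1$, and: 1. $W/\partial W$ is a Hausdorff space which has a CW structure with exactly one $0$-cell, exactly $|I_j|$ cells of dimension $2j-1$ for $1\le j\le n$, and no other cells. 2. $$H_i(W/\partial W;\mathbb Z)\cong\begin{cases}\mathbb Z^{|I_j|}& i=2j-1,\ 1\le j\le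 n,\\ \mathbb Z& i=0,\\ 0&\text{otherwise,}\end{cases}\qquad H_i(W,\partial W;\mathbb Z)\cong\begin{cases}\mathbb Z^{|I_j|}& i=2j-1,\ 1\le j\le n,\\ 0&\text{otherwise.}\end{cases}$$ Moreover $H_{2n-1}(W,\partial W;\mathbb Z)\cong\mathbb Z$, and $W$ is an orientable topological $(2n-1)$-manifold with boundary $\partial W$ (orientable meaning that its interior $W\setminus\partial W$ admits a locally consistent choice of generators of the local homology groups). -/

import Mathlib

open scoped NNReal

noncomputable section

namespace QuasitoricBoundary

open CategoryTheory CategoryTheory.Limits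

/-! ### Relative singular homology with integer coefficients -/

/-- The integral singular chain complex of a topological space. -/
abbrev singC (X : Type) [TopologicalSpace X] : ChainComplex (ModuleCat.{0} ℤ) ℕ :=
  ((AlgebraicTopology.singularChainComplexFunctor (ModuleCat.{0} ℤ)).obj
    (ModuleCat.of ℤ ℤ)).obj (TopCat.of X)

/-- The chain map induced by a continuous map. -/
abbrev singMap {X Y : Type} [TopologicalSpace X] [TopologicalSpace Y] (f : C(X, Y)) :
    singC X ⟶ singC Y :=
  ((AlgebraicTopology.singularChainComplexFunctor (ModuleCat.{0} ℤ)).obj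
    (ModuleCat.of ℤ ℤ)).map (TopCat.ofHom f)

/-- The inclusion of a subspace. -/
def incl {X : Type} [TopologicalSpace X] (A : Set X) : C(A, X) :=
  ⟨Subtype.val, continuous_subtype_val⟩

/-- The restriction of a map of pairs `f : (X, A) → (Y, B)` to the subspaces. -/
def restrictPair {X Y : Type} [TopologicalSpace X] [TopologicalSpace Y] (f : C(X, Y))
    {A : Set X} {B : Set Y} (h : Set.MapsTo f A B) : C(A, B) :=
  ⟨h.restrict f A B, f.continuous.restrict h⟩

/-- The relative singular chain complex `C(X, A) = C(X) / C(A)`. -/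
def relC (X : Type) [TopologicalSpace X] (A : Set X) : ChainComplex (ModuleCat.{0} ℤ) ℕ :=
  cokernel (singMap (incl A))

/-- The chain map `C(X, A) → C(Y, B)` induced by a map of pairs. -/
def relMap {X Y : Type} [TopologicalSpace X] [TopologicalSpace Y] (f : C(X, Y))
    {A : Set X} {B : Set Y} (h : Set.MapsTo f A B) : relC X A ⟶ relC Y B :=
  cokernel.map (singMap (incl A)) (singMap (incl B)) (singMap (restrictPair f h)) (singMap f) (by
    rw [← Functor.map_comp, ← Functor.map_comp]
    rfl)

/-- The absolute singular homology `H_i(X; ℤ)`. -/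
def singH (i : ℕ) (X : Type) [TopologicalSpace X] : ModuleCat.{0} ℤ := (singC X).homology i

/-- The relative singular homology `H_i(X, A; ℤ)`. -/
def relH (i : ℕ) (X : Type) [TopologicalSpace X] (A : Set X) : ModuleCat.{0} ℤ :=
  (relC X A).homology i

/-- The map `H_i(X, A) → H_i(X, B)` induced by the identity of `X`, for `A ⊆ B`. -/
def relHRestrict (i : ℕ) {X : Type} [TopologicalSpace X] {A B : Set X} (h : A ⊆ B) :
    relH i X A →ₗ[ℤ] relH i X B :=
  (HomologicalComplex.homologyMap (relMap (ContinuousMap.id X) h) i).hom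

/-! ### Manifolds with boundary and orientability -/

/-- `X` is a topological manifold with boundary of dimension `d ≥ 1` whose boundary is exactly `B`.
The half space of dimension `d` is written as `[0, ∞) × ℝ^(d - 1)`. -/
structure IsManifoldWithBoundary (d : ℕ) (X : Type) [TopologicalSpace X] (B : Set X) : Prop where
  t2 : T2Space X
  secondCountable : SecondCountableTopology X
  exists_chart : ∀ x : X, ∃ e : OpenPartialHomeomorph X (ℝ≥0 × (Fin (d - 1) → ℝ)),
    x ∈ e.source ∧ ∀ y ∈ e.source, (y ∈ B ↔ (e y).1 = 0)

/-- An orientation of a `d`-manifold `M` without boundary: a choice of generators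
`μ x ∈ H_d(M, M ∖ {x})` which is locally the restriction of classes in `H_d(M, M ∖ V)`. -/
def IsOrientation (d : ℕ) (M : Type) [TopologicalSpace M]
    (μ : ∀ x : M, relH d M {x}ᶜ) : Prop :=
  (∀ x, Submodule.span ℤ {μ x} = ⊤) ∧
    ∀ x : M, ∃ V : Set M, IsOpen V ∧ x ∈ V ∧ ∃ c : relH d M Vᶜ,
      ∀ (y : M) (hy : y ∈ V),
        relHRestrict d (Set.compl_subset_compl.mpr (Set.singleton_subset_iff.mpr hy)) c = μ y

/-- `X` is a `d`-manifold with boundary `B`, and it is orientable, i.e. its interior admits an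
orientation. -/
def IsOrientableManifoldWithBoundary (d : ℕ) (X : Type) [TopologicalSpace X] (B : Set X) : Prop :=
  IsManifoldWithBoundary d X B ∧
    ∃ μ : ∀ x : ↥(Bᶜ), relH d ↥(Bᶜ) {x}ᶜ, IsOrientation d ↥(Bᶜ) μ

/-! ### Collapsing a subspace -/

/-- The equivalence relation on `X` that identifies all points of `A` with each other. -/
def collapseSetoid {X : Type} (A : Set X) : Setoid X where
  r x y := x = y ∨ (x ∈ A ∧ y ∈ A)
  iseqv :=
    { refl := fun _ => Or.inl rfl
      symm := by
        rintro x y (rfl | ⟨hx, hy⟩)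
        · exact Or.inl rfl
        · exact Or.inr ⟨hy, hx⟩
      trans := by
        rintro x y z (rfl | ⟨hx, hy⟩) (rfl | ⟨hy', hz⟩)
        · exact Or.inl rfl
        · exact Or.inr ⟨hy', hz⟩
        · exact Or.inr ⟨hx, hy⟩
        · exact Or.inr ⟨hx, hz⟩ }

/-- The quotient space `X / A` (for nonempty `A`). -/
abbrev Collapse (X : Type) [TopologicalSpace X] (A : Set X) : Type := Quotient (collapseSetoid A)

/-! ### The polytope -/

/-- The simplex `Δ^n ⊆ ℝ^(n+1)`. -/
def Simplex (n : ℕ) : Set (Fin (n + 1) → ℝ) := {x | (∀ j, 0 ≤ x j) ∧ ∑ j, x j = 1}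

/-- `x_{n/2} + ⋯ + x_n`. -/
def upperSum (n : ℕ) (x : Fin (n + 1) → ℝ) : ℝ :=
  ∑ j ∈ Finset.univ.filter (fun j : Fin (n + 1) => n / 2 ≤ (j : ℕ)), x j

/-- `x_0 + ⋯ + x_{n/2}`. -/
def lowerSum (n : ℕ) (x : Fin (n + 1) → ℝ) : ℝ :=
  ∑ j ∈ Finset.univ.filter (fun j : Fin (n + 1) => (j : ℕ) ≤ n / 2), x j

/-- `x_{n/2}`. -/
def midCoord (n : ℕ) (x : Fin (n + 1) → ℝ) : ℝ := x ⟨n / 2, by omega⟩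

/-- The polytope `Δ^n_Q`: the simplex with neighbourhoods of the faces `F' = {x_{n/2} = ⋯ = x_n = 0}`
and `F'' = {x_0 = ⋯ = x_{n/2} = 0}` and of the vertex `A_{n/2}` cut off. -/
def DeltaQ (n : ℕ) (r : ℝ) : Set (Fin (n + 1) → ℝ) :=
  {x | x ∈ Simplex n ∧ r ≤ upperSum n x ∧ r ≤ lowerSum n x ∧ midCoord n x ≤ 1 - r}

/-- The facet `P₁` of `Δ^n_Q`. -/
def P1 (n : ℕ) (r : ℝ) : Set (Fin (n + 1) → ℝ) := {x | x ∈ Simplex n ∧ upperSum n x = r}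

/-- The facet `P₂` of `Δ^n_Q`. -/
def P2 (n : ℕ) (r : ℝ) : Set (Fin (n + 1) → ℝ) := {x | x ∈ Simplex n ∧ lowerSum n x = r}

/-- The facet `P₃` of `Δ^n_Q`. -/
def P3 (n : ℕ) (r : ℝ) : Set (Fin (n + 1) → ℝ) := {x | x ∈ Simplex n ∧ midCoord n x = 1 - r}

/-! ### The characteristic vectors and the space `W` -/

/-- The vector `η_j ∈ ℤ^(n-1)`, `0 ≤ j ≤ n`; the index `i : Fin (n - 1)` is the `(i+1)`-th place. -/
def eta (n j : ℕ) (i : Fin (n - 1)) : ℤ :=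
  if j < n / 2 - 1 then (if (i : ℕ) + 1 = j + 1 then 1 else 0)
  else if j = n / 2 - 1 then (if (i : ℕ) + 1 ≤ n / 2 then 1 else 0)
  else if j < n then (if (i : ℕ) + 1 = j then 1 else 0)
  else (if (i : ℕ) + 1 ≤ n / 2 - 1 then 0 else 1)

/-- The vector `η(Δ_l)` attached to the facet `{x_l = 0}` of `Δ^n`: `η(Δ_{n-j}) = η_j`. -/
def etaFacet (n : ℕ) (l : Fin (n + 1)) : Fin (n - 1) → ℤ := eta n (n - (l : ℕ))

/-- The torus `𝕋^(n-1)`. -/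
abbrev Torus (n : ℕ) : Type := Fin (n - 1) → Circle

/-- The one-parameter subgroup `t ↦ (t^{v_1}, …, t^{v_{n-1}})` of the torus. -/
def oneParam (n : ℕ) (v : Fin (n - 1) → ℤ) : Circle →* Torus n where
  toFun t := fun i => t ^ v i
  map_one' := by funext i; simp
  map_mul' s t := by funext i; simp [mul_zpow]

/-- The subtorus `𝕋_F` for the face `F` of `Δ^n` containing `p` in its relative interior.  That
face is the intersection of the facets `{x_l = 0}` with `p_l = 0`, and `𝕋_F` is generated by the
circles determined by the corresponding vectors `η(Δ_l)`. -/
def faceTorus (n : ℕ) (p : Fin (n + 1) → ℝ) : Subgroup (Torus n) :=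
  ⨆ (l : Fin (n + 1)) (_ : p l = 0), (oneParam n (etaFacet n l)).range

/-- The relation `∼_η` on `𝕋^(n-1) × Δ^n_Q`. -/
def etaSetoid (n : ℕ) (r : ℝ) : Setoid (Torus n × DeltaQ n r) where
  r a b := a.2 = b.2 ∧ b.1 * a.1⁻¹ ∈ faceTorus n a.2
  iseqv :=
    { refl := fun a => ⟨rfl, by rw [mul_inv_cancel]; exact one_mem _⟩
      symm := by
        rintro a b ⟨h1, h2⟩
        refine ⟨h1.symm, ?_⟩
        rw [← h1]
        have := inv_mem h2
        rwa [mul_inv_rev, inv_inv] at this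
      trans := by
        rintro a b c ⟨h1, h2⟩ ⟨h3, h4⟩
        refine ⟨h1.trans h3, ?_⟩
        rw [← h1] at h4
        have := mul_mem h4 h2
        rwa [mul_assoc, inv_mul_cancel_left] at this }

/-- The space `W(Δ^n_Q, η) = (𝕋^(n-1) × Δ^n_Q) / ∼_η`. -/
abbrev W (n : ℕ) (r : ℝ) : Type := Quotient (etaSetoid n r)

/-- The boundary `∂W`: the image of `𝕋^(n-1) × (P₁ ∪ P₂ ∪ P₃)`. -/
def boundaryW (n : ℕ) (r : ℝ) : Set (W n r) :=
  Quotient.mk (etaSetoid n r) '' {a | (a.2 : Fin (n + 1) → ℝ) ∈ P1 n r ∪ P2 n r ∪ P3 n r}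

/-- The quotient space `W / ∂W`. -/
abbrev WModBoundary (n : ℕ) (r : ℝ) : Type := Collapse (W n r) (boundaryW n r)

/-! ### Vertices, edges, indices and the sets `I_j` -/

/-- The vertices of a convex polytope. -/
def vertices {m : ℕ} (P : Set (Fin m → ℝ)) : Set (Fin m → ℝ) := P.extremePoints ℝ

/-- The edges of a convex polytope, i.e. its one-dimensional faces. -/
def edges {m : ℕ} (P : Set (Fin m → ℝ)) : Set (Set (Fin m → ℝ)) :=
  {e | IsExposed ℝ P e ∧ Module.finrank ℝ (vectorSpan ℝ e) = 1}

/-- The edge `e`, directed so that `ζ` increases along it, is incident to `v` and points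
towards `v`. -/
def PointsTowards {m : ℕ} (ζ : (Fin m → ℝ) →ₗ[ℝ] ℝ) (e : Set (Fin m → ℝ)) (v : Fin m → ℝ) : Prop :=
  v ∈ e ∧ ∀ w ∈ e, ζ w ≤ ζ v

/-- The index of a vertex `v` of `P`: the number of edges of `P` pointing towards `v`. -/
def ind {m : ℕ} (P : Set (Fin m → ℝ)) (ζ : (Fin m → ℝ) →ₗ[ℝ] ℝ) (v : Fin m → ℝ) : ℕ :=
  {e | e ∈ edges P ∧ PointsTowards ζ e v}.ncard

/-- The set `I_j` of pairs `(v, e_v)` where `v` is a vertex of `Δ^n_Q` of index `j` and `e_v` is an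
edge of `Δ^n_Q` that points towards `v` and is the trace of an edge of `Δ^n`. -/
def I (n : ℕ) (r : ℝ) (ζ : (Fin (n + 1) → ℝ) →ₗ[ℝ] ℝ) (j : ℕ) :
    Set ((Fin (n + 1) → ℝ) × Set (Fin (n + 1) → ℝ)) :=
  {q | q.1 ∈ vertices (DeltaQ n r) ∧ q.2 ∈ edges (DeltaQ n r) ∧
    ind (DeltaQ n r) ζ q.1 = j ∧ PointsTowards ζ q.2 q.1 ∧
    ∃ e ∈ edges (Simplex n), q.2 = e ∩ DeltaQ n r}

/-- `X` is a Hausdorff space with a CW structure that has exactly one `0`-cell, exactly `|J j|` cells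
of dimension `2j - 1` for `1 ≤ j ≤ n`, and no other cells. -/
def HasOddCWStructure (X : Type) [TopologicalSpace X] (n : ℕ) {S : Type} (J : ℕ → Set S) : Prop :=
  T2Space X ∧ ∃ cw : Topology.CWComplex (Set.univ : Set X),
    Nonempty (cw.cell 0 ≃ Unit) ∧
    (∀ j : ℕ, 1 ≤ j → j ≤ n → Nonempty (cw.cell (2 * j - 1) ≃ J j)) ∧
    (∀ d : ℕ, d ≠ 0 → (∀ j : ℕ, 1 ≤ j → j ≤ n → d ≠ 2 * j - 1) → IsEmpty (cw.cell d))

end QuasitoricBoundary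

end

open scoped NNReal

noncomputable section

namespace QuasitoricBoundary

open CategoryTheory CategoryTheory.Limits

/-! ### Generators of the singular chain groups -/

/-! The combinatorial quotient W is replaced by an orbit space in complex coordinates. Split the
coordinates of ℝ^(n+1) into three groups, l < n/2, l = n/2 and l > n/2 (`grp`). On the simplex the
three cutting inequalities say that every group sum is at most 1 - r, and ∂W lies over the points
where some group sum equals 1 - r. Up to sign, the η(Δ_l) are the images of the standard basis
vectors under an epimorphism 𝕋^(n+1) → 𝕋^(n-1) (`psi`); its kernel is a two-torus acting on the
coordinates of the three groups by the characters u, (uv)⁻¹, v (`psi_eq_one_iff`). Hence W is the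
orbit space of this two-torus on Z = {z ∈ ℂ^(n+1) : (|z_l|) ∈ Δ^n_Q} (`orb_theta_eq_iff`,
`homeoOrb`). Since no group carries the whole sum, every z has nonzero coordinates in two groups, so
the action is free.

Cells: for z ∈ Z let i and k be the first and the last place with a nonzero coordinate. Then i ≤ n/2
≤ k and i < k, the two places are in different groups, and exactly one element of the two-torus
makes z_i and z_k positive (`exists_isNormal`, `IsNormal.eq_of_smul`). What remains are k - i - 1
complex coordinates and one real parameter, that is, an open cell of dimension 2(k - i) - 1 once ∂W
is removed. On the boundary of the cell either the point lies over ∂W or an extreme coordinate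
vanishes and the support becomes shorter. With ∂W collapsed to the 0-cell this is a finite cell
structure on W/∂W (`cells`).

Homology: all cells of positive dimension are odd-dimensional, so when the cells are added one at a
time the exact sequences break into short ones and the homology modulo the base point is free on the
cells (`CellData.nonempty_basis_relH`). An explicit collar of ∂W identifies H(W, ∂W) with H(W/∂W,
pt). The tools needed from singular homology are excision, by barycentric subdivision
(`quasiIso_excision`), invariance under relative homeomorphisms, and the homology of a cube modulo
its boundary.

Counting: the vertices of Δ^n_Q are (1 - r)e_i + r e_k with i, k in different groups, and the only
edge there that comes from Δ^n is the one along e_k - e_i. Reading the index off the order of the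
numbers ζ(e_l) gives |I_j| = n + 1 - j - 2 max(n/2 - j, 0) for j ≥ 1, whatever ζ is
(`card_indexPairs_add`). The number of pairs i ≤ n/2 ≤ k with k - i = j is the same
(`card_cellIx_dim_add`), so the cells need only be counted and no cell has to be attached to a
particular vertex.

Manifold and orientation: near a point choose nonzero coordinates i in the group with the largest
sum and k in another group; the distance of the first group sum from 1 - r and the other normalised
coordinates form a chart. A generator of H_{2n-1}(W/∂W, pt) restricts to a generator of the local
homology at a point of the unique top cell, because the omitted cells are all odd-dimensional or the
base point. As the interior is connected, it does so everywhere, which is an orientation. -/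

/-- The standard topological simplex. -/
abbrev Splx (n : ℕ) : Type := stdSimplex ℝ (Fin (n + 1))

/-- The generator of the singular chain group given by a singular simplex. -/
def gen {X : Type} [TopologicalSpace X] {n : ℕ} (s : C(Splx n, X)) : (singC X).X n :=
  (SSet.ιChainComplex (R := ModuleCat.of ℤ ℤ) (TopCat.toSSet.obj (TopCat.of X))
    (((TopCat.of X).toSSetObjEquiv (.op (SimplexCategory.mk n))).symm s)).hom (1 : ℤ)

/-- The face inclusions of simplices. -/
def splxMap {m n : ℕ} (f : Fin (m + 1) → Fin (n + 1)) : C(Splx m, Splx n) :=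
  ⟨stdSimplex.map f, stdSimplex.continuous_map f⟩

variable {X Y : Type} [TopologicalSpace X] [TopologicalSpace Y] {n : ℕ}

lemma singMap_gen (f : C(X, Y)) (s : C(Splx n, X)) :
    (singMap f).f n (gen s) = gen (f.comp s) := by
  have := SSet.ι_chainComplexMap_f (R := ModuleCat.of ℤ ℤ) (f := TopCat.toSSet.map (TopCat.ofHom f))
    (x := ((TopCat.of X).toSSetObjEquiv (.op (SimplexCategory.mk n))).symm s)
  have h2 := congrArg (fun φ => φ.hom (1 : ℤ)) this
  exact h2

lemma d_gen (s : C(Splx (n + 1), X)) :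
    (singC X).d (n + 1) n (gen s) =
      ∑ i : Fin (n + 2), (-1 : ℤ) ^ (i : ℕ) • gen (s.comp (splxMap i.succAbove)) := by
  have := SSet.ιChainComplex_d (R := ModuleCat.of ℤ ℤ) (TopCat.toSSet.obj (TopCat.of X))
    (((TopCat.of X).toSSetObjEquiv (.op (SimplexCategory.mk (n + 1)))).symm s)
  have h2 := congrArg (fun φ => φ.hom (1 : ℤ)) this
  refine h2.trans ?_
  simp only [ModuleCat.hom_sum, LinearMap.sum_apply]
  rfl

lemma singC_hom_ext {M : ModuleCat.{0} ℤ} {f g : (singC X).X n ⟶ M}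
    (h : ∀ s : C(Splx n, X), f (gen s) = g (gen s)) : f = g := by
  refine SSet.chainComplex_hom_ext (X := TopCat.toSSet.obj (TopCat.of X))
    (R := ModuleCat.of ℤ ℤ) fun x => ?_
  ext
  have := h (((TopCat.of X).toSSetObjEquiv (.op (SimplexCategory.mk n))) x)
  simp only [gen, Equiv.symm_apply_apply] at this
  exact this

lemma linearMap_ext_gen {M : Type} [AddCommGroup M] [Module ℤ M] {f g : (singC X).X n →ₗ[ℤ] M}
    (h : ∀ s : C(Splx n, X), f (gen s) = g (gen s)) : f = g := by
  have := singC_hom_ext (M := ModuleCat.of ℤ M) (f := ModuleCat.ofHom f) (g := ModuleCat.ofHom g) h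
  exact congrArg ModuleCat.Hom.hom this

lemma span_gen : Submodule.span ℤ (Set.range (gen : C(Splx n, X) → _)) = ⊤ := by
  have : (Submodule.span ℤ (Set.range (gen : C(Splx n, X) → _))).mkQ = 0 := by
    refine @linearMap_ext_gen X _ n _ _ (Submodule.Quotient.module _) _ _ fun s => ?_
    simpa using Submodule.subset_span (Set.mem_range_self s)
  refine eq_top_iff.2 fun x _ => ?_
  have h := DFunLike.congr_fun this x
  exact (Submodule.Quotient.mk_eq_zero (Submodule.span ℤ (Set.range (gen : C(Splx n, X) → _)))).1 h

/-- The universal property of the singular chain groups. -/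
def chainLift {M : Type} [AddCommGroup M] (φ : C(Splx n, X) → M) : (singC X).X n →+ M :=
  ((SSet.isColimitChainComplexXCofan (TopCat.toSSet.obj (TopCat.of X)) (ModuleCat.of ℤ ℤ) n).desc
    (Cofan.mk (ModuleCat.of ℤ M) fun x => ModuleCat.ofHom (LinearMap.toSpanSingleton ℤ M
      (φ (((TopCat.of X).toSSetObjEquiv (.op (SimplexCategory.mk n))) x))))).hom.toAddMonoidHom

lemma chainLift_gen {M : Type} [AddCommGroup M] (φ : C(Splx n, X) → M) (s : C(Splx n, X)) :
    chainLift φ (gen s) = φ s := by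
  have := (SSet.isColimitChainComplexXCofan (TopCat.toSSet.obj (TopCat.of X))
    (ModuleCat.of ℤ ℤ) n).fac
    (Cofan.mk (ModuleCat.of ℤ M) fun x => ModuleCat.ofHom (LinearMap.toSpanSingleton ℤ M
      (φ (((TopCat.of X).toSSetObjEquiv (.op (SimplexCategory.mk n))) x))))
    ⟨((TopCat.of X).toSSetObjEquiv (.op (SimplexCategory.mk n))).symm s⟩
  have h2 := congrArg (fun φ => φ.hom (1 : ℤ)) this
  refine Eq.trans h2 ?_
  simp

/-! ### Affine chains in a simplex and barycentric subdivision -/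

/-- The affine map of simplices with given vertices. -/
def aff {m n : ℕ} (w : Fin (m + 1) → Splx n) : C(Splx m, Splx n) where
  toFun t := ⟨∑ i, (t : Fin (m + 1) → ℝ) i • (w i : Fin (n + 1) → ℝ),
    (convex_stdSimplex ℝ _).sum_mem (fun i _ => t.2.1 i) t.2.2 (fun i _ => (w i).2)⟩
  continuous_toFun := by
    have h : ∀ i, Continuous fun t : Splx m => (t : Fin (m + 1) → ℝ) i :=
      fun i => (continuous_apply i).comp continuous_subtype_val
    exact Continuous.subtype_mk (continuous_finsetSum _ fun i _ => (h i).smul continuous_const) _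

lemma aff_coe {m n : ℕ} (w : Fin (m + 1) → Splx n) (t : Splx m) :
    (aff w t : Fin (n + 1) → ℝ) = ∑ i, (t : Fin (m + 1) → ℝ) i • (w i : Fin (n + 1) → ℝ) := rfl

/-- The vertices of the standard simplex. -/
def vert (n : ℕ) : Fin (n + 1) → Splx n := fun i => stdSimplex.vertex i

/-- The barycenter of the standard simplex. -/
def bary (n : ℕ) : Splx n := stdSimplex.barycenter

lemma aff_vertex {m n : ℕ} (w : Fin (m + 1) → Splx n) (i : Fin (m + 1)) :
    aff w (vert m i) = w i := by
  refine stdSimplex.ext ?_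
  rw [aff_coe]
  simp [vert, Pi.single_apply]

lemma aff_vert (n : ℕ) : aff (vert n) = ContinuousMap.id _ := by
  ext t
  simp [aff_coe, vert, Finset.sum_apply, Pi.single_apply]

lemma aff_comp {l m n : ℕ} (w : Fin (m + 1) → Splx n) (u : Fin (l + 1) → Splx m) :
    (aff w).comp (aff u) = aff (fun i => aff w (u i)) := by
  ext t
  simp only [ContinuousMap.comp_apply, aff_coe, Finset.sum_apply, Finset.sum_smul,
    Finset.smul_sum, Pi.smul_apply, smul_eq_mul]
  rw [Finset.sum_comm]
  simp only [mul_assoc]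

lemma aff_comp_face {m n : ℕ} (w : Fin (m + 2) → Splx n) (i : Fin (m + 2)) :
    (aff w).comp (splxMap i.succAbove) = aff (w ∘ i.succAbove) := by
  have : splxMap i.succAbove = aff (vert (m + 1) ∘ i.succAbove) := by
    ext t j
    simp only [splxMap, ContinuousMap.coe_mk, aff_coe, stdSimplex.map_coe, vert, Finset.sum_apply,
      Function.comp, Pi.smul_apply, stdSimplex.vertex_coe, Pi.single_apply,
      FunOnFinite.linearMap_apply_apply, smul_eq_mul, mul_ite, mul_one, mul_zero,
      Finset.sum_filter]
    simp only [eq_comm]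
  rw [this, aff_comp]
  simp only [Function.comp, aff_vertex]
  rfl

/-- Affine chains of a simplex. -/
abbrev AffC (n m : ℕ) : Type := (Fin (m + 1) → Splx n) →₀ ℤ

variable {m n : ℕ}

/-- The boundary of affine chains. -/
def dA (n m : ℕ) : AffC n (m + 1) →ₗ[ℤ] AffC n m :=
  Finsupp.linearCombination ℤ fun w =>
    ∑ i : Fin (m + 2), (-1 : ℤ) ^ (i : ℕ) • Finsupp.single (w ∘ i.succAbove) 1

/-- The cone over an affine chain. -/
def coneA (b : Splx n) : AffC n m →ₗ[ℤ] AffC n (m + 1) :=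
  Finsupp.lmapDomain ℤ ℤ fun w => (Fin.cons b w : Fin (m + 2) → Splx n)

/-- The map of affine chains induced by an affine map. -/
def pushA {k : ℕ} (u : Fin (k + 1) → Splx n) : AffC k m →ₗ[ℤ] AffC n m :=
  Finsupp.lmapDomain ℤ ℤ fun w i => aff u (w i)

/-- The realization of affine chains as singular chains. -/
def realA {X : Type} [TopologicalSpace X] (s : C(Splx n, X)) (m : ℕ) :
    AffC n m →ₗ[ℤ] (singC X).X m :=
  Finsupp.linearCombination ℤ fun w => gen (s.comp (aff w))

/-- The chain homotopy of the barycentric subdivision. -/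
def homA (n : ℕ) : ∀ m, AffC n m →ₗ[ℤ] AffC n (m + 1)
  | 0 => Finsupp.linearCombination ℤ fun w => coneA (aff w (bary 0)) (Finsupp.single w 1)
  | m + 1 => Finsupp.linearCombination ℤ fun w => coneA (aff w (bary (m + 1)))
      (Finsupp.single w 1 - homA n m (dA n m (Finsupp.single w 1)))

/-- The barycentric subdivision of affine chains. -/
def sdA (n : ℕ) : ∀ m, AffC n m →ₗ[ℤ] AffC n m
  | 0 => LinearMap.id
  | m + 1 => Finsupp.linearCombination ℤ fun w => coneA (aff w (bary (m + 1)))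
      (sdA n m (dA n m (Finsupp.single w 1)))

lemma dA_single (w : Fin (m + 2) → Splx n) : dA n m (Finsupp.single w 1) =
    ∑ i : Fin (m + 2), (-1 : ℤ) ^ (i : ℕ) • Finsupp.single (w ∘ i.succAbove) 1 := by
  simp [dA]

lemma coneA_single (b : Splx n) (w : Fin (m + 1) → Splx n) :
    coneA b (Finsupp.single w 1) = Finsupp.single (Fin.cons b w : Fin (m + 2) → Splx n) 1 := by
  simp [coneA]

lemma pushA_single {k : ℕ} (u : Fin (k + 1) → Splx n) (w : Fin (m + 1) → Splx k) :
    pushA u (Finsupp.single w 1) = Finsupp.single (fun i => aff u (w i)) 1 := by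
  simp [pushA]

lemma realA_single {X : Type} [TopologicalSpace X] (s : C(Splx n, X)) (w : Fin (m + 1) → Splx n) :
    realA s m (Finsupp.single w 1) = gen (s.comp (aff w)) := by
  rw [realA, Finsupp.linearCombination_single]
  exact @one_smul ℤ _ _ (_) _

lemma homA_single_succ (w : Fin (m + 2) → Splx n) :
    homA n (m + 1) (Finsupp.single w 1) = coneA (aff w (bary (m + 1)))
      (Finsupp.single w 1 - homA n m (dA n m (Finsupp.single w 1))) := by
  simp [homA]

lemma homA_single_zero (w : Fin 1 → Splx n) :
    homA n 0 (Finsupp.single w 1) = coneA (aff w (bary 0)) (Finsupp.single w 1) := by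
  simp [homA]

lemma sdA_single_succ (w : Fin (m + 2) → Splx n) :
    sdA n (m + 1) (Finsupp.single w 1) = coneA (aff w (bary (m + 1)))
      (sdA n m (dA n m (Finsupp.single w 1))) := by
  simp [sdA]

lemma affC_ext {M : Type} [AddCommGroup M] [Module ℤ M] {f g : AffC n m →ₗ[ℤ] M}
    (h : ∀ w, f (Finsupp.single w 1) = g (Finsupp.single w 1)) : f = g := by
  ext w
  exact h w

lemma addHom_ext_affC {n m : ℕ} {M : Type} [AddCommGroup M] {f g : AffC n m →+ M}
    (h : ∀ w, f (Finsupp.single w 1) = g (Finsupp.single w 1)) : f = g := by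
  ext w
  exact h w

lemma realA_d {X : Type} [TopologicalSpace X] (s : C(Splx n, X)) (c : AffC n (m + 1)) :
    (singC X).d (m + 1) m (realA s (m + 1) c) = realA s m (dA n m c) := by
  have : ((singC X).d (m + 1) m).hom ∘ₗ realA s (m + 1) = realA s m ∘ₗ dA n m := by
    refine affC_ext fun w => ?_
    simp only [LinearMap.comp_apply, realA_single, dA_single, map_sum, map_zsmul]
    refine (d_gen _).trans ?_
    simp only [ContinuousMap.comp_assoc, aff_comp_face]
  exact LinearMap.congr_fun this c

/-- Realising affine chains in the simplex itself is injective: recording the vertices of a singular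
simplex is a left inverse. The identity is therefore inherited from the singular complex. -/
lemma dA_dA (c : AffC n (m + 2)) : dA n m (dA n (m + 1) c) = 0 := by
  let V : (singC (Splx n)).X m →+ AffC n m :=
    chainLift fun s => Finsupp.single (fun i => s (vert m i)) 1
  have hV : V.comp (realA (ContinuousMap.id _) m).toAddMonoidHom = AddMonoidHom.id _ := by
    refine addHom_ext_affC fun w => ?_
    simp only [AddMonoidHom.comp_apply, LinearMap.toAddMonoidHom_coe, realA_single, V,
      chainLift_gen, AddMonoidHom.id_apply, ContinuousMap.id_comp, aff_vertex]
  have h2 : realA (ContinuousMap.id _) m (dA n m (dA n (m + 1) c)) = 0 := by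
    rw [← realA_d, ← realA_d]
    exact congrArg (fun φ => φ.hom (realA (ContinuousMap.id (Splx n)) (m + 2) c))
      ((singC (Splx n)).d_comp_d (m + 2) (m + 1) m)
  have := DFunLike.congr_fun hV (dA n m (dA n (m + 1) c))
  rw [AddMonoidHom.comp_apply, LinearMap.toAddMonoidHom_coe, h2, map_zero] at this
  exact this.symm

/-- Face 0 of a cone is its base and face i + 1 is the cone over face i of the base. The degree of
the base must be positive: for a point the last term would be the apex. -/
lemma dA_coneA (b : Splx n) (c : AffC n (m + 1)) :
    dA n (m + 1) (coneA b c) = c - coneA b (dA n m c) := by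
  have : dA n (m + 1) ∘ₗ coneA b = LinearMap.id - coneA b ∘ₗ dA n m := by
    refine affC_ext fun w => ?_
    simp only [LinearMap.comp_apply, LinearMap.sub_apply, LinearMap.id_apply, coneA_single,
      dA_single, map_sum, map_smul]
    rw [Fin.sum_univ_succ]
    have h0 : (Fin.cons b w : Fin (m + 3) → Splx n) ∘ (0 : Fin (m + 3)).succAbove = w := by
      ext i; simp [Function.comp]
    have h1 : ∀ i : Fin (m + 2), (Fin.cons b w : Fin (m + 3) → Splx n) ∘ i.succ.succAbove =
        Fin.cons b (w ∘ i.succAbove) := by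
      intro i; funext j
      refine Fin.cases ?_ (fun j => ?_) j <;> simp [Function.comp]
    simp only [h0, h1, Fin.val_zero, pow_zero, one_smul, Fin.val_succ, pow_succ, mul_neg, mul_one,
      neg_smul, Finset.sum_neg_distrib, sub_eq_add_neg]
  exact LinearMap.congr_fun this c

/-- The barycenter of a 0-simplex is its vertex, so the cone is a constant 1-simplex and its two
faces cancel. This starts the inductions in which `dA_coneA` is not available. -/
lemma dA_coneA_zero (w : Fin 1 → Splx n) :
    dA n 0 (coneA (aff w (bary 0)) (Finsupp.single w 1)) = 0 := by
  have hb : aff w (bary 0) = w 0 := by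
    rw [← aff_vertex w 0]; congr 1; exact Subsingleton.elim _ _
  have h0 : ∀ i : Fin 2, (Fin.cons (w 0) w : Fin 2 → Splx n) ∘ i.succAbove = w := by
    intro i; funext j
    fin_cases i <;> fin_cases j <;> simp [Function.comp]
  rw [coneA_single, dA_single, hb, Fin.sum_univ_two, h0, h0]
  simp

/-- With b the barycenter, H w = b(w - H∂w), so ∂Hw = w - H∂w - b(∂w - ∂H∂w). By induction and ∂∂ =
0 the last bracket is sd ∂w, and b(sd ∂w) is sd w. -/
lemma homotopyA {n m : ℕ} (c : AffC n (m + 1)) :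
    dA n (m + 1) (homA n (m + 1) c) + homA n m (dA n m c) = c - sdA n (m + 1) c := by
  have : dA n (m + 1) ∘ₗ homA n (m + 1) + homA n m ∘ₗ dA n m
      = LinearMap.id - sdA n (m + 1) := by
    refine affC_ext fun w => ?_
    simp only [LinearMap.add_apply, LinearMap.comp_apply, LinearMap.sub_apply, LinearMap.id_apply,
      homA_single_succ, sdA_single_succ, dA_coneA]
    have key : dA n m (Finsupp.single w 1 - homA n m (dA n m (Finsupp.single w 1))) =
        sdA n m (dA n m (Finsupp.single w 1)) := by
      cases m with
      | zero =>
        have : dA n 0 ∘ₗ homA n 0 = 0 := affC_ext fun w => by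
          rw [LinearMap.comp_apply, homA_single_zero, dA_coneA_zero]; rfl
        have h := LinearMap.congr_fun this (dA n 0 (Finsupp.single w 1))
        rw [LinearMap.comp_apply] at h
        rw [map_sub, h]
        simp [sdA]
      | succ m =>
        have h := homotopyA (n := n) (m := m) (dA n (m + 1) (Finsupp.single w 1))
        rw [dA_dA, map_zero, add_zero] at h
        rw [map_sub, h]
        abel
    rw [key]
    abel
  exact LinearMap.congr_fun this c

/-- ∂H∂c is computed twice: by applying ∂ to the homotopy formula for c, and from the homotopy
formula for ∂c. -/
lemma sdA_dA (c : AffC n (m + 1)) : sdA n m (dA n m c) = dA n m (sdA n (m + 1) c) := by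
  have h := congrArg (dA n m) (homotopyA (n := n) (m := m) c)
  rw [map_add, map_sub, dA_dA, zero_add] at h
  cases m with
  | zero =>
    have : dA n 0 ∘ₗ homA n 0 = 0 := affC_ext fun w => by
      rw [LinearMap.comp_apply, homA_single_zero, dA_coneA_zero]; rfl
    have h' := LinearMap.congr_fun this (dA n 0 c)
    rw [LinearMap.comp_apply] at h'
    rw [h'] at h
    simpa [sdA] using sub_eq_zero.1 h.symm
  | succ m =>
    have h' := homotopyA (n := n) (m := m) (dA n (m + 1) c)
    rw [dA_dA, map_zero, add_zero, h] at h'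
    simpa using h'.symm

lemma pushA_coneA {k : ℕ} (u : Fin (k + 1) → Splx n) (b : Splx k) (c : AffC k m) :
    pushA u (coneA b c) = coneA (aff u b) (pushA u c) := by
  have : pushA u ∘ₗ coneA b = coneA (aff u b) ∘ₗ pushA (m := m) u := by
    refine affC_ext fun w => ?_
    simp only [LinearMap.comp_apply, coneA_single, pushA_single]
    congr 1
    funext j
    refine Fin.cases ?_ (fun j => ?_) j <;> simp
  exact LinearMap.congr_fun this c

lemma pushA_dA {k : ℕ} (u : Fin (k + 1) → Splx n) (c : AffC k (m + 1)) :
    pushA u (dA k m c) = dA n m (pushA u c) := by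
  have : pushA u ∘ₗ dA k m = dA n m ∘ₗ pushA u := by
    refine affC_ext fun w => ?_
    simp only [LinearMap.comp_apply, dA_single, pushA_single, map_sum, map_smul]
    rfl
  exact LinearMap.congr_fun this c

lemma aff_aff_apply {k : ℕ} (u : Fin (k + 1) → Splx n) (w : Fin (m + 1) → Splx k) (t : Splx m) :
    aff (fun i => aff u (w i)) t = aff u (aff w t) := by
  rw [← aff_comp]; rfl

/-- Affine maps preserve barycenters and cones, hence the whole recursion. This makes the operator
defined below on the universal simplex natural. -/
lemma pushA_homA {n m k : ℕ} (u : Fin (k + 1) → Splx n) (c : AffC k m) :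
    pushA u (homA k m c) = homA n m (pushA u c) := by
  have : pushA u ∘ₗ homA k m = homA n m ∘ₗ pushA u := by
    refine affC_ext fun w => ?_
    cases m with
    | zero =>
      simp only [LinearMap.comp_apply, homA_single_zero, pushA_single, pushA_coneA, aff_aff_apply]
    | succ m =>
      simp only [LinearMap.comp_apply, homA_single_succ, pushA_single, pushA_coneA, aff_aff_apply,
        map_sub]
      rw [pushA_homA, pushA_dA, pushA_single]
  exact LinearMap.congr_fun this c

lemma pushA_sdA {n m k : ℕ} (u : Fin (k + 1) → Splx n) (c : AffC k m) :
    pushA u (sdA k m c) = sdA n m (pushA u c) := by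
  have : pushA u ∘ₗ sdA k m = sdA n m ∘ₗ pushA u := by
    refine affC_ext fun w => ?_
    cases m with
    | zero => rfl
    | succ m =>
      simp only [LinearMap.comp_apply, sdA_single_succ, pushA_single, pushA_coneA, aff_aff_apply]
      rw [pushA_sdA, pushA_dA, pushA_single]
  exact LinearMap.congr_fun this c

/-! ### Small chains -/

variable {X : Type} [TopologicalSpace X]

lemma closure_gen (n : ℕ) :
    AddSubgroup.closure (Set.range (gen : C(Splx n, X) → (singC X).X n)) = ⊤ := by
  refine eq_top_iff.2 fun x _ => ?_
  have hx : x ∈ Submodule.span ℤ (Set.range (gen : C(Splx n, X) → (singC X).X n)) := by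
    rw [span_gen]; trivial
  induction hx using Submodule.span_induction with
  | mem x h => exact AddSubgroup.subset_closure h
  | zero => exact zero_mem _
  | add x y _ _ hx hy => exact add_mem (hx trivial) (hy trivial)
  | smul a x _ hx =>
    have := zsmul_mem (hx trivial) a
    rwa [← int_smul_eq_zsmul (inferInstance)] at this

lemma addHom_ext_gen {n : ℕ} {M : Type} [AddCommGroup M] {f g : (singC X).X n →+ M}
    (h : ∀ s, f (gen s) = g (gen s)) : f = g :=
  AddMonoidHom.eq_of_eqOn_dense (closure_gen n) (by rintro _ ⟨s, rfl⟩; exact h s)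

/-- The chain homotopy of the barycentric subdivision of singular chains. -/
def homX (X : Type) [TopologicalSpace X] (m : ℕ) : (singC X).X m →+ (singC X).X (m + 1) :=
  chainLift fun s => realA s (m + 1) (homA m m (Finsupp.single (vert m) 1))

/-- The barycentric subdivision of singular chains. -/
def sdX (X : Type) [TopologicalSpace X] (m : ℕ) : (singC X).X m →+ (singC X).X m :=
  chainLift fun s => realA s m (sdA m m (Finsupp.single (vert m) 1))

lemma homX_gen {m : ℕ} (s : C(Splx m, X)) :
    homX X m (gen s) = realA s (m + 1) (homA m m (Finsupp.single (vert m) 1)) :=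
  chainLift_gen _ _

lemma sdX_gen {m : ℕ} (s : C(Splx m, X)) :
    sdX X m (gen s) = realA s m (sdA m m (Finsupp.single (vert m) 1)) :=
  chainLift_gen _ _

lemma realA_comp_aff {n m k : ℕ} (s : C(Splx n, X)) (u : Fin (k + 1) → Splx n) (c : AffC k m) :
    realA (s.comp (aff u)) m c = realA s m (pushA u c) := by
  have : realA (s.comp (aff u)) m = realA s m ∘ₗ pushA u := by
    refine affC_ext fun w => ?_
    rw [LinearMap.comp_apply, pushA_single, realA_single, realA_single, ContinuousMap.comp_assoc,
      aff_comp]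
  exact LinearMap.congr_fun this c

lemma realA_vert {n : ℕ} (s : C(Splx n, X)) : realA s n (Finsupp.single (vert n) 1) = gen s := by
  rw [realA_single, aff_vert, ContinuousMap.comp_id]

/-- The operator on singular chains is the transport of one universal affine chain. Naturality lets
it be evaluated on every realised affine chain, so identities between operators pass from affine to
singular chains. -/
lemma homX_realA {n m : ℕ} (s : C(Splx n, X)) (c : AffC n m) :
    homX X m (realA s m c) = realA s (m + 1) (homA n m c) := by
  have : (homX X m).comp (realA s m).toAddMonoidHom =
      ((realA s (m + 1)).toAddMonoidHom).comp (homA n m).toAddMonoidHom := by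
    refine addHom_ext_affC fun w => ?_
    simp only [AddMonoidHom.comp_apply, LinearMap.toAddMonoidHom_coe, realA_single, homX_gen]
    rw [realA_comp_aff, pushA_homA, pushA_single]
    simp only [aff_vertex]
  exact DFunLike.congr_fun this c

lemma sdX_realA {n m : ℕ} (s : C(Splx n, X)) (c : AffC n m) :
    sdX X m (realA s m c) = realA s m (sdA n m c) := by
  have : (sdX X m).comp (realA s m).toAddMonoidHom =
      ((realA s m).toAddMonoidHom).comp (sdA n m).toAddMonoidHom := by
    refine addHom_ext_affC fun w => ?_
    simp only [AddMonoidHom.comp_apply, LinearMap.toAddMonoidHom_coe, realA_single, sdX_gen]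
    rw [realA_comp_aff, pushA_sdA, pushA_single]
    simp only [aff_vertex]
  exact DFunLike.congr_fun this c

/-- The differential of the singular chain complex as an additive map. -/
def dX (X : Type) [TopologicalSpace X] (m : ℕ) : (singC X).X (m + 1) →+ (singC X).X m :=
  ((singC X).d (m + 1) m).hom.toAddMonoidHom

lemma dX_apply {m : ℕ} (c : (singC X).X (m + 1)) : dX X m c = (singC X).d (m + 1) m c := rfl

lemma homotopyX {m : ℕ} (c : (singC X).X (m + 1)) :
    dX X (m + 1) (homX X (m + 1) c) + homX X m (dX X m c) = c - sdX X (m + 1) c := by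
  have : (dX X (m + 1)).comp (homX X (m + 1)) + (homX X m).comp (dX X m) =
      AddMonoidHom.id _ - sdX X (m + 1) := by
    refine addHom_ext_gen fun s => ?_
    simp only [AddMonoidHom.add_apply, AddMonoidHom.comp_apply, AddMonoidHom.sub_apply,
      AddMonoidHom.id_apply]
    rw [← realA_vert s, dX_apply, dX_apply, homX_realA, realA_d, realA_d, homX_realA, sdX_realA,
      ← map_add, ← map_sub, homotopyA]
  exact DFunLike.congr_fun this c

lemma sdX_dX {m : ℕ} (c : (singC X).X (m + 1)) :
    dX X m (sdX X (m + 1) c) = sdX X m (dX X m c) := by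
  have : (dX X m).comp (sdX X (m + 1)) = (sdX X m).comp (dX X m) := by
    refine addHom_ext_gen fun s => ?_
    simp only [AddMonoidHom.comp_apply]
    rw [← realA_vert s, dX_apply, dX_apply, sdX_realA, realA_d, realA_d, sdX_realA, sdA_dA]
  exact DFunLike.congr_fun this c

lemma sdX_zero (c : (singC X).X 0) : sdX X 0 c = c := by
  have : sdX X 0 = AddMonoidHom.id _ := by
    refine addHom_ext_gen fun s => ?_
    rw [← realA_vert s, sdX_realA]; rfl
  exact DFunLike.congr_fun this c

/-- Affine chains all of whose simplices have vertices at mutual distance at most `D`. -/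
def smallA (n m : ℕ) (D : ℝ) : AddSubgroup (AffC n m) :=
  AddSubgroup.closure {c | ∃ w, c = Finsupp.single w 1 ∧ ∀ i j, dist (w i) (w j) ≤ D}

lemma dist_aff_le {n m : ℕ} {w : Fin (m + 1) → Splx n} {b : Splx n} {R : ℝ}
    (h : ∀ i, dist b (w i) ≤ R) (t : Splx m) : dist b (aff w t) ≤ R := by
  rw [Subtype.dist_eq, dist_comm]
  refine (convex_closedBall (b : Fin (n + 1) → ℝ) R).sum_mem (fun i _ => t.2.1 i) t.2.2
    (fun i _ => ?_)
  rw [Metric.mem_closedBall, dist_comm]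
  exact h i

/-- The difference is the mean of the m + 1 vectors w_j - w_i. One of them is zero and the other m
have norm at most D. -/
lemma dist_bary_le {n m : ℕ} {w : Fin (m + 1) → Splx n} {D : ℝ}
    (h : ∀ i j, dist (w i) (w j) ≤ D) (i : Fin (m + 1)) :
    dist (aff w (bary m)) (w i) ≤ (m / (m + 1) : ℝ) * D := by
  have hm : (0 : ℝ) < m + 1 := by positivity
  have e : ((aff w (bary m)).1 - (w i).1 : Fin (n + 1) → ℝ) =
      ∑ j, ((m + 1 : ℝ)⁻¹) • ((w j).1 - (w i).1) := by
    rw [← Finset.smul_sum, Finset.sum_sub_distrib, smul_sub, Finset.smul_sum]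
    refine congrArg₂ (· - ·) ?_ ?_
    · refine (aff_coe w (bary m)).trans (Finset.sum_congr rfl fun j _ => ?_)
      have : (bary m).1 j = (m + 1 : ℝ)⁻¹ := by
        refine (stdSimplex.barycenter_apply (𝕜 := ℝ) (X := Fin (m + 1)) j).trans ?_
        simp
      exact congrArg (fun a : ℝ => a • ((w j).1 : Fin (n + 1) → ℝ)) this
    · rw [Finset.sum_const, Finset.card_univ, Fintype.card_fin, ← Nat.cast_smul_eq_nsmul ℝ,
        smul_smul]
      push_cast
      rw [inv_mul_cancel₀ hm.ne', one_smul]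
  rw [Subtype.dist_eq, dist_eq_norm, e, ← Finset.add_sum_erase _ _ (Finset.mem_univ i), sub_self,
    smul_zero, zero_add]
  refine (norm_sum_le _ _).trans ?_
  have : ∀ j ∈ Finset.univ.erase i, ‖((m + 1 : ℝ)⁻¹) • ((w j).1 - (w i).1)‖ ≤ (m + 1 : ℝ)⁻¹ * D := by
    intro j _
    rw [norm_smul, Real.norm_of_nonneg (by positivity)]
    refine mul_le_mul_of_nonneg_left ?_ (by positivity)
    rw [← dist_eq_norm, ← Subtype.dist_eq]
    exact h j i
  refine (Finset.sum_le_sum this).trans_eq ?_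
  rw [Finset.sum_const, Finset.card_erase_of_mem (Finset.mem_univ i), Finset.card_univ,
    Fintype.card_fin, nsmul_eq_mul, Nat.add_sub_cancel]
  ring

/-- A single ratio θ, valid in all dimensions up to m, lets the induction pass to faces. The
condition that the new vertices lie in the image of w bounds their distance from the barycenter,
which is the new cone point. -/
lemma sdA_single_mem (n : ℕ) {θ : ℝ} (hθ : 0 ≤ θ) : ∀ (m : ℕ) (_ : (m / (m + 1) : ℝ) ≤ θ)
    (w : Fin (m + 1) → Splx n) (D : ℝ), (∀ i j, dist (w i) (w j) ≤ D) →
    sdA n m (Finsupp.single w 1) ∈ AddSubgroup.closure {c | ∃ u : Fin (m + 1) → Splx n,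
      c = Finsupp.single u 1 ∧ (∀ i, u i ∈ Set.range (aff w)) ∧ ∀ i j, dist (u i) (u j) ≤ θ * D}
  | 0, _, w, D, hw => by
    have hD : 0 ≤ D := dist_nonneg.trans (hw 0 0)
    refine AddSubgroup.subset_closure ⟨w, rfl, fun i => ⟨vert 0 i, aff_vertex w i⟩, fun i j => ?_⟩
    rw [Subsingleton.elim (α := Fin 1) i j, dist_self]
    positivity
  | m + 1, hm, w, D, hw => by
    have hD : 0 ≤ D := dist_nonneg.trans (hw 0 0)
    have hm' : (m / (m + 1) : ℝ) ≤ θ := by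
      refine le_trans ?_ hm
      push_cast
      rw [div_le_div_iff₀ (by positivity) (by positivity)]
      nlinarith
    rw [sdA_single_succ, dA_single, map_sum, map_sum]
    refine sum_mem fun i _ => ?_
    rw [map_zsmul, map_zsmul]
    refine zsmul_mem ?_ _
    have ih := sdA_single_mem n hθ m hm' (w ∘ i.succAbove) D (fun _ _ => hw _ _)
    have := AddSubgroup.mem_map_of_mem
      (coneA (m := m) (aff w (bary (m + 1)))).toAddMonoidHom ih
    rw [AddMonoidHom.map_closure] at this
    refine AddSubgroup.closure_mono ?_ this
    rintro _ ⟨_, ⟨u, rfl, hu, hd⟩, rfl⟩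
    refine ⟨Fin.cons (aff w (bary (m + 1))) u, coneA_single _ _, ?_, ?_⟩
    · refine Fin.cases ⟨_, rfl⟩ fun j => ?_
      obtain ⟨t, ht⟩ := hu j
      rw [← aff_comp_face] at ht
      exact ⟨_, ht⟩
    · have hb : ∀ j, dist (aff w (bary (m + 1))) (u j) ≤ θ * D := by
        intro j
        obtain ⟨t, ht⟩ := hu j
        rw [← ht]
        refine dist_aff_le (fun k => ?_) t
        exact (dist_bary_le hw _).trans (mul_le_mul_of_nonneg_right hm hD)
      refine Fin.cases (Fin.cases ?_ fun j => ?_) fun j => Fin.cases ?_ fun k => ?_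
      · simpa using mul_nonneg hθ hD
      · simpa using hb j
      · simpa [dist_comm] using hb j
      · simpa using hd j k

lemma sdA_mem_smallA (n : ℕ) {D : ℝ} {c : AffC n n} (hc : c ∈ smallA n n D) :
    sdA n n c ∈ smallA n n ((n / (n + 1) : ℝ) * D) := by
  have h := AddSubgroup.mem_map_of_mem (sdA n n).toAddMonoidHom hc
  rw [smallA, AddMonoidHom.map_closure] at h
  refine (AddSubgroup.closure_le _).2 ?_ h
  rintro _ ⟨_, ⟨w, rfl, hw⟩, rfl⟩
  refine AddSubgroup.closure_mono ?_ (sdA_single_mem n (by positivity) n le_rfl w D hw)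
  rintro _ ⟨u, rfl, -, hu⟩
  exact ⟨u, rfl, hu⟩

lemma iterate_sdA_mem_smallA (n k : ℕ) :
    (sdA n n)^[k] (Finsupp.single (vert n) 1) ∈
      smallA n n ((n / (n + 1) : ℝ) ^ k * Metric.diam (Set.univ : Set (Splx n))) := by
  induction k with
  | zero =>
    refine AddSubgroup.subset_closure ⟨_, rfl, fun i j => ?_⟩
    rw [pow_zero, one_mul]
    exact Metric.dist_le_diam_of_mem isCompact_univ.isBounded trivial trivial
  | succ k ih =>
    rw [Function.iterate_succ_apply', pow_succ', mul_assoc]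
    exact sdA_mem_smallA n ih

/-- Chains that are sums of chains in `A` and chains in `B`. -/
def smallC (A B : Set X) (m : ℕ) : AddSubgroup ((singC X).X m) :=
  AddSubgroup.closure {c | ∃ s : C(Splx m, X), c = gen s ∧ (Set.range s ⊆ A ∨ Set.range s ⊆ B)}

lemma realA_mem_smallC {A B : Set X} {n : ℕ} {s : C(Splx n, X)}
    (hs : Set.range s ⊆ A ∨ Set.range s ⊆ B) (m : ℕ) (c : AffC n m) :
    realA s m c ∈ smallC A B m := by
  have hc : c ∈ AddSubgroup.comap (realA s m).toAddMonoidHom (smallC A B m) := by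
    induction c using Finsupp.induction_linear with
    | zero => exact zero_mem _
    | add f g hf hg => exact add_mem hf hg
    | single w a =>
      rw [← mul_one a, ← smul_eq_mul, ← Finsupp.smul_single]
      refine zsmul_mem ?_ a
      refine AddSubgroup.subset_closure ⟨s.comp (aff w), realA_single _ _, ?_⟩
      refine hs.imp (fun h => ?_) (fun h => ?_) <;>
      · rintro _ ⟨t, rfl⟩; exact h ⟨_, rfl⟩
  exact hc

lemma homX_mem_smallC {A B : Set X} {m : ℕ} {c : (singC X).X m} (hc : c ∈ smallC A B m) :
    homX X m c ∈ smallC A B (m + 1) := by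
  refine (AddSubgroup.closure_le (K := (smallC A B (m + 1)).comap (homX X m))).2 ?_ hc
  rintro _ ⟨s, rfl, hs⟩
  change homX X m (gen s) ∈ smallC A B (m + 1)
  rw [homX_gen]
  exact realA_mem_smallC hs _ _

lemma sdX_mem_smallC {A B : Set X} {m : ℕ} {c : (singC X).X m} (hc : c ∈ smallC A B m) :
    sdX X m c ∈ smallC A B m := by
  refine (AddSubgroup.closure_le (K := (smallC A B m).comap (sdX X m))).2 ?_ hc
  rintro _ ⟨s, rfl, hs⟩
  change sdX X m (gen s) ∈ smallC A B m
  rw [sdX_gen]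
  exact realA_mem_smallC hs _ _

lemma iterate_sdX_mem_smallC {A B : Set X} {m : ℕ} {c : (singC X).X m} (hc : c ∈ smallC A B m)
    (k : ℕ) : (sdX X m)^[k] c ∈ smallC A B m := by
  induction k with
  | zero => exact hc
  | succ k ih => rw [Function.iterate_succ_apply']; exact sdX_mem_smallC ih

lemma iterate_sdX_realA {n m : ℕ} (s : C(Splx n, X)) (c : AffC n m) (k : ℕ) :
    (sdX X m)^[k] (realA s m c) = realA s m ((sdA n m)^[k] c) := by
  induction k generalizing c with
  | zero => rfl
  | succ k ih => rw [Function.iterate_succ_apply, sdX_realA, ih, Function.iterate_succ_apply]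

/-- The preimages of the two interiors cover the compact simplex. Subdivision is iterated until the
mesh is below a Lebesgue number. -/
lemma exists_iterate_sdX_gen {A B : Set X} (hAB : interior A ∪ interior B = Set.univ) {m : ℕ}
    (s : C(Splx m, X)) : ∃ k, (sdX X m)^[k] (gen s) ∈ smallC A B m := by
  obtain ⟨δ, hδ, hL⟩ := lebesgue_number_lemma_of_metric (s := (Set.univ : Set (Splx m)))
    (c := fun b : Bool => s ⁻¹' (cond b (interior A) (interior B))) isCompact_univ
    (fun b => by cases b <;> exact isOpen_interior.preimage s.continuous)
    (fun x _ => by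
      rcases hAB.ge (Set.mem_univ (s x)) with h | h
      · exact Set.mem_iUnion.2 ⟨true, h⟩
      · exact Set.mem_iUnion.2 ⟨false, h⟩)
  set D := Metric.diam (Set.univ : Set (Splx m))
  have hlim : Filter.Tendsto (fun k : ℕ => (m / (m + 1) : ℝ) ^ k * D) Filter.atTop (nhds 0) := by
    have := (tendsto_pow_atTop_nhds_zero_of_lt_one (r := (m / (m + 1) : ℝ)) (by positivity)
      (by rw [div_lt_one (by positivity)]; linarith)).mul_const D
    simpa using this
  obtain ⟨k, hk⟩ := (hlim.eventually (gt_mem_nhds hδ)).exists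
  refine ⟨k, ?_⟩
  rw [← realA_vert s, iterate_sdX_realA]
  have h := iterate_sdA_mem_smallA m k
  refine (AddSubgroup.closure_le
    (K := (smallC A B m).comap (realA s m).toAddMonoidHom)).2 ?_ h
  rintro _ ⟨w, rfl, hw⟩
  refine AddSubgroup.subset_closure ⟨s.comp (aff w), realA_single _ _, ?_⟩
  -- The whole small simplex lies in the δ-ball about its first vertex.
  obtain ⟨b, hb⟩ := hL (w 0) trivial
  have hr : Set.range (s.comp (aff w)) ⊆ cond b (interior A) (interior B) := by
    rintro _ ⟨t, rfl⟩
    refine hb ?_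
    rw [Metric.mem_ball, dist_comm]
    exact (dist_aff_le (fun i => hw 0 i) t).trans_lt hk
  cases b
  · exact Or.inr (hr.trans interior_subset)
  · exact Or.inl (hr.trans interior_subset)

lemma exists_iterate_sdX {A B : Set X} (hAB : interior A ∪ interior B = Set.univ) {m : ℕ}
    (c : (singC X).X m) : ∃ k, (sdX X m)^[k] c ∈ smallC A B m := by
  have hc : c ∈ AddSubgroup.closure (Set.range (gen : C(Splx m, X) → (singC X).X m)) := by
    rw [closure_gen]; trivial
  induction hc using AddSubgroup.closure_induction with
  | mem x h => obtain ⟨s, rfl⟩ := h; exact exists_iterate_sdX_gen hAB s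
  | zero => exact ⟨0, zero_mem _⟩
  | add x y _ _ hx hy =>
    obtain ⟨k, hk⟩ := hx
    obtain ⟨l, hl⟩ := hy
    -- Small chains stay small under subdivision, so the sum of the two exponents serves both
    -- summands.
    refine ⟨k + l, ?_⟩
    rw [iterate_map_add]
    refine add_mem ?_ ?_
    · rw [add_comm, Function.iterate_add_apply]; exact iterate_sdX_mem_smallC hk l
    · rw [Function.iterate_add_apply]; exact iterate_sdX_mem_smallC hl k
  | neg x _ hx =>
    obtain ⟨k, hk⟩ := hx
    refine ⟨k, ?_⟩
    rw [iterate_map_neg]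
    exact neg_mem hk

/-- A chain with small boundary is homologous to a small chain, modulo small chains. -/
theorem exists_sub_boundary_mem_smallC {A B : Set X} (hAB : interior A ∪ interior B = Set.univ)
    {m : ℕ} (c : (singC X).X (m + 1)) (hc : dX X m c ∈ smallC A B m) :
    ∃ e, c - dX X (m + 1) e ∈ smallC A B (m + 1) := by
  obtain ⟨k, hk⟩ := exists_iterate_sdX hAB c
  induction k generalizing c with
  | zero => exact ⟨0, by simpa using hk⟩
  | succ k ih =>
    obtain ⟨e, he⟩ := ih (sdX X (m + 1) c) (by rw [sdX_dX]; exact sdX_mem_smallC hc) hk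
    -- The homotopy formula gives c - ∂(e + Hc) = (sd c - ∂e) + H∂c, and H∂c is small because ∂c is.
    refine ⟨e + homX X (m + 1) c, ?_⟩
    have h := homotopyX c
    have : c - dX X (m + 1) (e + homX X (m + 1) c) =
        (sdX X (m + 1) c - dX X (m + 1) e) + homX X m (dX X m c) := by
      rw [map_add, eq_sub_of_add_eq h]
      abel
    rw [this]
    exact add_mem he (homX_mem_smallC hc)

/-- Subdivision is the identity in degree 0, so a chain that becomes small was small from the start.
-/
theorem mem_smallC_zero {A B : Set X} (hAB : interior A ∪ interior B = Set.univ)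
    (c : (singC X).X 0) : c ∈ smallC A B 0 := by
  obtain ⟨k, hk⟩ := exists_iterate_sdX hAB c
  rwa [Function.iterate_fixed (sdX_zero c)] at hk

/-! ### Relative singular homology: exact sequences, homotopy invariance, excision -/

variable {X Y Z : Type} [TopologicalSpace X] [TopologicalSpace Y] [TopologicalSpace Z]

instance mono_singMap_incl (A : Set X) : Mono (singMap (incl A)) := by
  have : Mono (TopCat.ofHom (incl A)) := (TopCat.mono_iff_injective _).2 Subtype.val_injective
  infer_instance

/-- The short exact sequence of complexes defining relative chains. -/
def relSES (A : Set X) : ShortComplex (ChainComplex (ModuleCat.{0} ℤ) ℕ) :=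
  ShortComplex.mk (singMap (incl A)) (cokernel.π (singMap (incl A))) (cokernel.condition _)

lemma relSES_shortExact (A : Set X) : (relSES A).ShortExact where
  exact := ShortComplex.exact_cokernel _
  mono_f := mono_singMap_incl A
  epi_g := by dsimp [relSES]; infer_instance

/-- The projection from chains to relative chains. -/
def relπ (A : Set X) : singC X ⟶ relC X A := cokernel.π (singMap (incl A))

/-! ### Short exact sequences of chain complexes, degree by degree -/

section degreewise

variable {S : ShortComplex (ChainComplex (ModuleCat.{0} ℤ) ℕ)}

lemma shortExact_apply_eq_zero_iff (hS : S.ShortExact) (m : ℕ) (x : S.X₂.X m) :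
    S.g.f m x = 0 ↔ ∃ y, S.f.f m y = x := by
  have h := (HomologicalComplex.shortExact_iff_degreewise_shortExact S).1 hS m
  constructor
  · intro hx
    exact (ShortComplex.moduleCat_exact_iff _).1 h.exact x hx
  · rintro ⟨y, rfl⟩
    exact congrArg (fun φ : S.X₁ ⟶ S.X₃ => (φ.f m).hom y) S.zero

lemma shortExact_g_surjective (hS : S.ShortExact) (m : ℕ) : Function.Surjective (S.g.f m) := by
  have h := (HomologicalComplex.shortExact_iff_degreewise_shortExact S).1 hS m
  exact (ModuleCat.epi_iff_surjective _).1 h.epi_g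

lemma mono_of_f_injective {K L : ChainComplex (ModuleCat.{0} ℤ) ℕ} (f : K ⟶ L)
    (h : ∀ m, Function.Injective (f.f m)) : Mono f := by
  have : ∀ m, Mono (f.f m) := fun m => (ModuleCat.mono_iff_injective _).2 (h m)
  exact HomologicalComplex.mono_of_mono_f f this

lemma quasiIso_of_shortExact_of_acyclic (hS : S.ShortExact) (h : S.X₃.Acyclic) :
    QuasiIso S.f := by
  rw [quasiIso_iff]
  intro i
  rw [quasiIsoAt_iff_isIso_homologyMap]
  have : Epi (HomologicalComplex.homologyMap S.f i) :=
    (hS.homology_exact₂ i).epi_f ((h i).isZero_homology.eq_of_tgt _ _)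
  have : Mono (HomologicalComplex.homologyMap S.f i) :=
    (hS.homology_exact₁ (i + 1) i rfl).mono_g ((h (i + 1)).isZero_homology.eq_of_src _ _)
  exact isIso_of_mono_of_epi _

/-- Elementwise criterion for the acyclicity of a chain complex. -/
lemma acyclic_of_elements (K : ChainComplex (ModuleCat.{0} ℤ) ℕ)
    (h0 : ∀ x : K.X 0, ∃ y : K.X 1, K.d 1 0 y = x)
    (h : ∀ (m : ℕ) (x : K.X (m + 1)), K.d (m + 1) m x = 0 → ∃ y, K.d (m + 2) (m + 1) y = x) :
    K.Acyclic := by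
  intro m
  cases m with
  | zero =>
    rw [HomologicalComplex.exactAt_iff' K 1 0 0 (by simp) (by simp)]
    exact (ShortComplex.moduleCat_exact_iff _).2 fun x _ => h0 x
  | succ m =>
    rw [HomologicalComplex.exactAt_iff' K (m + 2) (m + 1) m (by simp) (by simp)]
    exact (ShortComplex.moduleCat_exact_iff _).2 fun x hx => h m x hx

end degreewise

lemma relπ_surjective (A : Set X) (m : ℕ) : Function.Surjective ((relπ A).f m) :=
  shortExact_g_surjective (relSES_shortExact A) m

lemma relπ_eq_zero_iff (A : Set X) (m : ℕ) (x : (singC X).X m) :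
    (relπ A).f m x = 0 ↔ ∃ y, (singMap (incl A)).f m y = x :=
  shortExact_apply_eq_zero_iff (relSES_shortExact A) m x

lemma relπ_relMap (f : C(X, Y)) {A : Set X} {B : Set Y} (h : Set.MapsTo f A B) :
    relπ A ≫ relMap f h = singMap f ≫ relπ B :=
  cokernel.π_desc _ _ _

lemma relMap_relπ_apply (f : C(X, Y)) {A : Set X} {B : Set Y} (h : Set.MapsTo f A B) (m : ℕ)
    (x : (singC X).X m) :
    (relMap f h).f m ((relπ A).f m x) = (relπ B).f m ((singMap f).f m x) :=
  congrArg (fun φ : singC X ⟶ relC Y B => (φ.f m).hom x) (relπ_relMap f h)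

lemma relC_hom_ext {A : Set X} {K : ChainComplex (ModuleCat.{0} ℤ) ℕ} {f g : relC X A ⟶ K}
    (h : relπ A ≫ f = relπ A ≫ g) : f = g :=
  coequalizer.hom_ext h

lemma singMap_comp (f : C(X, Y)) (g : C(Y, Z)) :
    singMap f ≫ singMap g = singMap (g.comp f) :=
  (Functor.map_comp _ _ _).symm

lemma singMap_id : singMap (ContinuousMap.id X) = 𝟙 (singC X) :=
  CategoryTheory.Functor.map_id _ _

lemma relMap_comp (f : C(X, Y)) (g : C(Y, Z)) {A : Set X} {B : Set Y} {C : Set Z}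
    (h : Set.MapsTo f A B) (h' : Set.MapsTo g B C) :
    relMap f h ≫ relMap g h' = relMap (g.comp f) (h'.comp h) := by
  refine relC_hom_ext ?_
  rw [← Category.assoc, relπ_relMap, Category.assoc, relπ_relMap, relπ_relMap, ← Category.assoc,
    singMap_comp]

lemma mapsTo_continuousMap_id {A B : Set X} (h : A ⊆ B) : Set.MapsTo (ContinuousMap.id X) A B := h

/-- The chain map `C(X, A) → C(X, B)` for `A ⊆ B`. -/
abbrev relInc {A B : Set X} (h : A ⊆ B) : relC X A ⟶ relC X B :=
  relMap (ContinuousMap.id X) (mapsTo_continuousMap_id h)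

lemma relMap_id (A : Set X) : relInc (subset_refl A) = 𝟙 (relC X A) := by
  refine relC_hom_ext ?_
  rw [relπ_relMap, singMap_id]
  rfl

/-- The morphism of short exact sequences induced by a map of pairs. -/
def relSESMap (f : C(X, Y)) {A : Set X} {B : Set Y} (h : Set.MapsTo f A B) :
    relSES A ⟶ relSES B where
  τ₁ := singMap (restrictPair f h)
  τ₂ := singMap f
  τ₃ := relMap f h
  comm₁₂ := by
    dsimp only [relSES]
    rw [singMap_comp, singMap_comp]
    rfl
  comm₂₃ := (relπ_relMap f h).symm

lemma quasiIso_relMap (f : C(X, Y)) {A : Set X} {B : Set Y} (h : Set.MapsTo f A B)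
    (h₁ : QuasiIso (singMap (restrictPair f h))) (h₂ : QuasiIso (singMap f)) :
    QuasiIso (relMap f h) :=
  HomologicalComplex.HomologySequence.quasiIso_τ₃ (relSESMap f h) (relSES_shortExact A)
    (relSES_shortExact B) h₁ h₂

lemma homologyMap_singMap_eq_of_homotopy {f g : C(X, Y)} (H : f.Homotopy g) (i : ℕ) :
    HomologicalComplex.homologyMap (singMap f) i = HomologicalComplex.homologyMap (singMap g) i :=
  TopCat.Homotopy.congr_homologyMap_singularChainComplexFunctor
    (f := TopCat.ofHom f) (g := TopCat.ofHom g) H _ i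

lemma quasiIso_singMap_of_homotopyInverse (f : C(X, Y)) (g : C(Y, X))
    (H : (g.comp f).Homotopy (ContinuousMap.id X)) (H' : (f.comp g).Homotopy (ContinuousMap.id Y)) :
    QuasiIso (singMap f) := by
  rw [quasiIso_iff]
  intro i
  rw [quasiIsoAt_iff_isIso_homologyMap]
  refine ⟨HomologicalComplex.homologyMap (singMap g) i, ?_, ?_⟩
  · rw [← HomologicalComplex.homologyMap_comp, singMap_comp,
      homologyMap_singMap_eq_of_homotopy H, singMap_id, HomologicalComplex.homologyMap_id]
  · rw [← HomologicalComplex.homologyMap_comp, singMap_comp,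
      homologyMap_singMap_eq_of_homotopy H', singMap_id, HomologicalComplex.homologyMap_id]

lemma quasiIso_singMap_id : QuasiIso (singMap (ContinuousMap.id X)) := by
  rw [singMap_id]; infer_instance

/-- If a set `N` can be deformed into `A ⊆ N` in such a way that `A` stays in `A`, then the pairs
`(X, A)` and `(X, N)` have the same homology. -/
lemma quasiIso_relMap_of_deformation {A N : Set X} (hAN : A ⊆ N) (H : C(unitInterval × N, X))
    (h0 : ∀ x, H (0, x) = x) (hN : ∀ t x, H (t, x) ∈ N) (hA : ∀ t (x : N), (x : X) ∈ A → H (t, x) ∈ A)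
    (h1 : ∀ x, H (1, x) ∈ A) : QuasiIso (relInc hAN) := by
  refine quasiIso_relMap _ _ ?_ quasiIso_singMap_id
  let g : C(N, A) := ⟨fun x => ⟨H (1, x), h1 x⟩, by fun_prop⟩
  refine quasiIso_singMap_of_homotopyInverse _ g ?_ ?_
  · refine ContinuousMap.Homotopy.symm
      ⟨⟨fun p => ⟨H (p.1, ⟨p.2, hAN p.2.2⟩), hA _ _ p.2.2⟩, by fun_prop⟩, ?_, ?_⟩
    · intro x; exact Subtype.ext (h0 _)
    · intro x; rfl
  · refine ContinuousMap.Homotopy.symm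
      ⟨⟨fun p => ⟨H p, hN _ _⟩, by fun_prop⟩, ?_, ?_⟩
    · intro x; exact Subtype.ext (h0 _)
    · intro x; rfl

lemma isIso_relMap_homeomorph (e : X ≃ₜ Y) {A : Set X} {B : Set Y}
    (h : Set.MapsTo (e : C(X, Y)) A B) (h' : Set.MapsTo (e.symm : C(Y, X)) B A) :
    IsIso (relMap (e : C(X, Y)) h) := by
  refine ⟨relMap (e.symm : C(Y, X)) h', ?_, ?_⟩
  · rw [relMap_comp, ← relMap_id]
    congr 1
    ext x; simp
  · rw [relMap_comp, ← relMap_id]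
    congr 1
    ext x; simp

/-! ### The chains of a subspace -/

open Classical in
/-- The projection of the chains of `X` to the chains of the subspace `A`. -/
def projC (A : Set X) (m : ℕ) : (singC X).X m →+ (singC A).X m :=
  chainLift fun s => if h : ∀ t, s t ∈ A then gen ⟨fun t => ⟨s t, h t⟩, by fun_prop⟩ else 0

lemma projC_incl (A : Set X) (m : ℕ) (x : (singC A).X m) :
    projC A m ((singMap (incl A)).f m x) = x := by
  have : (projC A m).comp ((singMap (incl A)).f m).hom.toAddMonoidHom = AddMonoidHom.id _ := by
    refine addHom_ext_gen fun s => ?_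
    change projC A m ((singMap (incl A)).f m (gen s)) = gen s
    rw [singMap_gen, projC, chainLift_gen, dif_pos (by exact fun t => (s t).2)]
    rfl
  exact DFunLike.congr_fun this x

lemma incl_projC_gen_of_subset (A : Set X) (m : ℕ) (s : C(Splx m, X)) (h : Set.range s ⊆ A) :
    (singMap (incl A)).f m (projC A m (gen s)) = gen s := by
  have h' : ∀ t, s t ∈ A := fun t => h ⟨t, rfl⟩
  rw [projC, chainLift_gen, dif_pos h', singMap_gen]
  rfl

lemma gen_mem_range_incl (A : Set X) (m : ℕ) (s : C(Splx m, X)) (h : Set.range s ⊆ A) :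
    ∃ y, (singMap (incl A)).f m y = gen s :=
  ⟨_, incl_projC_gen_of_subset A m s h⟩

/-- The projections to the chains of two subspaces commute. -/
lemma exists_incl_preimage (A B : Set X) (m : ℕ) (x : (singC A).X m) :
    ∃ z : (singC ↥((Subtype.val : B → X) ⁻¹' A)).X m,
      (singMap (incl ((Subtype.val : B → X) ⁻¹' A))).f m z =
        projC B m ((singMap (incl A)).f m x) := by
  have hx : x ∈ AddSubgroup.closure (Set.range (gen : C(Splx m, A) → (singC A).X m)) := by
    rw [closure_gen]; trivial
  induction hx using AddSubgroup.closure_induction with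
  | mem x h =>
    obtain ⟨s, rfl⟩ := h
    rw [singMap_gen]
    by_cases h : ∀ t, (s t : X) ∈ B
    · have e : projC B m (gen ((incl A).comp s)) =
          gen (X := B) ⟨fun t => ⟨s t, h t⟩, by fun_prop⟩ := by
        rw [projC, chainLift_gen, dif_pos (by exact h)]
        rfl
      rw [e]
      refine gen_mem_range_incl _ m _ ?_
      rintro _ ⟨t, rfl⟩
      exact (s t).2
    · refine ⟨0, ?_⟩
      rw [map_zero, projC, chainLift_gen, dif_neg (by exact h)]
  | zero => exact ⟨0, by simp only [map_zero]⟩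
  | add x y _ _ hx hy =>
    obtain ⟨z, hz⟩ := hx
    obtain ⟨z', hz'⟩ := hy
    exact ⟨z + z', by simp only [map_add, hz, hz']⟩
  | neg x _ hx =>
    obtain ⟨z, hz⟩ := hx
    exact ⟨-z, by simp only [map_neg, hz]⟩

lemma mapsTo_incl_preimage (A B : Set X) :
    Set.MapsTo (incl B) ((Subtype.val : B → X) ⁻¹' A) A := fun _ h => h

/-- A chain of B that is also a chain of A is a chain of A ∩ B: write it as a chain of A and
discard, by `projC`, the simplices that leave B. -/
instance mono_relMap_incl (A B : Set X) : Mono (relMap (incl B) (mapsTo_incl_preimage A B)) := by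
  refine mono_of_f_injective _ fun m => (injective_iff_map_eq_zero _).2 fun x hx => ?_
  obtain ⟨x, rfl⟩ := relπ_surjective _ m x
  rw [relMap_relπ_apply, relπ_eq_zero_iff] at hx
  obtain ⟨y, hy⟩ := hx
  obtain ⟨z, hz⟩ := exists_incl_preimage A B m y
  rw [relπ_eq_zero_iff]
  refine ⟨z, hz.trans ?_⟩
  rw [hy, projC_incl]

/-- The short exact sequence of relative chains of a triple. -/
def tripleSES {A B : Set X} (h : A ⊆ B) : ShortComplex (ChainComplex (ModuleCat.{0} ℤ) ℕ) :=
  ShortComplex.mk (relMap (incl B) (mapsTo_incl_preimage A B))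
    (relInc h) (by
      refine relC_hom_ext ?_
      rw [← Category.assoc, relπ_relMap, Category.assoc, relπ_relMap, ← Category.assoc,
        singMap_comp, comp_zero]
      exact cokernel.condition _)

lemma tripleSES_shortExact {A B : Set X} (h : A ⊆ B) : (tripleSES h).ShortExact where
  exact := by
    rw [HomologicalComplex.exact_iff_degreewise_exact]
    intro m
    refine (ShortComplex.moduleCat_exact_iff _).2 fun x hx => ?_
    obtain ⟨x, rfl⟩ := relπ_surjective _ m x
    replace hx : (relInc h).f m ((relπ A).f m x) = 0 := hx
    rw [relMap_relπ_apply, relπ_eq_zero_iff] at hx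
    obtain ⟨y, hy⟩ := hx
    refine ⟨(relπ _).f m y, (relMap_relπ_apply _ (mapsTo_incl_preimage A B) m y).trans ?_⟩
    rw [hy, singMap_id]
    rfl
  mono_f := mono_relMap_incl A B
  epi_g := by
    have : Epi (relπ A ≫ (tripleSES h).g) := by
      dsimp only [tripleSES]
      rw [relπ_relMap, singMap_id, Category.id_comp]
      exact inferInstanceAs (Epi (cokernel.π _))
    exact epi_of_epi (relπ A) _

/-- The excision theorem. -/
theorem quasiIso_excision {A B : Set X} (hAB : interior A ∪ interior B = Set.univ) :
    QuasiIso (relMap (incl B) (mapsTo_incl_preimage A B)) := by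
  set u := relMap (incl B) (mapsTo_incl_preimage A B)
  let S : ShortComplex (ChainComplex (ModuleCat.{0} ℤ) ℕ) :=
    ShortComplex.mk u (cokernel.π u) (cokernel.condition u)
  have hS : S.ShortExact :=
    { exact := ShortComplex.exact_cokernel _
      mono_f := mono_relMap_incl A B
      epi_g := by dsimp [S]; infer_instance }
  -- The cokernel of u is C(X)/(C(A) + C(B)), and the kernel of p consists exactly of the small
  -- chains (`hsmall`, `hker`). Excision is the acyclicity of this quotient.
  let p : singC X ⟶ cokernel u := relπ A ≫ cokernel.π u
  have hp : ∀ m, Function.Surjective (p.f m) := fun m =>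
    (shortExact_g_surjective hS m).comp (relπ_surjective A m)
  have hd : ∀ (m : ℕ) (x : (singC X).X (m + 1)),
      (cokernel u).d (m + 1) m (p.f (m + 1) x) = p.f m (dX X m x) := fun m x =>
    congrArg (fun φ : (singC X).X (m + 1) ⟶ (cokernel u).X m => φ.hom x) (p.comm (m + 1) m)
  have hsmall : ∀ (m : ℕ) (x : (singC X).X m), x ∈ smallC A B m → p.f m x = 0 := by
    intro m x hx
    refine (AddSubgroup.closure_le (K := (p.f m).hom.toAddMonoidHom.ker)).2 ?_ hx
    rintro _ ⟨s, rfl, hs | hs⟩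
    · have := (relπ_eq_zero_iff A m (gen s)).2 (gen_mem_range_incl A m s hs)
      change (cokernel.π u).f m ((relπ A).f m (gen s)) = 0
      rw [this, map_zero]
    · obtain ⟨y, hy⟩ := gen_mem_range_incl B m s hs
      refine (shortExact_apply_eq_zero_iff hS m _).2 ⟨(relπ _).f m y, ?_⟩
      rw [← hy]
      exact relMap_relπ_apply _ (mapsTo_incl_preimage A B) m y
  have hin : ∀ (C : Set X) (m : ℕ) (_ : C = A ∨ C = B) (y : (singC C).X m),
      (singMap (incl C)).f m y ∈ smallC A B m := by
    intro C m hC y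
    have hy : y ∈ AddSubgroup.closure (Set.range (gen : C(Splx m, C) → (singC C).X m)) := by
      rw [closure_gen]; trivial
    refine (AddSubgroup.closure_le (K := (smallC A B m).comap
      ((singMap (incl C)).f m).hom.toAddMonoidHom)).2 ?_ hy
    rintro _ ⟨s, rfl⟩
    refine AddSubgroup.subset_closure ⟨(incl C).comp s, singMap_gen _ _, ?_⟩
    have : Set.range ((incl C).comp s) ⊆ C := by rintro _ ⟨t, rfl⟩; exact (s t).2
    rcases hC with rfl | rfl
    · exact Or.inl this
    · exact Or.inr this
  have hker : ∀ (m : ℕ) (x : (singC X).X m), p.f m x = 0 → x ∈ smallC A B m := by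
    intro m x hx
    obtain ⟨k, hk⟩ := (shortExact_apply_eq_zero_iff hS m _).1
      (show (cokernel.π u).f m ((relπ A).f m x) = 0 from hx)
    obtain ⟨b, rfl⟩ := relπ_surjective _ m k
    have hk' : (relπ A).f m ((singMap (incl B)).f m b) = (relπ A).f m x :=
      (relMap_relπ_apply _ (mapsTo_incl_preimage A B) m b).symm.trans hk
    have : (relπ A).f m (x - (singMap (incl B)).f m b) = 0 := by
      rw [map_sub, hk', sub_self]
    obtain ⟨a, ha⟩ := (relπ_eq_zero_iff A m _).1 this
    rw [eq_sub_iff_add_eq] at ha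
    rw [← ha]
    exact add_mem (hin A m (Or.inl rfl) a) (hin B m (Or.inr rfl) b)
  -- In degree 0 every chain is small and the quotient is zero. In positive degree a cycle of the
  -- quotient is a chain with small boundary, which differs from a small chain by a boundary.
  refine quasiIso_of_shortExact_of_acyclic hS (acyclic_of_elements _ ?_ ?_)
  · intro x
    obtain ⟨x, rfl⟩ := hp 0 x
    exact ⟨0, (map_zero _).trans (hsmall 0 x (mem_smallC_zero hAB x)).symm⟩
  · intro m x hx
    obtain ⟨x, rfl⟩ := hp (m + 1) x
    obtain ⟨e, he⟩ := exists_sub_boundary_mem_smallC hAB x (hker m _ ((hd m x).symm.trans hx))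
    refine ⟨p.f (m + 2) e, (hd (m + 1) e).trans ?_⟩
    have := hsmall _ _ he
    rw [map_sub, sub_eq_zero] at this
    exact this.symm

/-! ### Relative homeomorphisms -/

open Topology

variable {X Y Z : Type} [TopologicalSpace X] [TopologicalSpace Y] [TopologicalSpace Z]

/-- `H` is a strong deformation in `X` which pushes `N` into `A`. -/
structure IsCollar (H : C(unitInterval × X, X)) (A N : Set X) : Prop where
  subset : A ⊆ N
  zero : ∀ x, H (0, x) = x
  fix : ∀ t, ∀ x ∈ A, H (t, x) = x
  stable : ∀ t, ∀ x ∈ N, H (t, x) ∈ N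
  one : ∀ x ∈ N, H (1, x) ∈ A

lemma IsCollar.quasiIso {H : C(unitInterval × X, X)} {A N : Set X} (h : IsCollar H A N) :
    QuasiIso (relInc h.subset) :=
  quasiIso_relMap_of_deformation h.subset
    (H.comp ⟨fun p : unitInterval × N => (p.1, (p.2 : X)), by fun_prop⟩)
    (fun x => h.zero x) (fun t x => h.stable t x x.2)
    (fun t x hx => by
      have := h.fix t x hx
      simpa [this] using hx) (fun x => h.one x x.2)

lemma quasiIso_excision_of_isClosed {A N : Set X} (hA : IsClosed A) (hN : IsOpen N) (h : A ⊆ N) :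
    QuasiIso (relMap (incl Aᶜ) (mapsTo_incl_preimage N Aᶜ)) := by
  refine quasiIso_excision ?_
  rw [hN.interior_eq, hA.isOpen_compl.interior_eq, Set.eq_univ_iff_forall]
  intro x
  by_cases hx : x ∈ A
  · exact Or.inl (h hx)
  · exact Or.inr hx

section RelativeHomeomorphism

variable [CompactSpace X] [T2Space Y] (f : C(X, Y)) {B : Set Y}

/-- A continuous map from a compact space to a Hausdorff space which is bijective over the open
set `Bᶜ` is a homeomorphism over it. -/
def homeomorphOverCompl (hinj : Set.InjOn f (f ⁻¹' B)ᶜ) (hcov : Bᶜ ⊆ Set.range f) :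
    ↥(f ⁻¹' B)ᶜ ≃ₜ ↥Bᶜ :=
  (Equiv.ofBijective (Bᶜ.restrictPreimage f) (by
    constructor
    · intro x y hxy
      exact Subtype.ext (hinj x.2 y.2 (congrArg Subtype.val hxy))
    · rintro ⟨y, hy⟩
      obtain ⟨x, rfl⟩ := hcov hy
      exact ⟨⟨x, hy⟩, rfl⟩)).toHomeomorphOfContinuousClosed
    (f.continuous.restrictPreimage) (f.continuous.isClosedMap.restrictPreimage _)

/-- Y is a quotient of X ⊔ B. On X the pushed deformation is f ∘ H and on B it is stationary; these
agree under the identifications because H fixes f⁻¹(B) and f is injective elsewhere. -/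
lemma exists_isCollar_push [CompactSpace Y] (hB : IsClosed B) (hinj : Set.InjOn f (f ⁻¹' B)ᶜ)
    (hcov : Bᶜ ⊆ Set.range f) {H : C(unitInterval × X, X)} :
    ∃ K : C(unitInterval × Y, Y), ∀ N, IsCollar H (f ⁻¹' B) N → IsCollar K B (B ∪ f '' N) := by
  -- K is chosen before N. If H violates the conditions that do not involve N, the claim is vacuous
  -- and any K will do.
  by_cases hH : (∀ x, H (0, x) = x) ∧ (∀ t, ∀ x ∈ f ⁻¹' B, H (t, x) = x)
  swap
  · exact ⟨⟨Prod.snd, continuous_snd⟩, fun N h => (hH ⟨h.zero, h.fix⟩).elim⟩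
  obtain ⟨hzero, hfix⟩ := hH
  have : CompactSpace B := isCompact_iff_compactSpace.1 hB.isCompact
  let g : C(X ⊕ B, Y) := ⟨Sum.elim f Subtype.val, f.continuous.sumElim continuous_subtype_val⟩
  let G : C(unitInterval × (X ⊕ B), unitInterval × Y) :=
    ⟨Prod.map id g, continuous_id.prodMap g.continuous⟩
  have hgs : Function.Surjective g := by
    intro y
    by_cases hy : y ∈ B
    · exact ⟨Sum.inr ⟨y, hy⟩, rfl⟩
    · obtain ⟨x, rfl⟩ := hcov hy
      exact ⟨Sum.inl x, rfl⟩
  -- The product with the interval is still a quotient map, being a surjection from a compact space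
  -- to a Hausdorff one.
  have hG : IsQuotientMap G := (G.continuous.isClosedMap).isQuotientMap G.continuous
    (Function.surjective_id.prodMap hgs)
  let K' : C(unitInterval × (X ⊕ B), Y) :=
    ⟨Sum.elim (fun p : unitInterval × X => f (H p)) (fun p : unitInterval × B => (p.2 : Y)) ∘
      Homeomorph.prodSumDistrib, by
      refine (Continuous.sumElim ?_ ?_).comp (Homeomorph.continuous _) <;> fun_prop⟩
  have hKl : ∀ t x, K' (t, Sum.inl x) = f (H (t, x)) := fun t x => rfl
  have hKr : ∀ t (b : B), K' (t, Sum.inr b) = b := fun t x => rfl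
  have hfac : Function.FactorsThrough K' G := by
    rintro ⟨t, a⟩ ⟨t', a'⟩ h
    obtain rfl : t = t' := congrArg Prod.fst h
    replace h : g a = g a' := congrArg Prod.snd h
    rcases a with x | b <;> rcases a' with x' | b'
    · replace h : f x = f x' := h
      rw [hKl, hKl]
      by_cases hx : x ∈ f ⁻¹' B
      · have hx' : x' ∈ f ⁻¹' B := by rwa [Set.mem_preimage, ← h]
        rw [hfix t x hx, hfix t x' hx', h]
      · have hx' : x' ∉ f ⁻¹' B := by rwa [Set.mem_preimage, ← h]
        rw [hinj hx hx' h]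
    · replace h : f x = b' := h
      rw [hKl, hKr, hfix t x (by rw [Set.mem_preimage, h]; exact b'.2), h]
    · replace h : (b : Y) = f x' := h
      rw [hKl, hKr, hfix t x' (by rw [Set.mem_preimage, ← h]; exact b.2), h]
    · rw [hKr, hKr]; exact h
  let K : C(unitInterval × Y, Y) := hG.lift K' hfac
  have hK : ∀ p, K (G p) = K' p := fun p => DFunLike.congr_fun (hG.lift_comp K' hfac) p
  have hKf : ∀ t x, K (t, f x) = f (H (t, x)) := fun t x => hK (t, Sum.inl x)
  have hKB : ∀ t, ∀ b ∈ B, K (t, b) = b := fun t b hb => hK (t, Sum.inr ⟨b, hb⟩)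
  refine ⟨K, fun N h => ⟨Set.subset_union_left, ?_, hKB, ?_, ?_⟩⟩
  · intro y
    by_cases hy : y ∈ B
    · exact hKB 0 y hy
    · obtain ⟨x, rfl⟩ := hcov hy
      rw [hKf, h.zero]
  · rintro t _ (hy | ⟨x, hx, rfl⟩)
    · rw [hKB t _ hy]; exact Or.inl hy
    · rw [hKf]; exact Or.inr ⟨_, h.stable t x hx, rfl⟩
  · rintro _ (hy | ⟨x, hx, rfl⟩)
    · rw [hKB 1 _ hy]; exact hy
    · rw [hKf]; exact h.one x hx

/-- Since N contains f⁻¹(B), the complement is the image of the compact set X ∖ N. -/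
lemma isOpen_union_image [CompactSpace Y] (hinj : Set.InjOn f (f ⁻¹' B)ᶜ)
    (hcov : Bᶜ ⊆ Set.range f) {N : Set X} (hN : IsOpen N) (h : f ⁻¹' B ⊆ N) :
    IsOpen (B ∪ f '' N) := by
  have : (B ∪ f '' N)ᶜ = f '' Nᶜ := by
    ext y
    constructor
    · intro hy
      rw [Set.mem_compl_iff, Set.mem_union, not_or] at hy
      obtain ⟨x, rfl⟩ := hcov hy.1
      exact ⟨x, fun hx => hy.2 ⟨x, hx, rfl⟩, rfl⟩
    · rintro ⟨x, hx, rfl⟩ (hy | ⟨x', hx', h'⟩)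
      · exact hx (h hy)
      · by_cases hy : f x ∈ B
        · exact hx (h hy)
        · have hy' : f x' ∉ B := by rwa [h']
          exact hx (hinj hy' hy h' ▸ hx')
  rw [← isClosed_compl_iff, this]
  exact f.continuous.isClosedMap _ hN.isClosed_compl

/-- A quasi-isomorphism induces isomorphisms of homology modules. -/
def homologyIsoOfQuasiIso {K L : ChainComplex (ModuleCat.{0} ℤ) ℕ} (u : K ⟶ L) (h : QuasiIso u)
    (i : ℕ) : K.homology i ≅ L.homology i :=
  asIso (HomologicalComplex.homologyMap u i)

/-- A relative homeomorphism of compact pairs induces an isomorphism in homology. -/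
theorem nonempty_relH_iso_of_relativeHomeomorphism [CompactSpace Y] (hB : IsClosed B)
    (hinj : Set.InjOn f (f ⁻¹' B)ᶜ) (hcov : Bᶜ ⊆ Set.range f) {H : C(unitInterval × X, X)}
    {N : Set X} (hN : IsOpen N) (hH : IsCollar H (f ⁻¹' B) N) (i : ℕ) :
    Nonempty (relH i X (f ⁻¹' B) ≅ relH i Y B) := by
  obtain ⟨K, hK⟩ := exists_isCollar_push f hB hinj hcov (H := H)
  have hK := hK N hH
  set e := homeomorphOverCompl f hinj hcov
  have he : ∀ x, (e x : Y) = f x := fun _ => rfl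
  have h1 : Set.MapsTo (e : C(_, _)) ((Subtype.val : ↥(f ⁻¹' B)ᶜ → X) ⁻¹' N)
      ((Subtype.val : ↥Bᶜ → Y) ⁻¹' (B ∪ f '' N)) := fun x hx => Or.inr ⟨x, hx, rfl⟩
  have h2 : Set.MapsTo (e.symm : C(_, _)) ((Subtype.val : ↥Bᶜ → Y) ⁻¹' (B ∪ f '' N))
      ((Subtype.val : ↥(f ⁻¹' B)ᶜ → X) ⁻¹' N) := by
    intro y hy
    obtain ⟨x, rfl⟩ := e.surjective y
    change (e.symm (e x) : X) ∈ N
    rw [e.symm_apply_apply]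
    rcases hy with hy | ⟨x', hx', h⟩
    · exact (x.2 hy).elim
    · have hx'B : x' ∈ (f ⁻¹' B)ᶜ := by
        change f x' ∉ B
        rw [h]; exact (e x).2
      rwa [← hinj hx'B x.2 h]
  have hiso := isIso_relMap_homeomorph e h1 h2
  -- With A = f⁻¹(B) and N' = B ∪ f(N), the chain is H(X, A) ≅ H(X, N) ≅ H(X ∖ A, N ∖ A) ≅ H(Y ∖ B,
  -- N' ∖ B) ≅ H(Y, N') ≅ H(Y, B): collar, excision, homeomorphism, excision, collar.
  exact ⟨homologyIsoOfQuasiIso _ hH.quasiIso i ≪≫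
    (homologyIsoOfQuasiIso _ (quasiIso_excision_of_isClosed (hB.preimage f.continuous) hN
      hH.subset) i).symm ≪≫
    homologyIsoOfQuasiIso (relMap (e : C(_, _)) h1) inferInstance i ≪≫
    homologyIsoOfQuasiIso _ (quasiIso_excision_of_isClosed hB
      (isOpen_union_image f hinj hcov hN hH.subset) hK.subset) i ≪≫
    (homologyIsoOfQuasiIso _ hK.quasiIso i).symm⟩

end RelativeHomeomorphism

/-! ### The homology of a ball modulo its boundary sphere -/

/-- The closed unit ball of `ℝ^d`, for the maximum norm. -/
abbrev Cube (d : ℕ) : Type := Metric.closedBall (0 : Fin d → ℝ) 1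

/-- The boundary of the cube. -/
def cubeBdry (d : ℕ) : Set (Cube d) := {x | ‖(x : Fin d → ℝ)‖ = 1}

lemma Cube.norm_le {d : ℕ} (x : Cube d) : ‖(x : Fin d → ℝ)‖ ≤ 1 := by
  exact mem_closedBall_zero_iff.1 x.2

/-- The radial deformation of the cube. -/
def cubeCollar (d : ℕ) : C(unitInterval × Cube d, Cube d) :=
  ⟨fun p => ⟨(max (1 - (p.1 : ℝ) / 2) ‖(p.2 : Fin d → ℝ)‖)⁻¹ • (p.2 : Fin d → ℝ), by
    rw [mem_closedBall_zero_iff, norm_smul, norm_inv]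
    have h : 0 < max (1 - (p.1 : ℝ) / 2) ‖(p.2 : Fin d → ℝ)‖ :=
      lt_max_of_lt_left (by linarith [p.1.2.2])
    rw [Real.norm_of_nonneg h.le, inv_mul_le_one₀ h]
    exact le_max_right _ _⟩, by
    have hne : ∀ p : unitInterval × Cube d, max (1 - (p.1 : ℝ) / 2) ‖(p.2 : Fin d → ℝ)‖ ≠ 0 :=
      fun p => (lt_max_of_lt_left (by linarith [p.1.2.2])).ne'
    refine Continuous.subtype_mk (Continuous.smul (Continuous.inv₀ ?_ hne) ?_) _ <;> fun_prop⟩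

lemma norm_cubeCollar {d : ℕ} (t : unitInterval) (x : Cube d) :
    ‖(cubeCollar d (t, x) : Fin d → ℝ)‖ =
      (max (1 - (t : ℝ) / 2) ‖(x : Fin d → ℝ)‖)⁻¹ * ‖(x : Fin d → ℝ)‖ := by
  have h : 0 < max (1 - (t : ℝ) / 2) ‖(x : Fin d → ℝ)‖ :=
    lt_max_of_lt_left (by linarith [t.2.2])
  change ‖(max (1 - (t : ℝ) / 2) ‖(x : Fin d → ℝ)‖)⁻¹ • (x : Fin d → ℝ)‖ = _
  rw [norm_smul, norm_inv, Real.norm_of_nonneg h.le]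

lemma le_norm_cubeCollar {d : ℕ} (t : unitInterval) (x : Cube d) :
    ‖(x : Fin d → ℝ)‖ ≤ ‖(cubeCollar d (t, x) : Fin d → ℝ)‖ := by
  have h : 0 < max (1 - (t : ℝ) / 2) ‖(x : Fin d → ℝ)‖ :=
    lt_max_of_lt_left (by linarith [t.2.2])
  rw [norm_cubeCollar]
  refine le_mul_of_one_le_left (norm_nonneg _) ((one_le_inv₀ h).2 ?_)
  exact max_le (by linarith [t.2.1]) x.norm_le

/-- At time 1 the divisor is max(1/2, ‖x‖), so points of norm at least 1/2 reach the boundary, and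
norms never decrease on the way. An open N is needed for excision, a closed one for the complement
of an open ball inside a cell. -/
lemma isCollar_cube {d : ℕ} {N : Set (Cube d)} (h1 : cubeBdry d ⊆ N)
    (h2 : ∀ x ∈ N, ∀ y : Cube d, ‖(x : Fin d → ℝ)‖ ≤ ‖(y : Fin d → ℝ)‖ → y ∈ N)
    (h3 : ∀ x ∈ N, 1 / 2 ≤ ‖(x : Fin d → ℝ)‖) : IsCollar (cubeCollar d) (cubeBdry d) N where
  subset := h1
  zero x := by
    refine Subtype.ext ?_
    change (max (1 - (0 : ℝ) / 2) ‖(x : Fin d → ℝ)‖)⁻¹ • (x : Fin d → ℝ) = _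
    rw [zero_div, sub_zero, max_eq_left x.norm_le, inv_one, one_smul]
  fix t x hx := by
    refine Subtype.ext ?_
    change (max (1 - (t : ℝ) / 2) ‖(x : Fin d → ℝ)‖)⁻¹ • (x : Fin d → ℝ) = _
    have hx' : ‖(x : Fin d → ℝ)‖ = 1 := hx
    rw [hx', max_eq_right (by linarith [t.2.1]), inv_one, one_smul]
  stable t x hx := h2 x hx _ (le_norm_cubeCollar t x)
  one x hx := by
    have h := h3 x hx
    change ‖(cubeCollar d (1, x) : Fin d → ℝ)‖ = 1
    rw [norm_cubeCollar, max_eq_right (by simp; linarith), inv_mul_cancel₀]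
    linarith

lemma isCollar_cube_open (d : ℕ) :
    IsCollar (cubeCollar d) (cubeBdry d) {x | 1 / 2 < ‖(x : Fin d → ℝ)‖} :=
  isCollar_cube (fun x (hx : _ = _) => by rw [Set.mem_ofPred_eq, hx]; norm_num)
    (fun _ hx _ hy => lt_of_lt_of_le hx hy) (fun _ hx => le_of_lt hx)

lemma isCollar_cube_closed (d : ℕ) :
    IsCollar (cubeCollar d) (cubeBdry d) {x | 1 / 2 ≤ ‖(x : Fin d → ℝ)‖} :=
  isCollar_cube (fun x (hx : _ = _) => by rw [Set.mem_ofPred_eq, hx]; norm_num)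
    (fun _ hx _ hy => le_trans hx hy) (fun _ hx => hx)

/-! ### The homology of a cube modulo its boundary -/

variable {X Y : Type} [TopologicalSpace X] [TopologicalSpace Y]

@[fun_prop]
lemma Cube.continuous_apply {d : ℕ} (i : Fin d) :
    Continuous fun x : Cube d => (x : Fin d → ℝ) i :=
  (_root_.continuous_apply i).comp continuous_subtype_val

lemma isZero_relC_of_incl_surjective {A : Set X}
    (h : ∀ m, Function.Surjective ((singMap (incl A)).f m)) (i : ℕ) : IsZero (relH i X A) := by
  refine HomologicalComplex.ExactAt.isZero_homology (acyclic_of_elements (relC X A) ?_ ?_ i)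
  · intro x
    obtain ⟨x, rfl⟩ := relπ_surjective A 0 x
    exact ⟨0, (map_zero _).trans ((relπ_eq_zero_iff A 0 x).2 (h 0 x)).symm⟩
  · intro m x _
    obtain ⟨x, rfl⟩ := relπ_surjective A _ x
    exact ⟨0, (map_zero _).trans ((relπ_eq_zero_iff A _ x).2 (h _ x)).symm⟩

lemma isZero_relH_univ (i : ℕ) : IsZero (relH i X Set.univ) := by
  refine isZero_relC_of_incl_surjective (fun m x => ?_) i
  refine ⟨(singMap (⟨fun x => ⟨x, trivial⟩, by fun_prop⟩ : C(X, (Set.univ : Set X)))).f m x, ?_⟩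
  have := singMap_comp (⟨fun x => ⟨x, trivial⟩, by fun_prop⟩ : C(X, (Set.univ : Set X)))
    (incl Set.univ)
  exact congrArg (fun φ : singC X ⟶ singC X => (φ.f m).hom x) (this.trans singMap_id)

/-- The part of the boundary of the cube complementary to the open face `x_0 = 1`. -/
def cubeCup (d : ℕ) : Set (Cube (d + 1)) :=
  {x | (x : Fin (d + 1) → ℝ) 0 = -1 ∨ ‖Fin.tail (x : Fin (d + 1) → ℝ)‖ = 1}

lemma norm_eq_max_tail {d : ℕ} (x : Fin (d + 1) → ℝ) : ‖x‖ = max |x 0| ‖Fin.tail x‖ := by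
  apply le_antisymm
  · refine (pi_norm_le_iff_of_nonneg (by positivity)).2 (Fin.cases ?_ fun i => ?_)
    · exact le_max_left _ _
    · exact (norm_le_pi_norm (Fin.tail x) i).trans (le_max_right _ _)
  · refine max_le (norm_le_pi_norm x 0) ?_
    exact (pi_norm_le_iff_of_nonneg (norm_nonneg _)).2 fun i => norm_le_pi_norm x i.succ

lemma abs_zero_le {d : ℕ} (x : Cube (d + 1)) : |(x : Fin (d + 1) → ℝ) 0| ≤ 1 :=
  (le_max_left _ _).trans ((norm_eq_max_tail _).symm.le.trans x.norm_le)

lemma norm_tail_le {d : ℕ} (x : Cube (d + 1)) : ‖Fin.tail (x : Fin (d + 1) → ℝ)‖ ≤ 1 :=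
  (le_max_right _ _).trans ((norm_eq_max_tail _).symm.le.trans x.norm_le)

lemma cubeCup_subset (d : ℕ) : cubeCup d ⊆ cubeBdry (d + 1) := by
  rintro x (h | h)
  · have : ‖(x : Fin (d + 1) → ℝ)‖ = 1 := by
      rw [norm_eq_max_tail, h, abs_neg, abs_one, max_eq_left (norm_tail_le x)]
    exact this
  · have : ‖(x : Fin (d + 1) → ℝ)‖ = 1 := by
      rw [norm_eq_max_tail, h, max_eq_right (abs_zero_le x)]
    exact this

/-- Sliding the first coordinate linearly to -1 deforms the cube into the cup and keeps both the
bottom face and the side faces inside the cup. -/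
lemma isZero_relH_cubeCup (d i : ℕ) : IsZero (relH i (Cube (d + 1)) (cubeCup d)) := by
  let φ : C(unitInterval × Cube (d + 1), Cube (d + 1)) :=
    ⟨fun p => ⟨Fin.cons ((1 - (p.1 : ℝ)) * (p.2 : Fin (d + 1) → ℝ) 0 - p.1)
        (Fin.tail (p.2 : Fin (d + 1) → ℝ)), by
      rw [mem_closedBall_zero_iff, norm_eq_max_tail]
      refine max_le ?_ ?_
      · rw [Fin.cons_zero]
        have h1 := abs_le.1 (abs_zero_le p.2)
        have h2 := p.1.2.1
        have h3 := p.1.2.2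
        rw [abs_le]
        constructor <;> nlinarith
      · rw [Fin.tail_cons]; exact norm_tail_le _⟩, by
      refine Continuous.subtype_mk ?_ _
      have hc : ∀ i, Continuous fun p : unitInterval × Cube (d + 1) =>
          (p.2 : Fin (d + 1) → ℝ) i := fun i => (Cube.continuous_apply i).comp continuous_snd
      refine continuous_pi (Fin.cases ?_ fun i => ?_)
      · simp only [Fin.cons_zero]
        exact ((continuous_const.sub (by fun_prop)).mul (hc 0)).sub (by fun_prop)
      · exact hc i.succ⟩
  have hφ0 : ∀ p, (φ p : Fin (d + 1) → ℝ) 0 = (1 - (p.1 : ℝ)) * (p.2 : Fin (d + 1) → ℝ) 0 - p.1 :=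
    fun p => rfl
  have hφt : ∀ p, Fin.tail (φ p : Fin (d + 1) → ℝ) = Fin.tail (p.2 : Fin (d + 1) → ℝ) :=
    fun p => rfl
  have hq : QuasiIso (relInc (Set.subset_univ (cubeCup d))) := by
    refine quasiIso_relMap_of_deformation _ (φ.comp ⟨fun p => (p.1, p.2.1), by fun_prop⟩) ?_ ?_ ?_ ?_
    · intro x
      refine Subtype.ext (funext (Fin.cases ?_ fun i => ?_))
      · refine (hφ0 _).trans ?_
        simp
      · rfl
    · intro t x; trivial
    · rintro t x (h | h)
      · left
        refine (hφ0 _).trans ?_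
        change (1 - (t : ℝ)) * (x.1 : Fin (d + 1) → ℝ) 0 - t = -1
        rw [h]; ring
      · right
        refine (congrArg norm (hφt _)).trans h
    · intro x
      left
      refine (hφ0 _).trans ?_
      simp
  exact (isZero_relH_univ i).of_iso (homologyIsoOfQuasiIso _ hq i)

/-- The inclusion of the face `x_0 = 1` of the cube. -/
def cubeFace (d : ℕ) : C(Cube d, cubeBdry (d + 1)) :=
  ⟨fun y => ⟨⟨Fin.cons 1 (y : Fin d → ℝ), by
    rw [mem_closedBall_zero_iff, norm_eq_max_tail, Fin.cons_zero, Fin.tail_cons, abs_one]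
    exact max_le le_rfl y.norm_le⟩, by
    change ‖(Fin.cons 1 (y : Fin d → ℝ) : Fin (d + 1) → ℝ)‖ = 1
    rw [norm_eq_max_tail, Fin.cons_zero, Fin.tail_cons, abs_one]
    exact max_eq_left y.norm_le⟩, by
    refine Continuous.subtype_mk (Continuous.subtype_mk ?_ _) _
    refine continuous_pi (Fin.cases ?_ fun i => ?_)
    · simp only [Fin.cons_zero]; fun_prop
    · simp only [Fin.cons_succ]; fun_prop⟩

/-- Outside the cup the boundary of the cube is the open face x_0 = 1, so the inclusion of that face
is a relative homeomorphism. -/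
lemma nonempty_relH_cubeFace_iso (d i : ℕ) :
    Nonempty (relH i (Cube d) (cubeBdry d) ≅
      relH i (cubeBdry (d + 1)) ((Subtype.val : cubeBdry (d + 1) → _) ⁻¹' cubeCup d)) := by
  have hval0 : ∀ y, ((cubeFace d y).1 : Fin (d + 1) → ℝ) 0 = 1 := fun _ => rfl
  have hvalt : ∀ y, Fin.tail ((cubeFace d y).1 : Fin (d + 1) → ℝ) = y := fun _ => rfl
  have hpre : cubeFace d ⁻¹' ((Subtype.val : cubeBdry (d + 1) → _) ⁻¹' cubeCup d) =
      cubeBdry d := by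
    ext y
    constructor
    · rintro (h | h)
      · exact absurd ((hval0 y).symm.trans h) (by norm_num)
      · exact (congrArg norm (hvalt y)).symm.trans h
    · intro h
      exact Or.inr ((congrArg norm (hvalt y)).trans h)
  have : IsClosed (cubeBdry (d + 1)) := by
    refine isClosed_eq ?_ continuous_const
    fun_prop
  have hc : CompactSpace (cubeBdry (d + 1)) := isCompact_iff_compactSpace.1 this.isCompact
  have hB : IsClosed ((Subtype.val : cubeBdry (d + 1) → _) ⁻¹' cubeCup d) := by
    refine IsClosed.preimage continuous_subtype_val ((isClosed_eq ?_ continuous_const).union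
      (isClosed_eq ?_ continuous_const))
    · fun_prop
    · simp only [Fin.tail_def]; fun_prop
  have key := nonempty_relH_iso_of_relativeHomeomorphism (cubeFace d) hB (by
      intro y _ y' _ h
      refine Subtype.ext ?_
      rw [← hvalt y, ← hvalt y', h]) (by
      rintro ⟨x, hx⟩ hxB
      replace hx : ‖(x : Fin (d + 1) → ℝ)‖ = 1 := hx
      replace hxB : ¬ ((x : Fin (d + 1) → ℝ) 0 = -1 ∨ ‖Fin.tail (x : Fin (d + 1) → ℝ)‖ = 1) := hxB
      rw [not_or] at hxB
      rw [norm_eq_max_tail] at hx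
      have h0 : |(x : Fin (d + 1) → ℝ) 0| = 1 := by
        rcases max_choice |(x : Fin (d + 1) → ℝ) 0| ‖Fin.tail (x : Fin (d + 1) → ℝ)‖ with h | h
        · rw [← h]; exact hx
        · exact (hxB.2 (h.symm.trans hx)).elim
      have h0' : (x : Fin (d + 1) → ℝ) 0 = 1 := by
        rcases (abs_eq zero_le_one).1 h0 with h | h
        · exact h
        · exact (hxB.1 h).elim
      refine ⟨⟨Fin.tail (x : Fin (d + 1) → ℝ), mem_closedBall_zero_iff.2 (norm_tail_le x)⟩, ?_⟩
      refine Subtype.ext (Subtype.ext (funext (Fin.cases ?_ fun i => rfl)))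
      exact h0'.symm)
    (H := cubeCollar d) (N := {x | 1 / 2 < ‖(x : Fin d → ℝ)‖})
    (isOpen_lt continuous_const (by fun_prop)) (by rw [hpre]; exact isCollar_cube_open d) i
  rw [hpre] at key
  exact key

lemma isZero_relH_cube_zero (d : ℕ) : IsZero (relH 0 (Cube (d + 1)) (cubeBdry (d + 1))) := by
  have hS := tripleSES_shortExact (cubeCup_subset d)
  have : Epi (HomologicalComplex.homologyMap (tripleSES (cubeCup_subset d)).g 0) := by
    have := hS.epi_g
    exact HomologicalComplex.epi_homologyMap_of_epi_of_not_rel _ _ (by simp)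
  exact @IsZero.of_epi _ _ _ _ _ _ this (isZero_relH_cubeCup d 0)

/-- This is the connecting map of the triple (cube, boundary, cup), whose terms H(cube, cup) vanish,
followed by the identification of boundary modulo cup with the face. -/
lemma nonempty_relH_cube_succ_iso (d i : ℕ) :
    Nonempty (relH (i + 1) (Cube (d + 1)) (cubeBdry (d + 1)) ≅ relH i (Cube d) (cubeBdry d)) := by
  have hS := tripleSES_shortExact (cubeCup_subset d)
  obtain ⟨e⟩ := nonempty_relH_cubeFace_iso d i
  exact ⟨hS.δIso (i + 1) i rfl (isZero_relH_cubeCup d _) (isZero_relH_cubeCup d _) ≪≫ e.symm⟩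

/-! ### Starting point of the induction: the empty subspace and the one-point space -/

lemma relH_empty_iso (A : Set X) (hA : A = ∅) (i : ℕ) : Nonempty (singH i X ≅ relH i X A) := by
  subst hA
  have hz : ∀ (m : ℕ) (x : (singC (∅ : Set X)).X m), x = 0 := by
    intro m x
    have : AddMonoidHom.id ((singC (∅ : Set X)).X m) = 0 :=
      addHom_ext_gen fun s => (s (vert m 0)).2.elim
    exact DFunLike.congr_fun this x
  have hac : (singC (∅ : Set X)).Acyclic := acyclic_of_elements _
    (fun x => ⟨0, (hz _ _).trans (hz _ _).symm⟩) (fun m x _ => ⟨0, (hz _ _).trans (hz _ _).symm⟩)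
  have hS := relSES_shortExact (∅ : Set X)
  have hq : QuasiIso (relSES (∅ : Set X)).g := by
    rw [quasiIso_iff]
    intro i
    rw [quasiIsoAt_iff_isIso_homologyMap]
    have : Mono (HomologicalComplex.homologyMap (relSES (∅ : Set X)).g i) :=
      (hS.homology_exact₂ i).mono_g ((hac i).isZero_homology.eq_of_src _ _)
    have : Epi (HomologicalComplex.homologyMap (relSES (∅ : Set X)).g i) := by
      cases i with
      | zero =>
        have := hS.epi_g
        exact HomologicalComplex.epi_homologyMap_of_epi_of_not_rel _ _ (by simp)
      | succ i =>
        exact (hS.homology_exact₃ (i + 1) i rfl).epi_f ((hac i).isZero_homology.eq_of_tgt _ _)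
    exact isIso_of_mono_of_epi _
  exact ⟨homologyIsoOfQuasiIso _ hq i⟩

lemma singH_subsingleton_zero [Nonempty X] [Subsingleton X] :
    Nonempty (singH 0 X ≅ ModuleCat.of ℤ ℤ) := by
  have : TotallyDisconnectedSpace (TopCat.of X) :=
    inferInstanceAs (TotallyDisconnectedSpace X)
  have : Unique (TopCat.of X) :=
    ⟨⟨(Classical.arbitrary X : X)⟩, fun x => Subsingleton.elim (α := X) _ _⟩
  refine ⟨AlgebraicTopology.singularHomologyFunctorZeroOfTotallyDisconnectedSpace
    (ModuleCat.{0} ℤ) (ModuleCat.of ℤ ℤ) (TopCat.of X) ≪≫ ?_⟩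
  exact coproductUniqueIso _

lemma isZero_singH_subsingleton [Subsingleton X] {i : ℕ} (hi : i ≠ 0) : IsZero (singH i X) := by
  have : TotallyDisconnectedSpace (TopCat.of X) :=
    inferInstanceAs (TotallyDisconnectedSpace X)
  exact AlgebraicTopology.isZero_singularHomologyFunctor_of_totallyDisconnectedSpace
    (ModuleCat.{0} ℤ) i (ModuleCat.of ℤ ℤ) (TopCat.of X) hi

theorem relH_cube_eq (d : ℕ) :
    Nonempty (relH d (Cube d) (cubeBdry d) ≅ ModuleCat.of ℤ ℤ) := by
  induction d with
  | zero =>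
    have h0 : cubeBdry 0 = ∅ := by
      ext x
      simp only [Set.mem_empty_iff_false, iff_false]
      intro (h : ‖(x : Fin 0 → ℝ)‖ = 1)
      rw [Subsingleton.elim (x : Fin 0 → ℝ) 0, norm_zero] at h
      exact zero_ne_one h
    obtain ⟨e⟩ := relH_empty_iso (cubeBdry 0) h0 0
    obtain ⟨e'⟩ := singH_subsingleton_zero (X := Cube 0)
    exact ⟨e.symm ≪≫ e'⟩
  | succ d ih =>
    obtain ⟨e⟩ := nonempty_relH_cube_succ_iso d d
    obtain ⟨e'⟩ := ih
    exact ⟨e ≪≫ e'⟩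

theorem isZero_relH_cube {d i : ℕ} (h : i ≠ d) : IsZero (relH i (Cube d) (cubeBdry d)) := by
  induction d generalizing i with
  | zero =>
    have h0 : cubeBdry 0 = ∅ := by
      ext x
      simp only [Set.mem_empty_iff_false, iff_false]
      intro (h : ‖(x : Fin 0 → ℝ)‖ = 1)
      rw [Subsingleton.elim (x : Fin 0 → ℝ) 0, norm_zero] at h
      exact zero_ne_one h
    obtain ⟨e⟩ := relH_empty_iso (cubeBdry 0) h0 i
    exact (isZero_singH_subsingleton h).of_iso e.symm
  | succ d ih =>
    cases i with
    | zero => exact isZero_relH_cube_zero d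
    | succ i =>
      obtain ⟨e⟩ := nonempty_relH_cube_succ_iso d i
      exact (ih (by omega)).of_iso e

/-! ### Cell structures -/

/-- The data of a (finite) cell structure on a space: characteristic maps on cubes such that every
point is in exactly one open cell and the boundary of a cell meets only cells of smaller
dimension. -/
structure CellData (X : Type) [TopologicalSpace X] (ι : Type) where
  dim : ι → ℕ
  Φ : ∀ o, C(Cube (dim o), X)
  eq_of_eq : ∀ {o o'} {x : Cube (dim o)} {x' : Cube (dim o')}, x ∉ cubeBdry _ → x' ∉ cubeBdry _ →
    Φ o x = Φ o' x' → o = o'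
  injOn : ∀ o, Set.InjOn (Φ o) (cubeBdry _)ᶜ
  cover : ∀ y, ∃ o, ∃ x ∉ cubeBdry (dim o), Φ o x = y
  bdry : ∀ o, ∀ x ∈ cubeBdry (dim o), ∃ o', dim o' < dim o ∧ ∃ x' ∉ cubeBdry (dim o'),
    Φ o' x' = Φ o x

namespace CellData

variable {X : Type} [TopologicalSpace X] {ι : Type} (D : CellData X ι)

/-- The union of the closed cells in `S`. -/
def F (S : Finset ι) : Set X := ⋃ o ∈ S, Set.range (D.Φ o)

/-- `S` contains with a cell all cells of smaller dimension. -/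
def Lower (S : Finset ι) : Prop := ∀ o ∈ S, ∀ o', D.dim o' < D.dim o → o' ∈ S

variable {D} in
lemma mem_F {S : Finset ι} {y : X} : y ∈ D.F S ↔ ∃ o ∈ S, ∃ x, D.Φ o x = y := by
  simp [F]

lemma F_mono {S T : Finset ι} (h : S ⊆ T) : D.F S ⊆ D.F T :=
  Set.biUnion_subset_biUnion_left h

lemma isClosed_F [T2Space X] (S : Finset ι) : IsClosed (D.F S) :=
  S.finite_toSet.isClosed_biUnion fun o _ => (isCompact_range (D.Φ o).continuous).isClosed

/-- A closed cell of S meets other open cells only along its boundary. Those have smaller dimension,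
hence belong to S as well. -/
lemma mem_F_iff {S : Finset ι} (hS : D.Lower S) {o : ι} {x : Cube (D.dim o)}
    (hx : x ∉ cubeBdry _) : D.Φ o x ∈ D.F S ↔ o ∈ S := by
  constructor
  · intro h
    obtain ⟨o', ho', x', hx'⟩ := mem_F.1 h
    by_cases hb : x' ∈ cubeBdry _
    · obtain ⟨o'', hlt, x'', hx'', h''⟩ := D.bdry o' x' hb
      rw [D.eq_of_eq hx hx'' (hx'.symm.trans h''.symm)]
      exact hS o' ho' o'' hlt
    · rwa [D.eq_of_eq hx hb hx'.symm]
  · intro h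
    exact mem_F.2 ⟨o, h, x, rfl⟩

lemma F_univ [Fintype ι] : D.F Finset.univ = Set.univ := by
  refine Set.eq_univ_of_forall fun y => ?_
  obtain ⟨o, x, -, h⟩ := D.cover y
  exact mem_F.2 ⟨o, Finset.mem_univ o, x, h⟩

section attach

variable [DecidableEq ι] {S : Finset ι} {o : ι}

lemma preimage_F (hS : D.Lower S) (ho : o ∉ S) (hS' : D.Lower (insert o S)) :
    D.Φ o ⁻¹' D.F S = cubeBdry _ := by
  ext x
  constructor
  · intro h
    by_contra hx
    exact ho ((D.mem_F_iff hS hx).1 h)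
  · intro h
    obtain ⟨o', hlt, x', hx', h'⟩ := D.bdry o x h
    have := hS' o (Finset.mem_insert_self _ _) o' hlt
    rcases Finset.mem_insert.1 this with rfl | h''
    · exact (lt_irrefl _ hlt).elim
    · exact mem_F.2 ⟨o', h'', x', h'⟩

lemma F_insert : D.F (insert o S) = D.F S ∪ Set.range (D.Φ o) := by
  rw [F, Finset.set_biUnion_insert, Set.union_comm]
  rfl

/-- The homology of a cell attachment. -/
lemma nonempty_relH_attach_iso [CompactSpace X] [T2Space X] (hS : D.Lower S) (ho : o ∉ S)
    (hS' : D.Lower (insert o S)) (i : ℕ) :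
    Nonempty (relH i (Cube (D.dim o)) (cubeBdry _) ≅
      relH i (D.F (insert o S)) ((Subtype.val : D.F (insert o S) → X) ⁻¹' D.F S)) := by
  let f : C(Cube (D.dim o), D.F (insert o S)) :=
    ⟨fun x => ⟨D.Φ o x, mem_F.2 ⟨o, Finset.mem_insert_self _ _, x, rfl⟩⟩, by fun_prop⟩
  have hpre : f ⁻¹' ((Subtype.val : D.F (insert o S) → X) ⁻¹' D.F S) = cubeBdry _ :=
    D.preimage_F hS ho hS'
  have : CompactSpace (D.F (insert o S)) :=
    isCompact_iff_compactSpace.1 (D.isClosed_F _).isCompact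
  have key := nonempty_relH_iso_of_relativeHomeomorphism f
    ((D.isClosed_F S).preimage continuous_subtype_val) (by
      rw [hpre]
      intro x hx x' hx' h
      exact D.injOn o hx hx' (congrArg Subtype.val h)) (by
      rintro ⟨y, hy⟩ hyS
      rw [F_insert] at hy
      rcases hy with hy | ⟨x, rfl⟩
      · exact (hyS hy).elim
      · exact ⟨x, rfl⟩)
    (H := cubeCollar _) (N := {x | 1 / 2 < ‖(x : Fin (D.dim o) → ℝ)‖})
    (isOpen_lt continuous_const (by fun_prop)) (by rw [hpre]; exact isCollar_cube_open _) i
  rw [hpre] at key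
  exact key

end attach

/-! #### The CW structure -/

open Classical in
/-- The characteristic map of a cell, extended to `ℝ^d`. -/
def extΦ (o : ι) (x : Fin (D.dim o) → ℝ) : X :=
  D.Φ o (if h : x ∈ Metric.closedBall 0 1 then ⟨x, h⟩ else ⟨0, by simp⟩)

variable {D} in
lemma extΦ_apply {o : ι} (x : Cube (D.dim o)) : D.extΦ o x = D.Φ o x := by
  rw [extΦ, dif_pos x.2]

lemma injOn_extΦ (o : ι) : Set.InjOn (D.extΦ o) (Metric.ball 0 1) := by
  intro x hx x' hx' h
  let y : Cube (D.dim o) := ⟨x, Metric.ball_subset_closedBall hx⟩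
  let y' : Cube (D.dim o) := ⟨x', Metric.ball_subset_closedBall hx'⟩
  have h' : D.Φ o y = D.Φ o y' := by rw [← extΦ_apply, ← extΦ_apply]; exact h
  exact congrArg Subtype.val (D.injOn o (ne_of_lt (mem_ball_zero_iff.1 hx))
    (ne_of_lt (mem_ball_zero_iff.1 hx')) h')

/-- The characteristic map of a cell as a partial equivalence. -/
def chart (o : ι) : PartialEquiv (Fin (D.dim o) → ℝ) X :=
  (D.injOn_extΦ o).toPartialEquiv _ _

variable {D} in
lemma chart_apply {o : ι} (x : Cube (D.dim o)) : D.chart o x = D.Φ o x := extΦ_apply x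

lemma chart_image_closedBall (o : ι) :
    D.chart o '' Metric.closedBall 0 1 = Set.range (D.Φ o) := by
  ext y
  constructor
  · rintro ⟨x, hx, rfl⟩
    exact ⟨⟨x, hx⟩, (chart_apply ⟨x, hx⟩).symm⟩
  · rintro ⟨x, rfl⟩
    exact ⟨x, x.2, chart_apply x⟩

lemma chart_image_ball (o : ι) :
    D.chart o '' Metric.ball 0 1 = D.Φ o '' (cubeBdry _)ᶜ := by
  ext y
  constructor
  · rintro ⟨x, hx, rfl⟩
    exact ⟨⟨x, Metric.ball_subset_closedBall hx⟩, ne_of_lt (mem_ball_zero_iff.1 hx),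
      (chart_apply ⟨x, Metric.ball_subset_closedBall hx⟩).symm⟩
  · rintro ⟨x, hx, rfl⟩
    exact ⟨x, mem_ball_zero_iff.2 (lt_of_le_of_ne x.norm_le hx), chart_apply x⟩

/-- The preimage of the open cell T under the characteristic map is exactly the open cube, since
boundary points lie in cells of smaller dimension. A map from a compact to a Hausdorff space that is
bijective over T is a homeomorphism over T. -/
lemma continuousOn_chart_symm [T2Space X] (o : ι) :
    ContinuousOn (D.chart o).symm (D.chart o).target := by
  set T : Set X := D.Φ o '' (cubeBdry _)ᶜ with hT
  have ht : (D.chart o).target = T := D.chart_image_ball o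
  have hpre : (D.Φ o ⁻¹' Tᶜ)ᶜ = (cubeBdry _)ᶜ := by
    ext x
    rw [Set.mem_compl_iff, Set.mem_preimage, Set.mem_compl_iff, not_not]
    constructor
    · rintro ⟨x', hx', h⟩ hx
      obtain ⟨o', hlt, x'', hx'', h'⟩ := D.bdry o x hx
      have := D.eq_of_eq hx'' hx' (h'.trans h.symm)
      exact hlt.ne (congrArg D.dim this)
    · intro hx
      exact ⟨x, hx, rfl⟩
  let e := homeomorphOverCompl (D.Φ o) (B := Tᶜ) (by rw [hpre]; exact D.injOn o)
    (by rw [compl_compl]; exact Set.image_subset_range _ _)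
  rw [ht, continuousOn_iff_continuous_domRestrict]
  have hmem : ∀ y : T, (y : X) ∈ Tᶜᶜ := fun y => by rw [compl_compl]; exact y.2
  have : T.domRestrict (D.chart o).symm = fun y : T => ((e.symm ⟨y, hmem y⟩).1 : Fin (D.dim o) → ℝ) := by
    funext y
    obtain ⟨x, hx⟩ := e.surjective ⟨y, hmem y⟩
    have hxy : D.Φ o x = y := congrArg Subtype.val hx
    have hxb : (x : Cube (D.dim o)) ∈ (cubeBdry _)ᶜ := hpre.le x.2
    rw [← hx, e.symm_apply_apply]
    change (D.chart o).symm y = _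
    rw [← hxy, ← chart_apply]
    exact (D.chart o).left_inv (mem_ball_zero_iff.2 (lt_of_le_of_ne x.1.norm_le hxb))
  rw [this]
  exact continuous_subtype_val.comp (continuous_subtype_val.comp
    (e.symm.continuous.comp (continuous_subtype_val.subtype_mk _)))

lemma continuousOn_chart (o : ι) : ContinuousOn (D.chart o) (Metric.closedBall 0 1) := by
  rw [continuousOn_iff_continuous_domRestrict]
  have : (Metric.closedBall 0 1).domRestrict (D.chart o) = D.Φ o := funext fun x => chart_apply x
  rw [this]
  exact (D.Φ o).continuous

/-- The CW structure given by a finite cell structure. -/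
@[reducible] def cwComplex [T2Space X] [Finite ι] : Topology.CWComplex (Set.univ : Set X) where
  cell d := {o : ι // D.dim o = d}
  map _ o := o.2 ▸ D.chart o.1
  source_eq := by rintro _ ⟨o, rfl⟩; rfl
  continuousOn := by rintro _ ⟨o, rfl⟩; exact D.continuousOn_chart o
  continuousOn_symm := by rintro _ ⟨o, rfl⟩; exact D.continuousOn_chart_symm o
  pairwiseDisjoint' := by
    rintro ⟨_, o, rfl⟩ - ⟨_, o', rfl⟩ - hne
    refine Set.disjoint_left.2 ?_
    change ∀ ⦃y⦄, y ∈ D.chart o '' Metric.ball 0 1 → ¬ y ∈ D.chart o' '' Metric.ball 0 1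
    rw [chart_image_ball, chart_image_ball]
    rintro _ ⟨x, hx, rfl⟩ ⟨x', hx', h⟩
    obtain rfl := D.eq_of_eq hx' hx h
    exact hne rfl
  mapsTo' := by
    classical
    rintro _ ⟨o, rfl⟩
    have : Fintype ι := Fintype.ofFinite ι
    -- There are finitely many cells in all, so no selection is needed for closure finiteness;
    -- `bdry` supplies a cell of smaller dimension.
    refine ⟨fun m => Finset.univ, fun x hx => ?_⟩
    have hx' : ‖x‖ = 1 := by simpa using hx
    obtain ⟨o', hlt, x', -, h⟩ := D.bdry o ⟨x, mem_closedBall_zero_iff.2 hx'.le⟩ hx'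
    simp only [Set.mem_iUnion]
    refine ⟨D.dim o', hlt, ⟨o', rfl⟩, Finset.mem_univ _, ?_⟩
    change D.chart o x ∈ D.chart o' '' Metric.closedBall 0 1
    rw [chart_image_closedBall]
    exact ⟨x', h.trans (chart_apply ⟨x, mem_closedBall_zero_iff.2 hx'.le⟩).symm⟩
  closed' A _ hA := by
    have : A = ⋃ o, A ∩ D.chart o '' Metric.closedBall 0 1 := by
      rw [← Set.inter_iUnion, Set.left_eq_inter]
      intro y _
      obtain ⟨o, x, -, h⟩ := D.cover y
      refine Set.mem_iUnion.2 ⟨o, ?_⟩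
      rw [chart_image_closedBall]
      exact ⟨x, h⟩
    rw [this]
    exact isClosed_iUnion_of_finite fun o => hA _ ⟨o, rfl⟩
  union' := by
    refine Set.eq_univ_of_forall fun y => ?_
    obtain ⟨o, x, -, h⟩ := D.cover y
    simp only [Set.mem_iUnion]
    refine ⟨D.dim o, ⟨o, rfl⟩, ?_⟩
    change y ∈ D.chart o '' Metric.closedBall 0 1
    rw [chart_image_closedBall]
    exact ⟨x, h⟩

/-! #### The homology -/

open Module

lemma exists_minimal_notMem [Fintype ι] {S : Finset ι} (hne : S ≠ Finset.univ) :
    ∃ o, o ∉ S ∧ ∀ o' ∉ S, D.dim o ≤ D.dim o' := by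
  classical
  have : (Finset.univ \ S).Nonempty := by
    rw [Finset.sdiff_nonempty]
    exact fun h => hne (Finset.univ_subset_iff.1 h)
  obtain ⟨o, ho, hmin⟩ := Finset.exists_min_image _ D.dim this
  refine ⟨o, (Finset.mem_sdiff.1 ho).2, fun o' ho' => hmin o' ?_⟩
  exact Finset.mem_sdiff.2 ⟨Finset.mem_univ _, ho'⟩

lemma lower_insert [DecidableEq ι] {S : Finset ι} (hS : D.Lower S) {o : ι}
    (hmin : ∀ o' ∉ S, D.dim o ≤ D.dim o') : D.Lower (insert o S) := by
  intro a ha b hb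
  rcases Finset.mem_insert.1 ha with rfl | ha
  · refine Finset.mem_insert_of_mem ?_
    by_contra h
    exact absurd (hmin b h) (not_le.2 hb)
  · exact Finset.mem_insert_of_mem (hS a ha b hb)

variable [CompactSpace X] [T2Space X]

lemma isZero_relH_attach [DecidableEq ι] {S : Finset ι} {o : ι} (hS : D.Lower S) (ho : o ∉ S)
    (hS' : D.Lower (insert o S)) {i : ℕ} (hi : i ≠ D.dim o) :
    IsZero (relH i (D.F (insert o S)) ((Subtype.val : D.F (insert o S) → X) ⁻¹' D.F S)) := by
  obtain ⟨e⟩ := D.nonempty_relH_attach_iso hS ho hS' i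
  exact (isZero_relH_cube hi).of_iso e.symm

/-- The obstruction lies in the homology of one attached cell in degree i - 1. That degree is even
and the dimension of the cell is odd. -/
lemma epi_relInc_insert [DecidableEq ι] {S : Finset ι} {o : ι} (hS : D.Lower S) (ho : o ∉ S)
    (hS' : D.Lower (insert o S)) (hodd : Odd (D.dim o)) {i : ℕ} (hi : Odd i) :
    Epi (HomologicalComplex.homologyMap (relInc (D.F_mono (Finset.subset_insert o S))) i) := by
  obtain ⟨k, rfl⟩ := hi
  have hT := tripleSES_shortExact (D.F_mono (Finset.subset_insert o S))
  refine (hT.homology_exact₃ (2 * k + 1) (2 * k) rfl).epi_f ?_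
  refine (D.isZero_relH_attach hS ho hS' ?_).eq_of_tgt _ _
  intro h
  rw [← h] at hodd
  exact (Nat.not_odd_iff_even.2 (even_two_mul k)) hodd

/-- Induction on the number of cells outside S, through the triple F S ⊆ F(S ∪ {o}) ⊆ X. Both outer
terms vanish in even degrees, so in odd degrees the sequence is short exact with free outer terms;
no boundary coefficient has to be computed. -/
lemma nonempty_basis_relH [Fintype ι] [DecidableEq ι] : ∀ (c : ℕ) (S : Finset ι), Sᶜ.card = c →
    D.Lower S → (∀ o ∉ S, Odd (D.dim o)) → ∀ i : ℕ,
      Nonempty (Basis {o // o ∉ S ∧ D.dim o = i} ℤ (relH i X (D.F S))) := by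
  intro c
  induction c with
  | zero =>
    intro S hc hS hodd i
    have hu : S = Finset.univ := by
      rw [Finset.card_eq_zero] at hc
      rwa [Finset.compl_eq_empty_iff] at hc
    subst hu
    have h0 : IsZero (relH i X (D.F Finset.univ)) := by rw [D.F_univ]; exact isZero_relH_univ i
    have : IsEmpty {o // o ∉ Finset.univ ∧ D.dim o = i} := ⟨fun o => o.2.1 (Finset.mem_univ _)⟩
    have : Subsingleton (relH i X (D.F Finset.univ)) := ModuleCat.subsingleton_of_isZero h0
    exact ⟨Basis.empty _⟩
  | succ c ih =>
    intro S hc hS hodd i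
    have hne : S ≠ Finset.univ := by
      rintro rfl; simp at hc
    -- The least dimension outside S keeps the enlarged set closed under passing to cells of smaller
    -- dimension.
    obtain ⟨o, ho, hmin⟩ := D.exists_minimal_notMem hne
    have hS' := D.lower_insert hS hmin
    have hc' : (insert o S)ᶜ.card = c := by
      rw [Finset.card_compl, Finset.card_insert_of_notMem ho]
      rw [Finset.card_compl] at hc
      omega
    have ih' := ih (insert o S) hc' hS' (fun a ha => hodd a (fun h => ha (Finset.mem_insert_of_mem h)))
    have hT := tripleSES_shortExact (D.F_mono (Finset.subset_insert o S))
    have hempty : ∀ {T : Finset ι}, (∀ o ∉ T, Odd (D.dim o)) → ∀ k,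
        IsEmpty {o // o ∉ T ∧ D.dim o = 2 * k} := fun hT k => ⟨fun a =>
      (Nat.not_odd_iff_even.2 (even_two_mul k)) (a.2.2 ▸ hT a.1 a.2.1)⟩
    have hodd' : ∀ a ∉ insert o S, Odd (D.dim a) :=
      fun a ha => hodd a (fun h => ha (Finset.mem_insert_of_mem h))
    have heven : ∀ k, IsZero (relH (2 * k) X (D.F (insert o S))) := fun k => by
      obtain ⟨b⟩ := ih' (2 * k)
      have := hempty hodd' k
      have := b.repr.toEquiv.subsingleton
      exact ModuleCat.isZero_of_subsingleton _
    have hoddne : ∀ k, 2 * k ≠ D.dim o := fun k h =>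
      (Nat.not_odd_iff_even.2 (even_two_mul k)) (h ▸ hodd o ho)
    rcases Nat.even_or_odd' i with ⟨k, rfl | rfl⟩
    · have hz : IsZero (relH (2 * k) X (D.F S)) :=
        (hT.homology_exact₂ (2 * k)).isZero_X₂
          ((D.isZero_relH_attach hS ho hS' (hoddne k)).eq_of_src _ _) ((heven k).eq_of_tgt _ _)
      have := hempty hodd k
      have : Subsingleton (relH (2 * k) X (D.F S)) := ModuleCat.subsingleton_of_isZero hz
      exact ⟨Basis.empty _⟩
    · obtain ⟨b₃⟩ := ih' (2 * k + 1)
      obtain ⟨e⟩ := D.nonempty_relH_attach_iso hS ho hS' (2 * k + 1)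
      have hb₁ : Nonempty (Basis {_u : Unit // D.dim o = 2 * k + 1} ℤ
          (relH (2 * k + 1) (D.F (insert o S))
            ((Subtype.val : D.F (insert o S) → X) ⁻¹' D.F S))) := by
        by_cases hk : D.dim o = 2 * k + 1
        · obtain ⟨e'⟩ := relH_cube_eq (D.dim o)
          rw [hk] at e'
          have e'' : relH (2 * k + 1) (Cube (D.dim o)) (cubeBdry (D.dim o)) ≅ ModuleCat.of ℤ ℤ := by
            rw [hk]; exact e'
          have : Unique {_u : Unit // D.dim o = 2 * k + 1} :=
            ⟨⟨⟨(), hk⟩⟩, fun _ => rfl⟩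
          exact ⟨(Basis.singleton _ ℤ).map (e''.symm ≪≫ e).toLinearEquiv⟩
        · have : IsEmpty {_u : Unit // D.dim o = 2 * k + 1} := ⟨fun u => hk u.2⟩
          have : Subsingleton (relH (2 * k + 1) (D.F (insert o S))
            ((Subtype.val : D.F (insert o S) → X) ⁻¹' D.F S)) :=
            ModuleCat.subsingleton_of_isZero (D.isZero_relH_attach hS ho hS' (Ne.symm hk))
          exact ⟨Basis.empty _⟩
      obtain ⟨b₁⟩ := hb₁
      let R : ShortComplex (ModuleCat.{0} ℤ) := ShortComplex.mk
        (HomologicalComplex.homologyMap (tripleSES (D.F_mono (Finset.subset_insert o S))).f (2 * k + 1))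
        (HomologicalComplex.homologyMap (tripleSES (D.F_mono (Finset.subset_insert o S))).g (2 * k + 1))
        (by rw [← HomologicalComplex.homologyMap_comp, ShortComplex.zero,
          HomologicalComplex.homologyMap_zero])
      have hR : R.ShortExact :=
        { exact := hT.homology_exact₂ (2 * k + 1)
          mono_f := (hT.homology_exact₁ (2 * k + 2) (2 * k + 1) rfl).mono_g
            ((heven (k + 1)).eq_of_src _ _)
          epi_g := D.epi_relInc_insert hS ho hS' (hodd o ho) ⟨k, rfl⟩ }
      have b := ModuleCat.Basis.ofShortExact hR b₁ b₃
      refine ⟨b.reindex ?_⟩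
      refine
        { toFun := Sum.elim (fun u => ⟨o, ho, u.2⟩)
            (fun a => ⟨a.1, fun h => a.2.1 (Finset.mem_insert_of_mem h), a.2.2⟩)
          invFun := fun a => if h : a.1 = o then Sum.inl ⟨(), by rw [← h]; exact a.2.2⟩ else
            Sum.inr ⟨a.1, by simp [h, a.2.1], a.2.2⟩
          left_inv := ?_
          right_inv := ?_ }
      · rintro (u | a)
        · simp
        · have : a.1 ≠ o := fun h => a.2.1 (by rw [h]; exact Finset.mem_insert_self _ _)
          simp [this]
      · rintro ⟨a, ha⟩
        by_cases h : a = o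
        · subst h; simp
        · simp [h]

/-- Cells are moved from outside S into S one by one until T is exhausted. As all cells of T have
smaller dimension than those outside T, a cell of least dimension outside S is in T while S ≠ T. -/
lemma epi_relInc_top [Fintype ι] [DecidableEq ι] {T : Finset ι} (hT : D.Lower T) {i : ℕ}
    (hi : Odd i) : ∀ (c : ℕ) (S : Finset ι) (h : S ⊆ T), (T \ S).card = c →
    D.Lower S → (∀ o ∉ S, Odd (D.dim o)) → (∀ o ∈ T, ∀ o' ∉ T, D.dim o < D.dim o') →
      Epi (HomologicalComplex.homologyMap (relInc (D.F_mono h)) i) := by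
  intro c
  induction c with
  | zero =>
    intro S h hc hS hodd _
    have : S = T := by
      rw [Finset.card_eq_zero, Finset.sdiff_eq_empty_iff_subset] at hc
      exact h.antisymm hc
    subst this
    have : relInc (D.F_mono h) = 𝟙 _ := relMap_id _
    rw [this, HomologicalComplex.homologyMap_id]
    infer_instance
  | succ c ih =>
    intro S h hc hS hodd htop
    have hne : S ≠ Finset.univ := by
      rintro rfl
      have : T \ Finset.univ = ∅ := by simp
      rw [this] at hc; simp at hc
    obtain ⟨o, ho, hmin⟩ := D.exists_minimal_notMem hne
    have hS' := D.lower_insert hS hmin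
    have hoT : o ∈ T := by
      have hpos : (T \ S).Nonempty := by rw [← Finset.card_pos, hc]; omega
      obtain ⟨a, ha⟩ := hpos
      rw [Finset.mem_sdiff] at ha
      by_contra hoT
      exact absurd (hmin a ha.2) (not_le.2 (htop a ha.1 o hoT))
    have h' : insert o S ⊆ T := Finset.insert_subset hoT h
    have hc' : (T \ insert o S).card = c := by
      rw [Finset.card_sdiff_of_subset h', Finset.card_insert_of_notMem ho]
      rw [Finset.card_sdiff_of_subset h] at hc
      omega
    have e1 := D.epi_relInc_insert hS ho hS' (hodd o ho) hi
    have e2 := ih (insert o S) h' hc' hS'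
      (fun a ha => hodd a (fun h => ha (Finset.mem_insert_of_mem h))) htop
    have : relInc (D.F_mono h) =
        relInc (D.F_mono (Finset.subset_insert o S)) ≫ relInc (D.F_mono h') := by
      rw [relInc, relInc, relInc, relMap_comp]
      rfl
    rw [this, HomologicalComplex.homologyMap_comp]
    exact epi_comp _ _

end CellData

/-! ### The complex model of `W` -/

/-- The three groups of coordinates: those below, at and above the place `n / 2`. -/
def grp (n : ℕ) (l : Fin (n + 1)) : Fin 3 :=
  if (l : ℕ) < n / 2 then 0 else if (l : ℕ) = n / 2 then 1 else 2

lemma grp_eq_zero {n : ℕ} {l : Fin (n + 1)} : grp n l = 0 ↔ (l : ℕ) < n / 2 := by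
  unfold grp
  split_ifs <;> simp_all

lemma grp_eq_one {n : ℕ} {l : Fin (n + 1)} : grp n l = 1 ↔ (l : ℕ) = n / 2 := by
  unfold grp
  split_ifs <;> simp <;> omega

lemma grp_eq_two {n : ℕ} {l : Fin (n + 1)} : grp n l = 2 ↔ n / 2 < (l : ℕ) := by
  unfold grp
  split_ifs <;> simp <;> omega

/-- The sum of the coordinates in a group. -/
def grpSum (n : ℕ) (x : Fin (n + 1) → ℝ) (g : Fin 3) : ℝ := ∑ l with grp n l = g, x l

lemma sum_grpSum (n : ℕ) (x : Fin (n + 1) → ℝ) : ∑ g, grpSum n x g = ∑ l, x l := by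
  unfold grpSum
  exact Finset.sum_fiberwise _ _ _

lemma grpSum_add (n : ℕ) (x : Fin (n + 1) → ℝ) :
    grpSum n x 0 + grpSum n x 1 + grpSum n x 2 = ∑ l, x l := by
  rw [← sum_grpSum, Fin.sum_univ_three]

lemma upperSum_eq (n : ℕ) (x : Fin (n + 1) → ℝ) :
    upperSum n x = ∑ l, x l - grpSum n x 0 := by
  unfold upperSum grpSum
  rw [eq_sub_iff_add_eq, ← Finset.sum_filter_add_sum_filter_not Finset.univ
    (fun j : Fin (n + 1) => n / 2 ≤ (j : ℕ)) x]
  congr 2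
  ext l
  simp [grp_eq_zero]

lemma lowerSum_eq (n : ℕ) (x : Fin (n + 1) → ℝ) :
    lowerSum n x = ∑ l, x l - grpSum n x 2 := by
  unfold lowerSum grpSum
  rw [eq_sub_iff_add_eq, ← Finset.sum_filter_add_sum_filter_not Finset.univ
    (fun j : Fin (n + 1) => (j : ℕ) ≤ n / 2) x]
  congr 2
  ext l
  simp [grp_eq_two]

lemma midCoord_eq (n : ℕ) (x : Fin (n + 1) → ℝ) : midCoord n x = grpSum n x 1 := by
  unfold midCoord grpSum
  rw [Finset.sum_eq_single_of_mem (⟨n / 2, by omega⟩ : Fin (n + 1)) (by simp [grp_eq_one])]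
  intro b hb hne
  rw [Finset.mem_filter, grp_eq_one] at hb
  exact absurd (Fin.ext hb.2) hne

lemma mem_deltaQ_iff {n : ℕ} {r : ℝ} {x : Fin (n + 1) → ℝ} :
    x ∈ DeltaQ n r ↔ (∀ l, 0 ≤ x l) ∧ ∑ l, x l = 1 ∧ ∀ g, grpSum n x g ≤ 1 - r := by
  unfold DeltaQ Simplex
  rw [Set.mem_ofPred_eq, Set.mem_ofPred_eq, upperSum_eq, lowerSum_eq, midCoord_eq]
  constructor
  · rintro ⟨⟨h0, h1⟩, h2, h3, h4⟩
    rw [h1] at h2 h3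
    refine ⟨h0, h1, fun g => ?_⟩
    fin_cases g
    · change grpSum n x 0 ≤ _; linarith
    · exact h4
    · change grpSum n x 2 ≤ _; linarith
  · rintro ⟨h0, h1, h2⟩
    have := h2 0
    have := h2 2
    rw [h1]
    exact ⟨⟨h0, rfl⟩, by linarith, by linarith, h2 1⟩

lemma mem_facets_iff {n : ℕ} {r : ℝ} {x : Fin (n + 1) → ℝ} (hx : x ∈ DeltaQ n r) :
    x ∈ P1 n r ∪ P2 n r ∪ P3 n r ↔ ∃ g, grpSum n x g = 1 - r := by
  have h1 := hx.1.2
  have hs := hx.1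
  simp only [P1, P2, P3, Set.mem_union, Set.mem_ofPred_eq, hs, true_and, upperSum_eq, lowerSum_eq,
    midCoord_eq, h1]
  constructor
  · rintro ((h | h) | h)
    · exact ⟨0, by linarith⟩
    · exact ⟨2, by linarith⟩
    · exact ⟨1, h⟩
  · rintro ⟨g, hg⟩
    fin_cases g
    · exact Or.inl (Or.inl (by change grpSum n x 0 = _ at hg; linarith))
    · exact Or.inr hg
    · exact Or.inl (Or.inr (by change grpSum n x 2 = _ at hg; linarith))

/-- The character by which the two-dimensional torus acts on the coordinates of a group. -/
def chi (n : ℕ) (l : Fin (n + 1)) : Circle × Circle →* Circle where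
  toFun t := (![t.1, (t.1 * t.2)⁻¹, t.2] : Fin 3 → Circle) (grp n l)
  map_one' := by
    generalize grp n l = g
    fin_cases g <;> simp
  map_mul' s t := by
    generalize grp n l = g
    fin_cases g
    · simp
    · simp [mul_comm, mul_assoc, mul_left_comm]
    · simp

lemma chi_eq {n : ℕ} {l l' : Fin (n + 1)} (h : grp n l = grp n l') (t : Circle × Circle) :
    chi n l t = chi n l' t := by
  simp [chi, h]

lemma chi_mul_mul {n : ℕ} {i k l : Fin (n + 1)} (h1 : grp n i ≠ grp n k) (h2 : grp n l ≠ grp n i)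
    (h3 : grp n l ≠ grp n k) (t : Circle × Circle) : chi n i t * chi n k t * chi n l t = 1 := by
  simp only [chi, MonoidHom.coe_mk, OneHom.coe_mk]
  generalize grp n i = a at *
  generalize grp n k = b at *
  generalize grp n l = c at *
  obtain ⟨u, v⟩ := t
  fin_cases a <;> fin_cases b <;> simp at h1 <;> fin_cases c <;> simp at h2 h3 <;>
    apply Subtype.ext <;> simp [-mul_inv_rev] <;> field_simp

/-- Any two of the characters u, (uv)⁻¹, v are coordinates on the two-torus. Hence the phases at two
places in different groups can be prescribed at once. -/
lemma exists_chi_eq {n : ℕ} {i k : Fin (n + 1)} (h : grp n i ≠ grp n k) (a b : Circle) :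
    ∃ t, chi n i t = a ∧ chi n k t = b := by
  simp only [chi, MonoidHom.coe_mk, OneHom.coe_mk]
  generalize grp n i = g at *
  generalize grp n k = g' at *
  fin_cases g <;> fin_cases g' <;> simp at h
  · exact ⟨(a, (a * b)⁻¹), by simp⟩
  · exact ⟨(a, b), by simp⟩
  · exact ⟨(b, (a * b)⁻¹), by simp [mul_comm]⟩
  · exact ⟨((a * b)⁻¹, b), by simp [mul_comm]⟩
  · exact ⟨(b, a), by simp⟩
  · exact ⟨((a * b)⁻¹, a), by simp [mul_comm]⟩

lemma continuous_chi (n : ℕ) (l : Fin (n + 1)) : Continuous (chi n l) := by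
  change Continuous fun t : Circle × Circle => (![t.1, (t.1 * t.2)⁻¹, t.2] : Fin 3 → Circle) (grp n l)
  generalize grp n l = g
  fin_cases g
  · exact continuous_fst
  · change Continuous fun t : Circle × Circle => (t.1 * t.2)⁻¹
    fun_prop
  · exact continuous_snd

/-! #### The torus `𝕋^(n-1)` as a quotient of `𝕋^(n+1)` -/

/-- The quotient map `𝕋^(n+1) → 𝕋^(n-1)`. -/
def psi (n : ℕ) : (Fin (n + 1) → Circle) →* Torus n where
  toFun s i :=
    if (i : ℕ) + 1 < n / 2 then s (Fin.ofNat (n + 1) (n / 2 + 1)) / s (Fin.ofNat (n + 1) (n - i))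
    else if (i : ℕ) + 1 = n / 2 then
      s (Fin.ofNat (n + 1) (n / 2 + 1)) * s (Fin.ofNat (n + 1) (n / 2)) * s 0
    else s 0 / s (Fin.ofNat (n + 1) (n - 1 - i))
  map_one' := by
    funext i
    split_ifs <;> simp
  map_mul' s t := by
    funext i
    simp only [Pi.mul_apply]
    split_ifs
    · rw [mul_div_mul_comm]
    · ac_rfl
    · rw [mul_div_mul_comm]

/-- A section of `psi`. -/
def sigma (n : ℕ) : Torus n →* (Fin (n + 1) → Circle) where
  toFun t l :=
    if (l : ℕ) = 0 then 1 else if (l : ℕ) = n / 2 + 1 then 1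
    else if (l : ℕ) = n / 2 then (if h : n / 2 - 1 < n - 1 then t ⟨n / 2 - 1, h⟩ else 1)
    else if (l : ℕ) < n / 2 then (if h : n - l - 1 < n - 1 then (t ⟨n - l - 1, h⟩)⁻¹ else 1)
    else (if h : n - l < n - 1 then (t ⟨n - l, h⟩)⁻¹ else 1)
  map_one' := by
    funext i
    split_ifs <;> simp
  map_mul' s t := by
    funext i
    simp only [Pi.mul_apply]
    split_ifs <;> simp [mul_comm]

lemma continuous_sigma (n : ℕ) : Continuous (sigma n) := by
  refine continuous_pi fun l => ?_
  change Continuous fun t : Torus n => if (l : ℕ) = 0 then 1 else if (l : ℕ) = n / 2 + 1 then 1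
    else if (l : ℕ) = n / 2 then (if h : n / 2 - 1 < n - 1 then t ⟨n / 2 - 1, h⟩ else 1)
    else if (l : ℕ) < n / 2 then (if h : n - l - 1 < n - 1 then (t ⟨n - l - 1, h⟩)⁻¹ else 1)
    else (if h : n - l < n - 1 then (t ⟨n - l, h⟩)⁻¹ else 1)
  split_ifs <;> fun_prop

lemma psi_sigma {n : ℕ} (hn : Even n) (hn2 : 2 ≤ n) (t : Torus n) : psi n (sigma n t) = t := by
  obtain ⟨m, rfl⟩ := hn
  funext i
  have hi := i.2
  have e1 : ∀ a, a < m + m + 1 → ((Fin.ofNat (m + m + 1) a : Fin (m + m + 1)) : ℕ) = a :=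
    fun a ha => Nat.mod_eq_of_lt ha
  have hm : (m + m) / 2 = m := by omega
  have h1 : ∀ l : Fin (m + m + 1), sigma (m + m) t l = if (l : ℕ) = 0 then 1 else
    if (l : ℕ) = m + 1 then 1
    else if (l : ℕ) = m then (if h : m - 1 < m + m - 1 then t ⟨m - 1, h⟩ else 1)
    else if (l : ℕ) < m then
      (if h : m + m - l - 1 < m + m - 1 then (t ⟨m + m - l - 1, h⟩)⁻¹ else 1)
    else (if h : m + m - l < m + m - 1 then (t ⟨m + m - l, h⟩)⁻¹ else 1) := by
    intro l
    simp only [sigma, MonoidHom.coe_mk, OneHom.coe_mk, hm]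
  have h2 : ∀ (a : ℕ) (ha : a < m + m - 1), a = i → t ⟨a, ha⟩ = t i := by
    rintro a ha rfl; rfl
  simp only [psi, MonoidHom.coe_mk, OneHom.coe_mk, hm]
  have s0 : sigma (m + m) t 0 = 1 := by rw [h1]; rfl
  have s1 : sigma (m + m) t (Fin.ofNat _ (m + 1)) = 1 := by
    rw [h1, e1 _ (by omega), if_neg (by omega), if_pos rfl]
  rw [s0, s1]
  split_ifs with h3 h4
  · rw [h1, e1 _ (by omega), if_neg (by omega), if_neg (by omega), if_neg (by omega),
      if_neg (by omega), dif_pos (by omega), h2 _ _ (by omega), one_div, inv_inv]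
  · rw [h1, e1 _ (by omega), if_neg (by omega), if_neg (by omega), if_pos rfl,
      dif_pos (by omega), h2 _ _ (by omega), mul_one, one_mul]
  · rw [h1, e1 _ (by omega), if_neg (by omega), if_neg (by omega), if_neg (by omega),
      if_pos (by omega), dif_pos (by omega), h2 _ _ (by omega), one_div, inv_inv]

/-- The equations psi s = 1 force all entries of the first group to equal s_0, all entries of the
last group to equal s_(n/2+1), and the product of these two with s_(n/2) to be 1. -/
lemma psi_eq_one_iff {n : ℕ} (hn : Even n) (hn2 : 2 ≤ n) (s : Fin (n + 1) → Circle) :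
    psi n s = 1 ↔ ∃ t, s = fun l => chi n l t := by
  obtain ⟨m, rfl⟩ := hn
  have e1 : ∀ a, a < m + m + 1 → ((Fin.ofNat (m + m + 1) a : Fin (m + m + 1)) : ℕ) = a :=
    fun a ha => Nat.mod_eq_of_lt ha
  have hm : (m + m) / 2 = m := by omega
  constructor
  · intro h
    have h := fun i => congrFun h i
    simp only [psi, MonoidHom.coe_mk, OneHom.coe_mk, hm, Pi.one_apply] at h
    refine ⟨(s 0, s (Fin.ofNat _ (m + 1))), funext fun l => ?_⟩
    simp only [chi, grp, MonoidHom.coe_mk, OneHom.coe_mk, hm]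
    have hl := l.2
    split_ifs with h1 h2
    · by_cases h0 : l = 0
      · simp [h0]
      · have h0' : (l : ℕ) ≠ 0 := fun h => h0 (Fin.ext h)
        have := h ⟨m + m - 1 - l, by omega⟩
        rw [if_neg (by simp; omega), if_neg (by simp; omega), div_eq_one] at this
        simp only [Matrix.cons_val_zero]
        rw [this]
        congr 1
        apply Fin.ext
        rw [e1 _ (by omega)]
        simp; omega
    · have := h ⟨m - 1, by omega⟩
      rw [if_neg (by simp; omega), if_pos (by simp; omega)] at this
      have e : l = Fin.ofNat _ m := Fin.ext (by rw [e1 _ (by omega), h2])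
      rw [e]
      simp only [Matrix.cons_val_one, Matrix.cons_val_zero]
      rw [eq_inv_iff_mul_eq_one, ← this]
      ac_rfl
    · by_cases h0 : (l : ℕ) = m + 1
      · have e : l = Fin.ofNat _ (m + 1) := Fin.ext (by rw [e1 _ (by omega), h0])
        rw [e]
        rfl
      · have := h ⟨m + m - l, by omega⟩
        rw [if_pos (by simp; omega), div_eq_one] at this
        simp only [Matrix.cons_val]
        rw [this]
        congr 1
        apply Fin.ext
        rw [e1 _ (by omega)]
        simp; omega
  · rintro ⟨t, rfl⟩
    funext i
    have hi := i.2
    simp only [psi, MonoidHom.coe_mk, OneHom.coe_mk, hm, Pi.one_apply]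
    split_ifs with h1 h2
    · rw [div_eq_one]
      apply chi_eq
      simp only [grp, hm]
      rw [e1 _ (by omega), e1 _ (by omega), if_neg (by omega), if_neg (by omega), if_neg (by omega),
        if_neg (by omega)]
    · rw [mul_assoc, mul_comm, mul_comm (chi _ _ _)]
      have g0 : grp (m + m) 0 = 0 := grp_eq_zero.2 (by simp; omega)
      have g1 : grp (m + m) (Fin.ofNat _ m) = 1 := grp_eq_one.2 (by rw [e1 _ (by omega), hm])
      have g2 : grp (m + m) (Fin.ofNat _ (m + 1)) = 2 :=
        grp_eq_two.2 (by rw [e1 _ (by omega), hm]; omega)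
      rw [mul_right_comm]
      apply chi_mul_mul <;> simp only [g0, g1, g2] <;> decide
    · rw [div_eq_one]
      apply chi_eq
      simp only [grp, hm]
      rw [e1 _ (by omega), if_pos (by simp; omega), if_pos (by omega)]

/-- The l-th circle goes to the circle of η(Δ_l). The possible inversion is harmless, because only
the subgroup traced out by the circle enters the definition of W. -/
lemma psi_mulSingle {n : ℕ} (hn : Even n) (hn2 : 2 ≤ n) (l : Fin (n + 1)) (u : Circle) :
    psi n (Pi.mulSingle l u) = oneParam n (etaFacet n l)
      (if (l : ℕ) = 0 ∨ (l : ℕ) = n / 2 ∨ (l : ℕ) = n / 2 + 1 then u else u⁻¹) := by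
  obtain ⟨m, rfl⟩ := hn
  funext i
  have hi := i.2
  have hl := l.2
  have e1 : ∀ a, a < m + m + 1 → ((Fin.ofNat (m + m + 1) a : Fin (m + m + 1)) : ℕ) = a :=
    fun a ha => Nat.mod_eq_of_lt ha
  have hm : (m + m) / 2 = m := by omega
  have e2 : ∀ a, a < m + m + 1 → (Pi.mulSingle l u : Fin (m + m + 1) → Circle)
      (Fin.ofNat _ a) = if a = l then u else 1 := by
    intro a ha
    rw [Pi.mulSingle_apply]
    congr 1
    rw [Fin.ext_iff, e1 a ha]
  have e3 : (Pi.mulSingle l u : Fin (m + m + 1) → Circle) 0 = if 0 = (l : ℕ) then u else 1 := by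
    rw [Pi.mulSingle_apply]
    congr 1
    rw [Fin.ext_iff, Fin.val_zero]
  simp only [psi, oneParam, etaFacet, eta, MonoidHom.coe_mk, OneHom.coe_mk, hm]
  rw [e2 (m + 1) (by omega), e2 m (by omega), e2 (m + m - i) (by omega),
    e2 (m + m - 1 - i) (by omega), e3]
  generalize (i : ℕ) = i at *
  generalize (l : ℕ) = l at *
  clear e1 e2 e3
  have h0 : l = 0 ∨ (0 < l ∧ l < m) ∨ l = m ∨ l = m + 1 ∨ m + 1 < l := by omega
  have h1 : i + 1 < m ∨ i + 1 = m ∨ m < i + 1 := by omega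
  -- Five positions of l (0, inside the first group, n/2, n/2 + 1, beyond) against three positions
  -- of the output coordinate relative to n/2.
  rcases h0 with h0 | h0 | h0 | h0 | h0 <;> rcases h1 with h1 | h1 | h1 <;>
    simp (disch := omega) only [if_pos, if_neg] <;> simp
  all_goals split_ifs <;> first | omega | simp

/-- The standing assumptions on the parameters. -/
class Params (n : ℕ) (r : ℝ) : Prop where
  even : Even n
  two_le : 2 ≤ n
  pos : 0 < r
  lt : r < 1 / 4

/-- The face torus is the image of the coordinate subtorus of 𝕋^(n+1) belonging to the zeros of p,
because `psi` carries each coordinate circle to the circle of the corresponding facet vector. -/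
lemma mem_faceTorus_iff {n : ℕ} (hn : Even n) (hn2 : 2 ≤ n) {p : Fin (n + 1) → ℝ} {t : Torus n} :
    t ∈ faceTorus n p ↔ ∃ s : Fin (n + 1) → Circle, (∀ l, p l ≠ 0 → s l = 1) ∧ psi n s = t := by
  constructor
  · intro h
    let K : Subgroup (Fin (n + 1) → Circle) :=
      { carrier := {s | ∀ l, p l ≠ 0 → s l = 1}
        mul_mem' := fun ha hb l hl => by rw [Pi.mul_apply, ha l hl, hb l hl, mul_one]
        one_mem' := fun l _ => rfl
        inv_mem' := fun ha l hl => by rw [Pi.inv_apply, ha l hl, inv_one] }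
    have hle : faceTorus n p ≤ K.map (psi n) := by
      refine iSup₂_le fun l hl => ?_
      rintro _ ⟨u, rfl⟩
      refine ⟨Pi.mulSingle l (if (l : ℕ) = 0 ∨ (l : ℕ) = n / 2 ∨ (l : ℕ) = n / 2 + 1 then u
        else u⁻¹), ?_, ?_⟩
      · intro l' hl'
        exact Pi.mulSingle_eq_of_ne (by rintro rfl; exact hl' hl) _
      · rw [psi_mulSingle hn hn2]
        split_ifs <;> simp
    exact hle h
  · rintro ⟨s, hs, rfl⟩
    rw [← Finset.univ_prod_mulSingle s, map_prod]
    refine Subgroup.prod_mem _ fun l _ => ?_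
    by_cases hl : p l = 0
    · rw [psi_mulSingle hn hn2]
      exact (le_iSup₂ (f := fun (l : Fin (n + 1)) (_ : p l = 0) =>
        (oneParam n (etaFacet n l)).range) l hl) ⟨_, rfl⟩
    · rw [hs l hl, Pi.mulSingle_one, map_one]
      exact one_mem _

/-- The space of complex vectors whose vector of absolute values lies in the polytope. -/
abbrev Zsp (n : ℕ) (r : ℝ) : Type := {z : Fin (n + 1) → ℂ // (fun l => ‖z l‖) ∈ DeltaQ n r}

/-- The sum of the absolute values of the coordinates in a group. -/
def gs {n : ℕ} (z : Fin (n + 1) → ℂ) (g : Fin 3) : ℝ := grpSum n (fun l => ‖z l‖) g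

lemma continuous_grpSum (n : ℕ) (g : Fin 3) : Continuous fun x : Fin (n + 1) → ℝ => grpSum n x g := by
  unfold grpSum
  fun_prop

lemma continuous_gs {n : ℕ} (g : Fin 3) : Continuous fun z : Fin (n + 1) → ℂ => gs z g :=
  (continuous_grpSum n g).comp (by fun_prop)

lemma gs_nonneg {n : ℕ} (z : Fin (n + 1) → ℂ) (g : Fin 3) : 0 ≤ gs z g :=
 by
  unfold gs grpSum
  positivity

/-! ### The complex model and its two-torus action -/

section

variable {n : ℕ} {r : ℝ}

lemma Zsp.sum_eq (z : Zsp n r) : ∑ l, ‖z.1 l‖ = 1 := (mem_deltaQ_iff.1 z.2).2.1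

lemma Zsp.gs_le (z : Zsp n r) (g : Fin 3) : gs z.1 g ≤ 1 - r := (mem_deltaQ_iff.1 z.2).2.2 g

lemma Zsp.gs_add (z : Zsp n r) : gs z.1 0 + gs z.1 1 + gs z.1 2 = 1 := by
  rw [← z.sum_eq]
  exact grpSum_add n _

lemma mem_Zsp {z : Fin (n + 1) → ℂ} :
    (fun l => ‖z l‖) ∈ DeltaQ n r ↔ ∑ l, ‖z l‖ = 1 ∧ ∀ g, gs z g ≤ 1 - r := by
  rw [mem_deltaQ_iff]
  exact ⟨fun h => h.2, fun h => ⟨fun _ => norm_nonneg _, h⟩⟩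

lemma isClosed_deltaQ : IsClosed (DeltaQ n r) := by
  have : DeltaQ n r = {x | (∀ l, 0 ≤ x l) ∧ ∑ l, x l = 1 ∧ ∀ g, grpSum n x g ≤ 1 - r} := by
    ext x
    exact mem_deltaQ_iff
  rw [this]
  simp only [Set.ofPred_and, Set.ofPred_forall]
  refine (isClosed_iInter fun l => isClosed_le continuous_const (continuous_apply l)).inter
    ((isClosed_eq (by fun_prop) continuous_const).inter
      (isClosed_iInter fun g => isClosed_le (continuous_grpSum n g) continuous_const))

lemma deltaQ_le_one {x : Fin (n + 1) → ℝ} (hx : x ∈ DeltaQ n r) (l : Fin (n + 1)) : x l ≤ 1 := by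
  rw [← hx.1.2]
  exact Finset.single_le_sum (fun l _ => hx.1.1 l) (Finset.mem_univ l)

instance : CompactSpace (DeltaQ n r) := by
  refine isCompact_iff_compactSpace.1 (Metric.isCompact_of_isClosed_isBounded isClosed_deltaQ
    (isBounded_iff_forall_norm_le.2 ⟨1, fun x hx => ?_⟩))
  rw [pi_norm_le_iff_of_nonneg zero_le_one]
  intro l
  rw [Real.norm_of_nonneg (hx.1.1 l)]
  exact deltaQ_le_one hx l

instance : CompactSpace (Zsp n r) := by
  have hc : Continuous fun (z : Fin (n + 1) → ℂ) l => ‖z l‖ := by fun_prop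
  have : IsCompact ((fun (z : Fin (n + 1) → ℂ) l => ‖z l‖) ⁻¹' DeltaQ n r) := by
    refine Metric.isCompact_of_isClosed_isBounded (isClosed_deltaQ.preimage hc)
      (isBounded_iff_forall_norm_le.2 ⟨1, fun z hz => ?_⟩)
    rw [pi_norm_le_iff_of_nonneg zero_le_one]
    exact fun l => deltaQ_le_one hz l
  exact isCompact_iff_compactSpace.1 this

instance : MulAction (Circle × Circle) (Zsp n r) where
  smul t z := ⟨fun l => chi n l t * z.1 l, by simpa [Circle.norm_coe] using z.2⟩
  one_smul z := Subtype.ext (funext fun l => by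
    change ((chi n l 1 : Circle) : ℂ) * z.1 l = z.1 l
    simp)
  mul_smul s t z := Subtype.ext (funext fun l => by
    change ((chi n l (s * t) : Circle) : ℂ) * z.1 l = chi n l s * (chi n l t * z.1 l)
    simp [mul_assoc])

lemma smul_apply (t : Circle × Circle) (z : Zsp n r) (l : Fin (n + 1)) :
    (t • z).1 l = chi n l t * z.1 l := rfl

instance : ContinuousSMul (Circle × Circle) (Zsp n r) := by
  refine ⟨Continuous.subtype_mk (continuous_pi fun l => ?_) _⟩
  have := continuous_chi n l
  exact (continuous_subtype_val.comp (this.comp continuous_fst)).mul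
    ((continuous_apply l).comp (continuous_subtype_val.comp continuous_snd))

instance : ProperSMul (Circle × Circle) (Zsp n r) :=
  ⟨Continuous.isProperMap (by fun_prop)⟩

/-- The orbit space of the complex model. -/
abbrev Orb (n : ℕ) (r : ℝ) : Type := Quotient (MulAction.orbitRel (Circle × Circle) (Zsp n r))

lemma orb_mk_eq {z z' : Zsp n r} :
    (Quotient.mk _ z : Orb n r) = Quotient.mk _ z' ↔ ∃ t : Circle × Circle, t • z' = z := by
  rw [Quotient.eq, MulAction.orbitRel_apply]
  exact Iff.rfl

/-- The map from `𝕋^(n-1) × Δ^n_Q` to the complex model. -/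
def theta (a : Torus n × DeltaQ n r) : Zsp n r :=
  ⟨fun l => sigma n a.1 l * (a.2.1 l : ℂ), by
    convert a.2.2 with l
    simp [Circle.norm_coe, abs_of_nonneg (a.2.2.1.1 l)]⟩

lemma continuous_theta : Continuous (theta : Torus n × DeltaQ n r → Zsp n r) := by
  refine Continuous.subtype_mk (continuous_pi fun l => ?_) _
  exact (continuous_subtype_val.comp ((continuous_apply l).comp
    ((continuous_sigma n).comp continuous_fst))).mul (Complex.continuous_ofReal.comp
    ((continuous_apply l).comp (continuous_subtype_val.comp continuous_snd)))

lemma norm_theta (a : Torus n × DeltaQ n r) (l : Fin (n + 1)) : ‖(theta a).1 l‖ = a.2.1 l := by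
  simp [theta, Circle.norm_coe, abs_of_nonneg (a.2.2.1.1 l)]

lemma gs_smul (t : Circle × Circle) (z : Zsp n r) (g : Fin 3) : gs (t • z).1 g = gs z.1 g := by
  unfold gs
  congr 1
  funext l
  simp [smul_apply, Circle.norm_coe]

/-! ### Identification of `W` with the orbit space -/

variable [hP : Params n r]

/-- If t relates the two vectors, then σ(b/a)·χ(t) is 1 at the nonzero coordinates and `psi` maps it
to b/a. Conversely, if s is 1 there and maps to b/a, then s/σ(b/a) is in the kernel of `psi`, hence
comes from the two-torus. -/
lemma orb_theta_eq_iff {a b : Torus n × DeltaQ n r} :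
    (Quotient.mk _ (theta a) : Orb n r) = Quotient.mk _ (theta b) ↔ etaSetoid n r a b := by
  have hn := hP.even
  have hn2 := hP.two_le
  rw [orb_mk_eq]
  change _ ↔ a.2 = b.2 ∧ b.1 * a.1⁻¹ ∈ faceTorus n a.2
  rw [mem_faceTorus_iff hn hn2]
  constructor
  · rintro ⟨t, ht⟩
    have h1 : ∀ l, chi n l t * (theta b).1 l = (theta a).1 l := fun l => by rw [← ht]; rfl
    have h2 : a.2 = b.2 := by
      refine Subtype.ext (funext fun l => ?_)
      rw [← norm_theta a, ← norm_theta b, ← h1 l]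
      simp [Circle.norm_coe]
    refine ⟨h2, fun l => sigma n b.1 l / sigma n a.1 l * chi n l t, fun l hl => ?_, ?_⟩
    · have h3 := h1 l
      have h4 : ((a.2.1 l : ℝ) : ℂ) ≠ 0 := by exact_mod_cast hl
      simp only [theta] at h3
      rw [← h2, ← mul_assoc] at h3
      have h5 := mul_right_cancel₀ h4 h3
      have h6 : chi n l t * sigma n b.1 l = sigma n a.1 l := Circle.ext (by simpa using h5)
      change sigma n b.1 l / sigma n a.1 l * chi n l t = 1
      rw [← h6, mul_comm (chi n l t), div_mul_cancel_left, inv_mul_cancel]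
    · have : (fun l => sigma n b.1 l / sigma n a.1 l * chi n l t) =
          sigma n (b.1 * a.1⁻¹) * fun l => chi n l t := by
        funext l
        rw [map_mul, map_inv, Pi.mul_apply, Pi.mul_apply, Pi.inv_apply, div_eq_mul_inv]
      rw [this, map_mul, psi_sigma hn hn2, (psi_eq_one_iff hn hn2 _).2 ⟨t, rfl⟩, mul_one]
  · rintro ⟨h2, s, hs, h⟩
    obtain ⟨t, ht⟩ := (psi_eq_one_iff hn hn2 (s / sigma n (b.1 * a.1⁻¹))).1 (by
      rw [map_div, psi_sigma hn hn2, h, div_self'])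
    refine ⟨t, Subtype.ext (funext fun l => ?_)⟩
    rw [smul_apply]
    simp only [theta]
    rw [← h2]
    by_cases hl : a.2.1 l = 0
    · simp [hl]
    · have h3 := congrFun ht l
      rw [Pi.div_apply, hs l hl, map_mul, map_inv, Pi.mul_apply, Pi.inv_apply] at h3
      rw [← h3, ← mul_assoc]
      congr 1
      rw [← Circle.coe_mul]
      congr 1
      rw [one_div, mul_inv, inv_inv, mul_right_comm, inv_mul_cancel, one_mul]

/-- In polar coordinates z = u·|z| with u ∈ 𝕋^(n+1). The vectors with phases u and σ(psi u) lie in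
one orbit, since these phases differ by an element of the kernel of `psi`. -/
lemma exists_orb_theta (z : Zsp n r) :
    ∃ a : Torus n × DeltaQ n r, (fun l => ‖z.1 l‖) = a.2.1 ∧
      (Quotient.mk _ (theta a) : Orb n r) = Quotient.mk _ z := by
  have hn := hP.even
  have hn2 := hP.two_le
  have : ∀ l, ∃ u : Circle, z.1 l = u * (‖z.1 l‖ : ℂ) := fun l =>
    ⟨Circle.exp (Complex.arg (z.1 l)), by
      rw [Circle.coe_exp, mul_comm, Complex.norm_mul_exp_arg_mul_I]⟩
  choose u hu using this
  refine ⟨(psi n u, ⟨_, z.2⟩), rfl, ?_⟩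
  rw [orb_mk_eq]
  obtain ⟨t, ht⟩ := (psi_eq_one_iff hn hn2 (sigma n (psi n u) / u)).1 (by
    rw [map_div, psi_sigma hn hn2, div_self'])
  refine ⟨t, Subtype.ext (funext fun l => ?_)⟩
  rw [smul_apply, hu l]
  have h3 := congrFun ht l
  rw [Pi.div_apply] at h3
  simp only [theta]
  rw [← h3, ← mul_assoc, ← Circle.coe_mul, div_mul_cancel]

variable (n r) in
/-- The space `W` is the orbit space of the complex model. -/
def homeoOrb : W n r ≃ₜ Orb n r :=
  Continuous.homeoOfEquivCompactToT2
    (f := Equiv.ofBijective (Quotient.lift (fun a => (Quotient.mk _ (theta a) : Orb n r))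
      (fun _ _ h => orb_theta_eq_iff.2 h)) ⟨by
        intro a b
        induction a using Quotient.inductionOn
        induction b using Quotient.inductionOn
        exact fun h => Quotient.sound (orb_theta_eq_iff.1 h), by
        intro y
        induction y using Quotient.inductionOn with | _ z
        obtain ⟨a, -, ha⟩ := exists_orb_theta z
        exact ⟨Quotient.mk _ a, ha⟩⟩)
    (continuous_quot_mk.comp continuous_theta |>.quotient_lift _)

instance : T2Space (W n r) := (homeoOrb n r).symm.t2Space

instance : CompactSpace (W n r) := inferInstance

instance : SecondCountableTopology (W n r) := by
  have : SecondCountableTopology (Orb n r) :=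
    ContinuousConstSMul.secondCountableTopology
  exact (homeoOrb n r).secondCountableTopology

/-- The quotient map from the complex model to `W`. -/
def toW (z : Zsp n r) : W n r := (homeoOrb n r).symm (Quotient.mk _ z)

lemma isOpenQuotientMap_toW : IsOpenQuotientMap (toW : Zsp n r → W n r) :=
  (homeoOrb n r).symm.isOpenQuotientMap.comp MulAction.isOpenQuotientMap_quotientMk

lemma continuous_toW : Continuous (toW : Zsp n r → W n r) := isOpenQuotientMap_toW.continuous

lemma toW_eq_iff {z z' : Zsp n r} : toW z = toW z' ↔ ∃ t : Circle × Circle, t • z' = z := by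
  rw [← orb_mk_eq]
  exact (homeoOrb n r).symm.injective.eq_iff

lemma toW_mem_boundaryW {z : Zsp n r} : toW z ∈ boundaryW n r ↔ ∃ g, gs z.1 g = 1 - r := by
  have key : ∀ a : Torus n × DeltaQ n r,
      Quotient.mk (etaSetoid n r) a = toW z ↔ (Quotient.mk _ (theta a) : Orb n r) = Quotient.mk _ z := by
    intro a
    rw [toW, ← (homeoOrb n r).symm_apply_apply (Quotient.mk (etaSetoid n r) a),
      (homeoOrb n r).symm.injective.eq_iff]
    exact Iff.rfl
  constructor
  · rintro ⟨a, ha, h⟩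
    rw [key, orb_mk_eq] at h
    obtain ⟨t, ht⟩ := h
    obtain ⟨g, hg⟩ := (mem_facets_iff a.2.2).1 ha
    refine ⟨g, ?_⟩
    rw [← gs_smul t, ht, ← hg]
    unfold gs
    simp only [norm_theta]
  · rintro ⟨g, hg⟩
    obtain ⟨a, ha, h⟩ := exists_orb_theta z
    refine ⟨a, (mem_facets_iff a.2.2).2 ⟨g, ?_⟩, (key a).2 h⟩
    rw [← ha]
    exact hg

end

/-! ### Collapsing a closed subspace -/

/-- Distinct fibres are disjoint closed sets in a normal space. Separating open sets are made
saturated by removing the closed images of their complements. -/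
lemma t2Space_of_isClosedMap {X Y : Type} [TopologicalSpace X] [TopologicalSpace Y] [T2Space X]
    [CompactSpace X] {f : X → Y} (hf : Continuous f) (hc : IsClosedMap f)
    (hs : Function.Surjective f) : T2Space Y := by
  have h1 : ∀ y, IsClosed (f ⁻¹' {y}) := fun y => by
    obtain ⟨x, rfl⟩ := hs y
    have := hc _ (isClosed_singleton (x := x))
    rw [Set.image_singleton] at this
    exact this.preimage hf
  refine ⟨fun y y' hne => ?_⟩
  obtain ⟨U, V, hU, hV, hyU, hyV, hd⟩ := normal_separation (h1 y) (h1 y')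
    (Disjoint.preimage _ (Set.disjoint_singleton.2 hne))
  refine ⟨(f '' Uᶜ)ᶜ, (f '' Vᶜ)ᶜ, (hc _ hU.isClosed_compl).isOpen_compl,
    (hc _ hV.isClosed_compl).isOpen_compl, ?_, ?_, ?_⟩
  · rintro ⟨x, hx, h⟩
    exact hx (hyU h)
  · rintro ⟨x, hx, h⟩
    exact hx (hyV h)
  · rw [Set.disjoint_left]
    intro z hz hz'
    obtain ⟨x, rfl⟩ := hs z
    have h2 : x ∈ U := by
      by_contra h
      exact hz ⟨x, h, rfl⟩
    have h3 : x ∈ V := by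
      by_contra h
      exact hz' ⟨x, h, rfl⟩
    exact Set.disjoint_left.1 hd h2 h3

section Collapse

variable {X : Type} [TopologicalSpace X] {A : Set X}

lemma collapse_mk_eq_iff {x y : X} :
    (Quotient.mk _ x : Collapse X A) = Quotient.mk _ y ↔ x = y ∨ (x ∈ A ∧ y ∈ A) := Quotient.eq

/-- The saturation of a closed set C is C ∪ A if C meets A, and C otherwise. -/
lemma isClosedMap_collapse_mk (hA : IsClosed A) :
    IsClosedMap (Quotient.mk (collapseSetoid A)) := by
  intro C hC
  have hq : Topology.IsQuotientMap (Quotient.mk (collapseSetoid A)) := isQuotientMap_quot_mk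
  rw [← hq.isClosed_preimage]
  by_cases h : (C ∩ A).Nonempty
  · convert hC.union hA using 1
    ext x
    simp only [Set.mem_preimage, Set.mem_image, collapse_mk_eq_iff, Set.mem_union]
    constructor
    · rintro ⟨y, hy, rfl | ⟨h1, h2⟩⟩
      exacts [Or.inl hy, Or.inr h2]
    · rintro (h1 | h1)
      · exact ⟨x, h1, Or.inl rfl⟩
      · obtain ⟨y, hy, hy'⟩ := h
        exact ⟨y, hy, Or.inr ⟨hy', h1⟩⟩
  · convert hC using 1
    ext x
    simp only [Set.mem_preimage, Set.mem_image, collapse_mk_eq_iff]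
    constructor
    · rintro ⟨y, hy, rfl | ⟨h1, h2⟩⟩
      · exact hy
      · exact absurd ⟨y, hy, h1⟩ h
    · exact fun h1 => ⟨x, h1, Or.inl rfl⟩

lemma t2Space_collapse [T2Space X] [CompactSpace X] (hA : IsClosed A) : T2Space (Collapse X A) :=
  t2Space_of_isClosedMap continuous_quot_mk (isClosedMap_collapse_mk hA) Quotient.mk_surjective

lemma isOpenEmbedding_collapse_mk (hA : IsClosed A) :
    Topology.IsOpenEmbedding (fun x : ↥Aᶜ => (Quotient.mk _ x.1 : Collapse X A)) := by
  refine Topology.IsOpenEmbedding.of_continuous_injective_isOpenMap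
    (continuous_quot_mk.comp continuous_subtype_val) ?_ ?_
  · intro x y h
    rcases collapse_mk_eq_iff.1 h with h | h
    · exact Subtype.ext h
    · exact absurd h.1 x.2
  · intro U hU
    have hq : Topology.IsQuotientMap (Quotient.mk (collapseSetoid A)) := isQuotientMap_quot_mk
    rw [← hq.isOpen_preimage]
    convert hA.isOpen_compl.isOpenMap_subtype_val _ hU using 1
    ext x
    simp only [Set.mem_preimage, Set.mem_image, collapse_mk_eq_iff]
    constructor
    · rintro ⟨y, hy, h | h⟩
      · exact ⟨y, hy, h⟩
      · exact absurd h.1 y.2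
    · rintro ⟨y, hy, rfl⟩
      exact ⟨y, hy, Or.inl rfl⟩

end Collapse

/-! ### The collapsed space -/

section

variable {n : ℕ} {r : ℝ}

/-- At most one group sum exceeds 1/2. The three boundary pieces are therefore disjoint and their
collars do not interfere. -/
lemma Zsp.gs_add_le (z : Zsp n r) {g g' : Fin 3} (h : g ≠ g') : gs z.1 g + gs z.1 g' ≤ 1 := by
  have h1 := z.gs_add
  have h2 := gs_nonneg z.1
  have := h2 0
  have := h2 1
  have := h2 2
  fin_cases g <;> fin_cases g' <;> simp at h ⊢ <;> linarith

/-- A vertex of the polytope, as a point of the complex model. -/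
lemma vertex_mem_Zsp (hr : 0 ≤ r) (hr2 : r ≤ 1 / 2) {i k : Fin (n + 1)} (h : grp n i ≠ grp n k) :
    (fun l => ‖(Pi.single i ((1 - r : ℝ) : ℂ) + Pi.single k (r : ℂ) : Fin (n + 1) → ℂ) l‖) ∈
      DeltaQ n r ∧ gs (Pi.single i ((1 - r : ℝ) : ℂ) + Pi.single k (r : ℂ)) (grp n i) = 1 - r := by
  have hne : i ≠ k := fun e => h (by rw [e])
  have e : (fun l => ‖(Pi.single i ((1 - r : ℝ) : ℂ) + Pi.single k (r : ℂ) : Fin (n + 1) → ℂ) l‖) =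
      fun l => (if l = i then 1 - r else 0) + (if l = k then r else 0) := by
    funext l
    simp only [Pi.add_apply, Pi.single_apply]
    split_ifs with h1 h2 h2
    · exact absurd (h1.symm.trans h2) hne
    · rw [add_zero, add_zero, Complex.norm_of_nonneg (by linarith)]
    · rw [zero_add, zero_add, Complex.norm_of_nonneg hr]
    · simp
  have hg : ∀ g, gs (Pi.single i ((1 - r : ℝ) : ℂ) + Pi.single k (r : ℂ)) g =
      (if grp n i = g then 1 - r else 0) + (if grp n k = g then r else 0) := by
    intro g
    unfold gs
    rw [e]
    unfold grpSum
    rw [Finset.sum_add_distrib, Finset.sum_ite_eq', Finset.sum_ite_eq']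
    simp
  refine ⟨mem_Zsp.2 ⟨?_, fun g => ?_⟩, ?_⟩
  · simp only [congrFun e, Finset.sum_add_distrib]
    simp
  · rw [hg]
    split_ifs with h1 h2
    · exact absurd (h1.trans h2.symm) h
    all_goals linarith
  · rw [hg, if_pos rfl, if_neg (Ne.symm h), add_zero]

variable [hP : Params n r]

lemma isClosed_boundaryW : IsClosed (boundaryW n r) := by
  rw [← (isOpenQuotientMap_toW (n := n) (r := r)).isQuotientMap.isClosed_preimage]
  have : toW ⁻¹' boundaryW n r = ⋃ g : Fin 3, {z : Zsp n r | gs z.1 g = 1 - r} := by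
    ext z
    simp [toW_mem_boundaryW]
  rw [this]
  exact isClosed_iUnion_of_finite fun g =>
    isClosed_eq ((continuous_gs g).comp continuous_subtype_val) continuous_const

instance : T2Space (WModBoundary n r) := t2Space_collapse isClosed_boundaryW

instance : CompactSpace (WModBoundary n r) := inferInstance

/-- The quotient map from the complex model to `W / ∂W`. -/
def toX : C(Zsp n r, WModBoundary n r) :=
  ⟨fun z => Quotient.mk _ (toW z), continuous_quot_mk.comp continuous_toW⟩

lemma toX_surjective : Function.Surjective (toX : Zsp n r → WModBoundary n r) :=
  Quotient.mk_surjective.comp isOpenQuotientMap_toW.surjective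

/-- The point lies over the boundary. -/
def IsBd (z : Zsp n r) : Prop := ∃ g, gs z.1 g = 1 - r

lemma toX_eq_iff {z z' : Zsp n r} :
    toX z = toX z' ↔ (∃ t : Circle × Circle, t • z' = z) ∨ (IsBd z ∧ IsBd z') := by
  change (Quotient.mk _ (toW z) : Collapse (W n r) (boundaryW n r)) = Quotient.mk _ (toW z') ↔ _
  rw [collapse_mk_eq_iff, toW_eq_iff, toW_mem_boundaryW, toW_mem_boundaryW]
  exact Iff.rfl

lemma grp_zero (hn2 : 2 ≤ n) : grp n 0 = 0 := grp_eq_zero.2 (by simp; omega)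

lemma grp_last (hn2 : 2 ≤ n) : grp n (Fin.last n) = 2 := grp_eq_two.2 (by simp; omega)

/-- The point to which the boundary is collapsed. -/
def basePt (n : ℕ) (r : ℝ) [hP : Params n r] : WModBoundary n r :=
  toX ⟨_, (vertex_mem_Zsp hP.pos.le (hP.lt.le.trans (by norm_num)) (i := 0) (k := Fin.last n)
    (by rw [grp_zero hP.two_le, grp_last hP.two_le]; decide)).1⟩

lemma toX_eq_basePt_iff {z : Zsp n r} : toX z = basePt n r ↔ IsBd z := by
  have h := (vertex_mem_Zsp hP.pos.le (hP.lt.le.trans (by norm_num)) (i := 0) (k := Fin.last n)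
    (by rw [grp_zero hP.two_le, grp_last hP.two_le]; decide)).2
  rw [basePt, toX_eq_iff]
  constructor
  · rintro (⟨t, rfl⟩ | h1)
    · exact ⟨_, (gs_smul _ _ _).trans h⟩
    · exact h1.1
  · exact fun h1 => Or.inr ⟨h1, _, h⟩

lemma mk_eq_basePt_iff {w : W n r} :
    (Quotient.mk _ w : WModBoundary n r) = basePt n r ↔ w ∈ boundaryW n r := by
  obtain ⟨z, rfl⟩ := isOpenQuotientMap_toW.surjective w
  rw [toW_mem_boundaryW]
  exact toX_eq_basePt_iff

/-! #### The collar of the boundary -/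

/-- The amount by which a large coordinate sum is increased by the collar homotopy. -/
def collarGain (r t s : ℝ) : ℝ := min (1 - r - s) (r / (1 / 2 - 2 * r) * t * max (s - 1 / 2) 0)

lemma collarGain_nonneg (hr : 0 < r) (hr4 : r < 1 / 4) {t s : ℝ} (ht : 0 ≤ t) (hs : s ≤ 1 - r) :
    0 ≤ collarGain r t s := by
  have : 0 < 1 / 2 - 2 * r := by linarith
  exact le_min (by linarith) (by positivity)

lemma collarGain_eq_zero {t s : ℝ} (h1 : s ≤ 1 - r) (hs : s ≤ 1 / 2) : collarGain r t s = 0 := by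
  unfold collarGain
  rw [max_eq_right (by linarith), mul_zero, min_eq_right (by linarith)]

/-- The weights `δ_g / (1 - s_g)`. -/
def collarWt (t : ℝ) (z : Zsp n r) (g : Fin 3) : ℝ :=
  collarGain r t (gs z.1 g) / (1 - gs z.1 g)

lemma collarWt_nonneg {t : ℝ} (ht : 0 ≤ t) (z : Zsp n r) (g : Fin 3) : 0 ≤ collarWt t z g :=
  div_nonneg (collarGain_nonneg hP.pos hP.lt ht (z.gs_le g)) (by linarith [z.gs_le g, hP.pos])

lemma collarWt_mul (t : ℝ) (z : Zsp n r) (g : Fin 3) :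
    collarWt t z g * (1 - gs z.1 g) = collarGain r t (gs z.1 g) :=
  div_mul_cancel₀ _ (by linarith [z.gs_le g, hP.pos])

lemma collarWt_eq_zero (t : ℝ) (z : Zsp n r) {g : Fin 3} (h : gs z.1 g ≤ 1 / 2) :
    collarWt t z g = 0 := by
  rw [collarWt, collarGain_eq_zero (z.gs_le g) h, zero_div]

lemma sum_collarWt_of_lt (t : ℝ) (z : Zsp n r) {g : Fin 3} (h : 1 / 2 < gs z.1 g) :
    ∑ g', collarWt t z g' = collarWt t z g :=
  Finset.sum_eq_single_of_mem g (Finset.mem_univ _) fun g' _ hne =>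
    collarWt_eq_zero t z (by linarith [z.gs_add_le hne])

lemma collarWt_le_one (t : ℝ) (z : Zsp n r) (g : Fin 3) : collarWt t z g ≤ 1 := by
  refine (div_le_one (by linarith [z.gs_le g, hP.pos])).2 ((min_le_left _ _).trans ?_)
  linarith [hP.pos]

lemma sum_collarWt_le_one (t : ℝ) (z : Zsp n r) : ∑ g, collarWt t z g ≤ 1 := by
  by_cases h : ∃ g, 1 / 2 < gs z.1 g
  · obtain ⟨g, hg⟩ := h
    rw [sum_collarWt_of_lt t z hg]
    exact collarWt_le_one t z g
  · push Not at h
    rw [Finset.sum_eq_zero fun g _ => collarWt_eq_zero t z (h g)]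
    exact zero_le_one

/-- The factor by which the coordinates of a group are multiplied by the collar homotopy. -/
def collarFactor (t : ℝ) (z : Zsp n r) (g : Fin 3) : ℝ :=
  1 - ∑ g', collarWt t z g' + collarWt t z g / max (gs z.1 g) (1 / 2)

lemma collarFactor_nonneg {t : ℝ} (ht : 0 ≤ t) (z : Zsp n r) (g : Fin 3) :
    0 ≤ collarFactor t z g :=
  add_nonneg (sub_nonneg.2 (sum_collarWt_le_one t z))
    (div_nonneg (collarWt_nonneg ht z g) (by positivity))

/-- The motion is a convex combination: z with weight 1 - Σw, and the g-part of z rescaled to sum 1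
with weight w_g. Hence the total stays 1, and a dominant group sum s grows by w(1 - s), which is the
prescribed gain. The maximum with 1/2 only avoids division by zero: for s ≤ 1/2 the weight is zero.
-/
lemma collarFactor_mul_gs (t : ℝ) (z : Zsp n r) (g : Fin 3) : collarFactor t z g * gs z.1 g =
    (1 - ∑ g', collarWt t z g') * gs z.1 g + collarWt t z g := by
  rw [collarFactor, add_mul]
  congr 1
  rcases le_or_gt (gs z.1 g) (1 / 2) with h | h
  · rw [collarWt_eq_zero t z h, zero_div, zero_mul]
  · rw [max_eq_left h.le, div_mul_cancel₀ _ (by linarith)]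

lemma gs_collar (t : ℝ) (ht : 0 ≤ t) (z : Zsp n r) (g : Fin 3) :
    gs (fun l => (collarFactor t z (grp n l) : ℂ) * z.1 l) g = collarFactor t z g * gs z.1 g := by
  unfold gs grpSum
  rw [Finset.mul_sum]
  refine Finset.sum_congr rfl fun l hl => ?_
  change ‖(collarFactor t z (grp n l) : ℂ) * z.1 l‖ = _
  rw [norm_mul, Complex.norm_of_nonneg (collarFactor_nonneg ht z _), (Finset.mem_filter.1 hl).2]

lemma collar_mem {t : ℝ} (ht : 0 ≤ t) (z : Zsp n r) :
    (fun l => ‖(collarFactor t z (grp n l) : ℂ) * z.1 l‖) ∈ DeltaQ n r := by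
  rw [mem_Zsp]
  constructor
  · rw [← grpSum_add]
    change gs (fun l => (collarFactor t z (grp n l) : ℂ) * z.1 l) 0 + gs _ 1 + gs _ 2 = 1
    simp only [gs_collar t ht, collarFactor_mul_gs]
    have h1 : ∑ g, collarWt t z g = collarWt t z 0 + collarWt t z 1 + collarWt t z 2 :=
      Fin.sum_univ_three _
    linear_combination (1 - ∑ g, collarWt t z g) * z.gs_add - h1
  · intro g
    rw [gs_collar t ht, collarFactor_mul_gs]
    have h1 : collarWt t z g ≤ ∑ g', collarWt t z g' :=
      Finset.single_le_sum (fun g _ => collarWt_nonneg ht z g) (Finset.mem_univ g)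
    have h2 := collarWt_mul t z g
    have h3 : collarGain r t (gs z.1 g) ≤ 1 - r - gs z.1 g := min_le_left _ _
    have h4 := mul_le_mul_of_nonneg_right h1 (gs_nonneg z.1 g)
    linarith

/-- The collar homotopy on the complex model. -/
def collarZ : C(unitInterval × Zsp n r, Zsp n r) :=
  ⟨fun p => ⟨_, collar_mem p.1.2.1 p.2⟩, by
    have h1 : ∀ g, Continuous fun p : unitInterval × Zsp n r => gs p.2.1 g := fun g =>
      (continuous_gs g).comp (continuous_subtype_val.comp continuous_snd)
    have h0 : Continuous fun p : unitInterval × Zsp n r => (p.1 : ℝ) :=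
      continuous_subtype_val.comp continuous_fst
    have h2 : ∀ g, Continuous fun p : unitInterval × Zsp n r => collarWt p.1 p.2 g := by
      intro g
      unfold collarWt collarGain
      refine Continuous.div ((continuous_const.sub (h1 g)).min ((continuous_const.mul h0).mul
        (((h1 g).sub continuous_const).max continuous_const))) (continuous_const.sub (h1 g)) ?_
      intro p
      linarith [p.2.gs_le g, hP.pos]
    have h3 : ∀ g, Continuous fun p : unitInterval × Zsp n r => collarFactor p.1 p.2 g := by
      intro g
      unfold collarFactor
      refine (continuous_const.sub (continuous_finsetSum _ fun g _ => h2 g)).add ((h2 g).div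
        ((h1 g).max continuous_const) fun p => ?_)
      positivity
    refine Continuous.subtype_mk (continuous_pi fun l => ?_) _
    exact (Complex.continuous_ofReal.comp (h3 _)).mul
      ((continuous_apply l).comp (continuous_subtype_val.comp continuous_snd))⟩

lemma collarZ_smul (t : unitInterval) (u : Circle × Circle) (z : Zsp n r) :
    collarZ (t, u • z) = u • collarZ (t, z) := by
  refine Subtype.ext (funext fun l => ?_)
  have h1 : collarFactor t (u • z) = collarFactor t z := by
    unfold collarFactor collarWt
    simp only [gs_smul]
  change (collarFactor t (u • z) (grp n l) : ℂ) * (chi n l u * z.1 l) =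
    chi n l u * (collarFactor t z (grp n l) * z.1 l)
  rw [h1, mul_left_comm]

lemma gs_collarZ (t : unitInterval) (z : Zsp n r) (g : Fin 3) : gs (collarZ (t, z)).1 g =
    (1 - ∑ g', collarWt t z g') * gs z.1 g + collarWt t z g := by
  rw [← collarFactor_mul_gs, ← gs_collar t t.2.1]
  rfl

lemma gs_collarZ_of_lt (t : unitInterval) (z : Zsp n r) {g : Fin 3} (h : 1 / 2 < gs z.1 g) :
    gs (collarZ (t, z)).1 g = gs z.1 g + collarGain r t (gs z.1 g) := by
  rw [gs_collarZ, sum_collarWt_of_lt _ _ h, ← collarWt_mul]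
  ring

lemma collarZ_eq_self {t : unitInterval} {z : Zsp n r} (h : ∀ g, collarWt t z g = 0) :
    collarZ (t, z) = z := by
  refine Subtype.ext (funext fun l => ?_)
  change (collarFactor t z (grp n l) : ℂ) * z.1 l = z.1 l
  simp [collarFactor, h]

/-- The collar homotopy depends only on absolute values, so it is equivariant, and open quotient
maps remain quotient maps after multiplication by the interval. -/
lemma exists_collarW : ∃ K : C(unitInterval × W n r, W n r),
    ∀ t z, K (t, toW z) = toW (collarZ (t, z)) := by
  have hq : IsOpenQuotientMap (Prod.map id toW : unitInterval × Zsp n r → unitInterval × W n r) :=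
    IsOpenQuotientMap.id.prodMap isOpenQuotientMap_toW
  let f : C(unitInterval × Zsp n r, unitInterval × W n r) := ⟨Prod.map id toW, hq.continuous⟩
  let g : C(unitInterval × Zsp n r, W n r) :=
    (⟨toW, continuous_toW⟩ : C(Zsp n r, W n r)).comp collarZ
  have hf : Topology.IsQuotientMap f := hq.isQuotientMap
  have hg : Function.FactorsThrough g f := by
    rintro ⟨t, z⟩ ⟨t', z'⟩ h
    obtain rfl : t = t' := congrArg Prod.fst h
    obtain ⟨u, rfl⟩ := toW_eq_iff.1 (congrArg Prod.snd h)
    exact toW_eq_iff.2 ⟨u, (collarZ_smul t u z').symm⟩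
  exact ⟨hf.lift g hg, fun t z => DFunLike.congr_fun (hf.lift_comp g hg) (t, z)⟩

lemma exists_isCollar_boundaryW : ∃ K : C(unitInterval × W n r, W n r),
    IsCollar K (boundaryW n r) (toW '' {z | ∃ g, 1 - 2 * r < gs z.1 g}) := by
  obtain ⟨K, collarW_toW⟩ := exists_collarW (n := n) (r := r)
  refine ⟨K, ?_⟩
  have hr := hP.pos
  have hr4 := hP.lt
  have hsurj : ∀ w : W n r, ∃ z, toW z = w := isOpenQuotientMap_toW.surjective
  constructor
  · intro w hw
    obtain ⟨z, rfl⟩ := hsurj w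
    obtain ⟨g, hg⟩ := toW_mem_boundaryW.1 hw
    exact ⟨z, ⟨g, by linarith⟩, rfl⟩
  · intro w
    obtain ⟨z, rfl⟩ := hsurj w
    rw [collarW_toW, collarZ_eq_self fun g => ?_]
    unfold collarWt collarGain
    have := z.gs_le g
    rw [Set.Icc.coe_zero, mul_zero, zero_mul, min_eq_right (by linarith), zero_div]
  · intro t w hw
    obtain ⟨z, rfl⟩ := hsurj w
    obtain ⟨g, hg⟩ := toW_mem_boundaryW.1 hw
    rw [collarW_toW, collarZ_eq_self fun g' => ?_]
    by_cases h : g' = g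
    · subst h
      unfold collarWt collarGain
      rw [hg, sub_self, min_eq_left, zero_div]
      have : 0 < 1 / 2 - 2 * r := by linarith
      have := t.2.1
      positivity
    · exact collarWt_eq_zero _ _ (by linarith [z.gs_add_le h])
  · rintro t _ ⟨z, ⟨g, hg⟩, rfl⟩
    rw [collarW_toW]
    refine ⟨_, ⟨g, ?_⟩, rfl⟩
    rw [gs_collarZ_of_lt _ _ (by linarith)]
    linarith [collarGain_nonneg hr hr4 t.2.1 (z.gs_le g)]
  · rintro _ ⟨z, ⟨g, hg⟩, rfl⟩
    rw [collarW_toW, toW_mem_boundaryW]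
    refine ⟨g, ?_⟩
    rw [gs_collarZ_of_lt _ _ (by linarith), collarGain, min_eq_left]
    · ring
    -- For s > 1 - 2r one has s - 1/2 > 1/2 - 2r, so with slope r/(1/2 - 2r) the second term exceeds
    -- r at time 1, hence also the missing amount 1 - r - s.
    · have h1 : 0 < 1 / 2 - 2 * r := by linarith
      rw [max_eq_left (by linarith), Set.Icc.coe_one, mul_one, div_mul_eq_mul_div,
        le_div_iff₀ h1]
      nlinarith

variable (n r) in
/-- Collapsing the boundary does not change the relative homology. -/
lemma nonempty_relH_W_iso (i : ℕ) :
    Nonempty (relH i (W n r) (boundaryW n r) ≅ relH i (WModBoundary n r) {basePt n r}) := by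
  let f : C(W n r, WModBoundary n r) := ⟨Quotient.mk _, continuous_quot_mk⟩
  have hf : f ⁻¹' {basePt n r} = boundaryW n r := by
    ext w
    exact mk_eq_basePt_iff
  have hopen : IsOpen (toW '' {z : Zsp n r | ∃ g, 1 - 2 * r < gs z.1 g}) := by
    refine isOpenQuotientMap_toW.isOpenMap _ ?_
    rw [Set.ofPred_exists]
    exact isOpen_iUnion fun g => isOpen_lt continuous_const
      ((continuous_gs g).comp continuous_subtype_val)
  obtain ⟨K, hK⟩ := exists_isCollar_boundaryW (n := n) (r := r)
  have h := nonempty_relH_iso_of_relativeHomeomorphism f (B := {basePt n r}) isClosed_singleton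
    (by
      rw [hf]
      intro x hx y hy hxy
      rcases collapse_mk_eq_iff.1 hxy with h | h
      · exact h
      · exact absurd h.1 hx)
    (fun y _ => Quotient.mk_surjective y) hopen (by rw [hf]; exact hK) i
  rwa [hf] at h

end

/-! ### The cells -/

section CellVec

variable {n d : ℕ} (i k : Fin (n + 1))

/-- The coordinates of a vector, extended by zero. -/
def ex (x : Fin d → ℝ) (a : ℕ) : ℝ := if h : a < d then x ⟨a, h⟩ else 0

lemma continuous_ex (a : ℕ) : Continuous fun x : Fin d → ℝ => ex x a := by
  unfold ex
  split_ifs <;> fun_prop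

lemma ex_smul (c : ℝ) (x : Fin d → ℝ) (a : ℕ) : ex (c • x) a = c * ex x a := by
  unfold ex
  split_ifs <;> simp

/-- The complex coordinates strictly between the places `i` and `k`. -/
def midY (x : Fin d → ℝ) (l : Fin (n + 1)) : ℂ :=
  if (i : ℕ) < l ∧ (l : ℕ) < k then ⟨ex x (2 * (l - i) - 1), ex x (2 * (l - i))⟩ else 0

lemma continuous_midY (l : Fin (n + 1)) : Continuous fun x : Fin d → ℝ => midY i k x l := by
  unfold midY
  split_ifs
  · have h1 := continuous_ex (d := d) (2 * (l - i) - 1)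
    have h2 := continuous_ex (d := d) (2 * (l - i))
    have e : (fun x : Fin d → ℝ => (⟨ex x (2 * (l - i) - 1), ex x (2 * (l - i))⟩ : ℂ)) =
        fun x => (ex x (2 * (l - i) - 1) : ℂ) + ex x (2 * (l - i)) * Complex.I := by
      funext x
      exact Complex.mk_eq_add_mul_I _ _
    rw [e]
    fun_prop
  · exact continuous_const

lemma midY_smul (c : ℝ) (x : Fin d → ℝ) (l : Fin (n + 1)) :
    midY i k (c • x) l = c * midY i k x l := by
  unfold midY
  split_ifs
  · rw [ex_smul, ex_smul]
    apply Complex.ext <;> simp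
  · simp

/-- The sum of the absolute values of the coordinates strictly between `i` and `k`. -/
def sumY (x : Fin d → ℝ) : ℝ := ∑ l, ‖midY i k x l‖

lemma continuous_sumY : Continuous fun x : Fin d → ℝ => sumY i k x :=
  continuous_finsetSum _ fun l _ => (continuous_midY i k l).norm

lemma sumY_nonneg (x : Fin d → ℝ) : 0 ≤ sumY i k x := Finset.sum_nonneg fun _ _ => norm_nonneg _

lemma sumY_smul {c : ℝ} (hc : 0 ≤ c) (x : Fin d → ℝ) : sumY i k (c • x) = c * sumY i k x := by
  unfold sumY
  rw [Finset.mul_sum]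
  exact Finset.sum_congr rfl fun l _ => by
    rw [midY_smul, norm_mul, Complex.norm_of_nonneg hc]

lemma gs_midY_smul {c : ℝ} (hc : 0 ≤ c) (x : Fin d → ℝ) (g : Fin 3) :
    gs (midY i k (c • x)) g = c * gs (midY i k x) g := by
  unfold gs grpSum
  rw [Finset.mul_sum]
  exact Finset.sum_congr rfl fun l _ => by
    dsimp only
    rw [midY_smul, norm_mul, Complex.norm_of_nonneg hc]

/-- The vector of the complex model with real coordinates at the places `i` and `k`, complex
coordinates between them and zeros elsewhere. -/
def cellVec (x : Fin d → ℝ) (l : Fin (n + 1)) : ℂ :=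
  if l = i then (((1 - sumY i k x + ex x 0) / 2 : ℝ) : ℂ)
  else if l = k then (((1 - sumY i k x - ex x 0) / 2 : ℝ) : ℂ) else midY i k x l

lemma continuous_cellVec : Continuous fun x : Fin d → ℝ => cellVec i k x := by
  refine continuous_pi fun l => ?_
  have h1 := continuous_sumY (d := d) i k
  have h2 := continuous_ex (d := d) 0
  unfold cellVec
  split_ifs
  · exact Complex.continuous_ofReal.comp (by fun_prop)
  · exact Complex.continuous_ofReal.comp (by fun_prop)
  · exact continuous_midY i k l

lemma cellVec_left (x : Fin d → ℝ) :
    cellVec i k x i = (((1 - sumY i k x + ex x 0) / 2 : ℝ) : ℂ) := if_pos rfl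

/-- The indicator of the group of a place. -/
def grpInd (i : Fin (n + 1)) (g : Fin 3) : ℝ := if grp n i = g then 1 else 0

variable {i k}

lemma cellVec_right (h : i < k) (x : Fin d → ℝ) :
    cellVec i k x k = (((1 - sumY i k x - ex x 0) / 2 : ℝ) : ℂ) := by
  rw [cellVec, if_neg h.ne', if_pos rfl]

lemma cellVec_mid {l : Fin (n + 1)} (h1 : i < l) (h2 : l < k) (x : Fin d → ℝ) :
    cellVec i k x l = midY i k x l := by
  rw [cellVec, if_neg h1.ne', if_neg h2.ne]

lemma cellVec_eq_zero {l : Fin (n + 1)} (h : i < k) (hl : l < i ∨ k < l) (x : Fin d → ℝ) :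
    cellVec i k x l = 0 := by
  have h1 : l ≠ i := by rintro rfl; rcases hl with hl | hl <;> order
  have h2 : l ≠ k := by rintro rfl; rcases hl with hl | hl <;> order
  rw [cellVec, if_neg h1, if_neg h2, midY, if_neg]
  rintro ⟨h3, h4⟩
  rcases hl with hl | hl
  · exact absurd h3 (not_lt.2 (Fin.lt_def.1 hl).le)
  · exact absurd h4 (not_lt.2 (Fin.lt_def.1 hl).le)

lemma norm_cellVec (h : i < k) {x : Fin d → ℝ} (hx : |ex x 0| + sumY i k x ≤ 1) (l : Fin (n + 1)) :
    ‖cellVec i k x l‖ = ‖midY i k x l‖ + (if l = i then (1 - sumY i k x + ex x 0) / 2 else 0) +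
      (if l = k then (1 - sumY i k x - ex x 0) / 2 else 0) := by
  have h1 := neg_abs_le (ex x 0)
  have h2 := le_abs_self (ex x 0)
  unfold cellVec
  split_ifs with h3 h4 h4
  · exact absurd (h3.symm.trans h4) h.ne
  · subst h3
    rw [Complex.norm_of_nonneg (by linarith), midY, if_neg (by simp)]
    simp
  · subst h4
    rw [Complex.norm_of_nonneg (by linarith), midY, if_neg (by simp)]
    simp
  · simp

lemma sum_norm_cellVec (h : i < k) {x : Fin d → ℝ} (hx : |ex x 0| + sumY i k x ≤ 1) :
    ∑ l, ‖cellVec i k x l‖ = 1 := by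
  simp only [norm_cellVec h hx, Finset.sum_add_distrib, Finset.sum_ite_eq', Finset.mem_univ,
    if_true]
  rw [← sumY]
  ring

/-- Twice the deviation of the coordinate sum of a group from its value at the centre. -/
def grpDev (i k : Fin (n + 1)) (x : Fin d → ℝ) (g : Fin 3) : ℝ :=
  2 * gs (midY i k x) g + grpInd i g * (ex x 0 - sumY i k x) + grpInd k g * (-ex x 0 - sumY i k x)

/-- Group sums are a constant plus half of a positively homogeneous function of the parameters. So
s_g ≤ 1 - r becomes a bound on that function, and the parameter set is the unit sublevel set of a
gauge. -/
lemma gs_cellVec (h : i < k) {x : Fin d → ℝ} (hx : |ex x 0| + sumY i k x ≤ 1) (g : Fin 3) :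
    gs (cellVec i k x) g = (grpInd i g + grpInd k g + grpDev i k x g) / 2 := by
  have e : gs (cellVec i k x) g = gs (midY i k x) g +
      grpInd i g * ((1 - sumY i k x + ex x 0) / 2) + grpInd k g * ((1 - sumY i k x - ex x 0) / 2) := by
    unfold gs grpSum grpInd
    simp only [norm_cellVec h hx, Finset.sum_add_distrib, Finset.sum_ite_eq', Finset.mem_filter,
      Finset.mem_univ, true_and, ite_mul, one_mul, zero_mul]
  rw [e, grpDev]
  ring

lemma grpInd_add_le (h : grp n i ≠ grp n k) (g : Fin 3) : grpInd i g + grpInd k g ≤ 1 := by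
  unfold grpInd
  split_ifs with h1 h2
  · exact absurd (h1.trans h2.symm) h
  all_goals norm_num

lemma grpDev_smul {c : ℝ} (hc : 0 ≤ c) (x : Fin d → ℝ) (g : Fin 3) :
    grpDev i k (c • x) g = c * grpDev i k x g := by
  unfold grpDev
  rw [gs_midY_smul _ _ hc, ex_smul, sumY_smul _ _ hc]
  ring

lemma continuous_grpDev (g : Fin 3) : Continuous fun x : Fin d → ℝ => grpDev i k x g := by
  have h1 := continuous_sumY (d := d) i k
  have h2 := continuous_ex (d := d) 0
  have h3 : Continuous fun x : Fin d → ℝ => gs (midY i k x) g :=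
    (continuous_gs g).comp (continuous_pi fun l => continuous_midY i k l)
  unfold grpDev
  fun_prop

/-- The bound for the deviation of the coordinate sum of a group. -/
def grpBound (r : ℝ) (i k : Fin (n + 1)) (g : Fin 3) : ℝ := 2 - 2 * r - grpInd i g - grpInd k g

lemma grpBound_pos {r : ℝ} (hr : r < 1 / 4) (h : grp n i ≠ grp n k) (g : Fin 3) :
    0 < grpBound r i k g := by
  unfold grpBound
  linarith [grpInd_add_le h g]

/-- The gauge of the set of parameters of a cell. -/
def cellGauge (r : ℝ) (i k : Fin (n + 1)) (x : Fin d → ℝ) : ℝ :=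
  max (|ex x 0| + sumY i k x) (max (grpDev i k x 0 / grpBound r i k 0)
    (max (grpDev i k x 1 / grpBound r i k 1) (grpDev i k x 2 / grpBound r i k 2)))

lemma forall_fin3 {p : Fin 3 → Prop} : (∀ g, p g) ↔ p 0 ∧ p 1 ∧ p 2 := by
  rw [Fin.forall_fin_succ, Fin.forall_fin_two]
  rfl

lemma cellGauge_le_iff {r c : ℝ} {x : Fin d → ℝ} : cellGauge r i k x ≤ c ↔
    |ex x 0| + sumY i k x ≤ c ∧ ∀ g, grpDev i k x g / grpBound r i k g ≤ c := by
  rw [cellGauge, max_le_iff, max_le_iff, max_le_iff, forall_fin3]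

lemma cellGauge_lt_iff {r c : ℝ} {x : Fin d → ℝ} : cellGauge r i k x < c ↔
    |ex x 0| + sumY i k x < c ∧ ∀ g, grpDev i k x g / grpBound r i k g < c := by
  rw [cellGauge, max_lt_iff, max_lt_iff, max_lt_iff, forall_fin3]

lemma cellGauge_smul {r c : ℝ} (hc : 0 ≤ c) (x : Fin d → ℝ) :
    cellGauge r i k (c • x) = c * cellGauge r i k x := by
  simp only [cellGauge, mul_max_of_nonneg _ _ hc, grpDev_smul hc, ex_smul, sumY_smul _ _ hc,
    abs_mul, abs_of_nonneg hc, mul_div_assoc, mul_add]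

lemma continuous_cellGauge (r : ℝ) : Continuous fun x : Fin d → ℝ => cellGauge r i k x := by
  have h1 := continuous_sumY (d := d) i k
  have h2 := continuous_ex (d := d) 0
  have h3 := fun g => (continuous_grpDev (d := d) (i := i) (k := k) g).div_const (grpBound r i k g)
  unfold cellGauge
  exact (h2.abs.add h1).max ((h3 0).max ((h3 1).max (h3 2)))

lemma norm_midY_le (x : Fin d → ℝ) (l : Fin (n + 1)) : ‖midY i k x l‖ ≤ sumY i k x :=
  Finset.single_le_sum (f := fun l => ‖midY i k x l‖) (fun _ _ => norm_nonneg _)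
    (Finset.mem_univ l)

/-- Already the first term of the gauge dominates every coordinate: place 0 directly, places 2j - 1
and 2j as real and imaginary part of the complex coordinate at i + j. This makes the gauge positive
away from 0. -/
lemma norm_le_cellGauge {r : ℝ} (x : Fin (2 * ((k : ℕ) - i) - 1) → ℝ) :
    ‖x‖ ≤ cellGauge r i k x := by
  have h0 : |ex x 0| + sumY i k x ≤ cellGauge r i k x := le_max_left _ _
  have h1 := sumY_nonneg i k x
  have h2 := abs_nonneg (ex x 0)
  rw [pi_norm_le_iff_of_nonneg (by linarith)]
  rintro ⟨a, ha⟩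
  have hk := k.2
  have he : ex x a = x ⟨a, ha⟩ := dif_pos ha
  rw [← he, Real.norm_eq_abs]
  rcases Nat.eq_zero_or_pos a with rfl | hpos
  · linarith
  · have hl : (i : ℕ) + (a + 1) / 2 < n + 1 := by omega
    have h3 := norm_midY_le (i := i) (k := k) x ⟨i + (a + 1) / 2, hl⟩
    have h4 : midY i k x ⟨i + (a + 1) / 2, hl⟩ =
        ⟨ex x (2 * ((a + 1) / 2) - 1), ex x (2 * ((a + 1) / 2))⟩ := by
      rw [midY, if_pos ⟨by simp; omega, by simp; omega⟩]
      simp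
    rw [h4] at h3
    rcases Nat.even_or_odd' a with ⟨b, rfl | rfl⟩
    · have := Complex.abs_im_le_norm ⟨ex x (2 * ((2 * b + 1) / 2) - 1), ex x (2 * ((2 * b + 1) / 2))⟩
      have e : 2 * ((2 * b + 1) / 2) = 2 * b := by omega
      simp only [e] at this h3
      linarith
    · have := Complex.abs_re_le_norm
        ⟨ex x (2 * ((2 * b + 1 + 1) / 2) - 1), ex x (2 * ((2 * b + 1 + 1) / 2))⟩
      have e : 2 * ((2 * b + 1 + 1) / 2) - 1 = 2 * b + 1 := by omega
      simp only [e] at this h3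
      linarith

/-- The parameters of a vector. -/
def cellParam (i k : Fin (n + 1)) (z : Fin (n + 1) → ℂ) : Fin (2 * ((k : ℕ) - i) - 1) → ℝ :=
  fun a => if (a : ℕ) = 0 then (z i).re - (z k).re
    else if Odd (a : ℕ) then (z (Fin.ofNat (n + 1) (i + (a + 1) / 2))).re
    else (z (Fin.ofNat (n + 1) (i + a / 2))).im

lemma ex_cellParam_zero (h : i < k) (z : Fin (n + 1) → ℂ) :
    ex (cellParam i k z) 0 = (z i).re - (z k).re := by
  have := Fin.lt_def.1 h
  rw [ex, dif_pos (by omega), cellParam, if_pos rfl]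

lemma midY_cellParam {l : Fin (n + 1)} (h1 : i < l) (h2 : l < k) (z : Fin (n + 1) → ℂ) :
    midY i k (cellParam i k z) l = z l := by
  have h1 := Fin.lt_def.1 h1
  have h2 := Fin.lt_def.1 h2
  have hk := k.2
  rw [midY, if_pos ⟨h1, h2⟩, ex, dif_pos (by omega), ex, dif_pos (by omega)]
  have h3 : Odd (2 * ((l : ℕ) - i) - 1) := ⟨l - i - 1, by omega⟩
  have h4 : ¬ Odd (2 * ((l : ℕ) - i)) := by simp
  simp only [cellParam, h3, h4, if_true, if_false]
  rw [if_neg (by omega), if_neg (by omega)]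
  have e1 : Fin.ofNat (n + 1) ((i : ℕ) + (2 * ((l : ℕ) - i) - 1 + 1) / 2) = l := by
    apply Fin.ext
    rw [Fin.val_ofNat, Nat.mod_eq_of_lt] <;> omega
  have e2 : Fin.ofNat (n + 1) ((i : ℕ) + (2 * ((l : ℕ) - i)) / 2) = l := by
    apply Fin.ext
    rw [Fin.val_ofNat, Nat.mod_eq_of_lt] <;> omega
  rw [e1, e2]

/-- The inner coordinates determine z_i + z_k = 1 - `sumY`, and the parameter at place 0 is z_i -
z_k; together they return both extreme coordinates. -/
lemma cellVec_cellParam (h : i < k) {z : Fin (n + 1) → ℂ} (hz : ∑ l, ‖z l‖ = 1)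
    (hi : z i = ‖z i‖) (hk : z k = ‖z k‖) (h0 : ∀ l, l < i ∨ k < l → z l = 0) :
    cellVec i k (cellParam i k z) = z := by
  have hY : sumY i k (cellParam i k z) = 1 - ‖z i‖ - ‖z k‖ := by
    have h1 : ∀ l, ‖midY i k (cellParam i k z) l‖ + (if l = i then ‖z i‖ else 0) +
        (if l = k then ‖z k‖ else 0) = ‖z l‖ := by
      intro l
      rcases lt_trichotomy l i with h2 | rfl | h2
      · rw [if_neg h2.ne, if_neg (h2.trans h).ne, h0 l (Or.inl h2), midY,
          if_neg (by rintro ⟨h3, -⟩; exact absurd h3 (not_lt.2 (Fin.lt_def.1 h2).le))]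
        simp
      · rw [if_pos rfl, if_neg h.ne, midY, if_neg (by simp)]
        simp
      · rcases lt_trichotomy l k with h4 | rfl | h4
        · rw [if_neg h2.ne', if_neg h4.ne, midY_cellParam h2 h4]
          simp
        · rw [if_pos rfl, if_neg h2.ne', midY, if_neg (by simp)]
          simp
        · rw [if_neg h2.ne', if_neg h4.ne', h0 l (Or.inr h4), midY,
            if_neg (by rintro ⟨-, h3⟩; exact absurd h3 (not_lt.2 (Fin.lt_def.1 h4).le))]
          simp
    have h2 := Finset.sum_congr (s₁ := Finset.univ) rfl fun l _ => h1 l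
    rw [hz, Finset.sum_add_distrib, Finset.sum_add_distrib, Finset.sum_ite_eq',
      Finset.sum_ite_eq', if_pos (Finset.mem_univ _), if_pos (Finset.mem_univ _), ← sumY] at h2
    linarith
  have hi' : (z i).re = ‖z i‖ := by rw [hi]; simp
  have hk' : (z k).re = ‖z k‖ := by rw [hk]; simp
  funext l
  rcases lt_trichotomy l i with h2 | rfl | h2
  · rw [cellVec_eq_zero h (Or.inl h2), h0 l (Or.inl h2)]
  · rw [cellVec_left, hY, ex_cellParam_zero h, hi', hk', hi]
    congr 1
    rw [← hi]
    ring
  · rcases lt_trichotomy l k with h4 | rfl | h4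
    · rw [cellVec_mid h2 h4, midY_cellParam h2 h4]
    · rw [cellVec_right h, hY, ex_cellParam_zero h, hi', hk', hk]
      congr 1
      rw [← hk]
      ring
    · rw [cellVec_eq_zero h (Or.inr h4), h0 l (Or.inr h4)]

lemma cellVec_injective (h : i < k) :
    Function.Injective (cellVec i k : (Fin (2 * ((k : ℕ) - i) - 1) → ℝ) → _) := by
  intro x y hxy
  have h1 := congrArg Complex.re (congrFun hxy i)
  have h2 := congrArg Complex.re (congrFun hxy k)
  rw [cellVec_left, cellVec_left, Complex.ofReal_re, Complex.ofReal_re] at h1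
  rw [cellVec_right h, cellVec_right h, Complex.ofReal_re, Complex.ofReal_re] at h2
  have h0 : ex x 0 = ex y 0 := by linarith
  funext ⟨a, ha⟩
  have hex : ∀ x : Fin (2 * ((k : ℕ) - i) - 1) → ℝ, ex x a = x ⟨a, ha⟩ := fun x => dif_pos ha
  rw [← hex x, ← hex y]
  rcases Nat.eq_zero_or_pos a with rfl | hpos
  · exact h0
  · have hk := k.2
    have hl : (i : ℕ) + (a + 1) / 2 < n + 1 := by omega
    have h3 := congrFun hxy ⟨i + (a + 1) / 2, hl⟩
    rw [cellVec_mid (by rw [Fin.lt_def]; simp; omega) (by rw [Fin.lt_def]; simp; omega),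
      cellVec_mid (by rw [Fin.lt_def]; simp; omega) (by rw [Fin.lt_def]; simp; omega), midY,
      midY, if_pos ⟨by simp; omega, by simp; omega⟩, if_pos ⟨by simp; omega, by simp; omega⟩,
      Complex.mk.injEq] at h3
    simp only [Nat.add_sub_cancel_left] at h3
    rcases Nat.even_or_odd' a with ⟨b, rfl | rfl⟩
    · have e : 2 * ((2 * b + 1) / 2) = 2 * b := by omega
      rw [e] at h3
      exact h3.2
    · have e : 2 * ((2 * b + 1 + 1) / 2) - 1 = 2 * b + 1 := by omega
      rw [e] at h3
      exact h3.1

end CellVec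

/-! ### The radial homeomorphism from the cube to the parameters of a cell -/

section CellRad

variable {n : ℕ} {i k : Fin (n + 1)} {r : ℝ}

/-- The radial map from the cube onto the set of parameters of a cell. -/
def cellRad (r : ℝ) (i k : Fin (n + 1)) (x : Fin (2 * ((k : ℕ) - i) - 1) → ℝ) :
    Fin (2 * ((k : ℕ) - i) - 1) → ℝ := (‖x‖ / cellGauge r i k x) • x

/-- The inverse of the radial map. -/
def cellUnrad (r : ℝ) (i k : Fin (n + 1)) (x : Fin (2 * ((k : ℕ) - i) - 1) → ℝ) :
    Fin (2 * ((k : ℕ) - i) - 1) → ℝ := (cellGauge r i k x / ‖x‖) • x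

lemma cellGauge_nonneg (x : Fin (2 * ((k : ℕ) - i) - 1) → ℝ) : 0 ≤ cellGauge r i k x :=
  (norm_nonneg x).trans (norm_le_cellGauge x)

lemma cellGauge_pos {x : Fin (2 * ((k : ℕ) - i) - 1) → ℝ} (hx : x ≠ 0) :
    0 < cellGauge r i k x :=
  (norm_pos_iff.2 hx).trans_le (norm_le_cellGauge x)

lemma cellGauge_zero : cellGauge r i k (0 : Fin (2 * ((k : ℕ) - i) - 1) → ℝ) = 0 := by
  rw [← zero_smul ℝ (0 : Fin (2 * ((k : ℕ) - i) - 1) → ℝ), cellGauge_smul le_rfl, zero_mul]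

lemma cellGauge_cellRad (x : Fin (2 * ((k : ℕ) - i) - 1) → ℝ) :
    cellGauge r i k (cellRad r i k x) = ‖x‖ := by
  rw [cellRad, cellGauge_smul (div_nonneg (norm_nonneg _) (cellGauge_nonneg x))]
  by_cases hx : x = 0
  · simp [hx]
  · exact div_mul_cancel₀ _ (cellGauge_pos hx).ne'

lemma norm_cellUnrad (x : Fin (2 * ((k : ℕ) - i) - 1) → ℝ) :
    ‖cellUnrad r i k x‖ = cellGauge r i k x := by
  rw [cellUnrad, norm_smul, Real.norm_of_nonneg (div_nonneg (cellGauge_nonneg x) (norm_nonneg _))]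
  by_cases hx : x = 0
  · simp [hx, cellGauge_zero]
  · exact div_mul_cancel₀ _ (norm_ne_zero_iff.2 hx)

lemma cellRad_cellUnrad (x : Fin (2 * ((k : ℕ) - i) - 1) → ℝ) :
    cellRad r i k (cellUnrad r i k x) = x := by
  by_cases hx : x = 0
  · simp [hx, cellRad, cellUnrad]
  · have h1 := (cellGauge_pos (r := r) hx).ne'
    have h2 := norm_ne_zero_iff.2 hx
    rw [cellRad, norm_cellUnrad, cellUnrad,
      cellGauge_smul (div_nonneg (cellGauge_nonneg x) (norm_nonneg _)), smul_smul]
    convert one_smul ℝ x using 2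
    field_simp

lemma cellUnrad_cellRad (x : Fin (2 * ((k : ℕ) - i) - 1) → ℝ) :
    cellUnrad r i k (cellRad r i k x) = x := by
  by_cases hx : x = 0
  · simp [hx, cellRad, cellUnrad]
  · have h1 := (cellGauge_pos (r := r) hx).ne'
    have h2 := norm_ne_zero_iff.2 hx
    rw [cellUnrad, cellGauge_cellRad, cellRad, norm_smul,
      Real.norm_of_nonneg (div_nonneg (norm_nonneg _) (cellGauge_nonneg x)), smul_smul]
    convert one_smul ℝ x using 2
    field_simp

/-- At 0 the quotient ‖x‖/gauge need not converge, but it is at most 1, which suffices after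
multiplication by x. -/
lemma continuous_cellRad : Continuous (cellRad r i k) := by
  rw [continuous_iff_continuousAt]
  intro x
  by_cases hx : x = 0
  · subst hx
    have h0 : cellRad r i k 0 = 0 := smul_zero _
    rw [ContinuousAt, h0]
    refine squeeze_zero_norm (a := fun x => ‖x‖) (fun x => ?_) ?_
    · rw [cellRad, norm_smul,
        Real.norm_of_nonneg (div_nonneg (norm_nonneg _) (cellGauge_nonneg x))]
      exact mul_le_of_le_one_left (norm_nonneg _)
        (div_le_one_of_le₀ (norm_le_cellGauge x) (cellGauge_nonneg x))
    · simpa using (continuous_norm.tendsto (0 : Fin (2 * ((k : ℕ) - i) - 1) → ℝ))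
  · exact (continuous_norm.continuousAt.div (continuous_cellGauge r).continuousAt
      (cellGauge_pos hx).ne').smul continuousAt_id

end CellRad

/-! ### Normal forms and characteristic maps -/

section

variable {n : ℕ} {r : ℝ} [hP : Params n r]

lemma grpDev_div_le_iff {d : ℕ} {i k : Fin (n + 1)} (h : i < k) (hg : grp n i ≠ grp n k)
    {x : Fin d → ℝ} (hx : |ex x 0| + sumY i k x ≤ 1) (g : Fin 3) :
    grpDev i k x g / grpBound r i k g ≤ 1 ↔ gs (cellVec i k x) g ≤ 1 - r := by
  rw [div_le_one (grpBound_pos hP.lt hg g), gs_cellVec h hx, grpBound]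
  constructor <;> intro h <;> linarith

lemma grpDev_div_lt_iff {d : ℕ} {i k : Fin (n + 1)} (h : i < k) (hg : grp n i ≠ grp n k)
    {x : Fin d → ℝ} (hx : |ex x 0| + sumY i k x ≤ 1) (g : Fin 3) :
    grpDev i k x g / grpBound r i k g < 1 ↔ gs (cellVec i k x) g < 1 - r := by
  rw [div_lt_one (grpBound_pos hP.lt hg g), gs_cellVec h hx, grpBound]
  constructor <;> intro h <;> linarith

lemma cellVec_mem {i k : Fin (n + 1)} (h : i < k) (hg : grp n i ≠ grp n k)
    {x : Fin (2 * ((k : ℕ) - i) - 1) → ℝ} (hx : cellGauge r i k x ≤ 1) :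
    (fun l => ‖cellVec i k x l‖) ∈ DeltaQ n r := by
  rw [cellGauge_le_iff] at hx
  exact mem_Zsp.2 ⟨sum_norm_cellVec h hx.1, fun g => (grpDev_div_le_iff h hg hx.1 g).1 (hx.2 g)⟩

/-- The index set of the cells of positive dimension. -/
abbrev CellIx (n : ℕ) : Type :=
  {p : Fin (n + 1) × Fin (n + 1) // (p.1 : ℕ) ≤ n / 2 ∧ n / 2 ≤ (p.2 : ℕ) ∧ p.1 < p.2}

lemma CellIx.grp_ne (o : CellIx n) : grp n o.1.1 ≠ grp n o.1.2 := by
  obtain ⟨⟨i, k⟩, h1, h2, h3⟩ := o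
  simp only [Fin.lt_def] at h1 h2 h3 ⊢
  unfold grp
  split_ifs <;> simp <;> omega

/-- The dimension of a cell. -/
abbrev CellIx.dim (o : CellIx n) : ℕ := 2 * ((o.1.2 : ℕ) - o.1.1) - 1

/-- The characteristic map of a cell, with values in the complex model. -/
def cellZ (o : CellIx n) : C(Cube o.dim, Zsp n r) :=
  ⟨fun x => ⟨cellVec o.1.1 o.1.2 (cellRad r o.1.1 o.1.2 x.1),
    cellVec_mem o.2.2.2 o.grp_ne (by rw [cellGauge_cellRad]; exact x.norm_le)⟩,
    Continuous.subtype_mk ((continuous_cellVec _ _).comp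
      (continuous_cellRad.comp continuous_subtype_val)) _⟩

lemma cellZ_apply (o : CellIx n) (x : Cube o.dim) (l : Fin (n + 1)) :
    (cellZ o x : Zsp n r).1 l = cellVec o.1.1 o.1.2 (cellRad r o.1.1 o.1.2 x.1) l := rfl

/-- The vector is in normal form with respect to the cell. -/
structure IsNormal (o : CellIx n) (z : Zsp n r) : Prop where
  left : z.1 o.1.1 = ‖z.1 o.1.1‖
  right : z.1 o.1.2 = ‖z.1 o.1.2‖
  zero : ∀ l, l < o.1.1 ∨ o.1.2 < l → z.1 l = 0

lemma gauge_aux (o : CellIx n) (x : Cube o.dim) :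
    |ex (cellRad r o.1.1 o.1.2 x.1) 0| + sumY o.1.1 o.1.2 (cellRad r o.1.1 o.1.2 x.1) ≤ 1 :=
  (le_max_left _ _).trans ((cellGauge_cellRad (r := r) x.1).le.trans x.norm_le)

lemma isNormal_cellZ (o : CellIx n) (x : Cube o.dim) : IsNormal o (cellZ o x : Zsp n r) := by
  have h := gauge_aux (r := r) o x
  have h1 := neg_abs_le (ex (cellRad r o.1.1 o.1.2 x.1) 0)
  have h2 := le_abs_self (ex (cellRad r o.1.1 o.1.2 x.1) 0)
  constructor
  · rw [cellZ_apply, cellVec_left, Complex.norm_of_nonneg (by linarith)]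
  · rw [cellZ_apply, cellVec_right o.2.2.2, Complex.norm_of_nonneg (by linarith)]
  · exact fun l hl => cellVec_eq_zero o.2.2.2 hl _

/-- The interior of a cell consists of the points which are not over the boundary and whose
extreme coordinates do not vanish. -/
lemma notMem_cubeBdry_iff (o : CellIx n) (x : Cube o.dim) : x ∉ cubeBdry o.dim ↔
    ¬ IsBd (cellZ o x : Zsp n r) ∧ (cellZ o x : Zsp n r).1 o.1.1 ≠ 0 ∧
      (cellZ o x : Zsp n r).1 o.1.2 ≠ 0 := by
  have h := gauge_aux (r := r) o x
  have e : x ∉ cubeBdry o.dim ↔ cellGauge r o.1.1 o.1.2 (cellRad r o.1.1 o.1.2 x.1) < 1 := by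
    rw [cellGauge_cellRad]
    exact ⟨fun h => lt_of_le_of_ne x.norm_le h, fun h => h.ne⟩
  rw [e, cellGauge_lt_iff, and_comm]
  refine and_congr ?_ ?_
  · rw [IsBd, not_exists]
    refine forall_congr' fun g => ?_
    rw [grpDev_div_lt_iff o.2.2.2 o.grp_ne h]
    exact ⟨fun h => h.ne, fun h => lt_of_le_of_ne (Zsp.gs_le (cellZ o x : Zsp n r) g) h⟩
  · rw [cellZ_apply, cellZ_apply, cellVec_left, cellVec_right o.2.2.2, Complex.ofReal_ne_zero,
      Complex.ofReal_ne_zero]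
    generalize ex (cellRad r o.1.1 o.1.2 x.1) 0 = u at *
    generalize sumY o.1.1 o.1.2 (cellRad r o.1.1 o.1.2 x.1) = Y at *
    constructor
    · intro h1
      have := neg_abs_le u
      have := le_abs_self u
      exact ⟨by linarith, by linarith⟩
    · rintro ⟨h1, h2⟩
      refine lt_of_le_of_ne h fun h3 => ?_
      rcases abs_choice u with h4 | h4 <;> rw [h4] at h3
      · exact h2 (by linarith)
      · exact h1 (by linarith)

/-- The parameters of z have gauge at most 1: the first term says that the extreme coordinates are
nonnegative, the others that the group sums are at most 1 - r. The inverse radial map then lands in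
the cube. -/
lemma exists_cellZ_eq {o : CellIx n} {z : Zsp n r} (h : IsNormal o z) :
    ∃ x, cellZ o x = z := by
  have h1 := cellVec_cellParam o.2.2.2 z.sum_eq h.left h.right h.zero
  have hY : |ex (cellParam o.1.1 o.1.2 z.1) 0| + sumY o.1.1 o.1.2 (cellParam o.1.1 o.1.2 z.1) ≤ 1 := by
    have h2 := congrArg Complex.re (congrFun h1 o.1.1)
    have h3 := congrArg Complex.re (congrFun h1 o.1.2)
    rw [cellVec_left, h.left, Complex.ofReal_re, Complex.ofReal_re] at h2
    rw [cellVec_right o.2.2.2, h.right, Complex.ofReal_re, Complex.ofReal_re] at h3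
    have h4 := norm_nonneg (z.1 o.1.1)
    have h5 := norm_nonneg (z.1 o.1.2)
    rw [← le_sub_iff_add_le, abs_le]
    constructor <;> linarith
  have hg : cellGauge r o.1.1 o.1.2 (cellParam o.1.1 o.1.2 z.1) ≤ 1 := by
    rw [cellGauge_le_iff]
    refine ⟨hY, fun g => ?_⟩
    rw [grpDev_div_le_iff o.2.2.2 o.grp_ne hY, h1]
    exact z.gs_le g
  refine ⟨⟨cellUnrad r o.1.1 o.1.2 (cellParam o.1.1 o.1.2 z.1), ?_⟩, Subtype.ext ?_⟩
  · rwa [mem_closedBall_zero_iff, norm_cellUnrad]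
  · refine Eq.trans ?_ h1
    change cellVec _ _ (cellRad _ _ _ (cellUnrad _ _ _ _)) = _
    rw [cellRad_cellUnrad]

lemma cellZ_injective (o : CellIx n) : Function.Injective (cellZ o : C(_, Zsp n r)) := by
  intro x y h
  have h1 := cellVec_injective o.2.2.2 (congrArg Subtype.val h)
  have h2 := congrArg (cellUnrad r o.1.1 o.1.2) h1
  rw [cellUnrad_cellRad, cellUnrad_cellRad] at h2
  exact Subtype.ext h2

lemma exists_circle_mul (w : ℂ) : ∃ u : Circle, u * w = ‖w‖ := by
  refine ⟨(Circle.exp (Complex.arg w))⁻¹, ?_⟩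
  nth_rw 2 [← Complex.norm_mul_exp_arg_mul_I w]
  rw [mul_comm, mul_assoc, ← Circle.coe_exp, ← Circle.coe_mul, mul_inv_cancel, Circle.coe_one,
    mul_one]

lemma Zsp.exists_grp_ne (z : Zsp n r) (g : Fin 3) : ∃ l, grp n l ≠ g ∧ z.1 l ≠ 0 := by
  by_contra! h
  have h1 : gs z.1 g = 1 := by
    rw [← z.sum_eq]
    unfold gs grpSum
    refine Finset.sum_subset (Finset.subset_univ _) fun l _ hl => ?_
    simp only [Finset.mem_filter, Finset.mem_univ, true_and] at hl
    rw [h l hl, norm_zero]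
  linarith [z.gs_le g, hP.pos]

/-- The places i and k are the extremes of the support of z, and their phases are removed by the
two-torus. -/
lemma exists_isNormal (z : Zsp n r) : ∃ (o : CellIx n) (t : Circle × Circle),
    IsNormal o (t • z) ∧ z.1 o.1.1 ≠ 0 ∧ z.1 o.1.2 ≠ 0 := by
  classical
  let S : Finset (Fin (n + 1)) := Finset.univ.filter (fun l : Fin (n + 1) => z.1 l ≠ 0)
  have hS : ∀ l, l ∈ S ↔ z.1 l ≠ 0 := fun l => by simp [S]
  obtain ⟨l0, h0, h0'⟩ := z.exists_grp_ne 0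
  obtain ⟨l1, h1, h1'⟩ := z.exists_grp_ne 1
  obtain ⟨l2, h2, h2'⟩ := z.exists_grp_ne 2
  have hne : S.Nonempty := ⟨l0, (hS _).2 h0'⟩
  have hmin := fun l (hl : z.1 l ≠ 0) => S.min'_le l ((hS l).2 hl)
  have hmax := fun l (hl : z.1 l ≠ 0) => S.le_max' l ((hS l).2 hl)
  have hi := (hS _).1 (S.min'_mem hne)
  have hk := (hS _).1 (S.max'_mem hne)
  generalize hI : S.min' hne = i at hi
  generalize hK : S.max' hne = k at hk
  replace hmin : ∀ l, z.1 l ≠ 0 → (i : ℕ) ≤ l := fun l hl => by rw [← hI]; exact hmin l hl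
  replace hmax : ∀ l, z.1 l ≠ 0 → (l : ℕ) ≤ k := fun l hl => by rw [← hK]; exact hmax l hl
  rw [Ne, grp_eq_zero] at h0
  rw [Ne, grp_eq_one] at h1
  rw [Ne, grp_eq_two] at h2
  have h01 := hmin l0 h0'
  have h02 := hmax l0 h0'
  have h11 := hmin l1 h1'
  have h12 := hmax l1 h1'
  have h21 := hmin l2 h2'
  have h22 := hmax l2 h2'
  -- A nonzero coordinate outside the last group gives i ≤ n/2, one outside the first group gives
  -- n/2 ≤ k, and one outside the middle group excludes i = k = n/2.
  let o : CellIx n := ⟨(i, k), by simp; omega, by simp; omega, by rw [Fin.lt_def]; simp; omega⟩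
  obtain ⟨a, ha⟩ := exists_circle_mul (z.1 i)
  obtain ⟨b, hb⟩ := exists_circle_mul (z.1 k)
  obtain ⟨t, ht1, ht2⟩ := exists_chi_eq o.grp_ne a b
  refine ⟨o, t, ⟨?_, ?_, ?_⟩, hi, hk⟩
  · rw [smul_apply, ht1, ha]
    simp
  · rw [smul_apply, ht2, hb]
    simp
  · intro l hl
    rw [smul_apply]
    have : z.1 l = 0 := by
      by_contra h
      have := hmin l h
      have := hmax l h
      rcases hl with hl | hl
      · have := Fin.lt_def.1 hl
        simp [o] at this
        omega
      · have := Fin.lt_def.1 hl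
        simp [o] at this
        omega
    rw [this, mul_zero]

lemma chi_eq_one {i k : Fin (n + 1)} (h : grp n i ≠ grp n k) {t : Circle × Circle}
    (hi : chi n i t = 1) (hk : chi n k t = 1) (l : Fin (n + 1)) : chi n l t = 1 := by
  by_cases h1 : grp n l = grp n i
  · rw [chi_eq h1, hi]
  by_cases h2 : grp n l = grp n k
  · rw [chi_eq h2, hk]
  · simpa [hi, hk] using chi_mul_mul h h1 h2 t

/-- An element preserving positivity at both extreme places has trivial characters there. As these
places are in different groups, all its characters are trivial. -/
lemma IsNormal.eq_of_smul {o : CellIx n} {z z' : Zsp n r} (h : IsNormal o z) (h' : IsNormal o z')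
    (h1 : z.1 o.1.1 ≠ 0) (h2 : z.1 o.1.2 ≠ 0) {t : Circle × Circle} (ht : t • z = z') : z = z' := by
  have key : ∀ l, z.1 l = ‖z.1 l‖ → z'.1 l = ‖z'.1 l‖ → z.1 l ≠ 0 → chi n l t = 1 := by
    intro l e1 e2 hne
    have e3 : chi n l t * z.1 l = z'.1 l := by rw [← ht]; rfl
    have e4 : ‖z'.1 l‖ = ‖z.1 l‖ := by rw [← e3]; simp [Circle.norm_coe]
    rw [e2, e4, ← e1] at e3
    exact Circle.ext (by simpa using (mul_eq_right₀ hne).1 e3)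
  have h3 := chi_eq_one o.grp_ne (key _ h.left h'.left h1) (key _ h.right h'.right h2)
  rw [← ht]
  refine Subtype.ext (funext fun l => ?_)
  rw [smul_apply, h3, Circle.coe_one, one_mul]

lemma isBd_smul {t : Circle × Circle} {z : Zsp n r} : IsBd (t • z) ↔ IsBd z := by
  simp only [IsBd, gs_smul]

/-- The index of the open cell is recovered as the pair of extremes of the support, which is
constant on orbits. -/
lemma cellZ_index_eq {o o' : CellIx n} {x : Cube o.dim} {x' : Cube o'.dim}
    (hx : x ∉ cubeBdry o.dim) (hx' : x' ∉ cubeBdry o'.dim)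
    (h : toX (cellZ o x : Zsp n r) = toX (cellZ o' x')) : o = o' := by
  obtain ⟨h1, h2, h3⟩ := (notMem_cubeBdry_iff (r := r) o x).1 hx
  obtain ⟨h1', h2', h3'⟩ := (notMem_cubeBdry_iff (r := r) o' x').1 hx'
  rcases toX_eq_iff.1 h with ⟨t, ht⟩ | h
  swap
  · exact absurd h.1 h1
  have e : ∀ l, (cellZ o x : Zsp n r).1 l = 0 ↔ (cellZ o' x' : Zsp n r).1 l = 0 := by
    intro l
    rw [← ht, smul_apply]
    simp
  have hz := (isNormal_cellZ (r := r) o x).zero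
  have hz' := (isNormal_cellZ (r := r) o' x').zero
  have a1 : o'.1.1 ≤ o.1.1 := by
    by_contra hc
    exact h2 ((e _).2 (hz' _ (Or.inl (not_le.1 hc))))
  have a2 : o.1.1 ≤ o'.1.1 := by
    by_contra hc
    exact h2' ((e _).1 (hz _ (Or.inl (not_le.1 hc))))
  have b1 : o'.1.2 ≤ o.1.2 := by
    by_contra hc
    exact h3' ((e _).1 (hz _ (Or.inr (not_le.1 hc))))
  have b2 : o.1.2 ≤ o'.1.2 := by
    by_contra hc
    exact h3 ((e _).2 (hz' _ (Or.inr (not_le.1 hc))))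
  exact Subtype.ext (Prod.ext (le_antisymm a2 a1) (le_antisymm b2 b1))

lemma injOn_toX_cellZ (o : CellIx n) :
    Set.InjOn (fun x => toX (cellZ o x : Zsp n r)) (cubeBdry o.dim)ᶜ := by
  intro x hx x' hx' h
  obtain ⟨h1, h2, h3⟩ := (notMem_cubeBdry_iff (r := r) o x).1 hx
  obtain ⟨h1', h2', h3'⟩ := (notMem_cubeBdry_iff (r := r) o x').1 hx'
  rcases toX_eq_iff.1 h with ⟨t, ht⟩ | h
  · exact (cellZ_injective (r := r) o ((isNormal_cellZ o x').eq_of_smul (isNormal_cellZ o x)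
      h2' h3' ht)).symm
  · exact absurd h.1 h1

lemma exists_toX_cellZ_eq {z : Zsp n r} (hb : ¬ IsBd z) : ∃ o : CellIx n,
    (z.1 o.1.1 ≠ 0 ∧ z.1 o.1.2 ≠ 0) ∧ ∃ x ∉ cubeBdry o.dim, toX (cellZ o x : Zsp n r) = toX z := by
  obtain ⟨o, t, h1, h2, h3⟩ := exists_isNormal z
  obtain ⟨x, hx⟩ := exists_cellZ_eq h1
  refine ⟨o, ⟨h2, h3⟩, x, (notMem_cubeBdry_iff (r := r) o x).2 ?_, toX_eq_iff.2 (Or.inl ⟨t, hx.symm⟩)⟩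
  rw [hx, isBd_smul, smul_apply, smul_apply]
  exact ⟨hb, by simpa using h2, by simpa using h3⟩

/-- Off the boundary of W, being on the boundary of the cube means that an extreme coordinate
vanishes. The support then spans a strictly shorter interval. -/
lemma exists_toX_cellZ_eq_of_mem_cubeBdry {o : CellIx n} {x : Cube o.dim} (hx : x ∈ cubeBdry o.dim)
    (hb : ¬ IsBd (cellZ o x : Zsp n r)) : ∃ o' : CellIx n, o'.dim < o.dim ∧
      ∃ x' ∉ cubeBdry o'.dim, toX (cellZ o' x' : Zsp n r) = toX (cellZ o x) := by
  have h0 : ¬ (¬ IsBd (cellZ o x : Zsp n r) ∧ (cellZ o x : Zsp n r).1 o.1.1 ≠ 0 ∧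
      (cellZ o x : Zsp n r).1 o.1.2 ≠ 0) := fun h =>
    (notMem_cubeBdry_iff (r := r) o x).2 h hx
  obtain ⟨o', ⟨h2, h3⟩, h⟩ := exists_toX_cellZ_eq hb
  refine ⟨o', ?_, h⟩
  have hz := (isNormal_cellZ (r := r) o x).zero
  have a1 : o.1.1 ≤ o'.1.1 := by
    by_contra hc
    exact h2 (hz _ (Or.inl (not_le.1 hc)))
  have a2 : o'.1.2 ≤ o.1.2 := by
    by_contra hc
    exact h3 (hz _ (Or.inr (not_le.1 hc)))
  have a3 : ¬ (o.1.1 = o'.1.1 ∧ o.1.2 = o'.1.2) := by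
    rintro ⟨e1, e2⟩
    rw [← e1] at h2
    rw [← e2] at h3
    exact h0 ⟨hb, h2, h3⟩
  rw [Fin.ext_iff, Fin.ext_iff] at a3
  rw [Fin.le_def] at a1 a2
  have hlt' := Fin.lt_def.1 o'.2.2.2
  have hlt := Fin.lt_def.1 o.2.2.2
  unfold CellIx.dim
  omega

/-- The centre of the cube. -/
def Cube.centre (d : ℕ) : Cube d := ⟨0, mem_closedBall_zero_iff.2 (by simp)⟩

lemma centre_notMem_cubeBdry (d : ℕ) : Cube.centre d ∉ cubeBdry d := by
  intro h
  have h1 : ‖(0 : Fin d → ℝ)‖ = 1 := h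
  simp at h1

lemma Cube.eq_centre (x : Cube 0) : x = Cube.centre 0 :=
  Subtype.ext (Subsingleton.elim (α := Fin 0 → ℝ) _ _)

variable (n r) in
/-- The cells of `W / ∂W`. -/
def cells : CellData (WModBoundary n r) (Option (CellIx n)) where
  dim o := o.elim 0 CellIx.dim
  Φ o := match o with
    | none => ⟨fun _ => basePt n r, continuous_const⟩
    | some o => toX.comp (cellZ o)
  eq_of_eq := by
    rintro (_ | o) (_ | o') x x' hx hx' h
    · rfl
    · exact absurd (toX_eq_basePt_iff.1 h.symm) ((notMem_cubeBdry_iff o' x').1 hx').1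
    · exact absurd (toX_eq_basePt_iff.1 h) ((notMem_cubeBdry_iff o x).1 hx).1
    · exact congrArg some (cellZ_index_eq hx hx' h)
  injOn := by
    rintro (_ | o)
    · exact fun x _ x' _ _ => (Cube.eq_centre x).trans (Cube.eq_centre x').symm
    · exact injOn_toX_cellZ o
  cover y := by
    obtain ⟨z, rfl⟩ := toX_surjective y
    by_cases hb : IsBd z
    · exact ⟨none, Cube.centre 0, centre_notMem_cubeBdry 0, (toX_eq_basePt_iff.2 hb).symm⟩
    · obtain ⟨o, -, h⟩ := exists_toX_cellZ_eq hb
      exact ⟨some o, h⟩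
  bdry := by
    rintro (_ | o) x hx
    · exact absurd hx (by rw [Cube.eq_centre x]; exact centre_notMem_cubeBdry 0)
    · by_cases hb : IsBd (cellZ o x : Zsp n r)
      · refine ⟨none, ?_, Cube.centre 0, centre_notMem_cubeBdry 0, (toX_eq_basePt_iff.2 hb).symm⟩
        have hlt := Fin.lt_def.1 o.2.2.2
        change 0 < 2 * ((o.1.2 : ℕ) - o.1.1) - 1
        omega
      · obtain ⟨o', h⟩ := exists_toX_cellZ_eq_of_mem_cubeBdry hx hb
        exact ⟨some o', h⟩

end

/-! ### The homology of `W / ∂W` -/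

section Point

variable {X : Type} [TopologicalSpace X] (p : X)

lemma mono_homologyMap_incl_singleton (i : ℕ) :
    Mono (HomologicalComplex.homologyMap (singMap (incl {p})) i) := by
  let ρ : C(X, ({p} : Set X)) := ⟨fun _ => ⟨p, rfl⟩, continuous_const⟩
  have h : singMap (incl {p}) ≫ singMap ρ = 𝟙 _ := by
    rw [singMap_comp, ← singMap_id]
    congr 1
    ext x
    exact x.2.symm
  have h2 : HomologicalComplex.homologyMap (singMap (incl {p})) i ≫
      HomologicalComplex.homologyMap (singMap ρ) i = 𝟙 _ := by
    rw [← HomologicalComplex.homologyMap_comp, h, HomologicalComplex.homologyMap_id]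
  have : Mono (HomologicalComplex.homologyMap (singMap (incl {p})) i ≫
      HomologicalComplex.homologyMap (singMap ρ) i) := by
    rw [h2]
    infer_instance
  exact mono_of_mono _ (HomologicalComplex.homologyMap (singMap ρ) i)

/-- The inclusion of a point is split by the constant map. So the connecting map vanishes, also in
degree 1, where the point has homology. -/
lemma nonempty_singH_iso_relH {i : ℕ} (hi : i ≠ 0) :
    Nonempty (singH i X ≅ relH i X {p}) := by
  have hS := relSES_shortExact ({p} : Set X)
  obtain ⟨j, rfl⟩ := Nat.exists_eq_succ_of_ne_zero hi
  have hij : (ComplexShape.down ℕ).Rel (j + 1) j := rfl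
  have hm : Mono (HomologicalComplex.homologyMap (relSES ({p} : Set X)).f j) :=
    mono_homologyMap_incl_singleton p j
  have hδ : hS.δ (j + 1) j hij = 0 := by
    rw [← cancel_mono (HomologicalComplex.homologyMap (relSES ({p} : Set X)).f j), zero_comp]
    exact hS.δ_comp _ _ _
  have he : Epi (HomologicalComplex.homologyMap (relSES ({p} : Set X)).g (j + 1)) :=
    (hS.homology_exact₃ (j + 1) j hij).epi_f hδ
  have hz : IsZero ((relSES ({p} : Set X)).X₁.homology (j + 1)) :=
    isZero_singH_subsingleton (X := ({p} : Set X)) hi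
  have hm' : Mono (HomologicalComplex.homologyMap (relSES ({p} : Set X)).g (j + 1)) :=
    (hS.homology_exact₂ (j + 1)).mono_g (hz.eq_of_src _ _)
  have := isIso_of_mono_of_epi (HomologicalComplex.homologyMap (relSES ({p} : Set X)).g (j + 1))
  exact ⟨@asIso _ _ _ _ _ this⟩

lemma nonempty_singH_zero_iso (h : IsZero (relH 0 X {p})) :
    Nonempty (singH 0 X ≅ ModuleCat.of ℤ ℤ) := by
  have hS := relSES_shortExact ({p} : Set X)
  have hm : Mono (HomologicalComplex.homologyMap (relSES ({p} : Set X)).f 0) :=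
    mono_homologyMap_incl_singleton p 0
  have he : Epi (HomologicalComplex.homologyMap (relSES ({p} : Set X)).f 0) :=
    (hS.homology_exact₂ 0).epi_f (h.eq_of_tgt _ _)
  have := isIso_of_mono_of_epi (HomologicalComplex.homologyMap (relSES ({p} : Set X)).f 0)
  obtain ⟨e⟩ := singH_subsingleton_zero (X := ({p} : Set X))
  exact ⟨(asIso (HomologicalComplex.homologyMap (relSES ({p} : Set X)).f 0)).symm ≪≫ e⟩

end Point

section

variable (n : ℕ) (r : ℝ) [hP : Params n r]

lemma cells_lower_none : (cells n r).Lower {none} := by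
  intro o ho o' h
  rw [Finset.mem_singleton] at ho
  subst ho
  exact absurd h (Nat.not_lt_zero _)

lemma cells_F_none : (cells n r).F {none} = {basePt n r} := by
  ext y
  rw [CellData.mem_F]
  constructor
  · rintro ⟨o, ho, x, rfl⟩
    rw [Finset.mem_singleton] at ho
    subst ho
    rfl
  · rintro rfl
    exact ⟨none, Finset.mem_singleton_self _, Cube.centre 0, rfl⟩

lemma odd_cellIx_dim (o : CellIx n) : Odd o.dim := by
  have := Fin.lt_def.1 o.2.2.2
  exact ⟨(o.1.2 : ℕ) - o.1.1 - 1, by unfold CellIx.dim; omega⟩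

lemma odd_cells_dim (o : Option (CellIx n)) (ho : o ∉ ({none} : Finset (Option (CellIx n)))) :
    Odd ((cells n r).dim o) := by
  match o with
  | none => exact absurd (Finset.mem_singleton_self _) ho
  | some o => exact odd_cellIx_dim n o

/-- The relative homology of `W / ∂W` modulo the base point has a basis indexed by the cells. -/
lemma nonempty_basis_relH_basePt (i : ℕ) :
    Nonempty (Module.Basis {o : CellIx n // o.dim = i} ℤ (relH i (WModBoundary n r) {basePt n r})) := by
  classical
  obtain ⟨b⟩ := (cells n r).nonempty_basis_relH _ {none} rfl (cells_lower_none n r)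
    (odd_cells_dim n r) i
  rw [cells_F_none] at b
  refine ⟨b.reindex
    { toFun := fun o => ⟨o.1.get (by
        rw [Option.isSome_iff_ne_none]
        exact fun h => o.2.1 (by rw [h]; exact Finset.mem_singleton_self _)), ?_⟩
      invFun := fun o => ⟨some o.1, by simp, o.2⟩
      left_inv := fun o => by simp
      right_inv := fun o => by simp }⟩
  obtain ⟨o, h1, h2⟩ := o
  match o with
  | none => exact absurd (Finset.mem_singleton_self _) h1
  | some o => exact h2

end

/-! ### Charts -/

section TwoPlaces

variable {n : ℕ} {i k : Fin (n + 1)}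

lemma norm_add_single_add_single (h : i ≠ k) {v : Fin (n + 1) → ℂ} (hi : v i = 0) (hk : v k = 0)
    {a b : ℝ} (ha : 0 ≤ a) (hb : 0 ≤ b) (l : Fin (n + 1)) :
    ‖(v + Pi.single i (a : ℂ) + Pi.single k (b : ℂ) : Fin (n + 1) → ℂ) l‖ =
      ‖v l‖ + (if l = i then a else 0) + (if l = k then b else 0) := by
  simp only [Pi.add_apply, Pi.single_apply]
  split_ifs with h1 h2 h2
  · exact absurd (h1.symm.trans h2) h
  · subst h1
    rw [hi, add_zero, zero_add, Complex.norm_of_nonneg ha]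
    simp
  · subst h2
    rw [hk, add_zero, zero_add, Complex.norm_of_nonneg hb]
    simp
  · simp

lemma gs_add_single_add_single (h : i ≠ k) {v : Fin (n + 1) → ℂ} (hi : v i = 0) (hk : v k = 0)
    {a b : ℝ} (ha : 0 ≤ a) (hb : 0 ≤ b) (g : Fin 3) :
    gs (v + Pi.single i (a : ℂ) + Pi.single k (b : ℂ)) g =
      gs v g + (if grp n i = g then a else 0) + (if grp n k = g then b else 0) := by
  unfold gs grpSum
  simp only [norm_add_single_add_single h hi hk ha hb, Finset.sum_add_distrib, Finset.sum_ite_eq',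
    Finset.mem_filter, Finset.mem_univ, true_and]

lemma sum_norm_add_single_add_single (h : i ≠ k) {v : Fin (n + 1) → ℂ} (hi : v i = 0)
    (hk : v k = 0) {a b : ℝ} (ha : 0 ≤ a) (hb : 0 ≤ b) :
    ∑ l, ‖(v + Pi.single i (a : ℂ) + Pi.single k (b : ℂ) : Fin (n + 1) → ℂ) l‖ = ∑ l, ‖v l‖ + a + b := by
  simp only [norm_add_single_add_single h hi hk ha hb, Finset.sum_add_distrib, Finset.sum_ite_eq',
    Finset.mem_univ, if_true]

variable (i k) in
/-- The vector spaces of the coordinates apart from those at the places `i` and `k`. -/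
abbrev OtherCoords : Type := {l : Fin (n + 1) // l ≠ i ∧ l ≠ k} → ℂ

/-- Extension of a vector by zero at the places `i` and `k`. -/
def extZero (y : OtherCoords i k) (l : Fin (n + 1)) : ℂ := if h : l ≠ i ∧ l ≠ k then y ⟨l, h⟩ else 0

lemma extZero_left (y : OtherCoords i k) : extZero y i = 0 := dif_neg (by simp)

lemma extZero_right (y : OtherCoords i k) : extZero y k = 0 := dif_neg (by simp)

lemma continuous_extZero : Continuous fun y : OtherCoords i k => extZero y := by
  refine continuous_pi fun l => ?_
  unfold extZero
  split_ifs <;> fun_prop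

/-- The value at the place `i` determined by the other coordinates. -/
def leftVal (r : ℝ) (p : ℝ≥0 × OtherCoords i k) : ℝ := 1 - r - p.1 - gs (extZero p.2) (grp n i)

/-- The value at the place `k` determined by the other coordinates. -/
def rightVal (r : ℝ) (p : ℝ≥0 × OtherCoords i k) : ℝ :=
  r + p.1 - (∑ l, ‖extZero p.2 l‖ - gs (extZero p.2) (grp n i))

/-- The vector of the complex model determined by its chart coordinates. -/
def chartVec (r : ℝ) (p : ℝ≥0 × OtherCoords i k) : Fin (n + 1) → ℂ :=
  extZero p.2 + Pi.single i (leftVal r p : ℂ) + Pi.single k (rightVal r p : ℂ)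

lemma continuous_leftVal (r : ℝ) : Continuous (leftVal r : ℝ≥0 × OtherCoords i k → ℝ) :=
  (continuous_const.sub (NNReal.continuous_coe.comp continuous_fst)).sub
    ((continuous_gs _).comp (continuous_extZero.comp continuous_snd))

lemma continuous_rightVal (r : ℝ) : Continuous (rightVal r : ℝ≥0 × OtherCoords i k → ℝ) := by
  have h := continuous_extZero.comp (continuous_snd (X := ℝ≥0) (Y := OtherCoords i k))
  exact (continuous_const.add (NNReal.continuous_coe.comp continuous_fst)).sub
    ((continuous_finsetSum _ fun l _ => ((continuous_apply l).comp h).norm).sub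
      ((continuous_gs _).comp h))

lemma continuous_chartVec (r : ℝ) : Continuous (chartVec r : ℝ≥0 × OtherCoords i k → _) := by
  have h := continuous_extZero.comp (continuous_snd (X := ℝ≥0) (Y := OtherCoords i k))
  refine (h.add ((continuous_single i).comp (Complex.continuous_ofReal.comp
    (continuous_leftVal r)))).add ((continuous_single k).comp (Complex.continuous_ofReal.comp
    (continuous_rightVal r)))

lemma chartVec_left (h : i ≠ k) (r : ℝ) (p : ℝ≥0 × OtherCoords i k) :
    chartVec r p i = leftVal r p := by
  simp [chartVec, extZero_left, h]

lemma chartVec_right (h : i ≠ k) (r : ℝ) (p : ℝ≥0 × OtherCoords i k) :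
    chartVec r p k = rightVal r p := by
  simp [chartVec, extZero_right, h.symm]

lemma chartVec_of_ne (r : ℝ) (p : ℝ≥0 × OtherCoords i k) {l : Fin (n + 1)} (h : l ≠ i ∧ l ≠ k) :
    chartVec r p l = p.2 ⟨l, h⟩ := by
  simp [chartVec, extZero, h.1, h.2]

lemma gs_chartVec_left (h : grp n i ≠ grp n k) {r : ℝ} {p : ℝ≥0 × OtherCoords i k}
    (h1 : 0 ≤ leftVal r p) (h2 : 0 ≤ rightVal r p) : gs (chartVec r p) (grp n i) = 1 - r - p.1 := by
  rw [chartVec, gs_add_single_add_single (by rintro rfl; exact h rfl) (extZero_left _)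
    (extZero_right _) h1 h2, if_pos rfl, if_neg h.symm, leftVal]
  ring

lemma sum_norm_chartVec (h : i ≠ k) {r : ℝ} {p : ℝ≥0 × OtherCoords i k}
    (h1 : 0 ≤ leftVal r p) (h2 : 0 ≤ rightVal r p) : ∑ l, ‖chartVec r p l‖ = 1 := by
  unfold chartVec
  rw [sum_norm_add_single_add_single h (extZero_left _) (extZero_right _) h1 h2, leftVal, rightVal]
  ring

/-- The unit complex number `conj w / |w|`. -/
def conjPhase (w : ℂ) : ℂ := (starRingEnd ℂ) w / ‖w‖

lemma mul_conjPhase (w : ℂ) : w * conjPhase w = ‖w‖ := by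
  rcases eq_or_ne w 0 with rfl | h
  · simp
  · have h1 : (‖w‖ : ℂ) ≠ 0 := by exact_mod_cast norm_ne_zero_iff.2 h
    rw [conjPhase, ← mul_div_assoc, Complex.mul_conj, Complex.normSq_eq_norm_sq]
    push_cast
    field_simp

lemma norm_conjPhase {w : ℂ} (h : w ≠ 0) : ‖conjPhase w‖ = 1 := by
  have h1 := norm_ne_zero_iff.2 h
  rw [conjPhase, norm_div, RCLike.norm_conj, Complex.norm_real, norm_norm, div_self h1]

lemma conjPhase_circle_mul (c : Circle) (w : ℂ) : conjPhase (c * w) = (c⁻¹ : Circle) * conjPhase w := by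
  rw [conjPhase, conjPhase, map_mul, norm_mul, Circle.norm_coe, one_mul, Circle.coe_inv_eq_conj,
    mul_div_assoc]

lemma conjPhase_ofReal {a : ℝ} (h : 0 < a) : conjPhase a = 1 := by
  rw [conjPhase, Complex.conj_ofReal, Complex.norm_of_nonneg h.le,
    div_self (by exact_mod_cast h.ne')]

lemma continuousAt_conjPhase {w : ℂ} (h : w ≠ 0) : ContinuousAt conjPhase w :=
  Complex.continuous_conj.continuousAt.div
    (Complex.continuous_ofReal.comp continuous_norm).continuousAt
    (by exact_mod_cast norm_ne_zero_iff.2 h)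

variable (i k) in
/-- The factor which normalises the coordinate at a place, making the coordinates at `i` and `k`
positive. -/
def normFactor (z : Fin (n + 1) → ℂ) (l : Fin (n + 1)) : ℂ :=
  if grp n l = grp n i then conjPhase (z i) else if grp n l = grp n k then conjPhase (z k)
  else (starRingEnd ℂ) (conjPhase (z i)) * (starRingEnd ℂ) (conjPhase (z k))

lemma continuousAt_normFactor {z : Fin (n + 1) → ℂ} (hi : z i ≠ 0) (hk : z k ≠ 0)
    (l : Fin (n + 1)) : ContinuousAt (fun z => normFactor i k z l) z := by
  have h1 : ContinuousAt (fun z : Fin (n + 1) → ℂ => conjPhase (z i)) z :=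
    ContinuousAt.comp (f := fun z : Fin (n + 1) → ℂ => z i) (continuousAt_conjPhase hi)
      (continuous_apply i).continuousAt
  have h2 : ContinuousAt (fun z : Fin (n + 1) → ℂ => conjPhase (z k)) z :=
    ContinuousAt.comp (f := fun z : Fin (n + 1) → ℂ => z k) (continuousAt_conjPhase hk)
      (continuous_apply k).continuousAt
  unfold normFactor
  split_ifs
  · exact h1
  · exact h2
  · exact (Complex.continuous_conj.continuousAt.comp h1).mul
      (Complex.continuous_conj.continuousAt.comp h2)

end TwoPlaces

/-! ### Normalised coordinates and the charts of `W` -/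

section

variable {n : ℕ} {r : ℝ} {i k : Fin (n + 1)}

lemma exists_smul_eq_normFactor (h : grp n i ≠ grp n k) {z : Zsp n r} (hi : z.1 i ≠ 0)
    (hk : z.1 k ≠ 0) : ∃ t : Circle × Circle, ∀ l, (chi n l t : ℂ) = normFactor i k z.1 l := by
  obtain ⟨t, h1, h2⟩ := exists_chi_eq h
    ⟨conjPhase (z.1 i), mem_sphere_zero_iff_norm.2 (norm_conjPhase hi)⟩
    ⟨conjPhase (z.1 k), mem_sphere_zero_iff_norm.2 (norm_conjPhase hk)⟩
  have h1' : (chi n i t : ℂ) = conjPhase (z.1 i) := congrArg Subtype.val h1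
  have h2' : (chi n k t : ℂ) = conjPhase (z.1 k) := congrArg Subtype.val h2
  refine ⟨t, fun l => ?_⟩
  unfold normFactor
  split_ifs with h3 h4
  · rw [chi_eq h3, h1']
  · rw [chi_eq h4, h2']
  · have h5 : chi n l t = (chi n i t)⁻¹ * (chi n k t)⁻¹ := by
      rw [← mul_inv, eq_inv_iff_mul_eq_one, mul_comm]
      exact chi_mul_mul h h3 h4 t
    rw [h5, Circle.coe_mul, Circle.coe_inv_eq_conj, Circle.coe_inv_eq_conj, h1', h2']

/-- The normalising factor changes by the inverse of the character at the same place, so normalised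
coordinates are functions on the orbit space. -/
lemma normFactor_smul_mul (h : grp n i ≠ grp n k) (t : Circle × Circle) (z : Zsp n r)
    (l : Fin (n + 1)) :
    normFactor i k (t • z).1 l * (t • z).1 l = normFactor i k z.1 l * z.1 l := by
  have key : normFactor i k (t • z).1 l = ((chi n l t)⁻¹ : Circle) * normFactor i k z.1 l := by
    unfold normFactor
    rw [smul_apply, smul_apply, conjPhase_circle_mul, conjPhase_circle_mul]
    split_ifs with h3 h4
    · rw [chi_eq h3]
    · rw [chi_eq h4]
    · have h5 : (chi n l t)⁻¹ = chi n i t * chi n k t := by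
        rw [inv_eq_iff_mul_eq_one, mul_comm]
        exact chi_mul_mul h h3 h4 t
      rw [h5, map_mul, map_mul, ← Circle.coe_inv_eq_conj, ← Circle.coe_inv_eq_conj, inv_inv,
        inv_inv, Circle.coe_mul]
      ring
  rw [key, smul_apply, mul_right_comm, ← mul_assoc, mul_right_comm, ← Circle.coe_mul,
    inv_mul_cancel, Circle.coe_one, one_mul, mul_comm]

/-- The points of the complex model at which the chart is defined. -/
def chartDom (n : ℕ) (r : ℝ) (i k : Fin (n + 1)) : Set (Zsp n r) :=
  {z | z.1 i ≠ 0 ∧ z.1 k ≠ 0 ∧ ∀ g, g ≠ grp n i → gs z.1 g < 1 - r}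

lemma isOpen_chartDom : IsOpen (chartDom n r i k) := by
  have h : ∀ l, Continuous fun z : Zsp n r => z.1 l := fun l =>
    (continuous_apply l).comp continuous_subtype_val
  have hg : ∀ g, Continuous fun z : Zsp n r => gs z.1 g := fun g =>
    (continuous_gs g).comp continuous_subtype_val
  simp only [chartDom, Set.ofPred_and, Set.ofPred_forall]
  refine (isOpen_ne_fun (h i) continuous_const).inter
    ((isOpen_ne_fun (h k) continuous_const).inter (isOpen_iInter_of_finite fun g => ?_))
  exact isOpen_iInter_of_finite fun _ => isOpen_lt (hg g) continuous_const

lemma smul_mem_chartDom {t : Circle × Circle} {z : Zsp n r} :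
    t • z ∈ chartDom n r i k ↔ z ∈ chartDom n r i k := by
  simp [chartDom, gs_smul, smul_apply]

/-- The chart coordinates of a point of the complex model. -/
def chartFun (i k : Fin (n + 1)) (z : Zsp n r) : ℝ≥0 × OtherCoords i k :=
  (Real.toNNReal (1 - r - gs z.1 (grp n i)), fun l => normFactor i k z.1 l * z.1 l)

lemma chartFun_smul (h : grp n i ≠ grp n k) (t : Circle × Circle) (z : Zsp n r) :
    chartFun i k (t • z) = chartFun i k z := by
  refine Prod.ext ?_ (funext fun l => normFactor_smul_mul h t z l)
  simp only [chartFun, gs_smul]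

lemma continuousAt_chartFun {z : Zsp n r} (hz : z ∈ chartDom n r i k) :
    ContinuousAt (chartFun i k) z := by
  refine ContinuousAt.prodMk ?_ (continuousAt_pi.2 fun l => ?_)
  · exact (continuous_real_toNNReal.comp (continuous_const.sub ((continuous_gs _).comp
      continuous_subtype_val))).continuousAt
  · exact ((continuousAt_normFactor hz.1 hz.2.1 l).comp continuous_subtype_val.continuousAt).mul
      ((continuous_apply l.1).comp continuous_subtype_val).continuousAt

lemma gs_eq_of_smul_eq {t : Circle × Circle} {z : Zsp n r} {v : Fin (n + 1) → ℂ}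
    (h : v = (t • z).1) (g : Fin 3) : gs v g = gs z.1 g := by
  rw [h, gs_smul]

/-- After normalisation z_i and z_k are positive reals. The sum of the group of i and the total sum
are two linear equations for them, with solutions `leftVal` and `rightVal`. -/
lemma chartVec_chartFun (h : grp n i ≠ grp n k) {z : Zsp n r} (hz : z ∈ chartDom n r i k) :
    leftVal r (chartFun i k z) = ‖z.1 i‖ ∧ rightVal r (chartFun i k z) = ‖z.1 k‖ ∧
    ∃ t : Circle × Circle, chartVec r (chartFun i k z) = (t • z).1 := by
  have hne : i ≠ k := by rintro rfl; exact h rfl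
  obtain ⟨t, ht⟩ := exists_smul_eq_normFactor h hz.1 hz.2.1
  obtain ⟨A, hA⟩ : ∃ A, A = ‖z.1 i‖ := ⟨_, rfl⟩
  obtain ⟨B, hB⟩ : ∃ B, B = ‖z.1 k‖ := ⟨_, rfl⟩
  rw [← hA, ← hB]
  have hnorm : ∀ l, ‖z.1 l‖ = ‖extZero (chartFun i k z).2 l‖ + (if l = i then A else 0) +
      (if l = k then B else 0) := by
    intro l
    by_cases h1 : l ≠ i ∧ l ≠ k
    · rw [extZero, dif_pos h1, if_neg h1.1, if_neg h1.2]
      simp only [chartFun]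
      rw [← ht, norm_mul, Circle.norm_coe]
      simp
    · rw [extZero, dif_neg h1]
      by_cases h2 : l = i
      · subst h2
        simp [hne, hA]
      · have h3 : l = k := by tauto
        subst h3
        simp [hne.symm, hB]
  have hs : ((Real.toNNReal (1 - r - gs z.1 (grp n i)) : ℝ≥0) : ℝ) = 1 - r - gs z.1 (grp n i) :=
    Real.coe_toNNReal _ (by linarith [z.gs_le (grp n i)])
  have hg : gs z.1 (grp n i) = gs (extZero (chartFun i k z).2) (grp n i) + A := by
    unfold gs grpSum
    simp only [hnorm, Finset.sum_add_distrib, Finset.sum_ite_eq', Finset.mem_filter,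
      Finset.mem_univ, true_and]
    simp [h.symm]
  have hsum := z.sum_eq
  simp only [hnorm, Finset.sum_add_distrib, Finset.sum_ite_eq', Finset.mem_univ, if_true] at hsum
  have hl : leftVal r (chartFun i k z) = A := by
    rw [leftVal]
    change 1 - r - ((Real.toNNReal (1 - r - gs z.1 (grp n i)) : ℝ≥0) : ℝ) - _ = _
    rw [hs]
    linarith
  have hr : rightVal r (chartFun i k z) = B := by
    rw [rightVal]
    change r + ((Real.toNNReal (1 - r - gs z.1 (grp n i)) : ℝ≥0) : ℝ) - _ = _
    rw [hs]
    linarith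
  refine ⟨hl, hr, t, funext fun l => ?_⟩
  rw [smul_apply, ht]
  by_cases h1 : l ≠ i ∧ l ≠ k
  · rw [chartVec_of_ne _ _ h1]
    rfl
  by_cases h2 : l = i
  · subst h2
    rw [chartVec_left hne, hl, hA, normFactor, if_pos rfl, mul_comm, mul_conjPhase]
  · have h3 : l = k := by tauto
    subst h3
    rw [chartVec_right hne, hr, hB, normFactor, if_neg h.symm, if_pos rfl, mul_comm, mul_conjPhase]

/-- The image of the chart. -/
def chartImg (r : ℝ) (i k : Fin (n + 1)) : Set (ℝ≥0 × OtherCoords i k) :=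
  {p | 0 < leftVal r p ∧ 0 < rightVal r p ∧ ∀ g, g ≠ grp n i → gs (chartVec r p) g < 1 - r}

lemma isOpen_chartImg : IsOpen (chartImg r i k) := by
  simp only [chartImg, Set.ofPred_and, Set.ofPred_forall]
  refine (isOpen_lt continuous_const (continuous_leftVal r)).inter
    ((isOpen_lt continuous_const (continuous_rightVal r)).inter
      (isOpen_iInter_of_finite fun g => ?_))
  exact isOpen_iInter_of_finite fun _ =>
    isOpen_lt ((continuous_gs g).comp (continuous_chartVec r)) continuous_const

lemma chartVec_mem (h : grp n i ≠ grp n k) {p : ℝ≥0 × OtherCoords i k} (hp : p ∈ chartImg r i k) :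
    (fun l => ‖chartVec r p l‖) ∈ DeltaQ n r := by
  have hne : i ≠ k := by rintro rfl; exact h rfl
  refine mem_Zsp.2 ⟨sum_norm_chartVec hne hp.1.le hp.2.1.le, fun g => ?_⟩
  by_cases hg : g = grp n i
  · rw [hg, gs_chartVec_left h hp.1.le hp.2.1.le]
    linarith [p.1.2]
  · exact (hp.2.2 g hg).le

lemma chartFun_chartVec (h : grp n i ≠ grp n k) {p : ℝ≥0 × OtherCoords i k}
    (hp : p ∈ chartImg r i k) : chartFun i k (⟨chartVec r p, chartVec_mem h hp⟩ : Zsp n r) = p := by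
  have hne : i ≠ k := by rintro rfl; exact h rfl
  refine Prod.ext ?_ (funext fun l => ?_)
  · change Real.toNNReal (1 - r - gs (chartVec r p) (grp n i)) = _
    rw [gs_chartVec_left h hp.1.le hp.2.1.le]
    simp
  · change normFactor i k (chartVec r p) l * chartVec r p l = _
    rw [chartVec_of_ne _ _ l.2, normFactor, chartVec_left hne, chartVec_right hne,
      conjPhase_ofReal hp.1, conjPhase_ofReal hp.2.1]
    simp

variable [hP : Params n r]

/-- The charts of `W`. -/
def wChart (r : ℝ) [hP : Params n r] {i k : Fin (n + 1)} (h : grp n i ≠ grp n k) :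
    OpenPartialHomeomorph (W n r) (ℝ≥0 × OtherCoords i k) :=
  have hsurj : Function.Surjective (toW : Zsp n r → W n r) := isOpenQuotientMap_toW.surjective
  have hf : ∀ z : Zsp n r, chartFun i k (Function.surjInv hsurj (toW z)) = chartFun i k z := by
    intro z
    obtain ⟨t, ht⟩ := toW_eq_iff.1 (Function.surjInv_eq hsurj (toW z))
    rw [← ht, chartFun_smul h]
  have hsrc : ∀ z : Zsp n r, toW z ∈ toW '' chartDom n r i k ↔ z ∈ chartDom n r i k := by
    intro z
    refine ⟨?_, fun hz => ⟨z, hz, rfl⟩⟩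
    rintro ⟨z', hz', h'⟩
    obtain ⟨t, rfl⟩ := toW_eq_iff.1 h'
    exact smul_mem_chartDom.1 hz'
  have himg : ∀ z ∈ chartDom n r i k, chartFun i k z ∈ chartImg r i k := by
    intro z hz
    obtain ⟨h1, h2, t, ht⟩ := chartVec_chartFun h hz
    refine ⟨by rw [h1]; exact norm_pos_iff.2 hz.1, by rw [h2]; exact norm_pos_iff.2 hz.2.1,
      fun g hg => ?_⟩
    rw [gs_eq_of_smul_eq ht]
    exact hz.2.2 g hg
  { toFun := fun w => chartFun i k (Function.surjInv hsurj w)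
    invFun := fun p => by
      classical
      -- Outside the target the value is arbitrary; a point over the base point is used.
      exact if hp : p ∈ chartImg r i k then toW ⟨chartVec r p, chartVec_mem h hp⟩
        else toW (Function.surjInv toX_surjective (basePt n r))
    source := toW '' chartDom n r i k
    target := chartImg r i k
    map_source' := by
      rintro _ ⟨z, hz, rfl⟩
      rw [hf]
      exact himg z hz
    map_target' := by
      intro p hp
      rw [dif_pos hp, hsrc]
      have hne : i ≠ k := by rintro rfl; exact h rfl
      refine ⟨?_, ?_, hp.2.2⟩
      · change chartVec r p i ≠ 0
        rw [chartVec_left hne]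
        exact_mod_cast hp.1.ne'
      · change chartVec r p k ≠ 0
        rw [chartVec_right hne]
        exact_mod_cast hp.2.1.ne'
    left_inv' := by
      rintro _ ⟨z, hz, rfl⟩
      rw [hf, dif_pos (himg z hz)]
      obtain ⟨h1, h2, t, ht⟩ := chartVec_chartFun h hz
      exact toW_eq_iff.2 ⟨t, Subtype.ext ht.symm⟩
    right_inv' := by
      intro p hp
      rw [dif_pos hp, hf, chartFun_chartVec h hp]
    open_source := isOpenQuotientMap_toW.isOpenMap _ isOpen_chartDom
    open_target := isOpen_chartImg
    continuousOn_toFun := by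
      rintro _ ⟨z, hz, rfl⟩
      refine ContinuousAt.continuousWithinAt ?_
      refine isOpenQuotientMap_toW.continuousAt_comp_iff.1 ?_
      exact (continuousAt_chartFun hz).congr (Filter.Eventually.of_forall fun z => (hf z).symm)
    continuousOn_invFun := by
      rw [continuousOn_iff_continuous_domRestrict]
      have h1 : Continuous fun p : chartImg r i k =>
          (toW ⟨chartVec r p.1, chartVec_mem h p.2⟩ : W n r) :=
        continuous_toW.comp (Continuous.subtype_mk
          ((continuous_chartVec r).comp continuous_subtype_val) _)
      convert h1 using 1
      funext p
      exact dif_pos p.2 }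

lemma wChart_source (h : grp n i ≠ grp n k) (z : Zsp n r) :
    toW z ∈ (wChart r h).source ↔ z ∈ chartDom n r i k := by
  refine ⟨?_, fun hz => ⟨z, hz, rfl⟩⟩
  rintro ⟨z', hz', h'⟩
  obtain ⟨t, rfl⟩ := toW_eq_iff.1 h'
  exact smul_mem_chartDom.1 hz'

lemma wChart_apply (h : grp n i ≠ grp n k) (z : Zsp n r) :
    wChart r h (toW z) = chartFun i k z := by
  have hsurj : Function.Surjective (toW : Zsp n r → W n r) := isOpenQuotientMap_toW.surjective
  obtain ⟨t, ht⟩ := toW_eq_iff.1 (Function.surjInv_eq hsurj (toW z))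
  change chartFun i k (Function.surjInv hsurj (toW z)) = _
  rw [← ht, chartFun_smul h]

/-- The place i is taken in a group with the largest sum. Every other group sum is then at most 1/2,
hence below 1 - r, so only the bound for the group of i can be attained nearby. -/
lemma exists_mem_chartDom (z : Zsp n r) :
    ∃ i k, grp n i ≠ grp n k ∧ z ∈ chartDom n r i k := by
  obtain ⟨g, -, hg⟩ := Finset.exists_max_image Finset.univ (fun g => gs z.1 g)
    ⟨0, Finset.mem_univ _⟩
  have hpos : 0 < gs z.1 g := by
    by_contra hc
    have h := z.gs_add
    have h0 := hg 0 (Finset.mem_univ _)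
    have h1 := hg 1 (Finset.mem_univ _)
    have h2 := hg 2 (Finset.mem_univ _)
    linarith
  have hi : ∃ i, grp n i = g ∧ z.1 i ≠ 0 := by
    by_contra! hc
    have : gs z.1 g = 0 := by
      unfold gs grpSum
      refine Finset.sum_eq_zero fun l hl => ?_
      rw [hc l (Finset.mem_filter.1 hl).2, norm_zero]
    linarith
  obtain ⟨i, rfl, hi⟩ := hi
  obtain ⟨k, hk, hk'⟩ := z.exists_grp_ne (grp n i)
  refine ⟨i, k, hk.symm, hi, hk', fun g' hg' => ?_⟩
  have h1 := hg g' (Finset.mem_univ _)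
  have h2 := z.gs_add_le hg'
  have := hP.lt
  linarith

lemma toW_mem_boundaryW_iff_chartFun {z : Zsp n r} (hz : z ∈ chartDom n r i k) :
    toW z ∈ boundaryW n r ↔ (chartFun i k z).1 = 0 := by
  rw [toW_mem_boundaryW]
  change _ ↔ Real.toNNReal (1 - r - gs z.1 (grp n i)) = 0
  rw [Real.toNNReal_eq_zero]
  constructor
  · rintro ⟨g, hg⟩
    have : g = grp n i := by
      by_contra hc
      exact (hz.2.2 g hc).ne hg
    rw [← this]
    linarith
  · intro h
    exact ⟨grp n i, le_antisymm (z.gs_le _) (by linarith)⟩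

lemma finrank_otherCoords (h : i ≠ k) :
    Module.finrank ℝ (OtherCoords i k) = Module.finrank ℝ (Fin (2 * n - 1 - 1) → ℝ) := by
  rw [Module.finrank_pi_fintype, Module.finrank_fin_fun]
  simp only [Complex.finrank_real_complex, Finset.sum_const, Finset.card_univ, smul_eq_mul]
  have : Fintype.card {l : Fin (n + 1) // l ≠ i ∧ l ≠ k} = n - 1 := by
    rw [Fintype.card_subtype]
    have e : (Finset.univ.filter fun l : Fin (n + 1) => l ≠ i ∧ l ≠ k) =
        (Finset.univ.erase i).erase k := by
      ext l
      simp [and_comm]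
    rw [e, Finset.card_erase_of_mem (by simp [h.symm]), Finset.card_erase_of_mem (by simp)]
    simp
  rw [this]
  omega

variable (n r) in
theorem isManifoldWithBoundary_W : IsManifoldWithBoundary (2 * n - 1) (W n r) (boundaryW n r) where
  t2 := inferInstance
  secondCountable := inferInstance
  exists_chart w := by
    obtain ⟨z, rfl⟩ := isOpenQuotientMap_toW.surjective w
    obtain ⟨i, k, h, hz⟩ := exists_mem_chartDom z
    let L : OtherCoords i k ≃L[ℝ] (Fin (2 * n - 1 - 1) → ℝ) :=
      ContinuousLinearEquiv.ofFinrankEq (finrank_otherCoords (by rintro rfl; exact h rfl))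
    refine ⟨(wChart r h).transHomeomorph ((Homeomorph.refl _).prodCongr L.toHomeomorph),
      (wChart_source h z).2 hz, ?_⟩
    rintro _ ⟨z', hz', rfl⟩
    rw [toW_mem_boundaryW_iff_chartFun hz', ← wChart_apply h]
    rfl

end

/-! ### Local homology -/

section LocalHomology

variable {X Y : Type} [TopologicalSpace X] [TopologicalSpace Y]

lemma mapsTo_compl_image {φ : C(Y, X)} (hφ : Function.Injective φ) (S : Set Y) :
    Set.MapsTo φ Sᶜ (φ '' S)ᶜ := by
  rintro y hy ⟨y', hy', h⟩
  exact hy (hφ h ▸ hy')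

/-- Excision for an open embedding. -/
lemma quasiIso_relMap_of_isOpenEmbedding {φ : C(Y, X)} (hφ : Topology.IsOpenEmbedding φ) (S : Set Y)
    (hS : closure (φ '' S) ⊆ Set.range φ) :
    QuasiIso (relMap φ (mapsTo_compl_image hφ.injective S)) := by
  let e : Y ≃ₜ Set.range φ := hφ.toIsEmbedding.toHomeomorph
  have he : ∀ y, (e y : X) = φ y := fun _ => rfl
  have h1 : Set.MapsTo (e : C(Y, Set.range φ)) Sᶜ
      ((Subtype.val : Set.range φ → X) ⁻¹' (φ '' S)ᶜ) :=
    fun y hy => mapsTo_compl_image hφ.injective S hy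
  have h2 : Set.MapsTo (e.symm : C(Set.range φ, Y))
      ((Subtype.val : Set.range φ → X) ⁻¹' (φ '' S)ᶜ) Sᶜ := by
    intro x hx hS
    refine hx ⟨e.symm x, hS, ?_⟩
    rw [← he]
    exact congrArg Subtype.val (e.apply_symm_apply x)
  have h3 := isIso_relMap_homeomorph e h1 h2
  have h4 : QuasiIso (relMap (incl (Set.range φ)) (mapsTo_incl_preimage (φ '' S)ᶜ (Set.range φ))) := by
    refine quasiIso_excision ?_
    rw [interior_compl, hφ.isOpen_range.interior_eq, Set.eq_univ_iff_forall]
    intro x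
    by_cases hx : x ∈ closure (φ '' S)
    · exact Or.inr (hS hx)
    · exact Or.inl hx
  have h5 : relMap φ (mapsTo_compl_image hφ.injective S) = relMap (e : C(Y, Set.range φ)) h1 ≫
      relMap (incl (Set.range φ)) (mapsTo_incl_preimage (φ '' S)ᶜ (Set.range φ)) := by
    rw [relMap_comp]
    rfl
  rw [h5]
  infer_instance

/-- In a normed space, the complement of a ball and the complement of a point of the ball have the
same relative homology. -/
lemma quasiIso_relInc_compl_ball {E : Type} [NormedAddCommGroup E] [NormedSpace ℝ E] {R : ℝ}
    {y : E} (hy : y ∈ Metric.ball 0 R) :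
    QuasiIso (relInc (Set.compl_subset_compl.2 (Set.singleton_subset_iff.2 hy))) := by
  have hy' : ‖y‖ < R := mem_ball_zero_iff.1 hy
  have hpos : ∀ x : ({y}ᶜ : Set E), 0 < ‖x.1 - y‖ := fun x =>
    norm_pos_iff.2 (sub_ne_zero.2 x.2)
  let s : unitInterval × ({y}ᶜ : Set E) → ℝ := fun p => 1 + p.1 * (2 * R / ‖p.2.1 - y‖)
  have hR : 0 < R := (norm_nonneg y).trans_lt hy'
  have hs : ∀ p, 1 ≤ s p := fun p => by
    have := p.1.2.1
    have := (hpos p.2).le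
    have : 0 ≤ (p.1 : ℝ) * (2 * R / ‖p.2.1 - y‖) := by positivity
    simp only [s]
    linarith
  have hsc : Continuous s := by
    refine continuous_const.add ((continuous_subtype_val.comp continuous_fst).mul
      (continuous_const.div ?_ fun p => (hpos p.2).ne'))
    exact ((continuous_subtype_val.comp continuous_snd).sub continuous_const).norm
  refine quasiIso_relMap_of_deformation _
    ⟨fun p => y + s p • (p.2.1 - y), continuous_const.add (hsc.smul
      ((continuous_subtype_val.comp continuous_snd).sub continuous_const))⟩ ?_ ?_ ?_ ?_
  · intro x
    simp [s]
  · intro t x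
    change y + s (t, x) • (x.1 - y) ≠ y
    rw [Ne, add_eq_left, smul_eq_zero, not_or]
    exact ⟨by linarith [hs (t, x)], sub_ne_zero.2 x.2⟩
  · intro t x hx hb
    refine hx ?_
    have h1 := hs (t, x)
    have hconv := (convex_ball (0 : E) R)
    -- If the moved point were in the ball, then x, lying between it and y, would be in the ball by
    -- convexity.
    have h2 : x.1 = (1 - (s (t, x))⁻¹) • y + (s (t, x))⁻¹ • (y + s (t, x) • (x.1 - y)) := by
      rw [smul_add, smul_smul, inv_mul_cancel₀ (by linarith), one_smul, sub_smul, one_smul]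
      abel
    rw [h2]
    exact hconv hy hb (sub_nonneg.2 (inv_le_one_of_one_le₀ h1)) (by positivity) (by ring)
  · intro x hb
    have h1 : ‖y + s (1, x) • (x.1 - y)‖ < R := mem_ball_zero_iff.1 hb
    -- The scale is chosen so that at time 1 the distance from y has grown by 2R. Since ‖y‖ < R, the
    -- point is then outside the ball.
    have h2 : ‖s (1, x) • (x.1 - y)‖ = ‖x.1 - y‖ + 2 * R := by
      have := hpos x
      rw [norm_smul, Real.norm_of_nonneg (by linarith [hs (1, x)])]
      simp only [s, Set.Icc.coe_one]
      field_simp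
    have h3 := norm_sub_le (y + s (1, x) • (x.1 - y)) y
    rw [add_sub_cancel_left, h2] at h3
    linarith [hpos x]

/-- In a Hausdorff space, the complement of a coordinate ball and the complement of a point of that
ball have the same relative homology. -/
lemma quasiIso_relInc_compl_image_ball [T2Space X] {E : Type} [NormedAddCommGroup E]
    [NormedSpace ℝ E] [ProperSpace E] {φ : C(E, X)} (hφ : Topology.IsOpenEmbedding φ) {R : ℝ} {y : E}
    (hy : y ∈ Metric.ball 0 R) (h : (φ '' Metric.ball 0 R)ᶜ ⊆ {φ y}ᶜ) : QuasiIso (relInc h) := by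
  have h1 := quasiIso_relMap_of_isOpenEmbedding hφ (Metric.ball 0 R) (by
    have hK : IsClosed (φ '' Metric.closedBall 0 R) :=
      ((isCompact_closedBall 0 R).image φ.continuous).isClosed
    exact (closure_minimal (Set.image_mono Metric.ball_subset_closedBall) hK).trans
      (Set.image_subset_range _ _))
  have h2 := quasiIso_relMap_of_isOpenEmbedding hφ {y} (by
    rw [Set.image_singleton, closure_singleton, Set.singleton_subset_iff]
    exact ⟨y, rfl⟩)
  have h3 := quasiIso_relInc_compl_ball hy
  have h' : (φ '' Metric.ball 0 R)ᶜ ⊆ (φ '' {y})ᶜ := by rwa [Set.image_singleton]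
  have h4 : relMap φ (mapsTo_compl_image hφ.injective (Metric.ball 0 R)) ≫ relInc h' =
      relInc (Set.compl_subset_compl.2 (Set.singleton_subset_iff.2 hy)) ≫
        relMap φ (mapsTo_compl_image hφ.injective {y}) := by
    rw [relMap_comp, relMap_comp]
    rfl
  have h5 : QuasiIso (relMap φ (mapsTo_compl_image hφ.injective (Metric.ball 0 R)) ≫ relInc h') := by
    rw [h4]
    infer_instance
  have h6 := quasiIso_of_comp_left (relMap φ (mapsTo_compl_image hφ.injective (Metric.ball 0 R)))
    (relInc h')
  convert h6 using 2 <;> rw [Set.image_singleton]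

lemma epi_homologyMap_comp_iff {A B C : Set X} (h : A ⊆ B) (h' : B ⊆ C) [QuasiIso (relInc h')]
    (i : ℕ) : Epi (HomologicalComplex.homologyMap (relInc (h.trans h')) i) ↔
      Epi (HomologicalComplex.homologyMap (relInc h) i) := by
  have e : relInc (h.trans h') = relInc h ≫ relInc h' := by
    rw [relMap_comp]
    rfl
  rw [e, HomologicalComplex.homologyMap_comp]
  constructor
  · intro h1
    have : HomologicalComplex.homologyMap (relInc h) i =
        (HomologicalComplex.homologyMap (relInc h) i ≫
          HomologicalComplex.homologyMap (relInc h') i) ≫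
            inv (HomologicalComplex.homologyMap (relInc h') i) := by simp
    rw [this]
    exact epi_comp _ _
  · intro h1
    exact epi_comp _ _

/-- If a class of `H_d(X, {p})` restricts to a generator of the local homology at one point of
`X ∖ {p}`, then it does so at all of them. -/
lemma epi_homologyMap_relInc_of_isPreconnected [T2Space X] {E : Type} [NormedAddCommGroup E]
    [NormedSpace ℝ E] [ProperSpace E] {p : X} (hp : IsPreconnected ({p}ᶜ : Set X))
    (hchart : ∀ y ≠ p, ∃ φ : C(E, X), Topology.IsOpenEmbedding φ ∧ φ 0 = y ∧ p ∉ Set.range φ) (i : ℕ)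
    {x y : X} (hx : {p} ⊆ ({x}ᶜ : Set X)) (hy : {p} ⊆ ({y}ᶜ : Set X))
    (h : Epi (HomologicalComplex.homologyMap (relInc hx) i)) :
    Epi (HomologicalComplex.homologyMap (relInc hy) i) := by
  let P : X → Prop := fun z => ∀ hz : {p} ⊆ ({z}ᶜ : Set X),
    Epi (HomologicalComplex.homologyMap (relInc hz) i)
  have hsub : ∀ z, {p} ⊆ ({z}ᶜ : Set X) ↔ z ≠ p := fun z => by
    rw [Set.singleton_subset_iff]
    exact ⟨fun h => Ne.symm h, fun h => Ne.symm h⟩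
  have hloc : ∀ z ≠ p, ∃ V, IsOpen V ∧ z ∈ V ∧ ∀ z' ∈ V, P z' ↔ P z := by
    intro z hz
    obtain ⟨φ, hφ, rfl, hr⟩ := hchart z hz
    have hball : {p} ⊆ (φ '' Metric.ball 0 1)ᶜ := by
      rw [Set.singleton_subset_iff]
      exact fun h => hr (Set.image_subset_range _ _ h)
    -- For all points of one coordinate ball, restriction to the local homology factors through the
    -- complement of the ball followed by an isomorphism. Surjectivity is therefore a locally
    -- constant condition.
    have key : ∀ u ∈ Metric.ball (0 : E) 1, P (φ u) ↔
        Epi (HomologicalComplex.homologyMap (relInc hball) i) := by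
      intro u hu
      have h1 : (φ '' Metric.ball 0 1)ᶜ ⊆ {φ u}ᶜ :=
        Set.compl_subset_compl.2 (Set.singleton_subset_iff.2 ⟨u, hu, rfl⟩)
      have := quasiIso_relInc_compl_image_ball hφ hu h1
      rw [← epi_homologyMap_comp_iff hball h1 i]
      exact ⟨fun h => h _, fun h _ => h⟩
    refine ⟨φ '' Metric.ball 0 1, hφ.isOpenMap _ Metric.isOpen_ball,
      ⟨0, Metric.mem_ball_self one_pos, rfl⟩, ?_⟩
    rintro _ ⟨u, hu, rfl⟩
    rw [key u hu, key 0 (Metric.mem_ball_self one_pos)]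
  let G : Set X := {z | z ≠ p ∧ P z}
  let G' : Set X := {z | z ≠ p ∧ ¬ P z}
  have hG : IsOpen G := by
    rw [isOpen_iff_forall_mem_open]
    rintro z ⟨hz, hPz⟩
    obtain ⟨V, hV, hzV, h⟩ := hloc z hz
    exact ⟨V ∩ {p}ᶜ, fun z' hz' => ⟨hz'.2, (h z' hz'.1).2 hPz⟩, hV.inter isOpen_compl_singleton,
      hzV, hz⟩
  have hG' : IsOpen G' := by
    rw [isOpen_iff_forall_mem_open]
    rintro z ⟨hz, hPz⟩
    obtain ⟨V, hV, hzV, h⟩ := hloc z hz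
    exact ⟨V ∩ {p}ᶜ, fun z' hz' => ⟨hz'.2, fun h' => hPz ((h z' hz'.1).1 h')⟩,
      hV.inter isOpen_compl_singleton, hzV, hz⟩
  have hsubG := hp.subset_left_of_subset_union hG hG'
    (Set.disjoint_left.2 fun z hz hz' => hz'.2 hz.2)
    (fun z hz => by
      by_cases hPz : P z
      exacts [Or.inl ⟨hz, hPz⟩, Or.inr ⟨hz, hPz⟩])
    ⟨x, (hsub x).1 hx, (hsub x).1 hx, fun _ => h⟩
  exact (hsubG ((hsub y).1 hy)).2 hy

/-- The map of relative homology groups induced by a map of pairs. -/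
def relHMap (i : ℕ) (f : C(X, Y)) {A : Set X} {B : Set Y} (h : Set.MapsTo f A B) :
    relH i X A →ₗ[ℤ] relH i Y B :=
  (HomologicalComplex.homologyMap (relMap f h) i).hom

lemma relHMap_relHMap {Z : Type} [TopologicalSpace Z] (i : ℕ) (f : C(X, Y)) (g : C(Y, Z))
    {A : Set X} {B : Set Y} {C : Set Z} (h : Set.MapsTo f A B) (h' : Set.MapsTo g B C)
    (x : relH i X A) : relHMap i g h' (relHMap i f h x) = relHMap i (g.comp f) (h'.comp h) x := by
  unfold relHMap
  rw [← relMap_comp, HomologicalComplex.homologyMap_comp]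
  rfl

lemma bijective_relHMap (i : ℕ) (f : C(X, Y)) {A : Set X} {B : Set Y} (h : Set.MapsTo f A B)
    [QuasiIso (relMap f h)] : Function.Bijective (relHMap i f h) :=
  ConcreteCategory.bijective_of_isIso (HomologicalComplex.homologyMap (relMap f h) i)

lemma span_singleton_eq_top_of_apply_eq {R M N P : Type*} [Ring R] [AddCommGroup M] [Module R M]
    [AddCommGroup N] [Module R N] [AddCommGroup P] [Module R P] {f : M →ₗ[R] P} {g : N →ₗ[R] P}
    (hf : Function.Bijective f) (hg : Function.Surjective g) {u : M} {c : N} (h : f u = g c)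
    (hc : Submodule.span R {c} = ⊤) : Submodule.span R {u} = ⊤ := by
  refine Submodule.map_injective_of_injective hf.1 ?_
  rw [Submodule.map_span, Set.image_singleton, h, Submodule.map_top, LinearMap.range_eq_top.2 hf.2,
    ← LinearMap.range_eq_top.2 hg, LinearMap.range_eq_map, ← hc, Submodule.map_span,
    Set.image_singleton]

/-- A class of `H_d(X, {p})` which restricts to generators of the local homology groups at all points
of `X ∖ {p}` defines an orientation of any manifold which is homeomorphic to `X ∖ {p}`. -/
lemma exists_isOrientation [T2Space X] [CompactSpace X] {M : Type} [TopologicalSpace M] {j : C(M, X)}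
    (hj : Topology.IsOpenEmbedding j) {p : X} (hp : p ∉ Set.range j) {d : ℕ} {c : relH d X {p}}
    (hc : Submodule.span ℤ {c} = ⊤)
    (hepi : ∀ (x : M) (hx : {p} ⊆ ({j x}ᶜ : Set X)),
      Epi (HomologicalComplex.homologyMap (relInc hx) d)) :
    ∃ μ : ∀ x : M, relH d M {x}ᶜ, IsOrientation d M μ := by
  have hsub : ∀ S : Set M, {p} ⊆ (j '' S)ᶜ := fun S => by
    rw [Set.singleton_subset_iff]
    exact fun h => hp (Set.image_subset_range _ _ h)
  let res : ∀ S : Set M, relH d X {p} →ₗ[ℤ] relH d X (j '' S)ᶜ := fun S =>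
    relHMap d _ (mapsTo_continuousMap_id (hsub S))
  have hbij : ∀ S : Set M, closure (j '' S) ⊆ Set.range j → Function.Bijective
      (relHMap d j (mapsTo_compl_image hj.injective S)) := by
    intro S hS
    have := quasiIso_relMap_of_isOpenEmbedding hj S hS
    exact bijective_relHMap d j (mapsTo_compl_image hj.injective S)
  have hpt : ∀ x : M, closure (j '' {x}) ⊆ Set.range j := fun x => by
    rw [Set.image_singleton, closure_singleton, Set.singleton_subset_iff]
    exact ⟨x, rfl⟩
  -- The orientation at x is the restriction of c, read in M through excision. It generates because
  -- c generates and the restriction is surjective.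
  choose μ hμ using fun x => (hbij {x} (hpt x)).2 (res {x} c)
  refine ⟨μ, fun x => ?_, fun x => ?_⟩
  · have h1 : Function.Surjective (res {x}) := by
      have h2 : ∀ B, B = ({j x}ᶜ : Set X) → ∀ hB : {p} ⊆ B,
          Epi (HomologicalComplex.homologyMap (relInc hB) d) := by
        rintro _ rfl hB
        exact hepi x hB
      exact (ModuleCat.epi_iff_surjective _).1 (h2 _ (by rw [Set.image_singleton]) (hsub {x}))
    exact span_singleton_eq_top_of_apply_eq (hbij {x} (hpt x)) h1 (hμ x) hc
  -- The closure of V must stay inside M, so that the restriction of c to V can also be excised into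
  -- M.
  · obtain ⟨V, hxV, hVo, hV⟩ : ∃ V : Set X, j x ∈ V ∧ IsOpen V ∧ closure V ⊆ Set.range j := by
      obtain ⟨V, h1, h2, h3⟩ := exists_open_between_and_isCompact_closure
        (isCompact_singleton (x := j x)) hj.isOpen_range (Set.singleton_subset_iff.2 ⟨x, rfl⟩)
      exact ⟨V, h2 rfl, h1, h3.1⟩
    have hcl : closure (j '' (j ⁻¹' V)) ⊆ Set.range j :=
      (closure_mono (Set.image_preimage_subset _ _)).trans hV
    obtain ⟨b, hb⟩ := (hbij (j ⁻¹' V) hcl).2 (res (j ⁻¹' V) c)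
    refine ⟨j ⁻¹' V, hVo.preimage j.continuous, hxV, b, fun y hy => ?_⟩
    apply (hbij {y} (hpt y)).1
    have hyV : (j '' (j ⁻¹' V))ᶜ ⊆ (j '' {y})ᶜ :=
      Set.compl_subset_compl.2 (Set.image_mono (Set.singleton_subset_iff.2 hy))
    have hyV' : (j ⁻¹' V)ᶜ ⊆ ({y}ᶜ : Set M) :=
      Set.compl_subset_compl.2 (Set.singleton_subset_iff.2 hy)
    have e1 : relHMap d j (mapsTo_compl_image hj.injective {y})
        (relHMap d _ (mapsTo_continuousMap_id hyV') b) = relHMap d _ (mapsTo_continuousMap_id hyV)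
          (relHMap d j (mapsTo_compl_image hj.injective (j ⁻¹' V)) b) := by
      rw [relHMap_relHMap, relHMap_relHMap]
      rfl
    have e2 : relHMap d _ (mapsTo_continuousMap_id hyV) (res (j ⁻¹' V) c) = res {y} c :=
      relHMap_relHMap _ _ _ _ _ _
    rw [hμ, ← e2, ← hb, ← e1]
    rfl

end LocalHomology

/-! ### The orientation of `W` -/

/-- A ball in a normed space as the interior of the cube. -/
lemma exists_openEmbedding_cube (d : ℕ) : ∃ g : C(Fin d → ℝ, Cube d),
    Topology.IsOpenEmbedding g ∧ (∀ x, g x ∉ cubeBdry d) ∧ ∃ R : ℝ, 0 < R ∧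
      g '' Metric.ball 0 R = {x : Cube d | ‖(x : Fin d → ℝ)‖ < 1 / 2} := by
  let β := OpenPartialHomeomorph.univUnitBall (E := Fin d → ℝ)
  have hβ : Topology.IsOpenEmbedding β := β.isOpenEmbedding rfl
  have hmem : ∀ x, ‖β x‖ < 1 := fun x => mem_ball_zero_iff.1 (β.map_source (Set.mem_univ x))
  have happ : ∀ x, β x = (√(1 + ‖x‖ ^ 2))⁻¹ • x := fun x => rfl
  let g : C(Fin d → ℝ, Cube d) :=
    ⟨fun x => ⟨β x, mem_closedBall_zero_iff.2 (hmem x).le⟩, hβ.continuous.subtype_mk _⟩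
  -- With ρ = ‖x‖, the inequality ρ/√(1 + ρ²) < 1/2 amounts to 3ρ² < 1.
  have hnorm : ∀ x, ‖β x‖ < 1 / 2 ↔ x ∈ Metric.ball 0 (√3)⁻¹ := by
    intro x
    have h1 : 0 < √(1 + ‖x‖ ^ 2) := by positivity
    have h3 : (0 : ℝ) < √3 := by positivity
    have h4 : √3 ^ 2 = 3 := Real.sq_sqrt (by norm_num)
    have h5 : √(1 + ‖x‖ ^ 2) ^ 2 = 1 + ‖x‖ ^ 2 := Real.sq_sqrt (by positivity)
    have h6 : 0 ≤ ‖x‖ := norm_nonneg x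
    rw [mem_ball_zero_iff, happ, norm_smul, norm_inv, Real.norm_of_nonneg h1.le,
      inv_mul_lt_iff₀ h1, ← one_div, lt_div_iff₀ h3]
    constructor <;> intro h <;> nlinarith [mul_nonneg h6 h3.le]
  refine ⟨g, Topology.IsOpenEmbedding.of_continuous_injective_isOpenMap g.continuous ?_ ?_,
    fun x h => (hmem x).ne h, (√3)⁻¹, by positivity, ?_⟩
  · intro x y h
    exact hβ.injective (congrArg Subtype.val h)
  · intro O hO
    have : g '' O = Subtype.val ⁻¹' (β '' O) := by
      ext y
      constructor
      · rintro ⟨x, hx, rfl⟩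
        exact ⟨x, hx, rfl⟩
      · rintro ⟨x, hx, h⟩
        exact ⟨x, hx, Subtype.ext h⟩
    rw [this]
    exact (hβ.isOpenMap O hO).preimage continuous_subtype_val
  · ext y
    constructor
    · rintro ⟨x, hx, rfl⟩
      exact (hnorm x).2 hx
    · intro hy
      have hy1 : (y : Fin d → ℝ) ∈ β.target := mem_ball_zero_iff.2 (lt_trans hy (by norm_num))
      have e := β.right_inv hy1
      refine ⟨β.symm y, ?_, Subtype.ext e⟩
      rw [← hnorm, e]
      exact hy

namespace CellData

variable {X : Type} [TopologicalSpace X] [CompactSpace X] [T2Space X] {ι : Type} (D : CellData X ι)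
  [Fintype ι] [DecidableEq ι]

/-- The homology modulo all cells but one is the local homology at the centre of that cell. -/
lemma exists_quasiIso_relInc_compl_point {T : Finset ι} {o : ι} (hT : D.Lower T) (ho : o ∉ T)
    (hu : insert o T = Finset.univ) :
    ∃ (x : X) (h : D.F T ⊆ ({x}ᶜ : Set X)), QuasiIso (relInc h) := by
  have hU : D.Lower (insert o T) := by
    rw [hu]
    exact fun _ _ _ _ => Finset.mem_univ _
  have hpre := D.preimage_F hT ho hU
  have hF : IsClosed (D.F T) := D.isClosed_F T
  have hinj : Set.InjOn (D.Φ o) (D.Φ o ⁻¹' D.F T)ᶜ := by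
    rw [hpre]
    exact D.injOn o
  have hcov : (D.F T)ᶜ ⊆ Set.range (D.Φ o) := by
    intro y hy
    have : y ∈ D.F (insert o T) := by
      rw [hu, F_univ]
      trivial
    rw [F_insert] at this
    exact this.resolve_left hy
  obtain ⟨g, hg, hgb, R, hR, hball⟩ := exists_openEmbedding_cube (D.dim o)
  let φ : C(Fin (D.dim o) → ℝ, X) := (D.Φ o).comp g
  have hgc : ∀ x, g x ∈ (D.Φ o ⁻¹' D.F T)ᶜ := fun x => by
    rw [hpre]
    exact hgb x
  have hφ : Topology.IsOpenEmbedding φ := by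
    let g' : (Fin (D.dim o) → ℝ) → ↥(D.Φ o ⁻¹' D.F T)ᶜ := fun x => ⟨g x, hgc x⟩
    have hg' : Topology.IsOpenEmbedding g' := by
      refine Topology.IsOpenEmbedding.of_continuous_injective_isOpenMap
        (g.continuous.subtype_mk _) (fun x y h => hg.injective (congrArg Subtype.val h)) ?_
      intro O hO
      have : g' '' O = Subtype.val ⁻¹' (g '' O) := by
        ext y
        constructor
        · rintro ⟨x, hx, rfl⟩
          exact ⟨x, hx, rfl⟩
        · rintro ⟨x, hx, h⟩
          exact ⟨x, hx, Subtype.ext h⟩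
      rw [this]
      exact (hg.isOpenMap O hO).preimage continuous_subtype_val
    exact hF.isOpen_compl.isOpenEmbedding_subtypeVal.comp
      ((homeomorphOverCompl (D.Φ o) hinj hcov).isOpenEmbedding.comp hg')
  obtain ⟨K, hK⟩ := exists_isCollar_push (D.Φ o) hF hinj hcov (H := cubeCollar _)
  have hK := hK {x | 1 / 2 ≤ ‖(x : Fin (D.dim o) → ℝ)‖} (by
    rw [hpre]
    exact isCollar_cube_closed _)
  -- The pushed closed collar of F T is exactly the complement of a coordinate ball of the remaining
  -- cell. So H(X, F T) agrees with the homology modulo that complement, and hence with the local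
  -- homology at the centre.
  have hset : D.F T ∪ D.Φ o '' {x | 1 / 2 ≤ ‖(x : Fin (D.dim o) → ℝ)‖} =
      (φ '' Metric.ball 0 R)ᶜ := by
    have e1 : φ '' Metric.ball 0 R = D.Φ o '' {x | ‖(x : Fin (D.dim o) → ℝ)‖ < 1 / 2} := by
      rw [← hball, Set.image_image]
      rfl
    rw [e1]
    ext y
    constructor
    · rintro (hy | ⟨x, hx, rfl⟩)
      · rintro ⟨x, hx, rfl⟩
        have : x ∈ cubeBdry (D.dim o) := by
          rw [← hpre]
          exact hy
        have h1 : ‖(x : Fin (D.dim o) → ℝ)‖ = 1 := this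
        have h2 : ‖(x : Fin (D.dim o) → ℝ)‖ < 1 / 2 := hx
        linarith
      · rintro ⟨x', hx', h⟩
        have h2 : ‖(x' : Fin (D.dim o) → ℝ)‖ < 1 / 2 := hx'
        have h3 : 1 / 2 ≤ ‖(x : Fin (D.dim o) → ℝ)‖ := hx
        have hx'b : x' ∉ D.Φ o ⁻¹' D.F T := by
          rw [hpre]
          intro h1
          have h1 : ‖(x' : Fin (D.dim o) → ℝ)‖ = 1 := h1
          linarith
        have hxb : x ∉ D.Φ o ⁻¹' D.F T := by
          rw [Set.mem_preimage, ← h]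
          exact hx'b
        rw [hinj hx'b hxb h] at h2
        linarith
    · intro hy
      by_cases hyT : y ∈ D.F T
      · exact Or.inl hyT
      · obtain ⟨x, rfl⟩ := hcov hyT
        refine Or.inr ⟨x, ?_, rfl⟩
        by_contra hx
        have hx' : ‖(x : Fin (D.dim o) → ℝ)‖ < 1 / 2 := lt_of_not_ge fun h => hx h
        exact hy ⟨x, hx', rfl⟩
  have h1 : D.F T ⊆ (φ '' Metric.ball 0 R)ᶜ := by
    rw [← hset]
    exact Set.subset_union_left
  have h2 : (φ '' Metric.ball 0 R)ᶜ ⊆ ({φ 0}ᶜ : Set X) :=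
    Set.compl_subset_compl.2 (Set.singleton_subset_iff.2 ⟨0, Metric.mem_ball_self hR, rfl⟩)
  have q1 : QuasiIso (relInc h1) := by
    have h3 : ∀ B, D.F T ∪ D.Φ o '' {x | 1 / 2 ≤ ‖(x : Fin (D.dim o) → ℝ)‖} = B →
        ∀ h : D.F T ⊆ B, QuasiIso (relInc h) := by
      rintro _ rfl h
      exact hK.quasiIso
    exact h3 _ hset h1
  have q2 := quasiIso_relInc_compl_image_ball hφ (Metric.mem_ball_self hR) h2
  refine ⟨φ 0, h1.trans h2, ?_⟩
  have e : relInc (h1.trans h2) = relInc h1 ≫ relInc h2 := by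
    rw [relMap_comp]
    rfl
  rw [e]
  infer_instance

end CellData

/-! ### Connectedness of the interior and the fundamental class -/

section

variable (n : ℕ) (r : ℝ) [hP : Params n r]

/-- The inclusion of the interior of `W` into `W / ∂W`. -/
def interiorToX : C(↥(boundaryW n r)ᶜ, WModBoundary n r) :=
  ⟨fun x => Quotient.mk _ x.1, continuous_quot_mk.comp continuous_subtype_val⟩

lemma isOpenEmbedding_interiorToX : Topology.IsOpenEmbedding (interiorToX n r) :=
  isOpenEmbedding_collapse_mk isClosed_boundaryW

lemma range_interiorToX : Set.range (interiorToX n r) = {basePt n r}ᶜ := by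
  ext y
  constructor
  · rintro ⟨w, rfl⟩ h
    exact w.2 (mk_eq_basePt_iff.1 h)
  · intro hy
    induction y using Quotient.inductionOn with | _ w
    exact ⟨⟨w, fun h => hy (mk_eq_basePt_iff.2 h)⟩, rfl⟩

/-- The set is the image of the product of a torus with the convex set Q of points at which no group
sum attains 1 - r. -/
lemma isPreconnected_compl_basePt : IsPreconnected ({basePt n r}ᶜ : Set (WModBoundary n r)) := by
  let Q : Set (Fin (n + 1) → ℝ) := {x | (∀ l, 0 ≤ x l) ∧ ∑ l, x l = 1 ∧ ∀ g, grpSum n x g < 1 - r}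
  have hQ : ∀ x ∈ Q, x ∈ DeltaQ n r := fun x hx =>
    mem_deltaQ_iff.2 ⟨hx.1, hx.2.1, fun g => (hx.2.2 g).le⟩
  have hconv : Convex ℝ Q := by
    intro x hx y hy a b ha hb hab
    have e : ∀ g, grpSum n (a • x + b • y) g = a * grpSum n x g + b * grpSum n y g := by
      intro g
      unfold grpSum
      simp [Finset.sum_add_distrib, Finset.mul_sum]
    refine ⟨fun l => ?_, ?_, fun g => ?_⟩
    · have := hx.1 l
      have := hy.1 l
      simp only [Pi.add_apply, Pi.smul_apply, smul_eq_mul]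
      positivity
    · simp only [Pi.add_apply, Pi.smul_apply, smul_eq_mul, Finset.sum_add_distrib,
        ← Finset.mul_sum, hx.2.1, hy.2.1]
      linarith
    · rw [e]
      have h1 := hx.2.2 g
      have h2 := hy.2.2 g
      rcases ha.eq_or_lt with rfl | ha
      · have : b = 1 := by linarith
        subst this
        linarith
      · have h3 : (a + b) * (1 - r) = 1 - r := by rw [hab, one_mul]
        linarith [mul_lt_mul_of_pos_left h1 ha, mul_le_mul_of_nonneg_left h2.le hb]
  have : PreconnectedSpace Q := Subtype.preconnectedSpace hconv.isPreconnected
  let f : Torus n × Q → WModBoundary n r := fun a => toX (theta (a.1, ⟨a.2.1, hQ _ a.2.2⟩))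
  have hf : Continuous f := by
    refine toX.continuous.comp (continuous_theta.comp (continuous_fst.prodMk ?_))
    exact (continuous_subtype_val.comp continuous_snd).subtype_mk _
  have hr : Set.range f = {basePt n r}ᶜ := by
    ext y
    constructor
    · rintro ⟨a, rfl⟩ h
      obtain ⟨g, hg⟩ := toX_eq_basePt_iff.1 h
      have : gs (theta (a.1, ⟨a.2.1, hQ _ a.2.2⟩) : Zsp n r).1 g = grpSum n a.2.1 g := by
        unfold gs
        simp only [norm_theta]
      linarith [a.2.2.2.2 g]
    · intro hy
      obtain ⟨z, rfl⟩ := toX_surjective y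
      obtain ⟨a, ha, h⟩ := exists_orb_theta z
      have hz : ¬ IsBd z := fun h => hy (toX_eq_basePt_iff.2 h)
      have haQ : a.2.1 ∈ Q := by
        have h1 := mem_deltaQ_iff.1 a.2.2
        refine ⟨h1.1, h1.2.1, fun g => lt_of_le_of_ne (h1.2.2 g) fun h2 => hz ⟨g, ?_⟩⟩
        rw [← h2, ← ha]
        rfl
      refine ⟨(a.1, ⟨a.2.1, haQ⟩), toX_eq_iff.2 (Or.inl ?_)⟩
      exact orb_mk_eq.1 h
  rw [← hr]
  exact isPreconnected_range hf

/-- Every point of the interior of a manifold with boundary has a coordinate neighbourhood which is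
the image of a Euclidean space. -/
lemma exists_openEmbedding_of_isManifoldWithBoundary {d : ℕ} {Y : Type} [TopologicalSpace Y]
    {B : Set Y} (h : IsManifoldWithBoundary d Y B) {y : Y} (hy : y ∉ B) :
    ∃ φ : C(ℝ × (Fin (d - 1) → ℝ), Y), Topology.IsOpenEmbedding φ ∧ φ 0 = y ∧
      Disjoint (Set.range φ) B := by
  obtain ⟨e, hye, hB⟩ := h.exists_chart y
  -- Away from the wall the half space is an open subset of Euclidean space.
  let P : OpenPartialHomeomorph (ℝ≥0 × (Fin (d - 1) → ℝ)) (ℝ × (Fin (d - 1) → ℝ)) :=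
    { toFun := fun p => (p.1, p.2)
      invFun := fun p => (Real.toNNReal p.1, p.2)
      source := {p | p.1 ≠ 0}
      target := {p | 0 < p.1}
      map_source' := fun p hp => by
        change (0 : ℝ) < p.1
        exact_mod_cast pos_iff_ne_zero.2 hp
      map_target' := fun p hp => (Real.toNNReal_pos.2 hp).ne'
      left_inv' := fun p hp => by simp
      right_inv' := fun p hp => Prod.ext (Real.coe_toNNReal _ (le_of_lt hp)) rfl
      open_source := isOpen_ne_fun continuous_fst continuous_const
      open_target := isOpen_lt continuous_const continuous_fst
      continuousOn_toFun := by fun_prop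
      continuousOn_invFun := by fun_prop }
  let κ := e.trans P
  have hκ : ∀ x ∈ κ.source, x ∉ B := by
    intro x hx hxB
    rw [OpenPartialHomeomorph.trans_source] at hx
    exact hx.2 ((hB x hx.1).1 hxB)
  have hyκ : y ∈ κ.source := by
    rw [OpenPartialHomeomorph.trans_source]
    exact ⟨hye, fun h0 => hy ((hB y hye).2 h0)⟩
  obtain ⟨ε, hε, hball⟩ := Metric.isOpen_iff.1 κ.open_target (κ y) (κ.map_source hyκ)
  let β := OpenPartialHomeomorph.univBall (κ y) ε
  let ψ := β.trans κ.symm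
  have hβt : β.target = Metric.ball (κ y) ε := OpenPartialHomeomorph.univBall_target _ hε
  have hψ : ψ.source = Set.univ := by
    rw [OpenPartialHomeomorph.trans_source, OpenPartialHomeomorph.univBall_source,
      Set.univ_inter, Set.eq_univ_iff_forall]
    intro u
    refine hball ?_
    rw [← hβt]
    exact β.map_source (by rw [OpenPartialHomeomorph.univBall_source]; trivial)
  have hψe := ψ.isOpenEmbedding hψ
  refine ⟨⟨ψ, hψe.continuous⟩, hψe, ?_, ?_⟩
  · change κ.symm (β 0) = y
    rw [OpenPartialHomeomorph.univBall_apply_zero, κ.left_inv hyκ]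
  · rw [Set.disjoint_left]
    rintro _ ⟨u, rfl⟩
    refine hκ _ ?_
    refine κ.map_target (hball ?_)
    rw [← hβt]
    exact β.map_source (by rw [OpenPartialHomeomorph.univBall_source]; trivial)

lemma exists_chart_X {y : WModBoundary n r} (hy : y ≠ basePt n r) :
    ∃ φ : C(ℝ × (Fin (2 * n - 1 - 1) → ℝ), WModBoundary n r), Topology.IsOpenEmbedding φ ∧
      φ 0 = y ∧ basePt n r ∉ Set.range φ := by
  induction y using Quotient.inductionOn with | _ w
  have hw : w ∉ boundaryW n r := fun h => hy (mk_eq_basePt_iff.2 h)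
  obtain ⟨φ, hφ, h0, hd⟩ :=
    exists_openEmbedding_of_isManifoldWithBoundary (isManifoldWithBoundary_W n r) hw
  have hmem : ∀ u, φ u ∈ (boundaryW n r)ᶜ := fun u => Set.disjoint_left.1 hd ⟨u, rfl⟩
  let φ' : C(ℝ × (Fin (2 * n - 1 - 1) → ℝ), ↥(boundaryW n r)ᶜ) :=
    ⟨fun u => ⟨φ u, hmem u⟩, φ.continuous.subtype_mk _⟩
  have hφ' : Topology.IsOpenEmbedding φ' := by
    refine Topology.IsOpenEmbedding.of_continuous_injective_isOpenMap φ'.continuous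
      (fun x y h => hφ.injective (congrArg Subtype.val h)) ?_
    intro O hO
    have : φ' '' O = Subtype.val ⁻¹' (φ '' O) := by
      ext y
      constructor
      · rintro ⟨x, hx, rfl⟩
        exact ⟨x, hx, rfl⟩
      · rintro ⟨x, hx, h⟩
        exact ⟨x, hx, Subtype.ext h⟩
    rw [this]
    exact (hφ.isOpenMap O hO).preimage continuous_subtype_val
  refine ⟨(interiorToX n r).comp φ', (isOpenEmbedding_interiorToX n r).comp hφ', ?_, ?_⟩
  · rw [← h0]
    rfl
  · rintro ⟨u, hu⟩
    have : interiorToX n r (φ' u) ∈ ({basePt n r}ᶜ : Set _) := by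
      rw [← range_interiorToX]
      exact ⟨_, rfl⟩
    exact this hu

/-- The index of the cell of the highest dimension. -/
def topCell : CellIx n :=
  ⟨(0, Fin.last n), by simp, by simp; omega, by
    rw [Fin.lt_def]
    have := hP.two_le
    simp
    omega⟩

lemma dim_lt_of_ne_topCell {o : CellIx n} (ho : o ≠ topCell n r) :
    o.dim < (topCell n r).dim := by
  have h1 := Fin.lt_def.1 o.2.2.2
  have h2 := o.1.2.2
  have h3 : ¬ ((o.1.1 : ℕ) = 0 ∧ (o.1.2 : ℕ) = n) := by
    rintro ⟨h3, h4⟩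
    exact ho (Subtype.ext (Prod.ext (Fin.ext h3) (Fin.ext h4)))
  change 2 * ((o.1.2 : ℕ) - o.1.1) - 1 < 2 * (n - 0) - 1
  omega

/-- Let T consist of all cells but the top one. The cells of T apart from the base point are
odd-dimensional, so the map from H(X, pt) to H(X, F T) is onto in odd degrees, and H(X, F T) is the
local homology at a point of the top cell. -/
lemma exists_epi_homologyMap_relInc : ∃ (x : WModBoundary n r) (h : {basePt n r} ⊆ ({x}ᶜ : Set _)),
    Epi (HomologicalComplex.homologyMap (relInc h) (2 * n - 1)) := by
  classical
  have hn := hP.two_le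
  let T : Finset (Option (CellIx n)) := Finset.univ.erase (some (topCell n r))
  have hmax : ∀ o : Option (CellIx n), o ≠ some (topCell n r) →
      (cells n r).dim o < (cells n r).dim (some (topCell n r)) := by
    intro o ho
    match o with
    | none =>
      change 0 < 2 * (n - 0) - 1
      omega
    | some o => exact dim_lt_of_ne_topCell n r fun h => ho (congrArg some h)
  have hT : (cells n r).Lower T := by
    intro o ho o' h
    refine Finset.mem_erase.2 ⟨?_, Finset.mem_univ _⟩
    rintro rfl
    exact lt_asymm h (hmax o (Finset.mem_erase.1 ho).1)
  have hS : {none} ⊆ T := by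
    rw [Finset.singleton_subset_iff]
    exact Finset.mem_erase.2 ⟨by simp, Finset.mem_univ _⟩
  have h1 := (cells n r).epi_relInc_top hT (i := 2 * n - 1) ⟨n - 1, by omega⟩ _ {none} hS rfl
    (cells_lower_none n r) (odd_cells_dim n r) (by
      intro o ho o' ho'
      have : o' = some (topCell n r) := by
        by_contra h
        exact ho' (Finset.mem_erase.2 ⟨h, Finset.mem_univ _⟩)
      rw [this]
      exact hmax o (Finset.mem_erase.1 ho).1)
  obtain ⟨x, h, hq⟩ := (cells n r).exists_quasiIso_relInc_compl_point hT
    (Finset.notMem_erase _ _) (Finset.insert_erase (Finset.mem_univ _))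
  refine ⟨x, ?_, ?_⟩
  · rw [← cells_F_none]
    exact ((cells n r).F_mono hS).trans h
  · have h2 := (epi_homologyMap_comp_iff ((cells n r).F_mono hS) h (2 * n - 1)).2 h1
    have h3 : ∀ A, (cells n r).F {none} = A → ∀ hA : A ⊆ ({x}ᶜ : Set _),
        Epi (HomologicalComplex.homologyMap (relInc hA) (2 * n - 1)) := by
      rintro _ rfl hA
      exact h2
    exact h3 _ (cells_F_none n r) _

lemma exists_generator : ∃ c : relH (2 * n - 1) (WModBoundary n r) {basePt n r},
    Submodule.span ℤ {c} = ⊤ := by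
  have hn := hP.two_le
  obtain ⟨b⟩ := nonempty_basis_relH_basePt n r (2 * n - 1)
  have hdim : (topCell n r).dim = 2 * n - 1 := rfl
  refine ⟨b ⟨topCell n r, hdim⟩, ?_⟩
  rw [← b.span_eq]
  congr 1
  ext c
  constructor
  · rintro rfl
    exact ⟨_, rfl⟩
  · rintro ⟨⟨o, ho⟩, rfl⟩
    have : o = topCell n r := by
      by_contra h
      have := dim_lt_of_ne_topCell n r h
      omega
    subst this
    rfl

theorem isOrientableManifoldWithBoundary_W :
    IsOrientableManifoldWithBoundary (2 * n - 1) (W n r) (boundaryW n r) := by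
  refine ⟨isManifoldWithBoundary_W n r, ?_⟩
  obtain ⟨c, hc⟩ := exists_generator n r
  obtain ⟨x, hx, hepi⟩ := exists_epi_homologyMap_relInc n r
  refine exists_isOrientation (isOpenEmbedding_interiorToX n r) (p := basePt n r) ?_ hc ?_
  · rw [range_interiorToX]
    exact fun h => h rfl
  · intro y hy
    exact epi_homologyMap_relInc_of_isPreconnected (isPreconnected_compl_basePt n r)
      (fun y hy => exists_chart_X n r hy) (2 * n - 1) hx hy hepi

end

/-! ### Edges at a simple vertex of a polytope -/

section SimpleVertex

variable {N : ℕ} {J : Type} [Fintype J]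

/-- Near its point `v`, the convex set `P` is the cone spanned by the linearly independent
directions `d`, with dual coordinates `φ`. -/
structure IsSimpleVertex (P : Set (Fin N → ℝ)) (v : Fin N → ℝ) (d : J → Fin N → ℝ)
    (φ : J → (Fin N → ℝ) →ₗ[ℝ] ℝ) : Prop where
  mem : v ∈ P
  dual_self : ∀ j, φ j (d j) = 1
  dual_ne : ∀ j j', j ≠ j' → φ j (d j') = 0
  nonneg : ∀ x ∈ P, ∀ j, 0 ≤ φ j (x - v)
  sum_eq : ∀ x ∈ P, ∑ j, φ j (x - v) • d j = x - v
  exists_mem : ∀ j, ∃ t : ℝ, 0 < t ∧ v + t • d j ∈ P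

/-- The points of `P` on the ray from `v` in the direction `w`. -/
def edgeAt (P : Set (Fin N → ℝ)) (v w : Fin N → ℝ) : Set (Fin N → ℝ) :=
  {x | x ∈ P ∧ ∃ t : ℝ, 0 ≤ t ∧ x = v + t • w}

namespace IsSimpleVertex

variable {P : Set (Fin N → ℝ)} {v : Fin N → ℝ} {d : J → Fin N → ℝ}
  {φ : J → (Fin N → ℝ) →ₗ[ℝ] ℝ}

lemma mem_extremePoints (h : IsSimpleVertex P v d φ) : v ∈ P.extremePoints ℝ := by
  refine ⟨h.mem, fun x hx y hy hv => ?_⟩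
  obtain ⟨a, b, ha, hb, hab, e⟩ := hv
  have e1 : a • (x - v) + b • (y - v) = 0 := by
    rw [smul_sub, smul_sub, sub_add_sub_comm, e, ← add_smul, hab, one_smul, sub_self]
  rw [← sub_eq_zero, ← h.sum_eq x hx]
  refine Finset.sum_eq_zero fun j _ => ?_
  have e2 := congrArg (φ j) e1
  rw [map_add, map_smul, map_smul, map_zero, smul_eq_mul, smul_eq_mul] at e2
  have h1 := mul_nonneg ha.le (h.nonneg x hx j)
  have h2 := mul_nonneg hb.le (h.nonneg y hy j)
  have h3 : a * φ j (x - v) = 0 := by linarith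
  rw [(mul_eq_zero.1 h3).resolve_left ha.ne', zero_smul]

lemma dir_ne_zero (h : IsSimpleVertex P v d φ) (j : J) : d j ≠ 0 := by
  intro h0
  have := h.dual_self j
  rw [h0, map_zero] at this
  exact zero_ne_one this

lemma mem_edgeAt (h : IsSimpleVertex P v d φ) (j : J) : v ∈ edgeAt P v (d j) :=
  ⟨h.mem, 0, le_rfl, by rw [zero_smul, add_zero]⟩

lemma edgeAt_injective (h : IsSimpleVertex P v d φ) : Function.Injective fun j => edgeAt P v (d j) := by
  intro j j' e
  by_contra hne
  obtain ⟨t, ht, hm⟩ := h.exists_mem j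
  have hm' : v + t • d j ∈ edgeAt P v (d j') := by
    have e' : edgeAt P v (d j) = edgeAt P v (d j') := e
    rw [← e']
    exact ⟨hm, t, ht.le, rfl⟩
  obtain ⟨-, s, -, hs⟩ := hm'
  have e2 := congrArg (φ j) (add_left_cancel hs)
  rw [map_smul, map_smul, h.dual_self, h.dual_ne j j' hne, smul_zero, smul_eq_mul, mul_one] at e2
  exact ht.ne' e2

/-- The edge is a segment starting at v in direction d_j, of positive length by `exists_mem`, so
only the sign of ζ(d_j) matters. -/
lemma pointsTowards_iff (h : IsSimpleVertex P v d φ) (ζ : (Fin N → ℝ) →ₗ[ℝ] ℝ) (j : J) :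
    PointsTowards ζ (edgeAt P v (d j)) v ↔ ζ (d j) ≤ 0 := by
  constructor
  · rintro ⟨-, hζ⟩
    obtain ⟨t, ht, hm⟩ := h.exists_mem j
    have := hζ _ ⟨hm, t, ht.le, rfl⟩
    rw [map_add, map_smul, smul_eq_mul] at this
    by_contra hc
    have := mul_pos ht (not_le.1 hc)
    linarith
  · intro hζ
    refine ⟨h.mem_edgeAt j, ?_⟩
    rintro _ ⟨-, t, ht, rfl⟩
    rw [map_add, map_smul, smul_eq_mul]
    have := mul_nonpos_of_nonneg_of_nonpos ht hζ
    linarith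

lemma edgeAt_eq (h : IsSimpleVertex P v d φ) (j : J) :
    edgeAt P v (d j) = {x | x ∈ P ∧ ∀ m, m ≠ j → φ m (x - v) = 0} := by
  ext x
  constructor
  · rintro ⟨hx, t, -, rfl⟩
    refine ⟨hx, fun m hm => ?_⟩
    rw [add_sub_cancel_left, map_smul, h.dual_ne m j hm, smul_zero]
  · rintro ⟨hx, h0⟩
    refine ⟨hx, φ j (x - v), h.nonneg x hx j, ?_⟩
    have := h.sum_eq x hx
    rw [Finset.sum_eq_single j (fun m _ hm => by rw [h0 m hm, zero_smul])
      (fun hj => absurd (Finset.mem_univ j) hj)] at this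
    rw [this, add_sub_cancel]

lemma finrank_vectorSpan_edgeAt (h : IsSimpleVertex P v d φ) (j : J) :
    Module.finrank ℝ (vectorSpan ℝ (edgeAt P v (d j))) = 1 := by
  have e : vectorSpan ℝ (edgeAt P v (d j)) = Submodule.span ℝ {d j} := by
    rw [vectorSpan_eq_span_vsub_set_right ℝ (h.mem_edgeAt j)]
    apply le_antisymm
    · rw [Submodule.span_le]
      rintro _ ⟨x, ⟨-, t, -, rfl⟩, rfl⟩
      simp only [vsub_eq_sub, add_sub_cancel_left]
      exact Submodule.smul_mem _ _ (Submodule.mem_span_singleton_self _)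
    · rw [Submodule.span_singleton_le_iff_mem]
      obtain ⟨t, ht, hm⟩ := h.exists_mem j
      have : t • d j ∈ Submodule.span ℝ ((fun x => x -ᵥ v) '' edgeAt P v (d j)) :=
        Submodule.subset_span ⟨_, ⟨hm, t, ht.le, rfl⟩, by simp⟩
      exact (Submodule.smul_mem_iff _ ht.ne').1 this
  rw [e, finrank_span_singleton (h.dir_ne_zero j)]

/-- The negative of the sum of the other dual coordinates attains its maximum over P exactly where
all of them vanish, which exposes the edge. -/
lemma edgeAt_mem_edges (h : IsSimpleVertex P v d φ) (j : J) : edgeAt P v (d j) ∈ edges P := by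
  classical
  refine ⟨fun _ => ?_, h.finrank_vectorSpan_edgeAt j⟩
  let l : (Fin N → ℝ) →ₗ[ℝ] ℝ := -∑ m ∈ Finset.univ.erase j, φ m
  have hl : ∀ x, l x - l v = -∑ m ∈ Finset.univ.erase j, φ m (x - v) := by
    intro x
    rw [← map_sub]
    simp only [l, LinearMap.neg_apply, LinearMap.sum_apply]
  have hle : ∀ x ∈ P, l x ≤ l v := by
    intro x hx
    have := Finset.sum_nonneg fun m (_ : m ∈ Finset.univ.erase j) => h.nonneg x hx m
    linarith [hl x]
  refine ⟨LinearMap.toContinuousLinearMap l, ?_⟩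
  rw [h.edgeAt_eq]
  ext x
  constructor
  · rintro ⟨hx, h0⟩
    refine ⟨hx, fun y hy => ?_⟩
    have : l x - l v = 0 := by
      rw [hl, Finset.sum_eq_zero fun m hm => h0 m (Finset.ne_of_mem_erase hm), neg_zero]
    change l y ≤ l x
    linarith [hle y hy]
  · rintro ⟨hx, h0⟩
    refine ⟨hx, fun m hm => ?_⟩
    have h1 : l v ≤ l x := h0 v h.mem
    have h2 : ∑ m ∈ Finset.univ.erase j, φ m (x - v) = 0 := by
      have := Finset.sum_nonneg fun m (_ : m ∈ Finset.univ.erase j) => h.nonneg x hx m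
      linarith [hl x]
    exact (Finset.sum_eq_zero_iff_of_nonneg fun m _ => h.nonneg x hx m).1 h2 m
      (Finset.mem_erase.2 ⟨hm, Finset.mem_univ m⟩)

/-- Let l expose e. Since v maximises l, all l(d_j) are ≤ 0, and e consists of the points of P whose
dual coordinates vanish wherever l(d_j) < 0. If no l(d_j) were 0, e would be a point; two zeros
would give two independent directions. -/
lemma exists_eq_edgeAt (h : IsSimpleVertex P v d φ) {e : Set (Fin N → ℝ)} (he : e ∈ edges P) (hv : v ∈ e) :
    ∃ j, e = edgeAt P v (d j) := by
  obtain ⟨hexp, hrank⟩ := he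
  obtain ⟨l, rfl⟩ := hexp ⟨v, hv⟩
  have hlv : ∀ y ∈ P, l y ≤ l v := hv.2
  have hmem : ∀ x ∈ P, (x ∈ {x | x ∈ P ∧ ∀ y ∈ P, l y ≤ l x} ↔ l (x - v) = 0) := by
    intro x hx
    rw [map_sub, sub_eq_zero]
    exact ⟨fun h' => le_antisymm (hlv x hx) (h'.2 v h.mem), fun h' => ⟨hx, h' ▸ hlv⟩⟩
  have hneg : ∀ j, l (d j) ≤ 0 := by
    intro j
    obtain ⟨t, ht, hm⟩ := h.exists_mem j
    have := hlv _ hm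
    rw [map_add, map_smul, smul_eq_mul] at this
    by_contra hc
    have := mul_pos ht (not_le.1 hc)
    linarith
  have hsum : ∀ x ∈ P, l (x - v) = 0 → ∀ j, l (d j) ≠ 0 → φ j (x - v) = 0 := by
    intro x hx hlx j hj
    rw [← h.sum_eq x hx, map_sum] at hlx
    have h0 := (Finset.sum_eq_zero_iff_of_nonpos (fun j _ => by
      rw [map_smul, smul_eq_mul]
      exact mul_nonpos_of_nonneg_of_nonpos (h.nonneg x hx j) (hneg j))).1 hlx j (Finset.mem_univ j)
    rw [map_smul, smul_eq_mul] at h0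
    exact (mul_eq_zero.1 h0).resolve_right hj
  set e : Set (Fin N → ℝ) := {x | x ∈ P ∧ ∀ y ∈ P, l y ≤ l x} with he
  have hdir : ∀ j, l (d j) = 0 → d j ∈ vectorSpan ℝ e := by
    intro j hj
    obtain ⟨t, ht, hm⟩ := h.exists_mem j
    have h1 : v + t • d j ∈ e := by
      rw [hmem _ hm, add_sub_cancel_left, map_smul, hj, smul_zero]
    have := vsub_mem_vectorSpan ℝ h1 hv
    rw [vsub_eq_sub, add_sub_cancel_left] at this
    exact (Submodule.smul_mem_iff _ ht.ne').1 this
  have hex : ∃ j, l (d j) = 0 := by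
    by_contra! hc
    have : e ⊆ {v} := by
      intro x hx
      rw [Set.mem_singleton_iff, ← sub_eq_zero, ← h.sum_eq x hx.1]
      exact Finset.sum_eq_zero fun j _ => by
        rw [hsum x hx.1 ((hmem x hx.1).1 hx) j (hc j), zero_smul]
    rw [vectorSpan_of_subsingleton ℝ (Set.subsingleton_singleton.anti this), finrank_bot] at hrank
    exact zero_ne_one hrank
  obtain ⟨j, hj⟩ := hex
  have huniq : ∀ m, m ≠ j → l (d m) ≠ 0 := by
    intro m hm h0
    have hne : (⟨d j, hdir j hj⟩ : vectorSpan ℝ e) ≠ 0 := fun h' =>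
      h.dir_ne_zero j (congrArg Subtype.val h')
    obtain ⟨c, hc⟩ := (finrank_eq_one_iff_of_nonzero' _ hne).1 hrank ⟨d m, hdir m h0⟩
    have := congrArg (φ m) (congrArg Subtype.val hc)
    change φ m (c • d j) = φ m (d m) at this
    rw [map_smul, h.dual_ne m j hm, h.dual_self, smul_zero] at this
    exact zero_ne_one this
  refine ⟨j, ?_⟩
  rw [h.edgeAt_eq]
  ext x
  constructor
  · exact fun hx => ⟨hx.1, fun m hm => hsum x hx.1 ((hmem x hx.1).1 hx) m (huniq m hm)⟩
  · rintro ⟨hx, h0⟩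
    rw [hmem x hx, ← h.sum_eq x hx, map_sum]
    refine Finset.sum_eq_zero fun m _ => ?_
    rw [map_smul]
    by_cases hm : m = j
    · rw [hm, hj, smul_zero]
    · rw [h0 m hm, zero_smul]

lemma ind_eq (h : IsSimpleVertex P v d φ) (ζ : (Fin N → ℝ) →ₗ[ℝ] ℝ) : ind P ζ v = {j | ζ (d j) ≤ 0}.ncard := by
  unfold ind
  rw [← Set.ncard_image_of_injective _ h.edgeAt_injective]
  congr 1
  ext e
  constructor
  · rintro ⟨he, hp⟩
    obtain ⟨j, rfl⟩ := h.exists_eq_edgeAt he hp.1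
    exact ⟨j, (h.pointsTowards_iff ζ j).1 hp, rfl⟩
  · rintro ⟨j, hj, rfl⟩
    exact ⟨h.edgeAt_mem_edges j, (h.pointsTowards_iff ζ j).2 hj⟩

end IsSimpleVertex

end SimpleVertex

/-! ### The vertices and edges of `Δ^n_Q` -/

section Polytope

variable {n : ℕ} {r : ℝ}

/-- The vertices of the simplex. -/
abbrev unitVec (l : Fin (n + 1)) : Fin (n + 1) → ℝ := Pi.single l 1

/-- The vertices of `Δ^n_Q`. -/
def vtx (r : ℝ) (i k : Fin (n + 1)) : Fin (n + 1) → ℝ := (1 - r) • unitVec i + r • unitVec k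

/-- The edges at the vertex `vtx r i k` are parallel to the edges of the simplex from
`foot i k l` to `l`. -/
def foot (i k l : Fin (n + 1)) : Fin (n + 1) := if grp n l = grp n i ∨ l = k then i else k

/-- The sum of the coordinates in a group, as a linear functional. -/
def grpSumL (n : ℕ) (g : Fin 3) : (Fin (n + 1) → ℝ) →ₗ[ℝ] ℝ :=
  ∑ l with grp n l = g, LinearMap.proj l

lemma grpSumL_apply (x : Fin (n + 1) → ℝ) (g : Fin 3) : grpSumL n g x = grpSum n x g := by
  unfold grpSumL grpSum
  simp only [LinearMap.sum_apply, LinearMap.proj_apply]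

lemma grpSumL_unitVec (l : Fin (n + 1)) (g : Fin 3) :
    grpSumL n g (unitVec l) = if grp n l = g then 1 else 0 := by
  rw [grpSumL_apply]
  unfold grpSum
  split_ifs with h
  · rw [Finset.sum_eq_single_of_mem l (by simp [h])]
    · simp
    · intro b _ hb
      simp [hb]
  · refine Finset.sum_eq_zero fun b hb => ?_
    rw [Finset.mem_filter] at hb
    have : b ≠ l := by
      rintro rfl
      exact h hb.2
    simp [this]

lemma sum_unitVec (l : Fin (n + 1)) : ∑ m, unitVec l m = 1 := by simp

lemma vtx_apply (i k l : Fin (n + 1)) :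
    vtx r i k l = (if l = i then 1 - r else 0) + (if l = k then r else 0) := by
  simp [vtx, Pi.single_apply]

lemma grpSumL_vtx (i k : Fin (n + 1)) (g : Fin 3) : grpSumL n g (vtx r i k) =
    (if grp n i = g then 1 - r else 0) + (if grp n k = g then r else 0) := by
  unfold vtx
  rw [map_add, map_smul, map_smul, grpSumL_unitVec, grpSumL_unitVec]
  simp

lemma vtx_injective [hP : Params n r] {i k i' k' : Fin (n + 1)} (h : i ≠ k)
    (e : vtx r i k = vtx r i' k') : i = i' ∧ k = k' := by
  have := hP.pos
  have := hP.lt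
  have h1 := congrFun e i
  have h2 := congrFun e k
  simp only [vtx_apply, if_true, if_neg h, if_neg h.symm] at h1 h2
  constructor
  · by_contra hc
    rw [if_neg hc] at h1
    split_ifs at h1 <;> linarith
  · by_contra hc
    rw [if_neg hc] at h2
    split_ifs at h2 <;> linarith

lemma vtx_mem_deltaQ [hP : Params n r] {i k : Fin (n + 1)} (h : grp n i ≠ grp n k) :
    vtx r i k ∈ DeltaQ n r := by
  have h0 := hP.pos
  have h1 := hP.lt
  refine mem_deltaQ_iff.2 ⟨fun l => ?_, ?_, fun g => ?_⟩
  · rw [vtx_apply]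
    split_ifs <;> linarith
  · simp only [vtx_apply, Finset.sum_add_distrib, Finset.sum_ite_eq', Finset.mem_univ, if_true]
    ring
  · rw [← grpSumL_apply, grpSumL_vtx]
    split_ifs with h2 h3 h3
    · exact absurd (h2.trans h3.symm) h
    all_goals linarith

/-- The dual coordinates at the vertex `vtx r i k`. -/
def dualCoord (i k l : Fin (n + 1)) : (Fin (n + 1) → ℝ) →ₗ[ℝ] ℝ :=
  if l = k then -grpSumL n (grp n i) else LinearMap.proj l

/-- The active constraints at this vertex are x_l ≥ 0 for l ≠ i, k and the bound on the group of i.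
The direction for l moves weight to l: from i if l is in the group of i or l = k, from k otherwise.
Only the direction with l = k leaves the cutting facet. -/
lemma isSimpleVertex_vtx [hP : Params n r] {i k : Fin (n + 1)} (h : grp n i ≠ grp n k) :
    IsSimpleVertex (DeltaQ n r) (vtx r i k)
      (fun l : {l // l ≠ i} => unitVec l.1 - unitVec (foot i k l)) fun l => dualCoord i k l := by
  have h0 := hP.pos
  have h1 := hP.lt
  have hik : i ≠ k := fun e => h (congrArg _ e)
  have hself : ∀ l : {l // l ≠ i}, dualCoord i k l (unitVec l.1 - unitVec (foot i k l)) = 1 := by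
    rintro ⟨l, hl⟩
    unfold dualCoord foot
    by_cases hlk : l = k
    · subst hlk
      rw [if_pos rfl, if_pos (Or.inr rfl), LinearMap.neg_apply, map_sub, grpSumL_unitVec,
        grpSumL_unitVec, if_neg h.symm, if_pos rfl]
      norm_num
    · rw [if_neg hlk]
      split_ifs <;> simp [hl, hlk]
  have hne : ∀ l l' : {l // l ≠ i}, l ≠ l' →
      dualCoord i k l (unitVec l'.1 - unitVec (foot i k l')) = 0 := by
    rintro ⟨l, hl⟩ ⟨l', hl'⟩ hll
    have hll : l ≠ l' := fun e => hll (Subtype.ext e)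
    unfold dualCoord foot
    by_cases hlk : l = k
    · subst hlk
      rw [if_pos rfl, LinearMap.neg_apply, map_sub, grpSumL_unitVec, grpSumL_unitVec]
      by_cases hg : grp n l' = grp n i
      · simp [hg]
      · simp [hg, hll.symm, h.symm]
    · rw [if_neg hlk]
      split_ifs <;> simp [hl, hlk, hll]
  refine ⟨vtx_mem_deltaQ h, hself, hne, ?_, ?_, ?_⟩
  · rintro x hx ⟨l, hl⟩
    have hx := mem_deltaQ_iff.1 hx
    unfold dualCoord
    by_cases hlk : l = k
    · rw [if_pos hlk, LinearMap.neg_apply, map_sub, grpSumL_vtx, if_pos rfl, if_neg h.symm,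
        grpSumL_apply]
      linarith [hx.2.2 (grp n i)]
    · rw [if_neg hlk, LinearMap.proj_apply, Pi.sub_apply, vtx_apply, if_neg hl, if_neg hlk]
      linarith [hx.1 l]
  · intro x hx
    have hxs := (mem_deltaQ_iff.1 hx).2.1
    have hvs := (mem_deltaQ_iff.1 (vtx_mem_deltaQ (r := r) h)).2.1
    generalize hy : x - vtx r i k = y
    have hys : ∑ m, y m = 0 := by
      rw [← hy]
      simp only [Pi.sub_apply, Finset.sum_sub_distrib, hxs, hvs, sub_self]
    -- The error z is killed by all dual coordinates and has coordinate sum 0, which forces it to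
    -- vanish: first at l ≠ i, k, then at i, then at k.
    let z := ∑ l : {l // l ≠ i}, dualCoord i k l y • (unitVec l.1 - unitVec (foot i k l)) - y
    have hz : ∀ l : {l // l ≠ i}, dualCoord i k l z = 0 := by
      intro l
      simp only [z]
      rw [map_sub, map_sum, Finset.sum_eq_single l, map_smul, hself, smul_eq_mul, mul_one, sub_self]
      · intro m _ hm
        rw [map_smul, hne l m hm.symm, smul_zero]
      · exact fun hl => absurd (Finset.mem_univ l) hl
    have hzs : ∑ m, z m = 0 := by
      simp only [z, Pi.sub_apply, Finset.sum_apply, Pi.smul_apply, Finset.sum_sub_distrib, hys]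
      rw [Finset.sum_comm]
      simp [← Finset.mul_sum, Finset.sum_sub_distrib]
    have hz1 : ∀ l, l ≠ i → l ≠ k → z l = 0 := by
      intro l hl hlk
      have := hz ⟨l, hl⟩
      unfold dualCoord at this
      rwa [if_neg hlk] at this
    have hz2 : z i = 0 := by
      have := hz ⟨k, hik.symm⟩
      unfold dualCoord at this
      rw [if_pos rfl, LinearMap.neg_apply, neg_eq_zero, grpSumL_apply] at this
      unfold grpSum at this
      rwa [Finset.sum_eq_single_of_mem i (by simp)] at this
      intro b hb hbi
      rw [Finset.mem_filter] at hb
      refine hz1 b hbi ?_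
      rintro rfl
      exact h hb.2.symm
    have hz3 : z k = 0 := by
      rwa [Finset.sum_eq_single_of_mem k (Finset.mem_univ _)] at hzs
      intro b _ hbk
      by_cases hbi : b = i
      · rw [hbi, hz2]
      · exact hz1 b hbi hbk
    rw [← sub_eq_zero]
    ext l
    change z l = 0
    by_cases hl : l = i
    · rw [hl, hz2]
    · by_cases hlk : l = k
      · rw [hlk, hz3]
      · exact hz1 l hl hlk
  · rintro ⟨l, hl⟩
    unfold foot
    by_cases hlk : l = k
    · subst hlk
      -- The length of each edge is chosen so that the point reached is the vertex at its other end: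
      -- here `vtx r k i`, and below `vtx r l k` and `vtx r i l`.
      refine ⟨1 - 2 * r, by linarith, ?_⟩
      rw [if_pos (Or.inr rfl)]
      convert vtx_mem_deltaQ (r := r) h.symm using 1
      unfold vtx
      module
    · by_cases hg : grp n l = grp n i
      · refine ⟨1 - r, by linarith, ?_⟩
        rw [if_pos (Or.inl hg)]
        convert vtx_mem_deltaQ (r := r) (hg.trans_ne h) using 1
        unfold vtx
        module
      · refine ⟨r, h0, ?_⟩
        rw [if_neg (not_or.2 ⟨hg, hlk⟩)]
        convert vtx_mem_deltaQ (r := r) (Ne.symm hg) using 1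
        unfold vtx
        module

lemma isSimpleVertex_unitVec (i : Fin (n + 1)) :
    IsSimpleVertex (Simplex n) (unitVec i)
      (fun l : {l // l ≠ i} => unitVec l.1 - unitVec i) fun l => LinearMap.proj l.1 := by
  have hmem : ∀ l : Fin (n + 1), unitVec l ∈ Simplex n := fun l => by
    refine ⟨fun m => ?_, sum_unitVec l⟩
    rw [unitVec, Pi.single_apply]
    split_ifs <;> norm_num
  refine ⟨hmem i, ?_, ?_, ?_, ?_, ?_⟩
  · rintro ⟨l, hl⟩
    simp [hl]
  · rintro ⟨l, hl⟩ ⟨l', hl'⟩ hll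
    have hll : l ≠ l' := fun e => hll (Subtype.ext e)
    simp [hl, hll]
  · rintro x hx ⟨l, hl⟩
    have := hx.1 l
    simpa [hl] using this
  · intro x hx
    have hs := hx.2
    ext m
    simp only [LinearMap.proj_apply, Finset.sum_apply, Pi.smul_apply, Pi.sub_apply, smul_eq_mul]
    rw [← Finset.sum_subtype (Finset.univ.erase i) (by simp)
      fun l => (x l - unitVec i l) * (unitVec l m - unitVec i m), Finset.sum_erase _ (by simp)]
    simp only [mul_sub, Finset.sum_sub_distrib, ← Finset.sum_mul, hs, sum_unitVec,
      sub_self, zero_mul, sub_zero]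
    simp [Pi.single_apply]
  · rintro ⟨l, hl⟩
    refine ⟨1, one_pos, ?_⟩
    rw [one_smul, add_sub_cancel]
    exact hmem l

/-- A small weight can be moved between l and l' in either direction: within one group no group sum
changes, and otherwise both bounds have slack. So x is the midpoint of a segment in the polytope. -/
lemma not_mem_extremePoints_deltaQ {x : Fin (n + 1) → ℝ} {l l' : Fin (n + 1)} (hl : l ≠ l')
    (hxl : 0 < x l) (hxl' : 0 < x l') (h : grp n l = grp n l' ∨
      grpSum n x (grp n l) < 1 - r ∧ grpSum n x (grp n l') < 1 - r) :
    x ∉ (DeltaQ n r).extremePoints ℝ := by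
  rintro ⟨hx, hext⟩
  have hx' := mem_deltaQ_iff.1 hx
  obtain ⟨ε, hε, h1, h2, h3⟩ : ∃ ε : ℝ, 0 < ε ∧ ε ≤ x l ∧ ε ≤ x l' ∧ (grp n l = grp n l' ∨
      grpSum n x (grp n l) + ε ≤ 1 - r ∧ grpSum n x (grp n l') + ε ≤ 1 - r) := by
    rcases h with h | ⟨h, h'⟩
    · exact ⟨min (x l) (x l'), lt_min hxl hxl', min_le_left _ _, min_le_right _ _, Or.inl h⟩
    · obtain ⟨ε, h1, h2⟩ := exists_between (lt_min (lt_min hxl hxl')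
        (lt_min (sub_pos.2 h) (sub_pos.2 h')))
      simp only [lt_min_iff] at h2
      exact ⟨ε, h1, h2.1.1.le, h2.1.2.le, Or.inr ⟨by linarith [h2.2.1], by linarith [h2.2.2]⟩⟩
  have key : ∀ s : ℝ, |s| = ε → x + s • (unitVec l - unitVec l') ∈ DeltaQ n r := by
    intro s hs
    have hs1 := neg_abs_le s
    have hs2 := le_abs_self s
    rw [hs] at hs1 hs2
    refine mem_deltaQ_iff.2 ⟨fun m => ?_, ?_, fun g => ?_⟩
    · simp only [Pi.add_apply, Pi.smul_apply, Pi.sub_apply, Pi.single_apply, smul_eq_mul]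
      have := hx'.1 m
      split_ifs with h4 h5 h5
      · exact absurd (h4.symm.trans h5) hl
      · rw [h4]; linarith
      · rw [h5]; linarith
      · linarith
    · simp only [Pi.add_apply, Pi.smul_apply, Pi.sub_apply, Finset.sum_add_distrib, hx'.2.1,
        ← Finset.smul_sum, Finset.sum_sub_distrib, sum_unitVec, sub_self, smul_zero, add_zero]
    · rw [← grpSumL_apply, map_add, map_smul, map_sub, grpSumL_unitVec, grpSumL_unitVec,
        grpSumL_apply, smul_eq_mul]
      have := hx'.2.2 g
      split_ifs with h4 h5 h5
      · linarith
      · rcases h3 with h3 | h3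
        · exact absurd (h3.symm.trans h4) h5
        · subst h4; linarith [h3.1]
      · rcases h3 with h3 | h3
        · exact absurd (h3.trans h5) h4
        · subst h5; linarith [h3.2]
      · linarith
  have e := hext (key ε (abs_of_pos hε)) (key (-ε) (by rw [abs_neg, abs_of_pos hε]))
    ⟨1 / 2, 1 / 2, by norm_num, by norm_num, by norm_num, by module⟩
  have := congrFun e l
  simp [hl] at this
  exact hε.ne' this

lemma exists_eq_vtx [hP : Params n r] {x : Fin (n + 1) → ℝ} (hx : x ∈ vertices (DeltaQ n r)) :
    ∃ i k, grp n i ≠ grp n k ∧ x = vtx r i k := by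
  have h0 := hP.pos
  have h1 := hP.lt
  have hx' := mem_deltaQ_iff.1 hx.1
  have hsum : ∀ g g', g ≠ g' → grpSum n x g + grpSum n x g' ≤ 1 := by
    intro g g' hg
    have hnn : ∀ g, 0 ≤ grpSum n x g := fun g => Finset.sum_nonneg fun l _ => hx'.1 l
    rw [← hx'.2.1, ← sum_grpSum, ← Finset.sum_pair hg]
    exact Finset.sum_le_sum_of_subset_of_nonneg (Finset.subset_univ _) fun g _ _ => hnn g
  -- If the group of i is tight, all other group sums are at most r, hence slack. A third positive
  -- coordinate could then be exchanged with x_i or with x_k.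
  have hstep : ∀ i k, grp n i ≠ grp n k → 0 < x i → 0 < x k → grpSum n x (grp n i) = 1 - r →
      x = vtx r i k := by
    intro i k hik hi hk hg
    have hlt : ∀ g, g ≠ grp n i → grpSum n x g < 1 - r := by
      intro g hg'
      linarith [hsum g _ hg']
    have hz : ∀ l, l ≠ i → l ≠ k → x l = 0 := by
      intro l hl hlk
      by_contra hc
      have hpos := lt_of_le_of_ne (hx'.1 l) (Ne.symm hc)
      by_cases hgl : grp n l = grp n i
      · exact not_mem_extremePoints_deltaQ hl hpos hi (Or.inl hgl) hx
      · exact not_mem_extremePoints_deltaQ hlk hpos hk (Or.inr ⟨hlt _ hgl, hlt _ hik.symm⟩) hx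
    have hxi : x i = 1 - r := by
      rw [← hg]
      unfold grpSum
      rw [Finset.sum_eq_single_of_mem i (by simp)]
      intro b hb hbi
      rw [Finset.mem_filter] at hb
      refine hz b hbi ?_
      rintro rfl
      exact hik hb.2.symm
    have hne : i ≠ k := fun e => hik (congrArg _ e)
    have hxk : x k = r := by
      have := hx'.2.1
      rw [Finset.sum_eq_add i k hne (fun c _ hc => hz c hc.1 hc.2) (by simp) (by simp), hxi] at this
      linarith
    ext l
    rw [vtx_apply]
    by_cases hl : l = i
    · subst hl; simp [hxi, hne]
    · by_cases hlk : l = k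
      · subst hlk; simp [hxk, hl]
      · simp [hl, hlk, hz l hl hlk]
  obtain ⟨i, hi⟩ : ∃ i, 0 < x i := by
    by_contra! hc
    have := Finset.sum_nonpos fun l (_ : l ∈ Finset.univ) => hc l
    linarith [hx'.2.1]
  obtain ⟨k, hik, hk⟩ : ∃ k, grp n i ≠ grp n k ∧ 0 < x k := by
    by_contra! hc
    have h2 : grpSum n x (grp n i) = ∑ l, x l := by
      unfold grpSum
      refine Finset.sum_subset (Finset.subset_univ _) fun l _ hl => ?_
      rw [Finset.mem_filter, not_and] at hl
      exact le_antisymm (hc l fun e => hl (Finset.mem_univ _) e.symm) (hx'.1 l)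
    linarith [hx'.2.2 (grp n i), hx'.2.1]
  by_cases hgi : grpSum n x (grp n i) = 1 - r
  · exact ⟨i, k, hik, hstep i k hik hi hk hgi⟩
  by_cases hgk : grpSum n x (grp n k) = 1 - r
  · exact ⟨k, i, hik.symm, hstep k i hik.symm hk hi hgk⟩
  exact absurd hx (not_mem_extremePoints_deltaQ (fun e => hik (congrArg _ e)) hi hk
    (Or.inr ⟨lt_of_le_of_ne (hx'.2.2 _) hgi, lt_of_le_of_ne (hx'.2.2 _) hgk⟩))

/-- The vertex `vtx r i k` sits at parameter r on the ray from e_i, and the bound on the group of i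
forces the parameter to be at least r. -/
lemma edgeAt_simplex_inter [hP : Params n r] {i k : Fin (n + 1)} (h : grp n i ≠ grp n k) :
    edgeAt (Simplex n) (unitVec i) (unitVec k - unitVec i) ∩ DeltaQ n r =
      edgeAt (DeltaQ n r) (vtx r i k) (unitVec k - unitVec i) := by
  ext x
  constructor
  · rintro ⟨⟨-, t, ht, rfl⟩, hx⟩
    refine ⟨hx, t - r, ?_, ?_⟩
    · have := (mem_deltaQ_iff.1 hx).2.2 (grp n i)
      rw [← grpSumL_apply, map_add, map_smul, map_sub, grpSumL_unitVec, grpSumL_unitVec,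
        if_pos rfl, if_neg h.symm, smul_eq_mul] at this
      linarith
    · unfold vtx
      module
  · rintro ⟨hx, t, ht, rfl⟩
    refine ⟨⟨hx.1, t + r, by linarith [hP.pos], ?_⟩, hx⟩
    unfold vtx
    module

lemma exists_edges_simplex_iff [hP : Params n r] {i k : Fin (n + 1)} (h : grp n i ≠ grp n k)
    {e : Set (Fin (n + 1) → ℝ)} (hv : vtx r i k ∈ e) : (∃ e' ∈ edges (Simplex n), e = e' ∩ DeltaQ n r) ↔
      e = edgeAt (DeltaQ n r) (vtx r i k) (unitVec k - unitVec i) := by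
  have h0 := hP.pos
  have h1 := hP.lt
  have hik : i ≠ k := fun e => h (congrArg _ e)
  have hi := isSimpleVertex_unitVec i
  constructor
  · rintro ⟨e', he', rfl⟩
    obtain ⟨l, hl⟩ := he'.1 ⟨_, hv.1⟩
    have hmem : ∀ m, unitVec m ∈ Simplex n := fun m => (isSimpleVertex_unitVec m).mem
    have hmax := hv.1
    rw [hl] at hmax
    have e1 : l (vtx r i k) = (1 - r) * l (unitVec i) + r * l (unitVec k) := by
      unfold vtx
      rw [map_add, map_smul, map_smul, smul_eq_mul, smul_eq_mul]
    have h2 := hmax.2 _ (hmem i)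
    have h3 := hmax.2 _ (hmem k)
    -- The vertex is an interior point of the segment from e_i to e_k, so a functional maximal there
    -- takes the same value at both ends.
    have h4 : l (unitVec i) = l (vtx r i k) := by nlinarith
    have h5 : l (unitVec k) = l (vtx r i k) := by nlinarith
    have hi' : unitVec i ∈ e' := by
      rw [hl]
      exact ⟨hmem i, by rw [h4]; exact hmax.2⟩
    have hk' : unitVec k ∈ e' := by
      rw [hl]
      exact ⟨hmem k, by rw [h5]; exact hmax.2⟩
    obtain ⟨⟨m, hm⟩, rfl⟩ := hi.exists_eq_edgeAt he' hi'
    have hmk : m = k := by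
      by_contra hmk
      obtain ⟨-, t, -, ht⟩ := hk'
      have := congrFun ht k
      simp [hik.symm, Ne.symm hmk] at this
    subst hmk
    exact edgeAt_simplex_inter h
  · rintro rfl
    exact ⟨_, hi.edgeAt_mem_edges ⟨k, hik.symm⟩, (edgeAt_simplex_inter h).symm⟩

end Polytope

/-! ### The number of elements of `I_j` -/

section Rank

variable {α : Type} {c : α → ℝ}

lemma rank_lt_rank {s : Finset α} {x y : α} (hx : x ∈ s) (h : c x < c y) :
    (s.filter fun l => c l < c x).card < (s.filter fun l => c l < c y).card := by
  refine Finset.card_lt_card (Finset.ssubset_iff_subset_ne.2 ⟨fun l hl => ?_, fun e => ?_⟩)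
  · rw [Finset.mem_filter] at hl ⊢
    exact ⟨hl.1, hl.2.trans h⟩
  · have : x ∈ s.filter fun l => c l < c y := Finset.mem_filter.2 ⟨hx, h⟩
    rw [← e, Finset.mem_filter] at this
    exact lt_irrefl _ this.2

lemma rank_injOn (hc : Function.Injective c) (s : Finset α) :
    Set.InjOn (fun k => (s.filter fun l => c l < c k).card) s := by
  intro x hx y hy e
  have e : (s.filter fun l => c l < c x).card = (s.filter fun l => c l < c y).card := e
  rcases lt_trichotomy (c x) (c y) with h | h | h
  · exact absurd e (rank_lt_rank hx h).ne
  · exact hc h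
  · exact absurd e (rank_lt_rank hy h).ne'

/-- Ranks with respect to an injective function are distinct and smaller than the cardinality, so
every possible value is taken exactly once. -/
lemma image_rank (hc : Function.Injective c) (s : Finset α) :
    s.image (fun k => (s.filter fun l => c l < c k).card) = Finset.range s.card := by
  refine Finset.eq_of_subset_of_card_le ?_ ?_
  · intro t ht
    obtain ⟨k, hk, rfl⟩ := Finset.mem_image.1 ht
    rw [Finset.mem_range]
    refine Finset.card_lt_card (Finset.filter_ssubset.2 ⟨k, hk, lt_irrefl _⟩)
  · rw [Finset.card_range, Finset.card_image_of_injOn (rank_injOn hc s)]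

lemma card_filter_rank (hc : Function.Injective c) (s : Finset α) (p : ℕ → Prop) [DecidablePred p] :
    (s.filter fun k => p (s.filter fun l => c l < c k).card).card =
      ((Finset.range s.card).filter p).card := by
  rw [← image_rank hc s, Finset.filter_image, Finset.card_image_of_injOn]
  exact (rank_injOn hc s).mono (Finset.coe_subset.2 (Finset.filter_subset _ _))

lemma card_le_rank (hc : Function.Injective c) (s : Finset α) (j : ℕ) :
    (s.filter fun k => j ≤ (s.filter fun l => c l < c k).card).card = s.card - j := by
  rw [card_filter_rank hc s fun t => j ≤ t]
  have : (Finset.range s.card).filter (fun t => j ≤ t) = Finset.Ico j s.card := by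
    ext t
    simp [and_comm]
  rw [this, Nat.card_Ico]

/-- For an element below b, the rank in s is the same as the rank in the part of s below b, and
there every rank occurs once. -/
lemma card_rank_eq (hc : Function.Injective c) (s : Finset α) (b : ℝ) (t : ℕ) :
    (s.filter fun k => c k < b ∧ (s.filter fun l => c l < c k).card = t).card =
      if t < (s.filter fun l => c l < b).card then 1 else 0 := by
  have h := card_filter_rank hc (s.filter fun l => c l < b) fun u => u = t
  have h1 : ((s.filter fun l => c l < b).filter fun k =>
      ((s.filter fun l => c l < b).filter fun l => c l < c k).card = t) =
      s.filter fun k => c k < b ∧ (s.filter fun l => c l < c k).card = t := by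
    rw [Finset.filter_filter]
    refine Finset.filter_congr fun k _ => and_congr_right fun hk => ?_
    rw [Finset.filter_filter]
    have : (s.filter fun l => c l < b ∧ c l < c k) = s.filter fun l => c l < c k :=
      Finset.filter_congr fun l _ => ⟨fun h => h.2, fun h => ⟨h.trans hk, h⟩⟩
    rw [this]
  rw [h1] at h
  rw [h, Finset.filter_eq']
  simp only [Finset.mem_range]
  split_ifs <;> simp

end Rank

section Count

variable {n : ℕ}

/-- The number of places `l` in the group of `i` with `c l < c i`. -/
def rankIn (c : Fin (n + 1) → ℝ) (i : Fin (n + 1)) : ℕ :=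
  (Finset.univ.filter fun l => grp n l = grp n i ∧ c l < c i).card

/-- The number of places `l` outside the group of `i` with `c l < b`. -/
def rankOut (c : Fin (n + 1) → ℝ) (i : Fin (n + 1)) (b : ℝ) : ℕ :=
  (Finset.univ.filter fun l => grp n l ≠ grp n i ∧ c l < b).card

/-- The pairs of places which correspond to the elements of `I_j`. -/
def indexPairs (c : Fin (n + 1) → ℝ) (j : ℕ) : Finset (Fin (n + 1) × Fin (n + 1)) :=
  Finset.univ.filter fun p => grp n p.1 ≠ grp n p.2 ∧ c p.2 < c p.1 ∧
    1 + rankIn c p.1 + rankOut c p.1 (c p.2) = j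

lemma rankIn_add_rankOut (c : Fin (n + 1) → ℝ) (i : Fin (n + 1)) :
    rankIn c i + rankOut c i (c i) = (Finset.univ.filter fun l => c l < c i).card := by
  unfold rankIn rankOut
  rw [← Finset.card_filter_add_card_filter_not (s := Finset.univ.filter fun l => c l < c i)
    (fun l => grp n l = grp n i), Finset.filter_filter, Finset.filter_filter]
  simp only [and_comm]

lemma card_grp (hn : Even n) :
    (Finset.univ.filter fun l : Fin (n + 1) => grp n l = 0).card = n / 2 ∧
    (Finset.univ.filter fun l : Fin (n + 1) => grp n l = 1).card = 1 ∧
    (Finset.univ.filter fun l : Fin (n + 1) => grp n l = 2).card = n / 2 := by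
  obtain ⟨m, hm⟩ := hn
  simp only [grp_eq_zero, grp_eq_one, grp_eq_two]
  have e : n / 2 = m := by omega
  refine ⟨?_, ?_, ?_⟩
  · rw [Fin.card_filter_val_lt]
    omega
  · rw [Finset.card_eq_one]
    exact ⟨⟨n / 2, by omega⟩, by ext l; simp [Fin.ext_iff]⟩
  · have h := Finset.card_filter_add_card_filter_not (s := (Finset.univ : Finset (Fin (n + 1))))
      (fun l : Fin (n + 1) => (l : ℕ) < n / 2 + 1)
    rw [Fin.card_filter_val_lt, Finset.card_univ, Fintype.card_fin] at h
    have h1 : (Finset.univ.filter fun l : Fin (n + 1) => n / 2 < (l : ℕ)) =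
        Finset.univ.filter fun l : Fin (n + 1) => ¬ ((l : ℕ) < n / 2 + 1) :=
      Finset.filter_congr fun l _ => by omega
    rw [h1]
    omega

/-- A group of size m has m - j elements of internal rank at least j, with truncated subtraction.
The middle group is a single place and contributes nothing as j ≥ 1. -/
lemma card_le_rankIn {c : Fin (n + 1) → ℝ} (hc : Function.Injective c) (hn : Even n) {j : ℕ}
    (hj : 1 ≤ j) : (Finset.univ.filter fun i => j ≤ rankIn c i).card = 2 * (n / 2 - j) := by
  have h : ∀ g, ((Finset.univ.filter fun i => j ≤ rankIn c i).filter fun i => grp n i = g).card =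
      (Finset.univ.filter fun l : Fin (n + 1) => grp n l = g).card - j := by
    intro g
    rw [← card_le_rank hc, Finset.filter_filter, Finset.filter_filter]
    congr 1
    refine Finset.filter_congr fun i _ => ?_
    rw [and_comm]
    refine and_congr_right fun hi => ?_
    unfold rankIn
    rw [Finset.filter_filter, hi]
  rw [Finset.card_eq_sum_card_fiberwise (f := grp n) (t := Finset.univ) fun _ _ => Finset.mem_univ _,
    Fin.sum_univ_three, h, h, h, (card_grp hn).1, (card_grp hn).2.1, (card_grp hn).2.2]
  omega

/-- For fixed i, as k runs over the admissible places, `rankOut` takes each value from 0 to `rankOut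
c i (c i)` - 1 once. So i contributes one pair if its internal rank is < j and its total rank is ≥
j, and none otherwise. There are n + 1 - j places of total rank ≥ j, from which those of internal
rank ≥ j are removed. -/
lemma card_indexPairs_add {c : Fin (n + 1) → ℝ} (hc : Function.Injective c) (hn : Even n) {j : ℕ}
    (hj : 1 ≤ j) : (indexPairs c j).card + 2 * (n / 2 - j) = n + 1 - j := by
  have h1 : (indexPairs c j).card = (Finset.univ.filter fun i =>
      j ≤ (Finset.univ.filter fun l => c l < c i).card ∧ ¬ j ≤ rankIn c i).card := by
    rw [Finset.card_eq_sum_card_fiberwise (f := Prod.fst) (t := Finset.univ)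
      fun _ _ => Finset.mem_univ _, Finset.card_filter]
    refine Finset.sum_congr rfl fun i _ => ?_
    have h2 : ((indexPairs c j).filter fun p => p.1 = i).card =
        (Finset.univ.filter fun k => (grp n k ≠ grp n i ∧ c k < c i) ∧
          1 + rankIn c i + rankOut c i (c k) = j).card := by
      refine Finset.card_bij' (fun p _ => p.2) (fun k _ => (i, k)) ?_ ?_ ?_ ?_
      · rintro ⟨a, k⟩ hp
        simp only [indexPairs, Finset.mem_filter, Finset.mem_univ, true_and] at hp ⊢
        obtain ⟨⟨h1, h2, h3⟩, rfl⟩ := hp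
        exact ⟨⟨h1.symm, h2⟩, h3⟩
      · intro k hk
        simp only [indexPairs, Finset.mem_filter, Finset.mem_univ, true_and, and_true] at hk ⊢
        exact ⟨hk.1.1.symm, hk.1.2, hk.2⟩
      · rintro ⟨a, k⟩ hp
        exact Prod.ext (Finset.mem_filter.1 hp).2.symm rfl
      · intro k _
        rfl
    rw [h2]
    by_cases hq : 1 + rankIn c i ≤ j
    · have h3 := card_rank_eq hc (Finset.univ.filter fun k => grp n k ≠ grp n i) (c i)
        (j - (1 + rankIn c i))
      simp only [Finset.filter_filter] at h3
      have h4 : (Finset.univ.filter fun k => (grp n k ≠ grp n i ∧ c k < c i) ∧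
          1 + rankIn c i + rankOut c i (c k) = j) = Finset.univ.filter fun k => grp n k ≠ grp n i ∧
            c k < c i ∧ (Finset.univ.filter fun l => grp n l ≠ grp n i ∧ c l < c k).card =
              j - (1 + rankIn c i) := by
        refine Finset.filter_congr fun k _ => ?_
        rw [and_assoc]
        refine and_congr_right fun _ => and_congr_right fun _ => ?_
        change _ ↔ rankOut c i (c k) = _
        omega
      rw [h4, h3, ← rankIn_add_rankOut]
      refine if_congr ?_ rfl rfl
      change _ < rankOut c i (c i) ↔ _
      omega
    · rw [if_neg (by omega), Finset.card_eq_zero, Finset.filter_eq_empty_iff]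
      rintro k _ ⟨-, h3⟩
      omega
  have h2 := card_le_rank hc Finset.univ j
  rw [Finset.card_univ, Fintype.card_fin] at h2
  have h3 := card_le_rankIn hc hn hj
  rw [h1, ← h2, ← h3, ← Finset.card_filter_add_card_filter_not
    (s := Finset.univ.filter fun i => j ≤ (Finset.univ.filter fun l => c l < c i).card)
    (fun i => j ≤ rankIn c i), Finset.filter_filter, Finset.filter_filter, add_comm]
  congr 2
  refine Finset.filter_congr fun i _ => ⟨fun h => ⟨?_, h⟩, fun h => h.2⟩
  have := rankIn_add_rankOut c i
  omega

/-- With m = n/2, a cell of this dimension is given by i alone, as k = i + j; the conditions say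
max(0, m - j) ≤ i ≤ min(m, n - j). -/
lemma card_cellIx_dim_add (hn : Even n) {j : ℕ} (hj : 1 ≤ j) (hjn : j ≤ n) :
    Nat.card {o : CellIx n // o.dim = 2 * j - 1} + 2 * (n / 2 - j) = n + 1 - j := by
  obtain ⟨m, hm⟩ := hn
  have e : n / 2 = m := by omega
  have h : ∀ o : CellIx n, o.dim = 2 * j - 1 ↔ (o.1.2 : ℕ) = o.1.1 + j := by
    intro o
    have := Fin.lt_def.1 o.2.2.2
    unfold CellIx.dim
    omega
  let f : {o : CellIx n // o.dim = 2 * j - 1} ≃ Finset.Icc (m - j) (min m (n - j)) :=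
    { toFun := fun o => ⟨o.1.1.1, by
        have h1 := (h o.1).1 o.2
        have h2 := o.1.2.1
        have h3 := o.1.2.2.1
        have h4 := o.1.1.2.2
        rw [Finset.mem_Icc]
        omega⟩
      invFun := fun a => ⟨⟨(⟨a.1, by have := Finset.mem_Icc.1 a.2; omega⟩,
          ⟨a.1 + j, by have := Finset.mem_Icc.1 a.2; omega⟩), by
            have := Finset.mem_Icc.1 a.2
            refine ⟨?_, ?_, ?_⟩
            · change a.1 ≤ n / 2; omega
            · change n / 2 ≤ a.1 + j; omega
            · change a.1 < a.1 + j; omega⟩, (h _).2 rfl⟩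
      left_inv := fun o => Subtype.ext (Subtype.ext (Prod.ext rfl (Fin.ext ((h o.1).1 o.2).symm)))
      right_inv := fun a => rfl }
  rw [Nat.card_congr f, Nat.card_eq_fintype_card, Fintype.card_coe, Nat.card_Icc]
  omega

end Count

/-! ### Indices of vertices and the cardinality of `I_j` -/

section

variable {n : ℕ} {r : ℝ} [hP : Params n r] {ζ : (Fin (n + 1) → ℝ) →ₗ[ℝ] ℝ}

/-- If ζ agreed on e_l and e_l', then exchanging l and l' would produce two vertices with equal
values: `vtx r l k` and `vtx r l' k` if the groups agree, `vtx r l l'` and `vtx r l' l` otherwise.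
-/
lemma injective_apply_unitVec (hζ : Set.InjOn ζ (vertices (DeltaQ n r))) :
    Function.Injective fun l : Fin (n + 1) => ζ (unitVec l) := by
  have h0 := hP.pos
  have h1 := hP.lt
  have hn := hP.two_le
  have hmem : ∀ {i k : Fin (n + 1)}, grp n i ≠ grp n k → vtx r i k ∈ vertices (DeltaQ n r) :=
    fun h => (isSimpleVertex_vtx h).mem_extremePoints
  intro l l' e
  have e : ζ (unitVec l) = ζ (unitVec l') := e
  by_contra hne
  by_cases hg : grp n l = grp n l'
  · obtain ⟨k, hk⟩ : ∃ k, grp n l ≠ grp n k := by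
      by_contra! hc
      have h2 := hc 0
      rw [hc (Fin.last n), eq_comm] at h2
      have h3 : grp n 0 = 0 := grp_eq_zero.2 (by simp; omega)
      rw [h3, eq_comm, grp_eq_zero, Fin.val_last] at h2
      omega
    refine hne (vtx_injective (r := r) (fun h => hk (congrArg _ h))
      (hζ (hmem hk) (hmem (hg ▸ hk : grp n l' ≠ grp n k)) ?_)).1
    unfold vtx
    simp only [map_add, map_smul, e]
  · refine hne (vtx_injective (r := r) hne (hζ (hmem hg) (hmem (Ne.symm hg)) ?_)).1
    unfold vtx
    simp only [map_add, map_smul, e]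

/-- The edge for l points towards the vertex exactly when ζ(e_l) is below ζ at its foot. The place k
counts 1, the group of i counts places below i, and the remaining places are compared with k. -/
lemma ind_vtx (hc : Function.Injective fun l : Fin (n + 1) => ζ (unitVec l)) {i k : Fin (n + 1)}
    (h : grp n i ≠ grp n k) (hζ : ζ (unitVec k) < ζ (unitVec i)) : ind (DeltaQ n r) ζ (vtx r i k) =
      1 + rankIn (fun l => ζ (unitVec l)) i + rankOut (fun l => ζ (unitVec l)) i (ζ (unitVec k)) := by
  rw [(isSimpleVertex_vtx h).ind_eq, ← Set.ncard_image_of_injective _ Subtype.val_injective]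
  unfold rankIn rankOut
  set A := Finset.univ.filter fun l => grp n l = grp n i ∧ ζ (unitVec l) < ζ (unitVec i)
  set B := Finset.univ.filter fun l => grp n l ≠ grp n i ∧ ζ (unitVec l) < ζ (unitVec k)
  have hA : ∀ l, l ∈ A ↔ grp n l = grp n i ∧ ζ (unitVec l) < ζ (unitVec i) := by simp [A]
  have hB : ∀ l, l ∈ B ↔ grp n l ≠ grp n i ∧ ζ (unitVec l) < ζ (unitVec k) := by simp [B]
  have hAB : Disjoint A B := Finset.disjoint_left.2 fun l hl hl' =>
    ((hB l).1 hl').1 ((hA l).1 hl).1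
  have hk : k ∉ A ∪ B := by
    rw [Finset.mem_union, hA, hB]
    rintro (hk | hk)
    exacts [h hk.1.symm, lt_irrefl _ hk.2]
  have hlt : ∀ {a b : Fin (n + 1)}, a ≠ b → ζ (unitVec a - unitVec b) ≤ 0 →
      ζ (unitVec a) < ζ (unitVec b) := by
    intro a b hab h'
    rw [map_sub, sub_nonpos] at h'
    exact lt_of_le_of_ne h' fun e => hab (hc e)
  have hset : Subtype.val '' {l : {l // l ≠ i} | ζ (unitVec l.1 - unitVec (foot i k l)) ≤ 0} =
      ↑(insert k (A ∪ B)) := by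
    ext l
    simp only [Finset.coe_insert, Finset.coe_union, Set.mem_insert_iff, Set.mem_union,
      Finset.mem_coe, hA, hB]
    constructor
    · rintro ⟨⟨l, hl⟩, h1, rfl⟩
      have h1 : ζ (unitVec l - unitVec (foot i k l)) ≤ 0 := h1
      unfold foot at h1
      by_cases hlk : l = k
      · exact Or.inl hlk
      · right
        by_cases hg : grp n l = grp n i
        · rw [if_pos (Or.inl hg)] at h1
          exact Or.inl ⟨hg, hlt hl h1⟩
        · rw [if_neg (not_or.2 ⟨hg, hlk⟩)] at h1
          exact Or.inr ⟨hg, hlt hlk h1⟩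
    · have hfoot : ∀ (hl : l ≠ i), ζ (unitVec l) < ζ (unitVec (foot i k l)) →
          l ∈ Subtype.val '' {l : {l // l ≠ i} | ζ (unitVec l.1 - unitVec (foot i k l)) ≤ 0} := by
        intro hl h1
        refine ⟨⟨l, hl⟩, ?_, rfl⟩
        change ζ (unitVec l - unitVec (foot i k l)) ≤ 0
        rw [map_sub]
        linarith
      rintro (rfl | ⟨hg, h1⟩ | ⟨hg, h1⟩)
      · refine hfoot (fun e => h (congrArg _ e.symm)) ?_
        unfold foot
        rwa [if_pos (Or.inr rfl)]
      · refine hfoot (fun e => ?_) ?_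
        · rw [e] at h1
          exact lt_irrefl _ h1
        · unfold foot
          rwa [if_pos (Or.inl hg)]
      · refine hfoot (fun e => hg (congrArg _ e)) ?_
        unfold foot
        rwa [if_neg]
        rintro (h2 | rfl)
        exacts [hg h2, lt_irrefl _ h1]
  rw [hset, Set.ncard_coe_finset, Finset.card_insert_of_notMem hk, Finset.card_union_of_disjoint hAB]
  omega

lemma I_eq_image (hζ : Set.InjOn ζ (vertices (DeltaQ n r))) (j : ℕ) :
    I n r ζ j = (fun p : Fin (n + 1) × Fin (n + 1) =>
      (vtx r p.1 p.2, edgeAt (DeltaQ n r) (vtx r p.1 p.2) (unitVec p.2 - unitVec p.1))) ''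
        ↑(indexPairs (fun l => ζ (unitVec l)) j) := by
  have hc := injective_apply_unitVec hζ
  have key : ∀ {i k : Fin (n + 1)} (h : grp n i ≠ grp n k),
      edgeAt (DeltaQ n r) (vtx r i k) (unitVec k - unitVec i) ∈ edges (DeltaQ n r) ∧
      (PointsTowards ζ (edgeAt (DeltaQ n r) (vtx r i k) (unitVec k - unitVec i)) (vtx r i k) ↔
        ζ (unitVec k) < ζ (unitVec i)) := by
    intro i k h
    have hki : k ≠ i := fun e => h (congrArg _ e.symm)
    have h1 := (isSimpleVertex_vtx (r := r) h).edgeAt_mem_edges ⟨k, hki⟩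
    have h2 := (isSimpleVertex_vtx (r := r) h).pointsTowards_iff ζ ⟨k, hki⟩
    have hf : foot i k k = i := if_pos (Or.inr rfl)
    simp only [hf] at h1 h2
    refine ⟨h1, h2.trans ?_⟩
    rw [map_sub, sub_nonpos]
    exact ⟨fun h' => lt_of_le_of_ne h' fun e => hki (hc e), le_of_lt⟩
  ext ⟨v, e⟩
  constructor
  · rintro ⟨hv, -, hind, hp, hex⟩
    obtain ⟨i, k, hik, rfl⟩ := exists_eq_vtx hv
    have he : e = _ := (exists_edges_simplex_iff hik hp.1).1 hex
    subst he
    have hlt := (key hik).2.1 hp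
    refine ⟨(i, k), ?_, rfl⟩
    rw [Finset.mem_coe]
    exact Finset.mem_filter.2 ⟨Finset.mem_univ _, hik, hlt, (ind_vtx hc hik hlt).symm.trans hind⟩
  · rintro ⟨⟨i, k⟩, hp, e⟩
    obtain ⟨-, hik, hlt, hj⟩ := Finset.mem_filter.1 (Finset.mem_coe.1 hp)
    rw [← e]
    have hp := (key hik).2.2 hlt
    exact ⟨(isSimpleVertex_vtx hik).mem_extremePoints, (key hik).1,
      (ind_vtx hc hik hlt).trans hj, hp, (exists_edges_simplex_iff hik hp.1).2 rfl⟩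

lemma finite_I (hζ : Set.InjOn ζ (vertices (DeltaQ n r))) (j : ℕ) : (I n r ζ j).Finite := by
  rw [I_eq_image hζ]
  exact (Finset.finite_toSet _).image _

lemma ncard_I_add (hζ : Set.InjOn ζ (vertices (DeltaQ n r))) {j : ℕ} (hj : 1 ≤ j) :
    (I n r ζ j).ncard + 2 * (n / 2 - j) = n + 1 - j := by
  rw [I_eq_image hζ, Set.InjOn.ncard_image, Set.ncard_coe_finset,
    card_indexPairs_add (injective_apply_unitVec hζ) hP.even hj]
  rintro ⟨i, k⟩ hp ⟨i', k'⟩ - e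
  have hik := (Finset.mem_filter.1 (Finset.mem_coe.1 hp)).2.1
  have := vtx_injective (r := r) (fun h => hik (congrArg _ h)) (congrArg Prod.fst e)
  exact Prod.ext this.1 this.2

/-- Both cardinalities satisfy the same equation, so a bijection exists without a natural choice. -/
lemma nonempty_cellIx_equiv_I (hζ : Set.InjOn ζ (vertices (DeltaQ n r))) {j : ℕ} (hj : 1 ≤ j)
    (hjn : j ≤ n) : Nonempty ({o : CellIx n // o.dim = 2 * j - 1} ≃ I n r ζ j) := by
  have := (finite_I hζ j).to_subtype
  have h1 := ncard_I_add hζ hj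
  have h2 := card_cellIx_dim_add hP.even hj hjn
  have h : Nat.card {o : CellIx n // o.dim = 2 * j - 1} = Nat.card (I n r ζ j) := by
    rw [Nat.card_coe_set_eq]
    omega
  exact ⟨(Finite.equivFin _).trans ((finCongr h).trans (Finite.equivFin _).symm)⟩

end

/-! ### The cell structure and the homology in terms of the sets `I_j` -/

section

variable {n : ℕ} {r : ℝ} [hP : Params n r] {ζ : (Fin (n + 1) → ℝ) →ₗ[ℝ] ℝ}

lemma exists_dim_eq (o : CellIx n) : ∃ j, 1 ≤ j ∧ j ≤ n ∧ o.dim = 2 * j - 1 := by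
  have h1 := Fin.lt_def.1 o.2.2.2
  have h2 := o.1.2.2
  exact ⟨(o.1.2 : ℕ) - o.1.1, by omega, by omega, rfl⟩

lemma hasOddCWStructure (hζ : Set.InjOn ζ (vertices (DeltaQ n r))) :
    HasOddCWStructure (WModBoundary n r) n (I n r ζ) := by
  refine ⟨inferInstance, (cells n r).cwComplex, ?_, ?_, ?_⟩
  · exact ⟨{ toFun := fun _ => ()
             invFun := fun _ => ⟨none, rfl⟩
             left_inv := by
               rintro ⟨_ | o, ho⟩
               · rfl
               · have h : o.dim = 0 := ho
                 exact absurd (odd_cellIx_dim n o) (by rw [h]; exact Nat.not_odd_zero)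
             right_inv := fun _ => rfl }⟩
  · intro j hj hjn
    obtain ⟨e⟩ := nonempty_cellIx_equiv_I hζ hj hjn
    refine ⟨Equiv.trans ?_ e⟩
    exact
      { toFun := fun o => match o with
          | ⟨some o, ho⟩ => ⟨o, ho⟩
          | ⟨none, ho⟩ => absurd ho (by change ¬ 0 = _; omega)
        invFun := fun o => ⟨some o.1, o.2⟩
        left_inv := by
          rintro ⟨_ | o, ho⟩
          · exact absurd ho (by change ¬ 0 = _; omega)
          · rfl
        right_inv := fun o => rfl }
  · intro d hd h
    refine ⟨?_⟩
    rintro ⟨_ | o, ho⟩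
    · exact hd ho.symm
    · obtain ⟨j, h1, h2, h3⟩ := exists_dim_eq o
      exact h j h1 h2 (ho.symm.trans h3)

variable (n r) in
lemma subsingleton_relH_basePt {i : ℕ} (hi : ∀ j : ℕ, 1 ≤ j → j ≤ n → i ≠ 2 * j - 1) :
    Subsingleton (relH i (WModBoundary n r) {basePt n r}) := by
  obtain ⟨b⟩ := nonempty_basis_relH_basePt n r i
  have : IsEmpty {o : CellIx n // o.dim = i} := ⟨fun o => by
    obtain ⟨j, h1, h2, h3⟩ := exists_dim_eq o.1
    exact hi j h1 h2 (o.2.symm.trans h3)⟩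
  exact b.repr.toEquiv.subsingleton

lemma nonempty_relH_basePt_equiv (hζ : Set.InjOn ζ (vertices (DeltaQ n r))) {j : ℕ} (hj : 1 ≤ j)
    (hjn : j ≤ n) : Nonempty (relH (2 * j - 1) (WModBoundary n r) {basePt n r} ≃ₗ[ℤ]
      (I n r ζ j →₀ ℤ)) := by
  obtain ⟨b⟩ := nonempty_basis_relH_basePt n r (2 * j - 1)
  obtain ⟨e⟩ := nonempty_cellIx_equiv_I hζ hj hjn
  exact ⟨(b.reindex e).repr⟩

variable (n r) in
lemma nonempty_relH_basePt_top_equiv :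
    Nonempty (relH (2 * n - 1) (WModBoundary n r) {basePt n r} ≃ₗ[ℤ] ℤ) := by
  obtain ⟨b⟩ := nonempty_basis_relH_basePt n r (2 * n - 1)
  let _ : Unique {o : CellIx n // o.dim = 2 * n - 1} :=
    { default := ⟨topCell n r, rfl⟩
      uniq := fun o => Subtype.ext (by
        by_contra h
        have h1 := dim_lt_of_ne_topCell n r h
        have h2 : (topCell n r).dim = 2 * n - 1 := rfl
        have h3 := o.2
        omega) }
  exact ⟨b.repr.trans (Finsupp.uniqueLinearEquiv ℤ ℤ default)⟩

end

end QuasitoricBoundary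

end

/-! ### The theorem -/

theorem mainTheorem2 (n : ℕ) (hn : Even n) (hn2 : 2 ≤ n) (r : ℝ) (hr : 0 < r) (hr4 : r < 1 / 4) :
    -- for every linear functional which distinguishes the vertices of `Δ^n_Q`:
    (∀ ζ : (Fin (n + 1) → ℝ) →ₗ[ℝ] ℝ,
      Set.InjOn ζ (QuasitoricBoundary.vertices (QuasitoricBoundary.DeltaQ n r)) →
      -- the CW structure on `W / ∂W`
      QuasitoricBoundary.HasOddCWStructure (QuasitoricBoundary.WModBoundary n r) n
        (QuasitoricBoundary.I n r ζ) ∧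
      -- the sets `I_j` are finite and `|I_n| = 1`
      (∀ j : ℕ, (QuasitoricBoundary.I n r ζ j).Finite) ∧
      (QuasitoricBoundary.I n r ζ n).ncard = 1 ∧
      -- the homology of the pair `(W, ∂W)`
      (∀ j : ℕ, 1 ≤ j → j ≤ n →
        Nonempty (QuasitoricBoundary.relH (2 * j - 1) (QuasitoricBoundary.W n r)
          (QuasitoricBoundary.boundaryW n r) ≃ₗ[ℤ] (QuasitoricBoundary.I n r ζ j →₀ ℤ))) ∧
      (∀ i : ℕ, (∀ j : ℕ, 1 ≤ j → j ≤ n → i ≠ 2 * j - 1) →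
        Subsingleton (QuasitoricBoundary.relH i (QuasitoricBoundary.W n r)
          (QuasitoricBoundary.boundaryW n r))) ∧
      -- the homology of the space `W / ∂W`
      (∀ j : ℕ, 1 ≤ j → j ≤ n →
        Nonempty (QuasitoricBoundary.singH (2 * j - 1) (QuasitoricBoundary.WModBoundary n r)
          ≃ₗ[ℤ] (QuasitoricBoundary.I n r ζ j →₀ ℤ))) ∧
      Nonempty (QuasitoricBoundary.singH 0 (QuasitoricBoundary.WModBoundary n r) ≃ₗ[ℤ] ℤ) ∧
      (∀ i : ℕ, i ≠ 0 → (∀ j : ℕ, 1 ≤ j → j ≤ n → i ≠ 2 * j - 1) →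
        Subsingleton (QuasitoricBoundary.singH i (QuasitoricBoundary.WModBoundary n r)))) ∧
    -- `H_{2n-1}(W, ∂W) = ℤ`, and `W` is an orientable manifold with boundary `∂W`
    Nonempty (QuasitoricBoundary.relH (2 * n - 1) (QuasitoricBoundary.W n r)
      (QuasitoricBoundary.boundaryW n r) ≃ₗ[ℤ] ℤ) ∧
    QuasitoricBoundary.IsOrientableManifoldWithBoundary (2 * n - 1) (QuasitoricBoundary.W n r)
      (QuasitoricBoundary.boundaryW n r) := by
  have hP : QuasitoricBoundary.Params n r := ⟨hn, hn2, hr, hr4⟩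
  have hW := fun i => QuasitoricBoundary.nonempty_relH_W_iso n r i
  refine ⟨fun ζ hζ => ⟨QuasitoricBoundary.hasOddCWStructure hζ, QuasitoricBoundary.finite_I hζ,
    ?_, ?_, ?_, ?_, ?_, ?_⟩, ?_, QuasitoricBoundary.isOrientableManifoldWithBoundary_W n r⟩
  -- For j = n the truncated term n/2 - n is 0, which leaves n + 1 - n = 1.
  · have := QuasitoricBoundary.ncard_I_add hζ (show 1 ≤ n by omega)
    omega
  · intro j hj hjn
    obtain ⟨e⟩ := hW (2 * j - 1)
    obtain ⟨e'⟩ := QuasitoricBoundary.nonempty_relH_basePt_equiv hζ hj hjn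
    exact ⟨e.toLinearEquiv.trans e'⟩
  · intro i hi
    obtain ⟨e⟩ := hW i
    have := QuasitoricBoundary.subsingleton_relH_basePt n r hi
    exact e.toLinearEquiv.toEquiv.subsingleton
  · intro j hj hjn
    obtain ⟨e⟩ := QuasitoricBoundary.nonempty_singH_iso_relH (QuasitoricBoundary.basePt n r)
      (show 2 * j - 1 ≠ 0 by omega)
    obtain ⟨e'⟩ := QuasitoricBoundary.nonempty_relH_basePt_equiv hζ hj hjn
    exact ⟨e.toLinearEquiv.trans e'⟩
  · have := QuasitoricBoundary.subsingleton_relH_basePt n r (i := 0) (fun j hj _ => by omega)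
    obtain ⟨e⟩ := QuasitoricBoundary.nonempty_singH_zero_iso (QuasitoricBoundary.basePt n r)
      (ModuleCat.isZero_of_subsingleton _)
    exact ⟨e.toLinearEquiv⟩
  · intro i h0 hi
    obtain ⟨e⟩ := QuasitoricBoundary.nonempty_singH_iso_relH (QuasitoricBoundary.basePt n r) h0
    have := QuasitoricBoundary.subsingleton_relH_basePt n r hi
    exact e.toLinearEquiv.toEquiv.subsingleton
  · obtain ⟨e⟩ := hW (2 * n - 1)
    obtain ⟨e'⟩ := QuasitoricBoundary.nonempty_relH_basePt_top_equiv n r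
    exact ⟨e.toLinearEquiv.trans e'⟩
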